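/- Setting. Let $n\ge1$, let $\mathbf c_1,\dots,\mathbf c_n\in\mathbb R^3$ be distinct, $q_i,g_i\in\mathbb R\setminus\{0\}$, $\kappa\ge0$, $\mathbf r_i=\mathbf x-\mathbf c_i$, and let $$\mathbf D_q=\sum_i\frac{q_i\mathbf r_i}{4\pi|\mathbf r_i|^3},\qquad \mathbf B_g=\sum_i\frac{g_i\mathbf r_i}{4\pi|\mathbf r_i|^3},\qquad X=\mathbb R^3\setminus\{\mathbf c_1,\dots,\mathbf c_n\}.$$ Let $f$ be a function on an open set $I\subset\mathbb R$. A static solution on an open set $\Omega$ consists of fields $\mathbf E,\mathbf B,\mathbf D,\mathbf H$ that are $C^1$ on $\Omega$ with $\nabla\cdot\mathbf D=\rho_e$, $\nabla\cdot\mathbf B=\rho_m$ in the sense of distributions on $\mathbb R^3$ and, on $\Omega$, $\nabla\times\mathbf E=-\mathbf j_m$, $\nabla\times\mathbf H=\mathbf j_e$, $$s=\tfrac12(\mathbf E^2-\mathbf B^2)+\tfrac{\kappa^2}2(\mathbf E\cdot\mathbf B)^2\in I,\quad \mathbf D=f'(s)(\mathbf E+\kappa^2(\mathbf E\cdot\mathbf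 B)\mathbf B),\quad \mathbf H=f'(s)(\mathbf B-\kappa^2(\mathbf E\cdot\mathbf B)\mathbf E).$$ Electric, magnetic and dyonic sources are $(\rho_e,\rho_m)=(\sum q_i\delta_{\mathbf c_i},0)$, $(0,\sum g_i\delta_{\mathbf c_i})$ and $(\sum q_i\delta_{\mathbf c_i},\sum g_i\delta_{\mathbf c_i})$. A field is non-conservative on $\Omega$ if it is $C^1$ there and its curl is not identically zero there; the corresponding induced current ($\mathbf j_m=-\nabla\times\mathbf E$, $\mathbf j_e=\nabla\times\mathbf H$) is then non-zero. The energy is finite if $\mathcal H=f'(s)(\mathbf E^2+\kappa^2(\mathbf E\cdot\mathbf B)^2)-f(s)$ is integrable on $\mathbb R^3$. The free charge of $\mathbf F$ is $\int\nabla\cdot\mathbf F\,d\mathbf x$, i.e. the limit of the integrals of $\nabla\cdot\mathbf F$ over $\{|\mathbf x|<R,\ |\mathbf r_i|>r_i\ \forall i\}$ as $R\to\infty$ and all $r_i\to0^+$ independently. If $\mathbf F$ is not differentiable on all of $X$, the free charge is the total of the distribution $\nabla\cdot\mathbf F$ on $X$, i.e. the limit of $-\int\mathbf F\cdot\nabla\chi\,d\mathbf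 x$ with $\chi=(1-\eta(|\mathbf x|/R))\prod_i\eta(|\mathbf r_i|/r_i)$, for every smooth $\eta$ that is $0$ on $(-\infty,1]$ and $1$ on $[2,\infty)$. Write $Q=\sum q_i$, $G=\sum g_i$. The notation $\mathbf F\sim\mathbf K$ means $|\mathbf F-\mathbf K|=o(|\mathbf K|)$. **Theorem.** (i) Let $f\in C^2(I)$, $f(0)=0$, $f'(0)=1$. *Electric case.* Let $I$ be an open interval containing $0$, and suppose that $f'(a/2)^2a=t$ is resolved by a function $a=h(t)$, i.e. $h$ is differentiable on $[0,\infty)$, $h(0)=0$, $h(t)/2\in I$ and $f'(h(t)/2)^2h(t)=t$ for $t\ge0$. Then $\mathbf D=\mathbf D_q$, $\mathbf B=\mathbf H=\mathbf 0$, $\mathbf E=\mathbf D/f'(\frac12h(\mathbf D^2))$ is a static solution on $X$ with electric sources, $\mathbf j_e=\mathbf 0$ and $\mathbf j_m=-\nabla\times\mathbf E$. If $n\ge2$, then $\mathbf E$ is non-conservative if and only if $f''(s)\ne0$ for some $s\in I$, $s>0$. *Magnetic case.* Let $I\supset(-\infty,0]$ be open. Then $\mathbf B=\mathbf B_g$,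 $\mathbf E=\mathbf D=\mathbf 0$, $\mathbf H=f'(-\frac12\mathbf B^2)\mathbf B$ is a static solution on $X$ with magnetic sources, $\mathbf j_m=\mathbf 0$ and $\mathbf j_e=\nabla\times\mathbf H$. If $n\ge2$, then $\mathbf H$ is non-conservative if and only if $f''(s)\ne0$ for some $s<0$. (ii) Let $\alpha,\beta>0$. Consider the logarithmic model $f(s)=-\frac1\beta\ln(1-\beta s)$ on $I=(-\infty,1/\beta)$, the exponential model $f(s)=\frac1\beta(e^{\beta s}-1)$ and the quadratic model $f(s)=s+\alpha s^2$, both on $I=\mathbb R$. Let $W$ be the principal branch of the Lambert function. Let $a(\gamma,\sigma^2)$ be the largest real root of $(\gamma+a)^2a=\sigma^2$, given by the cubic formula $$a=\frac{(C-2\gamma)^2}{6C},\qquad C=\bigl(8\gamma^3+108\sigma^2+12\sqrt{12\gamma^3\sigma^2+81\sigma^4}\bigr)^{1/3}$$ with principal complex roots ($a(0,0)=0$). *Electric case.* With $\mathbf D=\mathbf D_q$, $\mathbf B=\mathbf H=\mathbf 0$ and $\mathbf E$ equal, respectively, to $$\frac{2\mathbf D}{1+\sqrt{1+2\beta\mathbf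 D^2}},\qquad e^{-\frac12W(\beta\mathbf D^2)}\mathbf D,\qquad \frac{\mathbf D}{1+\alpha\,a(1/\alpha,\mathbf D^2/\alpha^2)},$$ one obtains static solutions on $X$ with electric sources, finite energy, free electric charge $Q$, and $\mathbf E\sim\mathbf D$ as $|\mathbf x|\to\infty$. If $n\ge2$, then $\mathbf E$ is non-conservative on $X$. In the logarithmic case $\mathbf E-\sqrt{2/\beta}\,\mathrm{sgn}(q_i)\,\mathbf r_i/|\mathbf r_i|\to\mathbf 0$ as $\mathbf x\to\mathbf c_i$. *Magnetic case.* With $\mathbf B=\mathbf B_g$, $\mathbf E=\mathbf D=\mathbf 0$ and $\mathbf H$ equal, respectively, to $$\frac{\mathbf B}{1+\frac\beta2\mathbf B^2},\qquad e^{-\frac\beta2\mathbf B^2}\mathbf B,\qquad(1-\alpha\mathbf B^2)\mathbf B,$$ one obtains static solutions on $X$ with magnetic sources and $\mathbf H\sim\mathbf B$ as $|\mathbf x|\to\infty$. If $n\ge2$, then $\mathbf H$ is non-conservative on $X$. In the logarithmic and exponential models the energy is finite and the free magnetic charge is $G$; in the quadratic model the energy is not finite and there is no finite free magnetic charge. In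 the logarithmic case $\mathbf H\sim\frac{8\pi}{\beta g_i}|\mathbf r_i|\mathbf r_i$ as $\mathbf x\to\mathbf c_i$. *Dyonic case.* Let $\mathbf D=\mathbf D_q$, $\mathbf B=\mathbf B_g$, $L=\dfrac{\mathbf D^2+\kappa^2(\mathbf B\times\mathbf D)^2}{1+\kappa^2\mathbf B^2}$, $\eta=\dfrac{(\mathbf B\cdot\mathbf D)^2}{\mathbf D^2+\kappa^2(2+\kappa^2\mathbf B^2)(\mathbf B\times\mathbf D)^2}$ (with $\eta=0$ where $\mathbf D=\mathbf 0$), and let $p$ be, respectively, $$\frac{1+\sqrt{1+\beta L(2+\beta\mathbf B^2)}}{2+\beta\mathbf B^2},\qquad e^{-\frac\beta2\mathbf B^2+\frac12W(\beta e^{\beta\mathbf B^2}L)},\qquad 1-\alpha\mathbf B^2+\alpha(1+\kappa^2\eta)\,a(\gamma,\sigma^2),$$ $$\gamma=\frac{1-\alpha\mathbf B^2}{\alpha(1+\kappa^2\eta)},\qquad \sigma^2=\frac{\mathbf D^2}{\alpha^2(1+\kappa^2\eta)^2(1+\kappa^2(2+\kappa^2\mathbf B^2)\eta)}.$$ Put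 $$\mathbf E=\frac1p\Bigl(\mathbf D-\frac{\kappa^2(\mathbf B\cdot\mathbf D)}{1+\kappa^2\mathbf B^2}\mathbf B\Bigr),\qquad \mathbf H=-\frac{\kappa^2(\mathbf B\cdot\mathbf D)}{p(1+\kappa^2\mathbf B^2)}\mathbf D+\Bigl(p+\frac{\kappa^4(\mathbf B\cdot\mathbf D)^2}{p(1+\kappa^2\mathbf B^2)^2}\Bigr)\mathbf B,$$ and, where $\mathbf D=\mathbf 0$, read these as $\mathbf E=\mathbf 0$, $\mathbf H=p\mathbf B$. Let $\Omega=X$ in the logarithmic and exponential models and $\Omega=\{\mathbf x\in X:\mathbf D\ne\mathbf 0\text{ or }\alpha\mathbf B^2<1\}$ in the quadratic model. Then $\mathbb R^3\setminus\Omega$ is a null set and: * $\mathbf E,\mathbf B,\mathbf D,\mathbf H$ are a static solution on $\Omega$ with dyonic sources, and $\mathbf E\sim\mathbf D$, $\mathbf H\sim\mathbf B$ as $|\mathbf x|\to\infty$. * The energy is finite if and only if $\kappa>0$. * If $\kappa>0$, the free electric and magnetic charges are $Q$ and $G$. If $\kappa=0$, they are $Q-\sum_i|g_i|\,\mathrm{sgn}(q_i)$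 and $G-\sum_i|q_i|\,\mathrm{sgn}(g_i)$. (They are total charges of the distributions $\nabla\cdot\mathbf E$, $\nabla\cdot\mathbf H$ on $X$, and also of the classical divergences if $\Omega=X$.) * If $\kappa=0$, then $\mathbf E\sim\bigl|\frac{g_i}{q_i}\bigr|\frac{q_i\mathbf r_i}{4\pi|\mathbf r_i|^3}$ and $\mathbf H\sim\bigl|\frac{q_i}{g_i}\bigr|\frac{g_i\mathbf r_i}{4\pi|\mathbf r_i|^3}$ as $\mathbf x\to\mathbf c_i$. * Let $n\ge2$. Each of $\mathbf E$ and $\mathbf H$ is non-conservative on $\Omega$, except exactly in the self-dual case $\kappa=0$, $(g_i)=\pm(q_i)$ (one sign for all $i$), where both are conservative. -/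

import Mathlib

open Set Filter Topology MeasureTheory Asymptotics
open scoped ContDiff

noncomputable section

/-- Euclidean three-space. -/
abbrev V3 : Type := EuclideanSpace ℝ (Fin 3)

/-- The cross product on Euclidean three-space. -/
def cross (u v : V3) : V3 := WithLp.toLp 2 (crossProduct u.ofLp v.ofLp)

/-- The partial derivative `∂ F_i / ∂ x_j` at `x`. -/
def partialD (F : V3 → V3) (x : V3) (i j : Fin 3) : ℝ :=
  (fderiv ℝ F x (EuclideanSpace.single j 1)) i

/-- The (classical, pointwise) divergence. -/
def divergence (F : V3 → V3) (x : V3) : ℝ := ∑ i, partialD F x i i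

/-- The (classical, pointwise) curl. -/
def curl (F : V3 → V3) (x : V3) : V3 :=
  !₂[partialD F x 2 1 - partialD F x 1 2,
     partialD F x 0 2 - partialD F x 2 0,
     partialD F x 1 0 - partialD F x 0 1]

/-- A `C¹` field on the open set `Ω` whose curl does not vanish identically there. -/
def Nonconservative (F : V3 → V3) (Ω : Set V3) : Prop :=
  ContDiffOn ℝ 1 F Ω ∧ ∃ x ∈ Ω, curl F x ≠ 0

/-! ### Point sources -/

/-- The field `∑ i, q_i (x - c_i) / (4 π |x - c_i|³)`. -/
def coulomb {n : ℕ} (c : Fin n → V3) (q : Fin n → ℝ) (x : V3) : V3 :=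
  ∑ i, (q i / (4 * Real.pi * ‖x - c i‖ ^ 3)) • (x - c i)

/-- `∇ · F = ∑ i, q_i δ(x - c_i)` in the sense of distributions on the whole space. -/
def HasPointSources {n : ℕ} (F : V3 → V3) (c : Fin n → V3) (q : Fin n → ℝ) : Prop :=
  LocallyIntegrable F volume ∧
  ∀ φ : V3 → ℝ, ContDiff ℝ ∞ φ → HasCompactSupport φ →
    -∫ x, inner ℝ (F x) (gradient φ x) = ∑ i, q i * φ (c i)

/-! ### The field equations of the theory with Lagrangian density `f(s)` -/

/-- The Lorentz invariant `s = (E² - B²)/2 + κ² (E·B)²/2`. -/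
def invariantS (κ : ℝ) (E B : V3) : ℝ :=
  (‖E‖ ^ 2 - ‖B‖ ^ 2) / 2 + κ ^ 2 / 2 * (inner ℝ E B) ^ 2

/-- Static solutions on the open set `Ω` (the whole space without the point sources and,
possibly, further singular points), with electric and magnetic point charges `q`, `g` at the
points `c`, and with electric and magnetic current densities `je`, `jm`.  The function `f` is
defined on `I`, and `s` has to take its values there. -/
structure IsStaticSolution (f : ℝ → ℝ) (I : Set ℝ) (κ : ℝ) {n : ℕ} (c : Fin n → V3)
    (q g : Fin n → ℝ) (Ω : Set V3) (E B D H je jm : V3 → V3) : Prop where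
  isOpen : IsOpen Ω
  smooth_E : ContDiffOn ℝ 1 E Ω
  smooth_B : ContDiffOn ℝ 1 B Ω
  smooth_D : ContDiffOn ℝ 1 D Ω
  smooth_H : ContDiffOn ℝ 1 H Ω
  faraday : ∀ x ∈ Ω, curl E x = -jm x
  ampere : ∀ x ∈ Ω, curl H x = je x
  coulomb_law : HasPointSources D c q
  gauss_law : HasPointSources B c g
  dom : ∀ x ∈ Ω, invariantS κ (E x) (B x) ∈ I
  constitutive_D : ∀ x ∈ Ω, D x = deriv f (invariantS κ (E x) (B x)) •
    (E x + (κ ^ 2 * inner ℝ (E x) (B x)) • B x)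
  constitutive_H : ∀ x ∈ Ω, H x = deriv f (invariantS κ (E x) (B x)) •
    (B x - (κ ^ 2 * inner ℝ (E x) (B x)) • E x)

/-- The Hamiltonian energy density `f'(s) (E² + κ² (E·B)²) - f(s)`. -/
def energyDensity (f : ℝ → ℝ) (κ : ℝ) (E B : V3 → V3) (x : V3) : ℝ :=
  deriv f (invariantS κ (E x) (B x)) * (‖E x‖ ^ 2 + κ ^ 2 * (inner ℝ (E x) (B x)) ^ 2)
    - f (invariantS κ (E x) (B x))

/-- The energy density has a convergent integral over the whole space. -/
def FiniteEnergy (f : ℝ → ℝ) (κ : ℝ) (E B : V3 → V3) : Prop :=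
  Integrable (energyDensity f κ E B) volume

/-! ### Free charges -/

/-- The ball of radius `R` about the origin without the closed balls of radii `r i` about the
points `c i`. -/
def perforatedBall {n : ℕ} (c : Fin n → V3) (r : Fin n → ℝ) (R : ℝ) : Set V3 :=
  Metric.ball 0 R \ ⋃ i, Metric.closedBall (c i) (r i)

/-- All (independent) radii `r i > 0` tend to `0` and `R` tends to infinity. -/
def exhaustion (n : ℕ) : Filter ((Fin n → ℝ) × ℝ) :=
  (𝓝[Set.univ.pi fun _ => Set.Ioi 0] 0) ×ˢ atTop

/-- The total free charge `∫ ∇ · F dx = lim ∫_{|x| < R, |x - c_i| > r_i} ∇ · F dx` of the field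
`F` equals `Q`. -/
def HasFreeCharge {n : ℕ} (c : Fin n → V3) (F : V3 → V3) (Q : ℝ) : Prop :=
  (∀ (r : Fin n → ℝ) (R : ℝ), (∀ i, 0 < r i) →
    IntegrableOn (divergence F) (perforatedBall c r R) volume) ∧
  Tendsto (fun p : (Fin n → ℝ) × ℝ => ∫ x in perforatedBall c p.1 p.2, divergence F x)
    (exhaustion n) (𝓝 Q)

/-- A cutoff which vanishes for `|x - c_i| ≤ r_i` and for `|x| ≥ 2R`, and is `1` for
`|x - c_i| ≥ 2 r_i`, `|x| ≤ R`. -/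
def cutoff {n : ℕ} (η : ℝ → ℝ) (c : Fin n → V3) (r : Fin n → ℝ) (R : ℝ) (x : V3) : ℝ :=
  (1 - η (‖x‖ / R)) * ∏ i, η (‖x - c i‖ / r i)

/-- The same for a field which need not be differentiable off the points `c i`: here `∇ · F` is
the distributional divergence off these points, and its total is computed with smooth
cutoffs. -/
def HasWeakFreeCharge {n : ℕ} (c : Fin n → V3) (F : V3 → V3) (Q : ℝ) : Prop :=
  LocallyIntegrableOn F (range c)ᶜ volume ∧
  ∀ η : ℝ → ℝ, ContDiff ℝ ∞ η → (∀ t ≤ 1, η t = 0) → (∀ t, 2 ≤ t → η t = 1) →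
    Tendsto (fun p : (Fin n → ℝ) × ℝ =>
        -∫ x, inner ℝ (F x) (gradient (cutoff η c p.1 p.2) x))
      (exhaustion n) (𝓝 Q)

/-! ### The three models -/

/-- Logarithmic model, defined for `s < 1/β`. -/
def fLog (β s : ℝ) : ℝ := -(1 / β) * Real.log (1 - β * s)

/-- Exponential model. -/
def fExp (β s : ℝ) : ℝ := (1 / β) * (Real.exp (β * s) - 1)

/-- Quadratic model. -/
def fQuad (α s : ℝ) : ℝ := s + α * s ^ 2

/-- The principal branch of the Lambert function on `[-1/e, ∞)`: the `w ≥ -1` such that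
`w e^w = x`. -/
def lambertW (x : ℝ) : ℝ := Function.invFunOn (fun w : ℝ => w * Real.exp w) (Set.Ici (-1)) x

/-- The largest real root `a` of the cubic equation `(γ + a)² a = σ²` (`σ2` stands for `σ²`) by
the cubic formula, with principal values of the complex square and cube roots; the result is
real. -/
def cubicRoot (γ σ2 : ℝ) : ℝ :=
  let C : ℂ := (8 * (γ : ℂ) ^ 3 + 108 * (σ2 : ℂ) +
    12 * (12 * (γ : ℂ) ^ 3 * (σ2 : ℂ) + 81 * (σ2 : ℂ) ^ 2) ^ (1 / 2 : ℂ)) ^ (1 / 3 : ℂ)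
  ((C - 2 * (γ : ℂ)) ^ 2 / (6 * C)).re

/-- `(D² + κ² (B × D)²) / (1 + κ² B²)`. -/
def reducedSq (κ : ℝ) (D B : V3) : ℝ :=
  (‖D‖ ^ 2 + κ ^ 2 * ‖cross B D‖ ^ 2) / (1 + κ ^ 2 * ‖B‖ ^ 2)

/-- The value of `f'(s) = 1 / (1 - β s)` in terms of `D` and `B`, logarithmic model. -/
def pLog (β κ : ℝ) (D B : V3) : ℝ :=
  (1 + Real.sqrt (1 + β * reducedSq κ D B * (2 + β * ‖B‖ ^ 2))) / (2 + β * ‖B‖ ^ 2)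

/-- The value of `s` in terms of `D` and `B`, exponential model. -/
def sExp (β κ : ℝ) (D B : V3) : ℝ :=
  -‖B‖ ^ 2 / 2 + 1 / (2 * β) * lambertW (β * Real.exp (β * ‖B‖ ^ 2) * reducedSq κ D B)

/-- The value of `f'(s) = e^{β s}` in terms of `D` and `B`, exponential model. -/
def pExp (β κ : ℝ) (D B : V3) : ℝ := Real.exp (β * sExp β κ D B)

/-- The ratio `η = (E·B)² / E²` in terms of `D` and `B`. -/
def etaRatio (κ : ℝ) (D B : V3) : ℝ :=
  (inner ℝ B D) ^ 2 / (‖D‖ ^ 2 + κ ^ 2 * (2 + κ ^ 2 * ‖B‖ ^ 2) * ‖cross B D‖ ^ 2)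

/-- The value of `a = E²` in terms of `D` and `B`, quadratic model. -/
def aQuad (α κ : ℝ) (D B : V3) : ℝ :=
  cubicRoot ((1 - α * ‖B‖ ^ 2) / (α * (1 + κ ^ 2 * etaRatio κ D B)))
    (‖D‖ ^ 2 / ((α * (1 + κ ^ 2 * etaRatio κ D B)) ^ 2 *
      (1 + κ ^ 2 * (2 + κ ^ 2 * ‖B‖ ^ 2) * etaRatio κ D B)))

/-- The value of `f'(s) = 1 + 2 α s` in terms of `D` and `B`, quadratic model. -/
def pQuad (α κ : ℝ) (D B : V3) : ℝ :=
  1 - α * ‖B‖ ^ 2 + α * (1 + κ ^ 2 * etaRatio κ D B) * aQuad α κ D B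

/-- The electric field in terms of `D`, `B` and the value `p` of `f'(s)`. -/
def dyonicE (κ p : ℝ) (D B : V3) : V3 :=
  p⁻¹ • (D - (κ ^ 2 * inner ℝ B D / (1 + κ ^ 2 * ‖B‖ ^ 2)) • B)

/-- The magnetic intensity field in terms of `D`, `B` and the value `p` of `f'(s)`. -/
def dyonicH (κ p : ℝ) (D B : V3) : V3 :=
  -(κ ^ 2 * inner ℝ B D / (p * (1 + κ ^ 2 * ‖B‖ ^ 2))) • D +
    (p + κ ^ 4 * (inner ℝ B D) ^ 2 / (p * (1 + κ ^ 2 * ‖B‖ ^ 2) ^ 2)) • B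

/-! ### Properties of multicentered solutions -/

/-- `E` is the electric field of an electrostatic solution with point charges `q` at `c`; it has
finite energy, the prescribed total free charge and Coulomb behavior at infinity, and, for two or
more charges, it is non-conservative.  The magnetic current density is `-∇ × E`. -/
structure ElectricSolution (f : ℝ → ℝ) (I : Set ℝ) (κ : ℝ) {n : ℕ} (c : Fin n → V3)
    (q : Fin n → ℝ) (E : V3 → V3) : Prop where
  solution : IsStaticSolution f I κ c q 0 (range c)ᶜ E 0 (coulomb c q) 0 0 (fun x => -curl E x)
  finite_energy : FiniteEnergy f κ E 0
  free_charge : HasFreeCharge c E (∑ i, q i)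
  infinity : E ~[Bornology.cobounded V3] coulomb c q
  nonconservative : 2 ≤ n → Nonconservative E (range c)ᶜ

/-- `H` is the magnetic intensity field of a magnetostatic solution with point charges `g` at
`c`; it has Coulomb behavior at infinity and, for two or more charges, it is non-conservative.
The electric current density is `∇ × H`. -/
structure MagneticSolution (f : ℝ → ℝ) (I : Set ℝ) (κ : ℝ) {n : ℕ} (c : Fin n → V3)
    (g : Fin n → ℝ) (H : V3 → V3) : Prop where
  solution : IsStaticSolution f I κ c 0 g (range c)ᶜ 0 (coulomb c g) 0 H (curl H) 0
  infinity : H ~[Bornology.cobounded V3] coulomb c g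
  nonconservative : 2 ≤ n → Nonconservative H (range c)ᶜ

/-- `F` has the total free charge `Q`: in the weak sense in any case, and in the classical sense
if `F` is regular off the points `c i` (`Ω` is the set where `F` is regular). -/
def DyonicFreeCharge {n : ℕ} (c : Fin n → V3) (Ω : Set V3) (F : V3 → V3) (Q : ℝ) : Prop :=
  HasWeakFreeCharge c F Q ∧ (Ω = (range c)ᶜ → HasFreeCharge c F Q)

/-- `E`, `H` are the electric and magnetic intensity fields of a dyonic solution with charges
`q`, `g` at `c`, regular on `Ω`, which is all of space up to a null set. -/
structure DyonicSolution (f : ℝ → ℝ) (I : Set ℝ) (κ : ℝ) {n : ℕ} (c : Fin n → V3)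
    (q g : Fin n → ℝ) (Ω : Set V3) (E H : V3 → V3) : Prop where
  null : volume Ωᶜ = 0
  solution : IsStaticSolution f I κ c q g Ω E (coulomb c g) (coulomb c q) H
    (curl H) (fun x => -curl E x)
  infinity_E : E ~[Bornology.cobounded V3] coulomb c q
  infinity_H : H ~[Bornology.cobounded V3] coulomb c g
  energy : FiniteEnergy f κ E (coulomb c g) ↔ 0 < κ
  free_charge_pos : 0 < κ →
    DyonicFreeCharge c Ω E (∑ i, q i) ∧ DyonicFreeCharge c Ω H (∑ i, g i)
  free_charge_zero : κ = 0 →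
    DyonicFreeCharge c Ω E (∑ i, q i - ∑ i, |g i| * Real.sign (q i)) ∧
    DyonicFreeCharge c Ω H (∑ i, g i - ∑ i, |q i| * Real.sign (g i))
  local_zero : κ = 0 → ∀ i,
    (E ~[𝓝[≠] (c i)] fun x =>
      (|g i / q i| * q i / (4 * Real.pi * ‖x - c i‖ ^ 3)) • (x - c i)) ∧
    (H ~[𝓝[≠] (c i)] fun x =>
      (|q i / g i| * g i / (4 * Real.pi * ‖x - c i‖ ^ 3)) • (x - c i))
  nonconservative : 2 ≤ n →
    (Nonconservative E Ω ↔ ¬ (κ = 0 ∧ (q = g ∨ q = -g))) ∧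
    (Nonconservative H Ω ↔ ¬ (κ = 0 ∧ (q = g ∨ q = -g)))

end

/-!
All fields are built from the Coulomb fields `D` and `B`, which are prescribed and have the required
sources (`hasPointSources_coulomb`); only the constitutive equations remain, and they are algebraic.
With `p = f'(s)` and the inverse function `S` of `f'`, they reduce to the scalar equation
`p² (2 S(p) + B²) = L` (`IsRoot`). Its left side increases with `p` where it is not negative, so
that for `L ≥ 0` there is at most one root, which by the inverse function theorem is a `C¹` function
of the position (`contDiffAt_root`). The formulas for `p` in the three models are verified as roots,
by means of the Lambert function and of the cubic formula. The dyonic fields are treated at once for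
all `f` for which `S` satisfies the growth conditions `Response` and `Model` (`RootField`,
`dyonicSolution`); electrostatic fields are the case `B = 0`, and magnetostatic fields are explicit.

*Asymptotics, energy and free charges.* At infinity `p → 1`. At a center, `p → |q_i / g_i|` if
`κ = 0`, hence `E` and `H` are again like Coulomb fields, with the charges exchanged up to signs,
and the energy density is like the inverse fourth power of the distance. If `κ > 0`, then `L`
remains between positive bounds and `p` vanishes like the square of the distance; so the energy
density is integrable, and the radial components of `E` and `H` are too small to carry a flux. A
free charge is the limit of the flux at infinity minus the fluxes at the centers. For smooth cutoffs
it is an integral over shells, which `flux_estimate` compares with Gauss' law for Coulomb fields;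
the classical integral over a perforated ball follows by approximating its indicator function with
steep cutoffs (`integral_perforatedBall_mem`). In the magnetic quadratic model the flux at a center
diverges (`not_hasFreeCharge`).

*Non-conservative fields.* The curl of `φ(|K|²) K` is `φ' ∇|K|² × K`. By analyticity, `∇|K|²` could
be parallel to `K` on an open set only if this held everywhere; near a charge this would make the
field of the other charges radial there (`cross_jac_coulomb_ne_zero`). This settles part (i), and
the dyonic fields if `(q_i)` and `(g_i)` are proportional, where the curl vanishes only if `φ` is
constant (`eq_of_curl_radial_eq_zero`). Otherwise let `λ = q_i / g_i` at some center: then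
`δ = D - λ B ≠ 0` is curl-free, divergence-free and analytic at this center, so it has a leading
term `A` which is the gradient of a harmonic form of some degree (`LeadingTerm`, `HarmonicForm`),
and so has the field of the other magnetic charges, with leading term `C`. If the curl of `E` or `H`
vanishes, the leading order along the rays `x = c_i + t e` is a linear relation between `e × A(e)`
and `e × C(e)` for all unit vectors `e`. This is impossible, since tangential parts of harmonic
forms of different degrees belong to different eigenvalues of the spherical Laplacian, and if the
degree of `A` does not exceed that of `C`, then `e × C(e)` drops out in the limit
(`HarmonicForm.no_balance`). There are two exceptions, with `κ > 0`. If `A` has degree zero, only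
`e × A` remains. If `A = J` has degree one, its contribution to the leading order cancels. Then the
next order is needed: its part even in `e` is an identity between polynomials on the sphere, which,
evaluated at isotropic vectors, yields `J = 0` (`eq_zero_of_evenPart`).

Notation: `f ⇝ a` is the limit at `0` from the right, `⟪u,v⟫` the inner product, and
`𝔉[Φ,p,c,g,w,x]` the value of `Φ` at `p x`, the Coulomb fields of the charges `g` and `w` at `x`,
and their Jacobians.
-/

open Set Filter Topology MeasureTheory Asymptotics Function Bornology
open EuclideanSpace (single inner_single_left inner_single_right)
open Real (norm_eq_abs norm_of_nonneg exp cos sin pi_pos log_le_sub_one_of_pos smoothTransition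
  dist_eq rpow_two rpow_neg sqrt_sq sqrt_mul sign)
open scoped ContDiff Real

noncomputable section
namespace MultiCenter

local notation:50 f:51 "⇝" a:51 => Tendsto f (𝓝[>] (0 : ℝ)) (𝓝 a)
local notation:max "⟪" u "," v "⟫" => inner ℝ u v

variable {d n : ℕ} {A₀ B D a e u v x : V3} {F G : V3 → V3} {A₀' J N : V3 →L[ℝ] V3} {p φ : V3 → ℝ}
  {g q w : Fin n → ℝ} {L b k lam m p' r s t α ε ι κ κ₁ ν : ℝ} {c : Fin n → V3}
  {S S' T f η : ℝ → ℝ} {A β : ℝ → V3} {A' Jβ : ℝ → V3 →L[ℝ] V3} {i : Fin n} {U Ω : Set V3}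
  {I : Set ℝ}

/-! ### Vector algebra and vector calculus in three dimensions -/

lemma eventually_pos : ∀ᶠ t in 𝓝[>] (0 : ℝ), 0 < t := self_mem_nhdsWithin

lemma tendsto_self_nhdsGT : (fun p : ℝ => p) ⇝ 0 := tendsto_id.mono_left nhdsWithin_le_nhds

lemma tendsto_pow_nhdsGT (k : ℕ) (hk : k ≠ 0 := by omega) : (fun t : ℝ => t ^ k) ⇝ 0 := by
  simpa [hk] using tendsto_self_nhdsGT.pow k

lemma tendsto_ray (x u : V3) : (fun t : ℝ => x + t • u) ⇝ x := by
  simpa using (tendsto_self_nhdsGT.smul_const u).const_add x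

@[simp] lemma cross_zero_coord (u v : V3) : cross u v 0 = u 1 * v 2 - u 2 * v 1 := by
  simp [cross, cross_apply]

@[simp] lemma cross_one_coord (u v : V3) : cross u v 1 = u 2 * v 0 - u 0 * v 2 := by
  simp [cross, cross_apply]

@[simp] lemma cross_two_coord (u v : V3) : cross u v 2 = u 0 * v 1 - u 1 * v 0 := by
  simp [cross, cross_apply]

lemma inner_eq (u v : V3) : ⟪u, v⟫ = u 0 * v 0 + u 1 * v 1 + u 2 * v 2 := by
  simp [PiLp.inner_apply, Fin.sum_univ_three, mul_comm]

lemma norm_sq_eq (u : V3) : ‖u‖ ^ 2 = u 0 ^ 2 + u 1 ^ 2 + u 2 ^ 2 := by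
  rw [← real_inner_self_eq_norm_sq, inner_eq]; ring

lemma ext3 (h0 : u 0 = v 0) (h1 : u 1 = v 1) (h2 : u 2 = v 2) : u = v := by
  ext i; fin_cases i <;> assumption

lemma cross_add_left (u v w : V3) : cross (u + v) w = cross u w + cross v w := by
  apply ext3 <;> simp <;> ring

lemma cross_add_right (u v w : V3) : cross u (v + w) = cross u v + cross u w := by
  apply ext3 <;> simp <;> ring

lemma cross_smul_left (a : ℝ) (u w : V3) : cross (a • u) w = a • cross u w := by
  apply ext3 <;> simp <;> ring

lemma cross_smul_right (a : ℝ) (u w : V3) : cross u (a • w) = a • cross u w := by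
  apply ext3 <;> simp <;> ring

/-- The cross product as a bilinear map. -/
def crossLinear : V3 →ₗ[ℝ] V3 →ₗ[ℝ] V3 :=
  LinearMap.mk₂ ℝ cross cross_add_left cross_smul_left cross_add_right cross_smul_right

/-- The cross product as a continuous bilinear map. -/
def crossL : V3 →L[ℝ] V3 →L[ℝ] V3 := crossLinear.toContinuousBilinearMap

lemma crossL_apply (u v : V3) : crossL u v = cross u v := rfl

lemma cross_sub_left (u v w : V3) : cross (u - v) w = cross u w - cross v w :=
  crossL.map_sub₂ u v w

lemma cross_sub_right (u v w : V3) : cross u (v - w) = cross u v - cross u w :=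
  (crossL u).map_sub v w

lemma cross_neg_left (u w : V3) : cross (-u) w = -cross u w := crossL.map_neg₂ u w

lemma cross_neg_right (u w : V3) : cross u (-w) = -cross u w := (crossL u).map_neg w

@[simp] lemma cross_self (u : V3) : cross u u = 0 := by apply ext3 <;> simp <;> ring

@[simp] lemma cross_zero_left (u : V3) : cross 0 u = 0 := crossL.map_zero₂ u

@[simp] lemma cross_zero_right (u : V3) : cross u 0 = 0 := (crossL u).map_zero

lemma cross_comm (u v : V3) : cross u v = -cross v u := by apply ext3 <;> simp <;> ring

/-- Lagrange's identity. -/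
lemma norm_cross_sq (u v : V3) : ‖cross u v‖ ^ 2 = ‖u‖ ^ 2 * ‖v‖ ^ 2 - ⟪u, v⟫ ^ 2 := by
  simp only [norm_sq_eq, inner_eq, cross_zero_coord, cross_one_coord, cross_two_coord]; ring

lemma inner_sq_le (u v : V3) : ⟪u, v⟫ ^ 2 ≤ ‖u‖ ^ 2 * ‖v‖ ^ 2 := by
  nlinarith [norm_cross_sq u v, sq_nonneg ‖cross u v‖]

lemma tendsto_cross {α : Type*} {l : Filter α} {f g : α → V3}
    (hf : Tendsto f l (𝓝 u)) (hg : Tendsto g l (𝓝 v)) :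
    Tendsto (fun t => cross (f t) (g t)) l (𝓝 (cross u v)) := by
  simpa only [comp_def, uncurry, crossL_apply] using (crossL.continuous₂.tendsto (u, v)).comp (hf.prodMk_nhds hg)

/-- A vector with vanishing cross product with the unit vector `e` is a multiple of `e`. -/
lemma eq_smul_of_cross_eq_zero (he : ‖e‖ = 1) (h : cross e v = 0) : v = ⟪e, v⟫ • e := by
  have h1 : e 0 ^ 2 + e 1 ^ 2 + e 2 ^ 2 = 1 := by rw [← norm_sq_eq, he, one_pow]
  have a0 := congrArg (fun w : V3 => w 0) h
  have a1 := congrArg (fun w : V3 => w 1) h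
  have a2 := congrArg (fun w : V3 => w 2) h
  simp at a0 a1 a2
  apply ext3 <;> simp [inner_eq]
  · linear_combination (-v 0) * h1 + e 2 * a1 - e 1 * a2
  · linear_combination (-v 1) * h1 - e 2 * a0 + e 0 * a2
  · linear_combination (-v 2) * h1 + e 1 * a0 - e 0 * a1

/-- The antisymmetric part of a linear map as an axial vector, so that `curl F x` is the axial
vector of `fderiv ℝ F x`. -/
def axial (J : V3 →L[ℝ] V3) : V3 := !₂[(J (single 1 1)) 2 - (J (single 2 1)) 1,
     (J (single 2 1)) 0 - (J (single 0 1)) 2,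
     (J (single 0 1)) 1 - (J (single 1 1)) 0]

lemma curl_eq_axial (F : V3 → V3) (x : V3) : curl F x = axial (fderiv ℝ F x) := rfl

lemma curl_congr (h : F =ᶠ[𝓝 x] G) : curl F x = curl G x := by
  rw [curl_eq_axial, curl_eq_axial, h.fderiv_eq]

lemma axial_add (J K : V3 →L[ℝ] V3) : axial (J + K) = axial J + axial K := by
  apply ext3 <;> simp [axial] <;> ring

lemma axial_smul (a : ℝ) (J : V3 →L[ℝ] V3) : axial (a • J) = a • axial J := by
  apply ext3 <;> simp [axial] <;> ring

lemma axial_smulRight (g w : V3) : axial ((innerSL ℝ g).smulRight w) = cross g w := by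
  apply ext3 <;> simp [axial, inner_single_right]

/-- Linear maps that are symmetric and trace-free: the Jacobians of fields without curl and
divergence. -/
def SymTraceless (J : V3 →L[ℝ] V3) : Prop := (∀ u v, ⟪J u, v⟫ = ⟪u, J v⟫) ∧
    ∀ b : OrthonormalBasis (Fin 3) ℝ V3, ∑ i, ⟪b i, J (b i)⟫ = 0

lemma symTraceless_of_trace (h : ∀ u v, ⟪J u, v⟫ = ⟪u, J v⟫)
    (b : OrthonormalBasis (Fin 3) ℝ V3) (hb : ∑ i, ⟪b i, J (b i)⟫ = 0) :
    SymTraceless J := by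
  refine ⟨h, fun b' => ?_⟩
  have h1 := LinearMap.trace_eq_sum_inner (J : V3 →ₗ[ℝ] V3) b
  have h2 := LinearMap.trace_eq_sum_inner (J : V3 →ₗ[ℝ] V3) b'
  simp only [ContinuousLinearMap.coe_coe] at h1 h2
  rw [← h2, h1, hb]

lemma SymTraceless.add {K : V3 →L[ℝ] V3} (hJ : SymTraceless J) (hK : SymTraceless K) :
    SymTraceless (J + K) :=
  ⟨fun u v => by simp [inner_add_left, inner_add_right, hJ.1, hK.1], fun b => by
    simp [inner_add_right, Finset.sum_add_distrib, hJ.2 b, hK.2 b]⟩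

lemma SymTraceless.smul (a : ℝ) (hJ : SymTraceless J) : SymTraceless (a • J) :=
  ⟨fun u v => by simp [inner_smul_left, inner_smul_right, hJ.1], fun b => by
    simp [inner_smul_right, ← Finset.mul_sum, hJ.2 b]⟩

lemma symTraceless_zero : SymTraceless (0 : V3 →L[ℝ] V3) := ⟨by simp, by simp⟩

lemma SymTraceless.sum {ι : Type*} {s : Finset ι} {J : ι → V3 →L[ℝ] V3}
    (h : ∀ i ∈ s, SymTraceless (J i)) : SymTraceless (∑ i ∈ s, J i) := by
  classical
  induction s using Finset.induction_on with
  | empty => simpa using symTraceless_zero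
  | insert a s ha ih =>
    rw [Finset.sum_insert ha]
    exact (h a (by simp)).add (ih fun i hi => h i (by simp [hi]))

lemma isClosed_symTraceless : IsClosed {J : V3 →L[ℝ] V3 | SymTraceless J} := by
  have : {J : V3 →L[ℝ] V3 | SymTraceless J} = (⋂ u : V3, ⋂ v : V3, {J | ⟪J u, v⟫ = ⟪u, J v⟫}) ∩
      ⋂ b : OrthonormalBasis (Fin 3) ℝ V3, {J : V3 →L[ℝ] V3 | ∑ i, ⟪b i, J (b i)⟫ = 0} := by
    ext J; simp [SymTraceless]
  rw [this]
  refine IsClosed.inter (isClosed_iInter fun u => isClosed_iInter fun v => ?_)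
    (isClosed_iInter fun b => ?_)
  · exact isClosed_eq (by fun_prop) (by fun_prop)
  · exact isClosed_eq (by fun_prop) (by fun_prop)

lemma SymTraceless.axial_eq_zero (h : SymTraceless J) : axial J = 0 := by
  have key : ∀ i j : Fin 3, (J (single i 1)) j = (J (single j 1)) i := by
    intro i j
    have := h.1 (single i 1) (single j 1)
    simpa [inner_single_left, inner_single_right] using this
  apply ext3 <;> simp [axial, key 1 2, key 0 2, key 0 1]

lemma SymTraceless.sum_diag (h : SymTraceless J) : ∑ i, (J (single i 1)) i = 0 := by
  simpa [inner_single_left] using h.2 (EuclideanSpace.basisFun (Fin 3) ℝ)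

lemma curl_eq_zero (hF : HasFDerivAt F J x) (hJ : SymTraceless J) : curl F x = 0 := by
  rw [curl_eq_axial, hF.fderiv, hJ.axial_eq_zero]

lemma curl_zero (x : V3) : curl (0 : V3 → V3) x = 0 :=
  curl_eq_zero (hasFDerivAt_const (0 : V3) x) symTraceless_zero

/-- The product rule `∇ × (φ F) = ∇φ × F + φ ∇ × F`. -/
lemma curl_smul {g : V3} (hφ : HasFDerivAt φ (innerSL ℝ g) x) (hF : DifferentiableAt ℝ F x) :
    curl (fun y => φ y • F y) x = cross g (F x) + φ x • curl F x := by
  rw [curl_eq_axial, (hφ.fun_smul hF.hasFDerivAt).fderiv, axial_add, axial_smul, axial_smulRight,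
    add_comm]; rfl

lemma curl_add (hF : DifferentiableAt ℝ F x)
    (hG : DifferentiableAt ℝ G x) : curl (fun y => F y + G y) x = curl F x + curl G x := by
  rw [curl_eq_axial, fderiv_fun_add hF hG, axial_add]; rfl

lemma hasFDerivAt_norm_sq (hF : HasFDerivAt F J x) (hJ : SymTraceless J) :
    HasFDerivAt (fun y => ‖F y‖ ^ 2) (innerSL ℝ ((2 : ℝ) • J (F x))) x := by
  refine hF.norm_sq.congr_fderiv ?_
  ext v
  simp [hJ.1]

lemma hasFDerivAt_inner {K : V3 →L[ℝ] V3} (hF : HasFDerivAt F J x)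
    (hG : HasFDerivAt G K x) (hJ : SymTraceless J) (hK : SymTraceless K) :
    HasFDerivAt (fun y => (⟪F y, G y⟫ : ℝ)) (innerSL ℝ (J (G x) + K (F x))) x := by
  refine (hF.inner ℝ hG).congr_fderiv ?_
  ext v
  simp [hJ.1, hK.1]
  rw [add_comm, real_inner_comm, hJ.1]

/-! ### The Coulomb kernel -/

/-- The kernel `x / |x|³`, which is `-∇(1/|x|)`. -/
def kernel (x : V3) : V3 := (‖x‖ ^ 3)⁻¹ • x

/-- The Jacobian `v / |x|³ - 3 (x · v) x / |x|⁵` of the kernel. -/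
def kernelJac (x : V3) : V3 →L[ℝ] V3 := (‖x‖ ^ 3)⁻¹ • ContinuousLinearMap.id ℝ V3 -
    (3 * (‖x‖ ^ 5)⁻¹) • (innerSL ℝ x).smulRight x

lemma hasFDerivAt_norm (hx : x ≠ 0) :
    HasFDerivAt (fun y : V3 => ‖y‖) (innerSL ℝ (‖x‖⁻¹ • x)) x := by
  have h1 : HasFDerivAt (fun y : V3 => ‖y‖ ^ 2) (2 • innerSL ℝ x) x :=
    (hasStrictFDerivAt_norm_sq x).hasFDerivAt
  have h2 := h1.sqrt (by positivity)
  simp only [sqrt_sq (norm_nonneg _)] at h2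
  refine h2.congr_fderiv ?_
  ext v
  simp
  field_simp

lemma hasFDerivAt_kernel (hx : x ≠ 0) : HasFDerivAt kernel (kernelJac x) x := by
  have hn : ‖x‖ ≠ 0 := norm_ne_zero_iff.2 hx
  have h1 : HasFDerivAt (fun y : V3 => (‖y‖ ^ 3)⁻¹) (innerSL ℝ ((-3 * (‖x‖ ^ 5)⁻¹) • x)) x := by
    have := ((hasDerivAt_inv (pow_ne_zero 3 hn)).comp_hasFDerivAt x
      ((hasDerivAt_pow 3 ‖x‖).comp_hasFDerivAt x (hasFDerivAt_norm hx)))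
    refine this.congr_fderiv ?_
    ext v
    simp
    field_simp
  refine (h1.smul (hasFDerivAt_id x)).congr_fderiv ?_
  ext v i
  simp [kernelJac]
  ring

lemma symTraceless_kernelJac (hx : x ≠ 0) : SymTraceless (kernelJac x) := by
  have hn : ‖x‖ ≠ 0 := norm_ne_zero_iff.2 hx
  refine symTraceless_of_trace (fun u v => ?_) (EuclideanSpace.basisFun (Fin 3) ℝ) ?_
  · simp [kernelJac, inner_sub_left, inner_sub_right, inner_smul_left, inner_smul_right,
      real_inner_comm]
    left; ring
  · have := norm_sq_eq x
    simp [kernelJac, Fin.sum_univ_three, inner_single_left, inner_single_right]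
    field_simp
    linear_combination 3 * this

lemma analyticAt_kernel (hx : x ≠ 0) : AnalyticAt ℝ kernel x := by
  have h1 : AnalyticAt ℝ (fun y : V3 => ‖y‖) x := (contDiffAt_norm ℝ hx).analyticAt
  exact ((h1.pow 3).inv (pow_ne_zero 3 (norm_ne_zero_iff.2 hx))).smul analyticAt_id

lemma norm_kernel : ‖kernel x‖ = (‖x‖ ^ 2)⁻¹ := by
  by_cases hx : x = 0
  · simp [hx, kernel]
  have hn : ‖x‖ ≠ 0 := norm_ne_zero_iff.2 hx
  rw [kernel, norm_smul, norm_inv, norm_pow, norm_norm]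
  field_simp

lemma kernel_smul (ht : 0 < t) (x : V3) : kernel (t • x) = (t ^ 2)⁻¹ • kernel x := by
  rw [kernel, kernel, norm_smul, norm_of_nonneg ht.le, smul_smul, smul_smul]
  congr 1
  by_cases hx : ‖x‖ = 0
  · simp [hx]
  · field_simp

lemma coulomb_eq (c : Fin n → V3) (q : Fin n → ℝ) (x : V3) :
    coulomb c q x = ∑ i, (q i / (4 * π)) • kernel (x - c i) := by
  refine Finset.sum_congr rfl fun i _ => ?_
  rw [kernel, smul_smul]
  congr 1
  rw [div_mul_eq_div_div, div_eq_mul_inv]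

/-- The Jacobian of `coulomb c q`. -/
def coulombJac (c : Fin n → V3) (q : Fin n → ℝ) (x : V3) : V3 →L[ℝ] V3 :=
  ∑ i, (q i / (4 * π)) • kernelJac (x - c i)

lemma hasFDerivAt_smul_kernel {w : ℝ} {c : V3} (h : w ≠ 0 → x ≠ c) :
    HasFDerivAt (fun y => w • kernel (y - c)) (w • kernelJac (x - c)) x := by
  by_cases hw : w = 0
  · subst hw
    have h0 : (0 : ℝ) • kernelJac (x - c) = 0 := by ext; simp
    simpa only [h0, zero_smul] using hasFDerivAt_const (𝕜 := ℝ) (0 : V3) x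
  · have h1 := hasFDerivAt_kernel (sub_ne_zero.2 (h hw))
    exact ((h1.comp x ((hasFDerivAt_id x).sub_const c)).const_smul w)

lemma analyticAt_smul_kernel {w : ℝ} {c : V3} (h : w ≠ 0 → x ≠ c) :
    AnalyticAt ℝ (fun y => w • kernel (y - c)) x := by
  by_cases hw : w = 0
  · subst hw
    simpa only [zero_smul] using analyticAt_const (𝕜 := ℝ) (v := (0 : V3)) (x := x)
  · have h1 := analyticAt_kernel (sub_ne_zero.2 (h hw))
    have h2 : AnalyticAt ℝ (fun y : V3 => kernel (y - c)) x :=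
      AnalyticAt.fun_comp (g := kernel) (f := fun y : V3 => y - c) h1 (by fun_prop)
    have h3 : AnalyticAt ℝ (fun _ : V3 => w) x := analyticAt_const
    exact h3.fun_smul h2

section
/-- The hypothesis admits the points `c i` without charge. -/
lemma hasFDerivAt_coulomb (h : ∀ i, q i ≠ 0 → x ≠ c i) :
    HasFDerivAt (coulomb c q) (coulombJac c q x) x := by
  have : coulomb c q = fun y => ∑ i, (q i / (4 * π)) • kernel (y - c i) := funext (coulomb_eq c q)
  rw [this]
  exact HasFDerivAt.fun_sum fun i _ => hasFDerivAt_smul_kernel fun hw => h i fun h0 => hw (by simp [h0])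

lemma analyticAt_coulomb (h : ∀ i, q i ≠ 0 → x ≠ c i) : AnalyticAt ℝ (coulomb c q) x := by
  have : coulomb c q = fun y => ∑ i, (q i / (4 * π)) • kernel (y - c i) := funext (coulomb_eq c q)
  rw [this]
  exact Finset.analyticAt_fun_sum _ fun i _ => analyticAt_smul_kernel fun hw => h i fun h0 => hw (by simp [h0])

lemma symTraceless_coulombJac (h : ∀ i, q i ≠ 0 → x ≠ c i) : SymTraceless (coulombJac c q x) := by
  refine SymTraceless.sum fun i _ => ?_
  by_cases hq : q i = 0
  · have h0 : (q i / (4 * π)) • kernelJac (x - c i) = 0 := by ext; simp [hq]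
    rw [h0]
    exact symTraceless_zero
  · exact (symTraceless_kernelJac (sub_ne_zero.2 (h i hq))).smul _

lemma ne_of_mem_compl_range (hx : x ∈ (range c)ᶜ) (i : Fin n) : x ≠ c i := fun h => hx ⟨i, h.symm⟩

lemma isOpen_compl_range : IsOpen (range c)ᶜ := (finite_range c).isClosed.isOpen_compl

lemma analyticOnNhd_coulomb : AnalyticOnNhd ℝ (coulomb c q) (range c)ᶜ := fun _ hx =>
  analyticAt_coulomb fun i _ => ne_of_mem_compl_range hx i

lemma contDiffOn_coulomb {k : WithTop ℕ∞} : ContDiffOn ℝ k (coulomb c q) (range c)ᶜ := fun x hx =>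
  (analyticOnNhd_coulomb x hx).contDiffAt.contDiffWithinAt

lemma hasFDerivAt_coulomb_compl (q : Fin n → ℝ) (hx : x ∈ (range c)ᶜ) :
    HasFDerivAt (coulomb c q) (coulombJac c q x) x :=
  hasFDerivAt_coulomb fun i _ => ne_of_mem_compl_range hx i

lemma symTraceless_coulombJac_compl (q : Fin n → ℝ) (hx : x ∈ (range c)ᶜ) :
    SymTraceless (coulombJac c q x) :=
  symTraceless_coulombJac fun i _ => ne_of_mem_compl_range hx i

lemma curl_coulomb (hx : x ∈ (range c)ᶜ) : curl (coulomb c q) x = 0 :=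
  curl_eq_zero (hasFDerivAt_coulomb_compl q hx) (symTraceless_coulombJac_compl q hx)

end

lemma coulomb_zero (c : Fin n → V3) : coulomb c (0 : Fin n → ℝ) = 0 := by funext x; simp [coulomb]

lemma coulomb_add (c : Fin n → V3) (q w : Fin n → ℝ) (x : V3) :
    coulomb c (q + w) x = coulomb c q x + coulomb c w x := by
  simp [coulomb_eq, ← Finset.sum_add_distrib, ← add_smul, add_div]

lemma coulomb_smul (c : Fin n → V3) (a : ℝ) (q : Fin n → ℝ) (x : V3) :
    coulomb c (a • q) x = a • coulomb c q x := by
  simp [coulomb_eq, Finset.smul_sum, smul_smul, mul_div_assoc]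

lemma coulomb_neg (c : Fin n → V3) (q : Fin n → ℝ) (x : V3) :
    coulomb c (-q) x = -coulomb c q x := by
  simpa using coulomb_smul c (-1) q x

section

/-! ### Homogeneous leading terms of analytic fields without curl and divergence -/

/-- `A` is homogeneous of degree `a`, with Jacobian `A'`, and has neither curl nor divergence, i.e.
it is the gradient of a harmonic form of degree `a + 1`. -/
structure HarmonicForm (a : ℕ) (A : V3 → V3) (A' : V3 → V3 →L[ℝ] V3) : Prop where
  smul : ∀ (t : ℝ) (u : V3), A (t • u) = t ^ a • A u
  hasFDerivAt : ∀ u, HasFDerivAt A (A' u) u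
  sym : ∀ u, SymTraceless (A' u)
  euler : ∀ u, A' u u = (a : ℝ) • A u

lemma harmonicForm_zero (a : ℕ) : HarmonicForm a 0 0 :=
  ⟨by simp, fun u => hasFDerivAt_const (0 : V3) u, fun _ => symTraceless_zero, by simp⟩

lemma exists_basis_of_unit (he : ‖e‖ = 1) :
    ∃ b : OrthonormalBasis (Fin 3) ℝ V3, b 0 = e ∧ ∀ i ≠ 0, ⟪e, b i⟫ = 0 := by
  have h : Orthonormal ℝ (({0} : Set (Fin 3)).domRestrict fun _ => e) :=
    ⟨fun _ => he, fun i j hij => absurd (Subsingleton.elim i j) hij⟩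
  obtain ⟨b, hb⟩ := h.exists_orthonormalBasis_extension_of_card_eq (by simp)
  obtain rfl := hb 0 rfl
  exact ⟨b, rfl, fun i hi => b.orthonormal.2 hi.symm⟩

/-- The great circle through `e` in the direction `v`. -/
lemma hasDerivAt_circle (e v : V3) : HasDerivAt (fun s : ℝ => cos s • e + sin s • v) v 0 := by
  have h1 := ((Real.hasDerivAt_cos 0).smul_const e).add ((Real.hasDerivAt_sin 0).smul_const v)
  simpa [Pi.add_def] using h1

lemma norm_circle (he : ‖e‖ = 1) (hv : ‖v‖ = 1) (h : ⟪e, v⟫ = 0) (s : ℝ) :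
    ‖cos s • e + sin s • v‖ = 1 := by
  have : ‖cos s • e + sin s • v‖ ^ 2 = 1 := by
    rw [norm_add_sq_real, norm_smul, norm_smul, he, hv, inner_smul_left, inner_smul_right, h]
    simp [Real.cos_sq_add_sin_sq]
  nlinarith [norm_nonneg (cos s • e + sin s • v)]

lemma hasDerivAt_cross {f g : ℝ → V3} {f' g' : V3} (hf : HasDerivAt f f' s)
    (hg : HasDerivAt g g' s) :
    HasDerivAt (fun r => cross (f r) (g r)) (cross f' (g s) + cross (f s) g') s := by
  simpa only [crossL_apply, add_comm] using
    crossL.hasDerivAt_of_bilinear (fun _ => hf) fun _ => hg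

section
variable {a : ℕ} {A C : V3 → V3} {A' C' : V3 → V3 →L[ℝ] V3}

lemma HarmonicForm.comp_circle (hA : HarmonicForm a A A') (e v : V3) :
    HasDerivAt (fun s : ℝ => A (cos s • e + sin s • v)) (A' e v) 0 := by
  have := hA.hasFDerivAt (cos 0 • e + sin 0 • v)
  simpa [comp_def] using this.comp_hasDerivAt 0 (hasDerivAt_circle e v)

/-- If the tangential parts of two harmonic forms are proportional on the unit sphere, then the
radial parts are related by the vanishing of the divergence. -/
lemma HarmonicForm.radial (hA : HarmonicForm a A A') (hC : HarmonicForm d C C')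
    (h : ∀ e : V3, ‖e‖ = 1 → cross e (A e) = k • cross e (C e)) (he : ‖e‖ = 1) :
    (a + 2 : ℝ) * ⟪e, A e⟫ = k * (d + 2) * ⟪e, C e⟫ := by
  set N : V3 →L[ℝ] V3 := A' e + (-k) • C' e with hN
  have hNs : SymTraceless N := (hA.sym e).add ((hC.sym e).smul _)
  set μ := ⟪e, A e - k • C e⟫ with hμ
  have hpar : A e - k • C e = μ • e := eq_smul_of_cross_eq_zero he (by
    rw [cross_sub_right, cross_smul_right, h e he, sub_self])
  have key : ∀ v : V3, ‖v‖ = 1 → ⟪e, v⟫ = 0 → ⟪v, N v⟫ = μ := by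
    intro v hv hev
    have hγ := hasDerivAt_circle e v
    have hAγ := hA.comp_circle e v
    have hCγ := hC.comp_circle e v
    have h1 := (hasDerivAt_cross hγ (hAγ.sub (hCγ.const_smul k)))
    have h2 : (fun s : ℝ => cross (cos s • e + sin s • v)
        (A (cos s • e + sin s • v) - k • C (cos s • e + sin s • v))) =
        fun _ => 0 := by
      funext s
      rw [cross_sub_right, cross_smul_right, h _ (norm_circle he hv hev s), sub_self]
    have h3 := h1.unique (h2 ▸ hasDerivAt_const (0 : ℝ) (0 : V3))
    simp only [Pi.sub_apply, Pi.smul_apply, Real.cos_zero, Real.sin_zero, one_smul, zero_smul, add_zero, hpar] at h3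
    have h4 : cross e (N v - μ • v) = 0 := by
      have : N v = A' e v - k • C' e v := by simp [hN, sub_eq_add_neg]
      rw [cross_sub_right, this, cross_smul_right, cross_comm e v, ← h3, cross_smul_right]
      abel_nf
      module
    have h5 := eq_smul_of_cross_eq_zero he h4
    have h6 : N v = μ • v + ⟪e, N v - μ • v⟫ • e := by rw [← h5]; abel
    rw [h6, inner_add_right, inner_smul_right, inner_smul_right, real_inner_self_eq_norm_sq, hv,
      real_inner_comm e v, hev]
    simp
  obtain ⟨b, hb, hb'⟩ := exists_basis_of_unit he
  have htr := hNs.2 b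
  rw [Fin.sum_univ_three, key _ (b.orthonormal.1 1) (hb' 1 (by decide)),
    key _ (b.orthonormal.1 2) (hb' 2 (by decide)), hb] at htr
  have : N e = (a : ℝ) • A e - (k * d) • C e := by
    simp [hN, hA.euler, hC.euler, sub_eq_add_neg, smul_smul]
  rw [this] at htr
  simp only [hμ, inner_sub_right, inner_smul_right] at htr
  linear_combination htr

/-- A harmonic form which is radial on the unit sphere vanishes. -/
lemma HarmonicForm.eq_zero (hA : HarmonicForm a A A')
    (h : ∀ e : V3, ‖e‖ = 1 → cross e (A e) = 0) : A = 0 := by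
  have h1 : ∀ e : V3, ‖e‖ = 1 → A e = 0 := by
    intro e he
    have h2 := hA.radial (harmonicForm_zero 0) (k := 0) (fun e he => by simp [h e he]) he
    have h3 : ⟪e, A e⟫ = 0 := by
      have : (0 : ℝ) < a + 2 := by positivity
      simpa [this.ne'] using h2
    rw [eq_smul_of_cross_eq_zero he (h e he), h3, zero_smul]
  funext u
  have h0 : A 0 = 0 := by
    obtain ⟨e, he⟩ := exists_norm_eq V3 zero_le_one
    simpa [h1 e he] using hA.smul 0 e
  by_cases hu : u = 0
  · simpa [hu] using h0
  · have hn : ‖u‖ ≠ 0 := norm_ne_zero_iff.2 hu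
    have h4 : u = ‖u‖ • (‖u‖⁻¹ • u) := by rw [smul_smul, mul_inv_cancel₀ hn, one_smul]
    rw [h4, hA.smul, h1 _ (by rw [norm_smul, norm_inv, norm_norm, inv_mul_cancel₀ hn])]
    simp

/-- Tangential parts of harmonic forms of different degrees are never proportional on the sphere,
since they belong to different eigenvalues of the spherical Laplacian. -/
lemma HarmonicForm.eq_zero_of_proportional (hA : HarmonicForm a A A') (hC : HarmonicForm d C C')
    (had : d < a) (h : ∀ e : V3, ‖e‖ = 1 → cross e (A e) = k • cross e (C e)) : A = 0 := by
  refine hA.eq_zero fun e he => ?_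
  have hpar : A e - k • C e = ⟪e, A e - k • C e⟫ • e := eq_smul_of_cross_eq_zero he (by
    rw [cross_sub_right, cross_smul_right, h e he, sub_self])
  have key : ∀ v : V3, ‖v‖ = 1 → ⟪e, v⟫ = 0 → ⟪v, A e⟫ = 0 := by
    intro v hv hev
    have hγ := hasDerivAt_circle e v
    have hAγ := hA.comp_circle e v
    have hCγ := hC.comp_circle e v
    have h1 := ((hγ.inner ℝ hAγ).const_mul (a + 2 : ℝ)).sub
      ((hγ.inner ℝ hCγ).const_mul (k * (d + 2)))
    have h2 := h1.unique ((hasDerivAt_const (0 : ℝ) (0 : ℝ)).congr_of_eventuallyEq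
      (.of_forall fun s => by simpa using sub_eq_zero.2 (hA.radial hC h (norm_circle he hv hev s))))
    simp only [Real.cos_zero, Real.sin_zero, one_smul, zero_smul, add_zero] at h2
    rw [← (hA.sym e).1, ← (hC.sym e).1, hA.euler, hC.euler, inner_smul_left, inner_smul_left] at h2
    have h3 : ⟪v, A e⟫ = k * ⟪v, C e⟫ := by
      have := congrArg (fun w => ⟪v, w⟫) hpar
      simp only [inner_sub_right, inner_smul_right, real_inner_comm e v, hev] at this
      linarith
    rw [real_inner_comm, real_inner_comm v (C e)] at h2
    simp only [conj_trivial] at h2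
    have h4 : (((a : ℝ) + 2) * (a + 1) - (d + 2) * (d + 1)) * ⟪v, A e⟫ = 0 := by
      linear_combination h2 - (d + 2) * (d + 1) * h3
    have h5 : (d : ℝ) < a := by exact_mod_cast had
    have h6 : ((a : ℝ) + 2) * (a + 1) - (d + 2) * (d + 1) ≠ 0 := by
      have : (0 : ℝ) ≤ d := by positivity
      nlinarith
    exact (mul_eq_zero.1 h4).resolve_left h6
  obtain ⟨b, hb, hb'⟩ := exists_basis_of_unit he
  have hsum := b.sum_repr' (A e)
  rw [Fin.sum_univ_three, key _ (b.orthonormal.1 1) (hb' 1 (by decide)),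
    key _ (b.orthonormal.1 2) (hb' 2 (by decide)), hb] at hsum
  rw [← hsum]
  simp [cross_smul_right]

/-- Let `A ≠ 0` and `C ≠ 0` be harmonic forms of degrees `a` and `d`. The tangential parts
of `A` and of `y C` cannot cancel in the limit if `y → 0` in the case `a ≤ d`. -/
lemma HarmonicForm.no_balance (hA : HarmonicForm a A A') (hC : HarmonicForm d C C') (hA0 : A ≠ 0)
    (hC0 : C ≠ 0) {l : Filter ℝ} [l.NeBot] {y : ℝ → ℝ} (hy : a ≤ d → Tendsto y l (𝓝 0))
    {k₁ k₂ : ℝ} (hk₁ : k₁ ≠ 0) (hk₂ : k₂ ≠ 0)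
    (h : ∀ e : V3, ‖e‖ = 1 → ∃ U W : ℝ → V3, Tendsto U l (𝓝 (k₁ • cross e (A e))) ∧
      Tendsto W l (𝓝 (k₂ • cross e (C e))) ∧ ∀ᶠ t in l, U t + y t • W t = 0) : False := by
  have h0 : ∃ e : V3, ‖e‖ = 1 ∧ cross e (C e) ≠ 0 := by
    by_contra! hc
    exact hC0 (hC.eq_zero hc)
  obtain ⟨e, he, hCe⟩ := h0
  obtain ⟨U, W, hU, hW, hUW⟩ := h e he
  have hne : k₂ • cross e (C e) ≠ 0 := smul_ne_zero hk₂ hCe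
  obtain ⟨ζ, hζ⟩ : ∃ ζ, Tendsto y l (𝓝 ζ) := by
    refine ⟨_, Tendsto.congr' ?_ (((hU.inner hW).neg).div (hW.norm.pow 2) (by positivity))⟩
    filter_upwards [hUW, hW.eventually_ne hne] with t ht htW
    have : U t = -(y t • W t) := eq_neg_of_add_eq_zero_left ht
    simp only [this, Pi.div_apply, inner_neg_left, inner_smul_left, real_inner_self_eq_norm_sq]
    have : ‖W t‖ ≠ 0 := norm_ne_zero_iff.2 htW
    simp; field_simp
  have hrel : ∀ e : V3, ‖e‖ = 1 → cross e (A e) = (-(ζ * k₂) / k₁) • cross e (C e) := by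
    intro e he
    obtain ⟨U, W, hU, hW, hUW⟩ := h e he
    have h1 := tendsto_nhds_unique (tendsto_const_nhds.congr' (hUW.mono fun t ht => ht.symm))
      (hU.add (hζ.smul hW))
    have h2 : k₁ • cross e (A e) = (-(ζ * k₂)) • cross e (C e) := by
      rw [neg_smul, ← smul_smul]; exact eq_neg_of_add_eq_zero_left h1.symm
    rw [div_eq_inv_mul, ← smul_smul, ← h2, smul_smul, inv_mul_cancel₀ hk₁, one_smul]
  rcases le_or_gt a d with had | had
  · have : ζ = 0 := tendsto_nhds_unique hζ (hy had)
    exact hA0 (hA.eq_zero fun e he => by simp [hrel e he, this])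
  · exact hA0 (hA.eq_zero_of_proportional hC had hrel)

end

/-- `M` is the homogeneous leading term, of degree `m`, of the field `F` at the point `c`, and
`P'` is its Jacobian; the limits along rays also describe the first derivatives. -/
structure LeadingTerm (F : V3 → V3) (c : V3) (m : ℕ) (M : V3 [×m]→L[ℝ] V3)
    (P' : V3 → V3 →L[ℝ] V3) : Prop where
  form : HarmonicForm m (fun u => M fun _ => u) P'
  ne : (fun u => M fun _ => u) ≠ 0
  tendsto : ∀ u, (fun t : ℝ => (t ^ m)⁻¹ • F (c + t • u)) ⇝ (M fun _ => u)
  tendsto_fderiv : ∀ u, (fun t : ℝ => ((t ^ m)⁻¹ * t) • fderiv ℝ F (c + t • u)) ⇝ (P' u)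

/-- If the first `m` homogeneous terms of the power series of `f` vanish, then the rescaled
functions `t^{-m} f(c + t u)` converge to the `m`-th term. -/
lemma tendsto_rescale {E : Type*} [NormedAddCommGroup E] [NormedSpace ℝ E] {f : V3 → E} {c : V3}
    {p : FormalMultilinearSeries ℝ V3 E} (hp : HasFPowerSeriesAt f p c) {m : ℕ}
    (hm : ∀ k < m, ∀ u : V3, p k (fun _ => u) = 0) (u : V3) :
    (fun t : ℝ => (t ^ m)⁻¹ • f (c + t • u)) ⇝ (p m fun _ => u) := by
  have h0 : (fun t : ℝ => t • u) ⇝ 0 :=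
    by simpa using tendsto_self_nhdsGT.smul_const u
  have h1 := (isBigO_refl (fun t : ℝ => (t ^ m)⁻¹) _).smul
    ((hp.isBigO_sub_partialSum_pow (m + 1)).comp_tendsto h0)
  have h2 : (fun t : ℝ => t * ‖u‖ ^ (m + 1)) ⇝ 0 := by
    simpa using tendsto_self_nhdsGT.mul_const (‖u‖ ^ (m + 1))
  refine tendsto_sub_nhds_zero_iff.1 ((h1.trans_tendsto (h2.congr' ?_)).congr' ?_) <;>
    filter_upwards [eventually_pos] with t ht
  · simp only [comp_apply, smul_eq_mul, norm_smul, norm_of_nonneg ht.le]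
    field_simp
    ring
  · have h3 : p.partialSum (m + 1) (t • u) = t ^ m • p m fun _ => u := by
      rw [FormalMultilinearSeries.partialSum, Finset.sum_range_succ,
        Finset.sum_eq_zero fun k hk => hm k (Finset.mem_range.1 hk) _, zero_add]
      simpa using (p m).map_smul_univ (fun _ => t) (fun _ => u)
    simp only [comp_apply]
    rw [h3, smul_sub, inv_smul_smul₀ (pow_ne_zero m ht.ne')]

/-- The derivative of a homogeneous term, since a single term is a power series as well. -/
lemma hasFDerivAt_term (p : FormalMultilinearSeries ℝ V3 V3) (j : ℕ) (u : V3) :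
    HasFDerivAt (fun u => p (j + 1) fun _ => u) (p.derivSeries j fun _ => u) u := by
  let q : FormalMultilinearSeries ℝ V3 V3 := fun k => if k = j + 1 then p k else 0
  have hr : q.radius = ⊤ := q.radius_eq_top_of_eventually_eq_zero
    (eventually_atTop.2 ⟨j + 2, fun k hk => if_neg (by omega)⟩)
  have h1 := q.hasFDerivAt_sum (x := u) (by rw [hr]; exact enorm_lt_top)
  have h2 : q.sum = fun u => p (j + 1) fun _ => u := funext fun u => by
    rw [FormalMultilinearSeries.sum, tsum_eq_single (j + 1) fun k hk => by simp [q, hk]]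
    simp [q]
  have h3 : q.derivSeries.sum u = p.derivSeries j fun _ => u := by
    rw [FormalMultilinearSeries.sum, tsum_eq_single j fun k hk => by
      rw [q.derivSeries_eq_zero (if_neg (by omega))]; rfl]
    have h4 : q (1 + j) = p (1 + j) := if_pos (add_comm _ _)
    simp [FormalMultilinearSeries.derivSeries, FormalMultilinearSeries.changeOriginSeries,
      FormalMultilinearSeries.changeOriginSeriesTerm, h4]
  rwa [h2, h3] at h1

/-- An analytic field without curl and divergence which does not vanish near `c` has a
homogeneous leading term there. -/
lemma exists_leadingTerm {c : V3} (hF : AnalyticAt ℝ F c)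
    (hsym : ∀ᶠ x in 𝓝 c, SymTraceless (fderiv ℝ F x)) (hne : ¬ ∀ᶠ x in 𝓝 c, F x = 0) :
    ∃ m M P', LeadingTerm F c m M P' := by
  by_cases hc : F c = 0
  swap
  · refine ⟨0, ContinuousMultilinearMap.constOfIsEmpty ℝ (fun _ => V3) (F c), 0,
      ⟨by simp, fun u => by simpa using hasFDerivAt_const (𝕜 := ℝ) (F c) u, fun _ => symTraceless_zero,
        by simp⟩, fun h => hc (by simpa using congrFun h 0), fun u => ?_, fun u => ?_⟩
    · simpa [comp_def] using hF.continuousAt.tendsto.comp (tendsto_ray c u)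
    · have h1 := hF.fderiv.continuousAt.tendsto.comp (tendsto_ray c u)
      simpa [comp_def] using tendsto_self_nhdsGT.smul h1
  obtain ⟨p, r, hp⟩ := hF
  have hp' := hp.fderiv
  have hdiag : ∀ k (u : V3), p.derivSeries k (fun _ => u) u = ((k : ℝ) + 1) • p (k + 1) fun _ => u := by
    intro k u
    rw [p.derivSeries_apply_diag, ← Nat.cast_succ, Nat.cast_smul_eq_nsmul]
  have hzero : ∀ k (u : V3), (∀ j < k, p.derivSeries j (fun _ => u) = 0) → p k (fun _ => u) = 0 := by
    intro k u h
    rcases k with _ | k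
    · rw [← hc, ← hp.coeff_zero fun _ => u]
    · have := hdiag k u
      rw [h k k.lt_succ_self] at this
      exact (smul_eq_zero.1 this.symm).resolve_left (by positivity)
  have hex : ∃ j, ∃ u : V3, p.derivSeries j (fun _ => u) ≠ 0 := by
    by_contra! h
    apply hne
    have hz : ∀ k, ∀ u : V3, p k (fun _ => u) = 0 := fun k u => hzero k u fun j _ => h j u
    have h3 := hp.eventually_hasSum_sub
    filter_upwards [h3] with x hx
    have : (fun n => p n fun _ => x - c) = fun _ => 0 := funext fun k => hz k _
    rw [this] at hx
    exact hx.unique hasSum_zero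
  classical
  set j := Nat.find hex with hj
  obtain ⟨u₀, hu₀⟩ := Nat.find_spec hex
  have hlt : ∀ k < j, ∀ u : V3, p.derivSeries k (fun _ => u) = 0 := fun k hk u => by
    have := Nat.find_min hex hk
    push Not at this
    exact this u
  have hlt' : ∀ k < j + 1, ∀ u : V3, p k (fun _ => u) = 0 := fun k hk u =>
    hzero k u fun l hl => hlt l (by omega) u
  have hT2 : ∀ u : V3, (fun t : ℝ => ((t ^ (j + 1))⁻¹ * t) • fderiv ℝ F (c + t • u)) ⇝
      (p.derivSeries j fun _ => u) := fun u => by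
    refine (tendsto_rescale ⟨r, hp'⟩ hlt u).congr' ?_
    filter_upwards [eventually_pos] with t ht
    congr 1
    rw [pow_succ]; field_simp
  refine ⟨j + 1, p (j + 1), fun u => p.derivSeries j fun _ => u,
    ⟨fun t u => by simpa using (p (j + 1)).map_smul_univ (fun _ => t) (fun _ => u), hasFDerivAt_term p j,
      fun u => ?_, fun u => by rw [hdiag]; push_cast; rfl⟩, fun h => ?_,
    tendsto_rescale ⟨r, hp⟩ hlt', hT2⟩
  · refine isClosed_symTraceless.mem_of_tendsto (hT2 u) ?_
    filter_upwards [(tendsto_ray c u).eventually hsym] with t ht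
    exact ht.smul _
  · have h1 := hasFDerivAt_term p j u₀
    rw [show (fun u : V3 => p (j + 1) fun _ => u) = fun _ => 0 from h] at h1
    exact hu₀ (h1.unique (hasFDerivAt_const _ _))

end

/-! ### Coulomb fields near the charges and at infinity -/

section
lemma sum_update_zero {E : Type*} [AddCommGroup E] [Module ℝ E] (q : Fin n → ℝ) (i : Fin n)
    (K : Fin n → E) : ∑ j, (q j / (4 * π)) • K j =
      (q i / (4 * π)) • K i + ∑ j, (update q i 0 j / (4 * π)) • K j := by
  rw [← Finset.add_sum_erase _ _ (Finset.mem_univ i),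
    ← Finset.add_sum_erase (a := i) (f := fun j => (update q i 0 j / (4 * π)) • _) _
      (Finset.mem_univ i), update_self, zero_div, zero_smul, zero_add]
  congr 1
  refine Finset.sum_congr rfl fun j hj => ?_
  rw [update_of_ne (Finset.ne_of_mem_erase hj)]

/-- The Coulomb field near the charge `i`: the field of this charge and that of the others. -/
lemma coulomb_split (c : Fin n → V3) (q : Fin n → ℝ) (i : Fin n) (x : V3) :
    coulomb c q x = (q i / (4 * π)) • kernel (x - c i) + coulomb c (update q i 0) x := by
  rw [coulomb_eq, coulomb_eq, sum_update_zero q i]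

lemma coulombJac_split (c : Fin n → V3) (q : Fin n → ℝ) (i : Fin n) (x : V3) :
    coulombJac c q x = (q i / (4 * π)) • kernelJac (x - c i) + coulombJac c (update q i 0) x :=
  sum_update_zero q i _

lemma ne_center_of_charge (hc : Injective c) (hi : w i = 0) (j : Fin n)
    (hj : w j ≠ 0) : c i ≠ c j := fun h => hj (by rw [← hc h, hi])

lemma analyticAt_coulomb_center (hc : Injective c) (hi : w i = 0) :
    AnalyticAt ℝ (coulomb c w) (c i) :=
  analyticAt_coulomb fun j hj => ne_center_of_charge hc hi j hj

lemma eventually_ne_of_charge (h : ∀ j, w j ≠ 0 → x ≠ c j) :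
    ∀ᶠ y in 𝓝 x, ∀ j, w j ≠ 0 → y ≠ c j := by
  refine eventually_all.2 fun j => ?_
  by_cases hj : w j = 0
  · simp [hj]
  · filter_upwards [isOpen_ne.mem_nhds (h j hj)] with y hy _ using hy

lemma eventually_symTraceless_coulomb (h : ∀ j, w j ≠ 0 → x ≠ c j) :
    ∀ᶠ y in 𝓝 x, SymTraceless (fderiv ℝ (coulomb c w) y) := by
  filter_upwards [eventually_ne_of_charge h] with y hy
  rw [(hasFDerivAt_coulomb hy).fderiv]
  exact symTraceless_coulombJac hy

lemma tendsto_ray_ne (x : V3) (hu : ‖u‖ = 1) :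
    Tendsto (fun t : ℝ => x + t • u) (𝓝[>] 0) (𝓝[≠] x) := by
  refine tendsto_nhdsWithin_iff.2 ⟨tendsto_ray x u, ?_⟩
  filter_upwards [eventually_pos] with t ht h
  have h1 : t • u = 0 := by simpa using h
  rcases smul_eq_zero.1 h1 with h2 | h2
  · exact ht.ne' h2
  · simp [h2] at hu

lemma kernel_unit (hu : ‖u‖ = 1) : kernel u = u := by simp [kernel, hu]

lemma kernelJac_smul (ht : 0 < t) (hu : ‖u‖ = 1) (v : V3) :
    kernelJac (t • u) v = (t ^ 3)⁻¹ • (v - (3 * ⟪u, v⟫) • u) := by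
  simp only [kernelJac, norm_smul, hu, norm_of_nonneg ht.le]
  apply ext3 <;> simp <;> field_simp

lemma eventually_mem_compl_range (hc : Injective c) (i : Fin n) :
    ∀ᶠ x in 𝓝[≠] (c i), x ∈ (range c)ᶜ := by
  have h1 : ∀ᶠ x in 𝓝 (c i), ∀ j, j ≠ i → x ≠ c j := by
    refine eventually_all.2 fun j => ?_
    by_cases hj : j = i
    · simp [hj]
    · filter_upwards [isOpen_ne.mem_nhds (hc.ne (Ne.symm hj))] with y hy _ using hy
  filter_upwards [nhdsWithin_le_nhds h1, self_mem_nhdsWithin] with x hx hxi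
  rintro ⟨j, rfl⟩
  by_cases hj : j = i
  · subst hj; exact hxi rfl
  · exact hx j hj rfl

lemma isPreconnected_compl_range (c : Fin n → V3) : IsPreconnected (range c)ᶜ := by
  refine ((finite_range c).countable.isPathConnected_compl_of_one_lt_rank ?_).isConnected.isPreconnected
  rw [← Module.finrank_eq_rank]
  simp

lemma tendsto_coulomb_ray (hc : Injective c) (i : Fin n) (hu : ‖u‖ = 1) :
    (fun t : ℝ => t ^ 2 • coulomb c w (c i + t • u)) ⇝ ((w i / (4 * π)) • u) := by
  have h1 := (analyticAt_coulomb_center (w := update w i 0) hc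
    (update_self i 0 w)).continuousAt.tendsto.comp (tendsto_ray (c i) u)
  have h3 := (tendsto_const_nhds (x := (w i / (4 * π)) • u)).add ((tendsto_pow_nhdsGT 2).smul h1)
  rw [zero_smul, add_zero] at h3
  refine h3.congr' ?_
  filter_upwards [eventually_pos] with t ht
  rw [coulomb_split c w i (c i + t • u), add_sub_cancel_left, kernel_smul ht, kernel_unit hu,
    smul_add, comp_apply, smul_smul, smul_smul]
  congr 2
  field_simp

/-- A Coulomb field which vanishes near some point has no charges. -/
lemma coulomb_unique (hc : Injective c) (hx : x ∈ (range c)ᶜ)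
    (h : ∀ᶠ y in 𝓝 x, coulomb c w y = 0) : w = 0 := by
  have h0 : EqOn (coulomb c w) 0 (range c)ᶜ :=
    analyticOnNhd_coulomb.eqOn_zero_of_preconnected_of_eventuallyEq_zero
      (isPreconnected_compl_range c) hx h
  funext i
  obtain ⟨u, hu⟩ := exists_norm_eq V3 zero_le_one
  have h1 := tendsto_coulomb_ray (w := w) hc i hu
  have h2 : (fun t : ℝ => t ^ 2 • coulomb c w (c i + t • u)) ⇝ 0 := by
    refine tendsto_const_nhds.congr' ?_
    filter_upwards [(tendsto_ray_ne (c i) hu).eventually (eventually_mem_compl_range hc i)] with t ht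
    rw [h0 ht]; simp
  have h3 := tendsto_nhds_unique h1 h2
  have hu0 : u ≠ 0 := fun h => by simp [h] at hu
  have h4 := (smul_eq_zero.1 h3).resolve_right hu0
  simpa [Real.pi_ne_zero] using h4

lemma exists_leadingTerm_coulomb (hc : Injective c) (hi : w i = 0)
    (hw : w ≠ 0) : ∃ m M P', LeadingTerm (coulomb c w) (c i) m M P' := by
  refine exists_leadingTerm (analyticAt_coulomb_center hc hi)
    (eventually_symTraceless_coulomb fun j hj => ne_center_of_charge hc hi j hj) fun h => hw ?_
  obtain ⟨u, hu⟩ := exists_norm_eq V3 zero_le_one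
  have h1 := (tendsto_ray_ne (c i) hu).eventually
    ((eventually_mem_compl_range hc i).and (nhdsWithin_le_nhds h.eventually_nhds))
  obtain ⟨t, ht1, ht2⟩ := h1.exists
  exact coulomb_unique hc ht1 ht2

/-! #### Bounds -/

lemma coulomb_sub_isBigO (hc : Injective c) (i : Fin n) :
    (fun x => coulomb c q x - (q i / (4 * π)) • kernel (x - c i)) =O[𝓝[≠] (c i)]
      fun _ => (1 : ℝ) := by
  have h1 := (analyticAt_coulomb_center (w := update q i 0) hc
    (update_self i 0 q)).continuousAt.tendsto.isBigO_one (F := ℝ)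
  refine (h1.mono nhdsWithin_le_nhds).congr_left fun x => ?_
  rw [coulomb_split c q i x, add_sub_cancel_left]

lemma tendsto_norm_sub_center (x : V3) : Tendsto (fun y => ‖y - x‖) (𝓝[≠] x) (𝓝[>] 0) := by
  refine tendsto_nhdsWithin_iff.2 ⟨?_, ?_⟩
  · have : Tendsto (fun y => ‖y - x‖) (𝓝 x) (𝓝 ‖x - x‖) := Continuous.tendsto (by fun_prop) x
    simpa using this.mono_left nhdsWithin_le_nhds
  · filter_upwards [self_mem_nhdsWithin] with y hy
    exact norm_sub_pos_iff.2 hy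

lemma tendsto_sq_sub_center (x : V3) : Tendsto (fun y => ‖y - x‖ ^ 2) (𝓝[≠] x) (𝓝 0) := by
  simpa using ((tendsto_norm_sub_center x).mono_right nhdsWithin_le_nhds).pow 2

lemma tendsto_sq_smul_sub (hc : Injective c) (i : Fin n) : Tendsto (fun x => ‖x - c i‖ ^ 2 •
    (coulomb c q x - (q i / (4 * π)) • kernel (x - c i))) (𝓝[≠] (c i)) (𝓝 0) := by
  have h := ((isLittleO_one_iff ℝ).2 (tendsto_sq_sub_center (c i))).smul_isBigO
    (coulomb_sub_isBigO (q := q) hc i)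
  simp only [smul_eq_mul, mul_one] at h
  exact (isLittleO_one_iff ℝ).1 h

lemma tendsto_sq_norm_coulomb (hc : Injective c) (i : Fin n) :
    Tendsto (fun x => ‖x - c i‖ ^ 2 * ‖coulomb c q x‖) (𝓝[≠] (c i)) (𝓝 |q i / (4 * π)|) := by
  have h3 := tendsto_sq_smul_sub (q := q) hc i
  have h6 : Tendsto (fun x => ‖x - c i‖ ^ 2 * ‖(q i / (4 * π)) • kernel (x - c i)‖)
      (𝓝[≠] (c i)) (𝓝 |q i / (4 * π)|) := by
    refine tendsto_const_nhds.congr' ?_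
    filter_upwards [self_mem_nhdsWithin] with x hx
    have : ‖x - c i‖ ≠ 0 := (norm_sub_pos_iff.2 hx).ne'
    rw [norm_smul, norm_kernel, norm_eq_abs]; field_simp
  have h7 : Tendsto (fun x => ‖x - c i‖ ^ 2 * ‖coulomb c q x‖ -
      ‖x - c i‖ ^ 2 * ‖(q i / (4 * π)) • kernel (x - c i)‖) (𝓝[≠] (c i)) (𝓝 0) := by
    refine squeeze_zero_norm (fun x => ?_) (tendsto_norm_zero.comp h3)
    have h8 := abs_norm_sub_norm_le (coulomb c q x) ((q i / (4 * π)) • kernel (x - c i))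
    rw [comp_apply, norm_smul (‖x - c i‖ ^ 2), ← mul_sub]
    exact (norm_mul_le _ _).trans (mul_le_mul_of_nonneg_left h8 (norm_nonneg (‖x - c i‖ ^ 2)))
  simpa using h7.add h6

lemma tendsto_norm_coulomb_atTop (hc : Injective c) (hq : q i ≠ 0) :
    Tendsto (fun x => ‖coulomb c q x‖) (𝓝[≠] (c i)) atTop := by
  have h1 := tendsto_sq_norm_coulomb (q := q) hc i
  have h2 : Tendsto (fun x => (‖x - c i‖ ^ 2)⁻¹) (𝓝[≠] (c i)) atTop := by
    refine tendsto_inv_nhdsGT_zero.comp (tendsto_nhdsWithin_iff.2 ⟨?_, ?_⟩)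
    · exact tendsto_sq_sub_center (c i)
    · filter_upwards [self_mem_nhdsWithin] with y hy
      exact pow_pos (norm_sub_pos_iff.2 hy) 2
  have h3 : 0 < |q i / (4 * π)| := abs_pos.2 (by positivity)
  refine (h2.atTop_mul_pos h3 h1).congr' ?_
  filter_upwards [self_mem_nhdsWithin] with x hx
  have : ‖x - c i‖ ≠ 0 := (norm_sub_pos_iff.2 hx).ne'
  field_simp

lemma coulomb_isBigO_center (hc : Injective c) (i : Fin n) :
    (coulomb c q) =O[𝓝[≠] (c i)] fun x => (‖x - c i‖ ^ 2)⁻¹ := by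
  have h1 := (tendsto_sq_norm_coulomb (q := q) hc i).isBigO_one (F := ℝ)
  have h2 := h1.mul (isBigO_refl (fun x => (‖x - c i‖ ^ 2)⁻¹) (𝓝[≠] (c i)))
  simp only [one_mul] at h2
  refine (isBigO_norm_left.1 (h2.congr' ?_ EventuallyEq.rfl))
  filter_upwards [self_mem_nhdsWithin] with x hx
  have : ‖x - c i‖ ≠ 0 := (norm_sub_pos_iff.2 hx).ne'
  field_simp

lemma coulomb_isBigO_infinity (c : Fin n → V3) (q : Fin n → ℝ) :
    (coulomb c q) =O[cobounded V3] fun x => (‖x‖ ^ 2)⁻¹ := by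
  have : coulomb c q = fun y => ∑ i, (q i / (4 * π)) • kernel (y - c i) := funext (coulomb_eq c q)
  rw [this]
  refine IsBigO.fun_sum fun i _ => ?_
  refine IsBigO.trans (IsBigO.of_bound ‖q i / (4 * π)‖ (g := fun x => kernel (x - c i))
    (.of_forall fun x => (norm_smul _ _).le)) (IsBigO.of_bound 4 ?_)
  have h1 : ∀ᶠ x : V3 in cobounded V3, 2 * ‖c i‖ + 1 ≤ ‖x‖ :=
    tendsto_norm_cobounded_atTop.eventually_ge_atTop _
  filter_upwards [h1] with x hx
  have hx0 : 0 < ‖x‖ := by linarith [norm_nonneg (c i)]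
  have h2 : ‖x‖ / 2 ≤ ‖x - c i‖ := by linarith [norm_sub_norm_le x (c i)]
  rw [norm_kernel, norm_inv, norm_pow, norm_norm]
  calc (‖x - c i‖ ^ 2)⁻¹ ≤ ((‖x‖ / 2) ^ 2)⁻¹ := by gcongr
    _ = 4 * (‖x‖ ^ 2)⁻¹ := by field_simp; norm_num

lemma tendsto_coulomb_infinity (c : Fin n → V3) (q : Fin n → ℝ) :
    Tendsto (coulomb c q) (cobounded V3) (𝓝 0) := by
  refine (coulomb_isBigO_infinity c q).trans_tendsto ?_
  exact (tendsto_inv_atTop_zero.comp ((tendsto_pow_atTop two_ne_zero).comp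
    tendsto_norm_cobounded_atTop))

/-- `|coulomb c q|²` takes all positive values. -/
lemma exists_norm_coulomb_eq (hc : Injective c) (hq : q i ≠ 0)
    (hs : 0 < s) : ∃ x ∈ (range c)ᶜ, ‖coulomb c q x‖ ^ 2 = s := by
  have hcont : ContinuousOn (fun x => ‖coulomb c q x‖ ^ 2) (range c)ᶜ :=
    ((contDiffOn_coulomb (k := 0)).continuousOn.norm.pow 2)
  obtain ⟨y, hy1, hy2⟩ := ((eventually_mem_compl_range hc i).and
    (((tendsto_norm_coulomb_atTop hc hq).eventually_ge_atTop (s + 1)))).exists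
  have h3 : ∀ᶠ x in cobounded V3, x ∈ (range c)ᶜ :=
    (Bornology.isBounded_def.1 (finite_range c).isBounded)
  have h4 : ∀ᶠ x in cobounded V3, ‖coulomb c q x‖ ^ 2 < s := by
    have := ((tendsto_coulomb_infinity c q).norm.pow 2)
    simp only [norm_zero, ne_eq, OfNat.ofNat_ne_zero, not_false_eq_true, zero_pow] at this
    exact this.eventually_lt_const hs
  obtain ⟨z, hz1, hz2⟩ := (h3.and h4).exists
  have := (isPreconnected_compl_range c).intermediate_value hz1 hy1 hcont
  exact this ⟨hz2.le, by nlinarith⟩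

end

/-! ### Fields of the form `φ(|K|²) K` -/

section
/-- With `K` scaled to `m u + β` and its Jacobian to `v ↦ m (v - 3 (u · v) u) + N v`, the vector
`(∇|K|²) × K / 2`. -/
lemma cross_jac_expansion (hu : ‖u‖ = 1) (m : ℝ) (β : V3) (N : V3 →L[ℝ] V3) :
    cross (m • ((m • u + β) - (3 * ⟪u, m • u + β⟫) • u) + N (m • u + β)) (m • u + β) =
      -(m ^ 2) • (3 • cross u β + cross u (N u)) +
        (m • cross (N u) β + cross (N β) (m • u + β) - (3 * m * ⟪u, β⟫) • cross u β) := by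
  have h1 : ⟪u, m • u + β⟫ = m + ⟪u, β⟫ := by
    rw [inner_add_right, inner_smul_right, real_inner_self_eq_norm_sq, hu]; ring
  rw [h1, map_add, map_smul]
  generalize N u = a
  generalize N β = b
  apply ext3 <;> simp <;> ring

/-- At `x = c i + t u`, the Coulomb field and its Jacobian, scaled by `t²` and `t³`. -/
lemma coulomb_ray (c : Fin n → V3) (q : Fin n → ℝ) (i : Fin n) (hu : ‖u‖ = 1)
    (ht : 0 < t) : coulomb c q (c i + t • u) = (t ^ 2)⁻¹ • ((q i / (4 * π)) • u +
      t ^ 2 • coulomb c (update q i 0) (c i + t • u)) := by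
  rw [coulomb_split c q i, add_sub_cancel_left, kernel_smul ht, kernel_unit hu, smul_add, smul_smul,
    smul_smul, smul_smul, inv_mul_cancel₀ (by positivity), one_smul, mul_comm]

lemma coulombJac_ray (c : Fin n → V3) (q : Fin n → ℝ) (i : Fin n) (hu : ‖u‖ = 1)
    (ht : 0 < t) (v : V3) : coulombJac c q (c i + t • u) v = (t ^ 3)⁻¹ •
      ((q i / (4 * π)) • (v - (3 * ⟪u, v⟫) • u) +
        (t ^ 3 • coulombJac c (update q i 0) (c i + t • u)) v) := by
  rw [coulombJac_split c q i, add_sub_cancel_left, add_apply,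
    smul_apply, kernelJac_smul ht hu, smul_add, smul_apply,
    smul_smul (t ^ 3)⁻¹ (t ^ 3), inv_mul_cancel₀ (by positivity), one_smul, smul_comm]

lemma LeadingTerm.tendsto_jac (hc : Injective c)
    (hi : w i = 0) {m : ℕ} {M : V3 [×m]→L[ℝ] V3} {P' : V3 → V3 →L[ℝ] V3}
    (h : LeadingTerm (coulomb c w) (c i) m M P') (u : V3) :
    (fun t : ℝ => ((t ^ m)⁻¹ * t) • coulombJac c w (c i + t • u)) ⇝ (P' u) := by
  refine (h.tendsto_fderiv u).congr' ?_
  filter_upwards [(tendsto_ray (c i) u).eventually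
    (eventually_ne_of_charge fun j hj => ne_center_of_charge hc hi j hj)] with t ht
  rw [(hasFDerivAt_coulomb ht).fderiv]

lemma tendsto_cross_jac_expansion {s : ℝ → ℝ} {b a k : ℝ → V3} {C A K : V3}
    {l : Filter ℝ} (hs : Tendsto s l (𝓝 0)) (hb : Tendsto b l (𝓝 C)) (ha : Tendsto a l (𝓝 A))
    (hk : Tendsto k l (𝓝 K)) :
    Tendsto (fun t => -(m ^ 2) • (3 • cross u (b t) + cross u (a t)) + s t •
      (m • cross (a t) (b t) + cross (k t) (m • u + s t • b t) -
        (3 * m * ⟪u, b t⟫) • cross u (b t))) l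
      (𝓝 (-(m ^ 2) • (3 • cross u C + cross u A))) := by
  have hu : Tendsto (fun _ : ℝ => u) l (𝓝 u) := tendsto_const_nhds
  have h1 : Tendsto (fun t => -(m ^ 2) • (3 • cross u (b t) + cross u (a t))) l
      (𝓝 (-(m ^ 2) • (3 • cross u C + cross u A))) :=
    (((tendsto_cross hu hb).const_smul (3 : ℕ)).add (tendsto_cross hu ha)).const_smul (-(m ^ 2))
  have h2 : Tendsto (fun t => m • cross (a t) (b t)) l (𝓝 (m • cross A C)) :=
    (tendsto_cross ha hb).const_smul m
  have h3 : Tendsto (fun t => m • u + s t • b t) l (𝓝 (m • u + (0 : ℝ) • C)) :=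
    tendsto_const_nhds.add (hs.smul hb)
  have h4 : Tendsto (fun t => (3 * m * ⟪u, b t⟫) • cross u (b t)) l
      (𝓝 ((3 * m * ⟪u, C⟫) • cross u C)) :=
    ((hu.inner hb).const_mul (3 * m)).smul (tendsto_cross hu hb)
  have h5 := h1.add (hs.smul ((h2.add (tendsto_cross hk h3)).sub h4))
  rwa [zero_smul, add_zero] at h5

/-- If `∇|K|²` is parallel to the Coulomb field `K` on some open set, then, by analyticity, it is
so everywhere. -/
lemma cross_jac_coulomb_eq_zero (hx : x ∈ (range c)ᶜ)
    (h : ∀ᶠ y in 𝓝 x, cross (coulombJac c q y (coulomb c q y)) (coulomb c q y) = 0) :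
    ∀ y ∈ (range c)ᶜ, cross (coulombJac c q y (coulomb c q y)) (coulomb c q y) = 0 := by
  set G : V3 → V3 := fun y => cross (fderiv ℝ (coulomb c q) y (coulomb c q y)) (coulomb c q y) with hG
  have hGa : AnalyticOnNhd ℝ G (range c)ᶜ := by
    intro y hy
    have h1 := analyticOnNhd_coulomb (q := q) y hy
    have h2 : AnalyticAt ℝ (fun y => fderiv ℝ (coulomb c q) y (coulomb c q y)) y :=
      (ContinuousLinearMap.analyticAt_bilinear (ContinuousLinearMap.id ℝ (V3 →L[ℝ] V3)) _).comp₂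
        h1.fderiv h1
    exact (crossL.analyticAt_bilinear _).comp₂ h2 h1
  have hG0 : EqOn G 0 (range c)ᶜ := by
    refine hGa.eqOn_zero_of_preconnected_of_eventuallyEq_zero (isPreconnected_compl_range c) hx ?_
    filter_upwards [h, isOpen_compl_range.mem_nhds hx] with y hy hy'
    simp only [hG, (hasFDerivAt_coulomb_compl q hy').fderiv, hy, Pi.zero_apply]
  intro y hy
  have := hG0 hy
  simpa only [hG, Pi.zero_apply, (hasFDerivAt_coulomb_compl q hy).fderiv] using this

/-- The preceding identity along a ray from the charge `i`, scaled. -/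
lemma cross_jac_coulomb_ray (hu : ‖u‖ = 1) (ht : 0 < t)
    (hm : q i / (4 * π) = m) (hs : s ≠ 0) {b : V3}
    (h2 : t ^ 2 • coulomb c (update q i 0) (c i + t • u) = s • b)
    (h3 : t ^ 3 • coulombJac c (update q i 0) (c i + t • u) = s • N)
    (h1 : cross (coulombJac c q (c i + t • u) (coulomb c q (c i + t • u)))
        (coulomb c q (c i + t • u)) = 0) :
    -(m ^ 2) • (3 • cross u b + cross u (N u)) + s •
      (m • cross (N u) b + cross (N b) (m • u + s • b) - (3 * m * ⟪u, b⟫) • cross u b) = 0 := by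
  rw [coulombJac_ray c q i hu ht, coulomb_ray c q i hu ht, hm, h2, h3] at h1
  have h4 : cross (m • ((m • u + s • b) - (3 * ⟪u, m • u + s • b⟫) • u) +
      (s • N) (m • u + s • b)) (m • u + s • b) = 0 := by
    rw [map_smul, inner_smul_right, mul_left_comm, mul_smul, ← smul_sub, smul_comm m,
      ← smul_add, cross_smul_left, cross_smul_left, cross_smul_right] at h1
    simpa [ht.ne'] using h1
  rw [cross_jac_expansion hu] at h4
  simp only [smul_apply, map_smul, cross_smul_left, cross_smul_right, inner_smul_right] at h4
  refine (smul_right_injective V3 hs ?_)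
  simp only
  rw [smul_zero, ← h4]
  module

/-- For two or more charges, `∇|K|²` is not parallel to the Coulomb field `K` throughout any open
set: otherwise, by analyticity, this would hold near a charge, where it forces the field of the
other charges to be radial. -/
lemma cross_jac_coulomb_ne_zero (hc : Injective c) (hi : q i ≠ 0)
    (hq : update q i 0 ≠ 0) (hx : x ∈ (range c)ᶜ) :
    ¬ ∀ᶠ y in 𝓝 x, cross (coulombJac c q y (coulomb c q y)) (coulomb c q y) = 0 := by
  intro h
  obtain ⟨d, M, P', hM⟩ := exists_leadingTerm_coulomb hc (update_self i 0 q) hq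
  refine hM.ne (hM.form.eq_zero fun u hu => ?_)
  set m := q i / (4 * π) with hm
  have hm0 : m ≠ 0 := by positivity
  set w := update q i 0 with hw
  have hB := hM.tendsto u
  have hJ := hM.tendsto_jac hc (update_self i 0 q) u
  set b : ℝ → V3 := fun t => (t ^ d)⁻¹ • coulomb c w (c i + t • u) with hb
  set N : ℝ → V3 →L[ℝ] V3 := fun t => ((t ^ d)⁻¹ * t) • coulombJac c w (c i + t • u) with hN
  have hNu : ∀ v : V3, (fun t => N t v) ⇝ (P' u v) := fun v =>
    ((ContinuousLinearMap.apply ℝ V3 v).continuous.tendsto _).comp hJ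
  have hNb : (fun t => N t (b t)) ⇝ (P' u (M fun _ => u)) :=
    (isBoundedBilinearMap_apply.continuous.tendsto (P' u, M fun _ => u)).comp (hJ.prodMk_nhds hB)
  -- the scaled identity, divided by `t ^ (d + 2)`
  have hsum := tendsto_cross_jac_expansion (u := u) (m := m)
    (tendsto_pow_nhdsGT (d + 2)) hB (hNu u) hNb
  have hzero := tendsto_nhds_unique hsum (tendsto_const_nhds (x := (0 : V3)) |>.congr' ?_)
  · rw [hM.form.euler, cross_smul_right] at hzero
    have h2 : ((-(m ^ 2)) * (3 + d)) • cross u (M fun _ => u) = 0 := by rw [← hzero]; module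
    have h3 : (3 + d : ℝ) ≠ 0 := by positivity
    exact (smul_eq_zero.1 h2).resolve_left (by simp [hm0, h3])
  · filter_upwards [self_mem_nhdsWithin, (tendsto_ray_ne (c i) hu).eventually
      (eventually_mem_compl_range hc i)] with t (ht : 0 < t) htX
    refine (cross_jac_coulomb_ray hu ht rfl (by positivity) ?_ ?_
      (cross_jac_coulomb_eq_zero hx h _ htX)).symm
    · simp only [hb, smul_smul]; congr 1; rw [pow_add]; field_simp
    · simp only [hN, smul_smul]; congr 1; rw [pow_add]; field_simp

/-- The product rule for the curl of `φ(|K|²) K`. -/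
lemma curl_radial {φ : ℝ → ℝ} {φ' : ℝ} (hx : x ∈ (range c)ᶜ)
    (hφ : HasDerivAt φ φ' (‖coulomb c q x‖ ^ 2)) :
    curl (fun y => φ (‖coulomb c q y‖ ^ 2) • coulomb c q y) x =
      (2 * φ') • cross (coulombJac c q x (coulomb c q x)) (coulomb c q x) := by
  have hK := hasFDerivAt_coulomb_compl q hx
  have hJ := symTraceless_coulombJac_compl q hx
  have h1 : HasFDerivAt (fun y => φ (‖coulomb c q y‖ ^ 2))
      (innerSL ℝ ((2 * φ') • coulombJac c q x (coulomb c q x))) x := by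
    refine (hφ.comp_hasFDerivAt x (hasFDerivAt_norm_sq hK hJ)).congr_fderiv ?_
    ext v
    simp; ring
  rw [curl_smul h1 hK.differentiableAt, curl_coulomb hx, smul_zero, add_zero, cross_smul_left]

/-- A field `φ(|K|²) K` with non-constant `φ` has a curl, where `K` is the field of at least two
charges. -/
lemma exists_curl_radial_ne_zero (hc : Injective c) (hi : q i ≠ 0)
    (hq : update q i 0 ≠ 0) {φ φ' : ℝ → ℝ} (hφ : ∀ s > 0, HasDerivAt φ (φ' s) s)
    (hφ' : ContinuousOn φ' (Ioi 0)) (hs : 0 < s) (hs' : φ' s ≠ 0) :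
    ∃ x ∈ (range c)ᶜ, curl (fun y => φ (‖coulomb c q y‖ ^ 2) • coulomb c q y) x ≠ 0 := by
  by_contra! h
  obtain ⟨x, hx, hxs⟩ := exists_norm_coulomb_eq hc hi hs
  refine cross_jac_coulomb_ne_zero hc hi hq hx ?_
  have hcont : ContinuousAt (fun y => ‖coulomb c q y‖ ^ 2) x :=
    ((analyticOnNhd_coulomb x hx).continuousAt.norm.pow 2)
  have hpos : ∀ᶠ y in 𝓝 x, 0 < ‖coulomb c q y‖ ^ 2 :=
    hcont.tendsto.eventually_const_lt (by rw [hxs]; exact hs)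
  have hne : ∀ᶠ y in 𝓝 x, φ' (‖coulomb c q y‖ ^ 2) ≠ 0 := by
    have h1 : ContinuousAt φ' (‖coulomb c q x‖ ^ 2) := by
      rw [hxs]; exact hφ'.continuousAt (Ioi_mem_nhds hs)
    exact (h1.comp (f := fun y => ‖coulomb c q y‖ ^ 2) hcont).eventually_ne (by simpa [hxs] using hs')
  filter_upwards [hpos, hne, isOpen_compl_range.mem_nhds hx] with y hy1 hy2 hy3
  have h2 := h y hy3
  rw [curl_radial hy3 (hφ _ hy1)] at h2
  exact (smul_eq_zero.1 h2).resolve_left (by simpa using hy2)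

end

section

/-! ### Response functions -/

/-- The properties of the inverse function `S` of `f'`, with derivative `S'`, on which the analysis
near the point charges depends. The last two fields describe `2 S(p) - k` as `p → 0`: it has a
logarithmic derivative like a power of exponent `r ≠ -3`, and its ratio at asymptotically equal
arguments tends to `1`. -/
structure Response (S S' : ℝ → ℝ) : Prop where
  hasDerivAt : ∀ p, 0 < p → HasDerivAt S (S' p) p
  continuousOn : ContinuousOn S' (Ioi 0)
  pos : ∀ p, 0 < p → 0 < S' p
  one : S 1 = 0
  limits : ∃ s₀, (fun p => p * S p) ⇝ (-s₀) ∧ (fun p => p ^ 2 * S' p) ⇝ s₀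
  exponent : ∀ k, 0 < k → ∃ r, r ≠ -3 ∧ (fun p => 2 * p * S' p / (2 * S p - k)) ⇝ r
  ratio : ∀ k, 0 < k → ∀ p₁ p₂ : ℝ → ℝ, Tendsto p₁ (𝓝[>] 0) (𝓝[>] 0) →
    Tendsto p₂ (𝓝[>] 0) (𝓝[>] 0) → (fun t => p₁ t / p₂ t) ⇝ 1 →
    (fun t => (2 * S (p₁ t) - k) / (2 * S (p₂ t) - k)) ⇝ 1

section
lemma Response.strictMonoOn (hS : Response S S') : StrictMonoOn S (Ioi 0) := by
  refine strictMonoOn_of_deriv_pos (convex_Ioi 0)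
    (fun p hp => (hS.hasDerivAt p hp).continuousAt.continuousWithinAt) fun p hp => ?_
  rw [interior_Ioi] at hp
  rw [(hS.hasDerivAt p hp).deriv]
  exact hS.pos p hp

lemma Response.nonneg (hS : Response S S') {p : ℝ} (hp : 1 ≤ p) : 0 ≤ S p := by
  rw [← hS.one]
  exact hS.strictMonoOn.monotoneOn (mem_Ioi.2 one_pos) (mem_Ioi.2 (by linarith)) hp

lemma Response.neg (hS : Response S S') {p : ℝ} (hp0 : 0 < p) (hp : p < 1) : S p < 0 := by
  rw [← hS.one]
  exact hS.strictMonoOn hp0 (mem_Ioi.2 one_pos) hp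

/-- `p S(p)` is bounded below for small `p`. -/
lemma Response.bddBelow (hS : Response S S') : ∃ K, 0 ≤ K ∧ ∀ p, 0 < p → -K ≤ p * S p := by
  obtain ⟨s₀, h1, -⟩ := hS.limits
  have h2 : ∀ᶠ p in 𝓝[>] (0 : ℝ), -s₀ - 1 < p * S p := h1.eventually_const_lt (by linarith)
  obtain ⟨ε, hε, h3⟩ := mem_nhdsGT_iff_exists_Ioo_subset.1 h2
  have hε : 0 < ε := hε
  refine ⟨max |s₀ + 1| |S (ε / 2)|, le_max_of_le_left (abs_nonneg _), fun p hp => ?_⟩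
  rcases lt_or_ge p ε with h | h
  · have h4 : -s₀ - 1 < p * S p := h3 ⟨hp, h⟩
    have := le_max_left |s₀ + 1| |S (ε / 2)|
    linarith [le_abs_self (s₀ + 1)]
  · have h5 := le_max_right |s₀ + 1| |S (ε / 2)|
    rcases le_or_gt 1 p with h1 | h1
    · have := mul_nonneg hp.le (hS.nonneg h1)
      linarith [abs_nonneg (S (ε / 2))]
    · have h6 : S (ε / 2) ≤ S p := hS.strictMonoOn.monotoneOn (half_pos hε) hp (by linarith)
      nlinarith [neg_abs_le (S (ε / 2)), hS.neg hp h1]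

/-- `p > 0` solves the constitutive equation for given `L` and `b = B²`. -/
def IsRoot (S : ℝ → ℝ) (L b p : ℝ) : Prop := 0 < p ∧ p ^ 2 * (2 * S p + b) = L

/-- The left side increases with `p` where it is not negative. -/
lemma IsRoot.unique (hS : Response S S') {p : ℝ} (hL : 0 ≤ L) (h : IsRoot S L b p)
    (h' : IsRoot S L b p') : p = p' := by
  have key : ∀ {p p' : ℝ}, IsRoot S L b p → IsRoot S L b p' → ¬ p < p' := by
    intro p p' h h' hlt
    have h1 := hS.strictMonoOn h.1 h'.1 hlt
    have h2 : 0 ≤ 2 * S p + b := by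
      have := h.2 ▸ hL
      exact nonneg_of_mul_nonneg_right this (pow_pos h.1 2)
    have h3 : p ^ 2 < p' ^ 2 := pow_lt_pow_left₀ hlt h.1.le two_ne_zero
    have h4 : p ^ 2 * (2 * S p + b) < p' ^ 2 * (2 * S p' + b) := by nlinarith [pow_pos h.1 2]
    rw [h.2, h'.2] at h4
    exact lt_irrefl _ h4
  rcases lt_trichotomy p p' with h1 | h1 | h1
  · exact absurd h1 (key h h')
  · exact h1
  · exact absurd h1 (key h' h)

/-- If `b → ∞` and `L → L₀ > 0`, then `p → 0` like `(L₀ / b)^{1/2}`. -/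
lemma tendsto_root (hS : Response S S') {ι : Type*} {l : Filter ι} {L b p : ι → ℝ} {L₀ : ℝ}
    (hL : Tendsto L l (𝓝 L₀)) (hb : Tendsto b l atTop)
    (hp : ∀ᶠ t in l, IsRoot S (L t) (b t) (p t)) :
    Tendsto p l (𝓝[>] 0) ∧ Tendsto (fun t => p t ^ 2 * (b t + k)) l (𝓝 L₀) ∧
      Tendsto (fun t => 2 * p t ^ 3 * S' (p t)) l (𝓝 0) := by
  obtain ⟨K, hK0, hK⟩ := hS.bddBelow
  have h1 : ∀ᶠ t in l, p t ^ 2 ≤ ((|L₀| + 1) + (2 * K) ^ 2 + 1) / (b t) * 2 := by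
    filter_upwards [hp, hb.eventually_ge_atTop 2,
      hL.eventually_lt_const (show L₀ < |L₀| + 1 by linarith [le_abs_self L₀])] with t ⟨h0, ht⟩ hbt hLt
    have h2 := hK _ h0
    have hb0 : 0 < b t := by linarith
    rw [div_mul_eq_mul_div, le_div_iff₀ hb0]
    have h3 : p t ^ 2 * b t ≤ |L₀| + 1 + 2 * K * p t := by nlinarith
    nlinarith [sq_nonneg (2 * K - p t), sq_nonneg (p t), mul_nonneg (sq_nonneg (p t)) (sub_nonneg.2 hbt)]
  have h2 : Tendsto (fun t => p t ^ 2) l (𝓝 0) := by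
    refine squeeze_zero' (.of_forall fun t => sq_nonneg _) h1 ?_
    simpa using (hb.const_div_atTop ((|L₀| + 1) + (2 * K) ^ 2 + 1)).mul_const 2
  have h3 : Tendsto p l (𝓝 0) := by
    have := h2.sqrt
    rw [Real.sqrt_zero] at this
    refine this.congr' ?_
    filter_upwards [hp] with t ht
    exact sqrt_sq ht.1.le
  have h4 : Tendsto p l (𝓝[>] 0) := tendsto_nhdsWithin_iff.2 ⟨h3, hp.mono fun t ht => ht.1⟩
  obtain ⟨s₀, hs1, hs2⟩ := hS.limits
  refine ⟨h4, ?_, ?_⟩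
  · have h5 := (hL.sub ((h3.mul (hs1.comp h4)).const_mul 2)).add (h2.mul_const k)
    simp only [zero_mul, mul_zero, sub_zero, add_zero] at h5
    refine h5.congr' ?_
    filter_upwards [hp] with t ht
    rw [← ht.2]
    simp only [comp_apply]
    ring
  · have h5 := (h3.mul (hs2.comp h4)).const_mul 2
    simp only [zero_mul, mul_zero] at h5
    refine h5.congr fun t => ?_
    simp only [comp_apply]
    ring

end

/-! ### The curl of dyonic fields

Here `D = λ B + δ`, where `B` and `δ` have no curl and no divergence. With `k = κ⁻²`,
`μ = (B² + k)⁻¹ (λ k - B · δ)`, the fields are `E = (δ + μ B) / p` and `H = p B - (λ - μ) E`. -/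

section
variable {B δ : V3 → V3} {JB Jδ : V3 →L[ℝ] V3} {μ : V3 → ℝ} {gp gμ : V3}

/-- The coefficient `μ` of `B` in the direction of `E`. -/
def mixing (k lam : ℝ) (B δ : V3) : ℝ := (‖B‖ ^ 2 + k)⁻¹ * (lam * k - ⟪B, δ⟫)

/-- `∇μ`. -/
def mixingGrad (k lam : ℝ) (B δ : V3) (JB Jδ : V3 →L[ℝ] V3) : V3 :=
  -((‖B‖ ^ 2 + k)⁻¹ • (JB δ + Jδ B)) - ((‖B‖ ^ 2 + k)⁻¹ * mixing k lam B δ) • ((2 : ℝ) • JB B)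

lemma hasFDerivAt_mixing (hk : 0 < k) (hB : HasFDerivAt B JB x) (hδ : HasFDerivAt δ Jδ x)
    (hJB : SymTraceless JB) (hJδ : SymTraceless Jδ) :
    HasFDerivAt (fun y => mixing k lam (B y) (δ y))
      (innerSL ℝ (mixingGrad k lam (B x) (δ x) JB Jδ)) x := by
  have h0 : ‖B x‖ ^ 2 + k ≠ 0 := by positivity
  have h1 := (hasDerivAt_inv h0).comp_hasFDerivAt x ((hasFDerivAt_norm_sq hB hJB).add_const k)
  have h2 := (hasFDerivAt_inner hB hδ hJB hJδ).const_sub (lam * k)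
  refine (h1.mul h2).congr_fderiv ?_
  ext v
  simp [mixing, mixingGrad]
  field_simp
  ring

/-- `L`, in terms of `B` and `δ`. -/
def reducedForm (k lam : ℝ) (B δ : V3) : ℝ :=
  lam ^ 2 * k + ‖δ‖ ^ 2 - (‖B‖ ^ 2 + k) * mixing k lam B δ ^ 2

/-- `∇L`. -/
def reducedFormGrad (k lam : ℝ) (B δ : V3) (JB Jδ : V3 →L[ℝ] V3) : V3 :=
  (2 : ℝ) • Jδ δ - (mixing k lam B δ ^ 2) • ((2 : ℝ) • JB B) -
    (2 * (lam * k - ⟪B, δ⟫)) • mixingGrad k lam B δ JB Jδ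

lemma hasFDerivAt_reducedForm (hk : 0 < k) (hB : HasFDerivAt B JB x) (hδ : HasFDerivAt δ Jδ x)
    (hJB : SymTraceless JB) (hJδ : SymTraceless Jδ) :
    HasFDerivAt (fun y => reducedForm k lam (B y) (δ y))
      (innerSL ℝ (reducedFormGrad k lam (B x) (δ x) JB Jδ)) x := by
  have h0 : ‖B x‖ ^ 2 + k ≠ 0 := by positivity
  have h1 := hasFDerivAt_mixing (lam := lam) hk hB hδ hJB hJδ
  have h2 := ((hasFDerivAt_norm_sq hδ hJδ).const_add (lam ^ 2 * k)).sub
    (((hasFDerivAt_norm_sq hB hJB).add_const k).mul (h1.pow 2))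
  refine h2.congr_fderiv ?_
  have h3 : (‖B x‖ ^ 2 + k) * mixing k lam (B x) (δ x) = lam * k - ⟪B x, δ x⟫ := by
    rw [mixing]; field_simp
  ext v
  simp [reducedFormGrad, ← h3]
  ring

/-- In terms of `D = λ B + δ`. -/
lemma reducedSq_eq_reducedForm (hκ : 0 < κ) (lam : ℝ) (B δ : V3) :
    reducedSq κ (lam • B + δ) B = reducedForm (κ ^ 2)⁻¹ lam B δ := by
  have h1 : 1 + κ ^ 2 * ‖B‖ ^ 2 ≠ 0 := by positivity
  have h2 : ‖B‖ ^ 2 + (κ ^ 2)⁻¹ ≠ 0 := by positivity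
  have h3 : ‖B‖ ^ 2 * κ ^ 2 + 1 ≠ 0 := by positivity
  have h4 : ‖lam • B + δ‖ ^ 2 = lam ^ 2 * ‖B‖ ^ 2 + 2 * lam * ⟪B, δ⟫ + ‖δ‖ ^ 2 := by
    rw [norm_add_sq_real, norm_smul, inner_smul_left, mul_pow, norm_eq_abs, sq_abs]
    simp; ring
  have h5 : ‖cross B (lam • B + δ)‖ ^ 2 = ‖B‖ ^ 2 * ‖δ‖ ^ 2 - ⟪B, δ⟫ ^ 2 := by
    rw [cross_add_right, cross_smul_right, cross_self, smul_zero, zero_add, norm_cross_sq]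
  rw [reducedSq, h4, h5, reducedForm, mixing]
  field_simp
  ring

lemma coeff_eq (hκ : 0 < κ) (lam : ℝ) (B δ : V3) :
    κ ^ 2 * ⟪B, lam • B + δ⟫ / (1 + κ ^ 2 * ‖B‖ ^ 2) = lam - mixing (κ ^ 2)⁻¹ lam B δ := by
  have h1 : 1 + κ ^ 2 * ‖B‖ ^ 2 ≠ 0 := by positivity
  have h3 : ‖B‖ ^ 2 * κ ^ 2 + 1 ≠ 0 := by positivity
  rw [inner_add_right, inner_smul_right, real_inner_self_eq_norm_sq, mixing]
  field_simp
  ring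

lemma dyonicE_eq (hκ : 0 < κ) (p lam : ℝ) (B δ : V3) :
    dyonicE κ p (lam • B + δ) B = p⁻¹ • (δ + mixing (κ ^ 2)⁻¹ lam B δ • B) := by
  rw [dyonicE, coeff_eq hκ]
  module

lemma dyonicH_eq_sub (p : ℝ) (D B : V3) : dyonicH κ p D B =
      p • B - (κ ^ 2 * ⟪B, D⟫ / (1 + κ ^ 2 * ‖B‖ ^ 2)) • dyonicE κ p D B := by
  have h1 : 1 + κ ^ 2 * ‖B‖ ^ 2 ≠ 0 := by positivity
  rw [dyonicH, dyonicE]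
  by_cases hp : p = 0
  · simp [hp]
  match_scalars <;> field_simp <;> ring

lemma dyonicH_eq (hκ : 0 < κ) (p lam : ℝ) (B δ : V3) :
    dyonicH κ p (lam • B + δ) B = p • B - (lam - mixing (κ ^ 2)⁻¹ lam B δ) •
      (p⁻¹ • (δ + mixing (κ ^ 2)⁻¹ lam B δ • B)) := by
  rw [dyonicH_eq_sub, coeff_eq hκ, dyonicE_eq hκ]

lemma hasFDerivAt_inv (hp : HasFDerivAt p (innerSL ℝ gp) x) (h0 : p x ≠ 0) :
    HasFDerivAt (fun y => (p y)⁻¹) (innerSL ℝ (-((p x ^ 2)⁻¹ • gp))) x := by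
  refine ((hasDerivAt_inv h0).comp_hasFDerivAt x hp).congr_fderiv ?_
  ext v
  simp

lemma curl_electric (hB : HasFDerivAt B JB x) (hδ : HasFDerivAt δ Jδ x)
    (hJB : SymTraceless JB) (hJδ : SymTraceless Jδ) (hp : HasFDerivAt p (innerSL ℝ gp) x)
    (h0 : p x ≠ 0) (hμ : HasFDerivAt μ (innerSL ℝ gμ) x) :
    curl (fun y => (p y)⁻¹ • (δ y + μ y • B y)) x =
      (p x)⁻¹ • cross gμ (B x) - (p x ^ 2)⁻¹ • cross gp (δ x + μ x • B x) := by
  have h1 : DifferentiableAt ℝ (fun y => μ y • B y) x :=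
    hμ.differentiableAt.fun_smul hB.differentiableAt
  rw [curl_smul (hasFDerivAt_inv hp h0) (hδ.differentiableAt.fun_add h1),
    curl_add hδ.differentiableAt h1, curl_smul hμ hB.differentiableAt, curl_eq_zero hB hJB,
    curl_eq_zero hδ hJδ, cross_neg_left, cross_smul_left]
  module

lemma curl_magnetic (hB : HasFDerivAt B JB x) (hδ : HasFDerivAt δ Jδ x)
    (hJB : SymTraceless JB) (hJδ : SymTraceless Jδ) (hp : HasFDerivAt p (innerSL ℝ gp) x)
    (h0 : p x ≠ 0) (hμ : HasFDerivAt μ (innerSL ℝ gμ) x) :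
    curl (fun y => p y • B y - (lam - μ y) • ((p y)⁻¹ • (δ y + μ y • B y))) x =
      cross gp (B x) + (p x)⁻¹ • cross gμ (δ x + μ x • B x) - (lam - μ x) •
        ((p x)⁻¹ • cross gμ (B x) - (p x ^ 2)⁻¹ • cross gp (δ x + μ x • B x)) := by
  have h1 : DifferentiableAt ℝ (fun y => μ y • B y) x :=
    hμ.differentiableAt.fun_smul hB.differentiableAt
  have h2 : DifferentiableAt ℝ (fun y => (p y)⁻¹ • (δ y + μ y • B y)) x :=
    (hasFDerivAt_inv hp h0).differentiableAt.fun_smul (hδ.differentiableAt.fun_add h1)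
  have h3 : HasFDerivAt (fun y => μ y - lam) (innerSL ℝ gμ) x := hμ.sub_const lam
  have h4 : (fun y => p y • B y - (lam - μ y) • ((p y)⁻¹ • (δ y + μ y • B y))) =
      fun y => p y • B y + (μ y - lam) • ((p y)⁻¹ • (δ y + μ y • B y)) := by
    funext y; module
  rw [h4, curl_add (hp.differentiableAt.fun_smul hB.differentiableAt)
    (h3.differentiableAt.fun_smul h2), curl_smul hp hB.differentiableAt, curl_smul h3 h2,
    curl_electric hB hδ hJB hJδ hp h0 hμ, curl_eq_zero hB hJB, cross_smul_right]
  module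

end

/-- A positive multiple of `∇ × E`; here `gμ = ∇μ`, `G = ∇L - p² ∇B²`, `v = p E`, `s = 2 L + σ`. -/
def thetaE (s : ℝ) (gμ G B v : V3) : V3 := s • cross gμ B - cross G v

/-- A positive multiple of `∇ × H`; `P = p²`, `τ = λ - μ`. -/
def thetaH (s P τ : ℝ) (gμ G B v : V3) : V3 :=
  -(τ • thetaE s gμ G B v) + (P • cross G B + s • cross gμ v)

section
variable {pv τ M : ℝ} {gμ G gp : V3}

lemma thetaE_eq_zero (hp : pv ≠ 0) (hG : M • gp = G) (hs : pv * M = s)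
    (h : pv⁻¹ • cross gμ B - (pv ^ 2)⁻¹ • cross gp v = 0) : thetaE s gμ G B v = 0 := by
  rw [thetaE, ← hG, ← hs, cross_smul_left]
  have := congrArg (fun w => (pv ^ 2 * M) • w) h
  simp only [smul_zero] at this
  rw [← this]
  match_scalars <;> field_simp

lemma thetaH_eq_zero (hp : pv ≠ 0) (hG : M • gp = G) (hs : pv * M = s)
    (h : cross gp B + pv⁻¹ • cross gμ v - τ • (pv⁻¹ • cross gμ B - (pv ^ 2)⁻¹ • cross gp v) = 0) :
    thetaH s (pv ^ 2) τ gμ G B v = 0 := by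
  rw [thetaH, thetaE, ← hG, ← hs, cross_smul_left, cross_smul_left]
  have := congrArg (fun w => (pv ^ 2 * M) • w) h
  simp only [smul_zero] at this
  rw [← this]
  match_scalars <;> field_simp

end

/-! ### Rescaling along a ray

Along a ray from a charge, `B = t⁻² β`, `δ = T A` with `T = t ^ a`, and all other quantities are
written with the corresponding powers of `t`. -/

section
variable {T h Z P τ : ℝ} {g z j β A : V3}

/-- The rescaled multiple of `∇ × E`. -/
def rayE (T h Z P s : ℝ) (g z j β A : V3) : V3 :=
  (s + 2 * h * Z ^ 2) • cross z β + (P - h * Z ^ 2) • cross g A + (2 * T * Z) • cross z A -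
    (2 * T ^ 2 * h⁻¹) • cross j A - (2 * T * Z) • cross j β -
    (Z * h * (s + h * Z ^ 2 - P) * T⁻¹) • cross g β

/-- The rescaled multiple of `∇ × H`, up to the contribution of `∇ × E`. -/
def rayH (t T h Z P s : ℝ) (g z j β A : V3) : V3 :=
  (2 * P * T * t ^ 2) • cross j β - (2 * P * t ^ 2 * h * Z) • cross z β +
    s • ((T * t ^ 2) • cross z A + (t ^ 2 * h * Z) • cross z β - (t ^ 2 * h * Z) • cross g A) +
    (t ^ 2 * T⁻¹ * (P * h * (h * Z ^ 2 - P) - s * h ^ 2 * Z ^ 2)) • cross g β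

/-- `∇μ` along the ray. -/
def rayGμ (t T h Z : ℝ) (g z : V3) : V3 := (h * T * t) • z - (t * h ^ 2 * Z) • g

/-- `∇L - p² ∇B²` along the ray. -/
def rayG (t T h Z P : ℝ) (g z j : V3) : V3 :=
  (2 * T ^ 2 * t⁻¹) • j - (((t ^ 2 * h * Z) ^ 2 + t ^ 4 * h * P) * (t ^ 5)⁻¹) • g -
    (2 * (t ^ 2)⁻¹ * Z) • rayGμ t T h Z g z

lemma thetaE_ray (ht : t ≠ 0) (hT : T ≠ 0) (hh : h ≠ 0) :
    thetaE s (rayGμ t T h Z g z) (rayG t T h Z P g z j) ((t ^ 2)⁻¹ • β) (T • A + (h * Z) • β) =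
      (h * T * t⁻¹) • rayE T h Z P s g z j β A := by
  simp only [thetaE, rayGμ, rayG, rayE, cross_smul_left, cross_smul_right, cross_sub_left,
    cross_add_right]
  match_scalars <;> field_simp <;> ring

lemma thetaH_ray (ht : t ≠ 0) (hT : T ≠ 0) (hh : h ≠ 0) :
    thetaH s (t ^ 4 * h * P) τ (rayGμ t T h Z g z) (rayG t T h Z P g z j) ((t ^ 2)⁻¹ • β)
        (T • A + (h * Z) • β) =
      (h * T * t⁻¹) • (-(τ • rayE T h Z P s g z j β A) + rayH t T h Z P s g z j β A) := by
  rw [thetaH, thetaE_ray ht hT hh]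
  simp only [rayGμ, rayG, rayH, cross_smul_left, cross_smul_right, cross_sub_left, cross_add_right]
  match_scalars <;> field_simp <;> ring

end

end

section
variable {T : ℝ} {β A : V3} {Jβ A' : V3 →L[ℝ] V3}

/-- The rescaled `(B² + k)⁻¹`. -/
def rayh (k t : ℝ) (β : V3) : ℝ := (‖β‖ ^ 2 + k * t ^ 4)⁻¹

/-- The rescaled `λ k - B · δ`. -/
def rayZ (k lam t T : ℝ) (β A : V3) : ℝ := lam * k * t ^ 2 - T * ⟪β, A⟫

/-- `L` along the ray. -/
def rayL (k lam t T : ℝ) (β A : V3) : ℝ :=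
  lam ^ 2 * k + T ^ 2 * ‖A‖ ^ 2 - rayh k t β * rayZ k lam t T β A ^ 2

lemma norm_sq_ray (ht : t ≠ 0) : ‖(t ^ 2)⁻¹ • β‖ ^ 2 = (t ^ 4)⁻¹ * ‖β‖ ^ 2 := by
  rw [norm_smul, mul_pow, norm_eq_abs, sq_abs]; ring

lemma rayh_eq (hk : 0 < k) (ht : 0 < t) : (‖(t ^ 2)⁻¹ • β‖ ^ 2 + k)⁻¹ = t ^ 4 * rayh k t β := by
  have h1 : ‖β‖ ^ 2 + k * t ^ 4 ≠ 0 := by positivity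
  rw [norm_sq_ray ht.ne', rayh]
  have h2 : (t ^ 4)⁻¹ * ‖β‖ ^ 2 + k = (t ^ 4)⁻¹ * (‖β‖ ^ 2 + k * t ^ 4) := by field_simp
  rw [h2, mul_inv, inv_inv]

lemma rayh_ne (hk : 0 < k) (ht : 0 < t) : rayh k t β ≠ 0 := by rw [rayh]; positivity

lemma mixing_ray (hk : 0 < k) (ht : 0 < t) :
    mixing k lam ((t ^ 2)⁻¹ • β) (T • A) = t ^ 2 * rayh k t β * rayZ k lam t T β A := by
  rw [mixing, rayh_eq hk ht, rayZ, inner_smul_left, inner_smul_right]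
  simp only [conj_trivial]
  field_simp

lemma mixingGrad_ray (hk : 0 < k) (ht : 0 < t) :
    mixingGrad k lam ((t ^ 2)⁻¹ • β) (T • A) ((t ^ 3)⁻¹ • Jβ) ((T * t⁻¹) • A') =
      rayGμ t T (rayh k t β) (rayZ k lam t T β A) ((2 : ℝ) • Jβ β) (-(Jβ A + A' β)) := by
  rw [mixingGrad, mixing_ray hk ht, rayh_eq hk ht, rayGμ]
  simp only [smul_apply, map_smul]
  match_scalars <;> field_simp

lemma reducedForm_ray (hk : 0 < k) (ht : 0 < t) :
    reducedForm k lam ((t ^ 2)⁻¹ • β) (T • A) = rayL k lam t T β A := by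
  have h1 : ‖(t ^ 2)⁻¹ • β‖ ^ 2 + k = (t ^ 4 * rayh k t β)⁻¹ := by rw [← rayh_eq hk ht, inv_inv]
  have h2 := rayh_ne (β := β) hk ht
  rw [reducedForm, mixing_ray hk ht, h1, rayL, norm_smul, mul_pow, norm_eq_abs, sq_abs]
  field_simp

lemma grad_ray (hk : 0 < k) (ht : 0 < t) {p : ℝ} :
    reducedFormGrad k lam ((t ^ 2)⁻¹ • β) (T • A) ((t ^ 3)⁻¹ • Jβ) ((T * t⁻¹) • A') -
        p ^ 2 • ((2 : ℝ) • ((t ^ 3)⁻¹ • Jβ) ((t ^ 2)⁻¹ • β)) =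
      rayG t T (rayh k t β) (rayZ k lam t T β A) (p ^ 2 * (‖(t ^ 2)⁻¹ • β‖ ^ 2 + k))
        ((2 : ℝ) • Jβ β) (-(Jβ A + A' β)) (A' A) := by
  have h1 : ‖(t ^ 2)⁻¹ • β‖ ^ 2 + k = (t ^ 4 * rayh k t β)⁻¹ := by rw [← rayh_eq hk ht, inv_inv]
  have h2 := rayh_ne (β := β) hk ht
  have h3 : lam * k - ⟪(t ^ 2)⁻¹ • β, T • A⟫ = (t ^ 2)⁻¹ * rayZ k lam t T β A := by
    rw [rayZ, inner_smul_left, inner_smul_right]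
    simp only [conj_trivial]
    field_simp
  rw [reducedFormGrad, mixingGrad_ray hk ht, mixing_ray hk ht, h1, rayG, h3]
  simp only [smul_apply, map_smul]
  match_scalars <;> field_simp <;> ring

end

/-! ### Limits along a ray -/

lemma tendsto_clm_apply {l : Filter ℝ} {J : ℝ → V3 →L[ℝ] V3} {v : ℝ → V3} {J₀ : V3 →L[ℝ] V3}
    {v₀ : V3} (hJ : Tendsto J l (𝓝 J₀)) (hv : Tendsto v l (𝓝 v₀)) :
    Tendsto (fun t => J t (v t)) l (𝓝 (J₀ v₀)) :=
  (isBoundedBilinearMap_apply.continuous.tendsto (J₀, v₀)).comp (hJ.prodMk_nhds hv)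

lemma kernelJac_unit (he : ‖e‖ = 1) (v : V3) : kernelJac e v = v - (3 * ⟪e, v⟫) • e := by
  simpa using kernelJac_smul one_pos he v

/-- Limits of the rescaled fields along a ray in the direction `e`. -/
structure RayLimit (m : ℝ) (e : V3) (ι : ℝ) (A₀ : V3) (A₀' : V3 →L[ℝ] V3) (β A : ℝ → V3)
    (Jβ A' : ℝ → V3 →L[ℝ] V3) (T : ℝ → ℝ) : Prop where
  unit : ‖e‖ = 1
  ne : m ≠ 0
  tendsto_T : T ⇝ ι
  tendsto_β : β ⇝ (m • e)
  tendsto_Jβ : Jβ ⇝ (m • kernelJac e)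
  tendsto_A : A ⇝ A₀
  tendsto_A' : A' ⇝ A₀'

namespace RayLimit
variable {L₀ : ℝ} {P s : ℝ → ℝ}

lemma lim_g (h : RayLimit m e ι A₀ A₀' β A Jβ A' T) :
    (fun t => (2 : ℝ) • Jβ t (β t)) ⇝ (-(4 * m ^ 2) • e) := by
  have h1 := (tendsto_clm_apply h.tendsto_Jβ h.tendsto_β).const_smul (2 : ℝ)
  have h2 : (2 : ℝ) • (m • kernelJac e) (m • e) = -(4 * m ^ 2) • e := by
    rw [smul_apply, map_smul, kernelJac_unit h.unit, real_inner_self_eq_norm_sq, h.unit]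
    module
  rwa [h2] at h1

lemma z (h : RayLimit m e ι A₀ A₀' β A Jβ A' T) :
    (fun t => -(Jβ t (A t) + A' t (β t))) ⇝ (-(m • (A₀ - (3 * ⟪e, A₀⟫) • e) + m • A₀' e)) := by
  have h1 := ((tendsto_clm_apply h.tendsto_Jβ h.tendsto_A).add
    (tendsto_clm_apply h.tendsto_A' h.tendsto_β)).neg
  rwa [smul_apply, map_smul, kernelJac_unit h.unit] at h1

lemma j (h : RayLimit m e ι A₀ A₀' β A Jβ A' T) : (fun t => A' t (A t)) ⇝ (A₀' A₀) :=
  tendsto_clm_apply h.tendsto_A' h.tendsto_A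

lemma lim_w (h : RayLimit m e ι A₀ A₀' β A Jβ A' T) :
    (fun t => (⟪β t, A t⟫ : ℝ)) ⇝ (m * ⟪e, A₀⟫) := by
  simpa [inner_smul_left] using h.tendsto_β.inner (𝕜 := ℝ) h.tendsto_A

lemma tendsto_h (h : RayLimit m e ι A₀ A₀' β A Jβ A' T) :
    (fun t => rayh k t (β t)) ⇝ ((m ^ 2)⁻¹) := by
  have h1 := (h.tendsto_β.norm.pow 2).add ((tendsto_pow_nhdsGT 4).const_mul k)
  rw [norm_smul, h.unit, mul_one, norm_eq_abs, sq_abs, mul_zero, add_zero] at h1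
  exact h1.inv₀ (pow_ne_zero 2 h.ne)

lemma tendsto_Z (h : RayLimit m e ι A₀ A₀' β A Jβ A' T) :
    (fun t => rayZ k lam t (T t) (β t) (A t)) ⇝ (-(ι * (m * ⟪e, A₀⟫))) := by
  have h1 := ((tendsto_pow_nhdsGT 2).const_mul (lam * k)).sub (h.tendsto_T.mul h.lim_w)
  simpa [rayZ] using h1

lemma tendsto_L (h : RayLimit m e ι A₀ A₀' β A Jβ A' T) :
    (fun t => rayL k lam t (T t) (β t) (A t)) ⇝ (lam ^ 2 * k + ι ^ 2 * (‖A₀‖ ^ 2 - ⟪e, A₀⟫ ^ 2)) := by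
  have h1 := (((h.tendsto_T.pow 2).mul (h.tendsto_A.norm.pow 2)).const_add (lam ^ 2 * k)).sub
    ((h.tendsto_h (k := k)).mul ((h.tendsto_Z (k := k) (lam := lam)).pow 2))
  refine (congrArg (fun x => Tendsto _ _ (𝓝 x)) ?_).mp h1
  have := h.ne
  field_simp
  ring

lemma tendsto_b (h : RayLimit m e ι A₀ A₀' β A Jβ A' T) :
    Tendsto (fun t : ℝ => ‖(t ^ 2)⁻¹ • β t‖ ^ 2) (𝓝[>] 0) atTop := by
  have h1 := h.tendsto_β.norm.pow 2
  rw [norm_smul, h.unit, mul_one, norm_eq_abs, sq_abs] at h1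
  have h2 : Tendsto (fun t : ℝ => (t ^ 4)⁻¹) (𝓝[>] 0) atTop :=
    tendsto_inv_nhdsGT_zero.comp (tendsto_nhdsWithin_iff.2 ⟨tendsto_pow_nhdsGT 4, by
        filter_upwards [eventually_pos] with t ht using pow_pos ht 4⟩)
  refine (h2.atTop_mul_pos (pow_pos (abs_pos.2 h.ne) 2 |>.trans_eq (sq_abs m)) h1).congr' ?_
  filter_upwards [eventually_pos] with t ht
  rw [norm_sq_ray ht.ne']

/-- The part of the rescaled multiple of `∇ × E` without the contribution of `∇B² × B`. -/
lemma tendsto_rayE_part (h : RayLimit m e ι A₀ A₀' β A Jβ A' T) (hP : P ⇝ L₀) (hs : s ⇝ (2 * L₀)) :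
    (fun t => (s t + 2 * rayh k t (β t) * rayZ k lam t (T t) (β t) (A t) ^ 2) •
        cross (-(Jβ t (A t) + A' t (β t))) (β t) +
      (P t - rayh k t (β t) * rayZ k lam t (T t) (β t) (A t) ^ 2) •
        cross ((2 : ℝ) • Jβ t (β t)) (A t) +
      (2 * T t * rayZ k lam t (T t) (β t) (A t)) • cross (-(Jβ t (A t) + A' t (β t))) (A t) -
      (2 * T t ^ 2 * (rayh k t (β t))⁻¹) • cross (A' t (A t)) (A t) -
      (2 * T t * rayZ k lam t (T t) (β t) (A t)) • cross (A' t (A t)) (β t)) ⇝ (((2 * L₀ + 2 * ι ^ 2 * ⟪e, A₀⟫ ^ 2) * m ^ 2) • (cross e A₀ + cross e (A₀' e)) -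
        (4 * (L₀ - ι ^ 2 * ⟪e, A₀⟫ ^ 2) * m ^ 2) • cross e A₀ +
        (2 * ι ^ 2 * m ^ 2 * ⟪e, A₀⟫) • cross (A₀ - (3 * ⟪e, A₀⟫) • e + A₀' e) A₀ -
        (2 * ι ^ 2 * m ^ 2) • cross (A₀' A₀) A₀ +
        (2 * ι ^ 2 * m ^ 2 * ⟪e, A₀⟫) • cross (A₀' A₀) e) := by
  have hh := h.tendsto_h (k := k)
  have hZ := h.tendsto_Z (k := k) (lam := lam)
  have hm := h.ne
  have hhi := hh.inv₀ (inv_ne_zero (pow_ne_zero 2 hm))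
  have h1 := (hs.add ((hh.const_mul 2).mul (hZ.pow 2))).smul (tendsto_cross h.z h.tendsto_β)
  have h2 := (hP.sub (hh.mul (hZ.pow 2))).smul (tendsto_cross h.lim_g h.tendsto_A)
  have h3 := ((h.tendsto_T.const_mul 2).mul hZ).smul (tendsto_cross h.z h.tendsto_A)
  have h4 := (((h.tendsto_T.pow 2).const_mul 2).mul hhi).smul (tendsto_cross h.j h.tendsto_A)
  have h5 := ((h.tendsto_T.const_mul 2).mul hZ).smul (tendsto_cross h.j h.tendsto_β)
  refine (congrArg (fun x => Tendsto _ _ (𝓝 x)) ?_).mp ((((h1.add h2).add h3).sub h4).sub h5)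
  rw [cross_comm (A₀ - (3 * ⟪e, A₀⟫) • e + A₀' e) A₀]
  simp only [cross_neg_left, cross_add_left, cross_sub_left, cross_smul_left, cross_smul_right,
    cross_add_right, cross_sub_right, cross_self, cross_comm A₀ e, cross_comm (A₀' e) e,
    cross_comm (A₀' e) A₀]
  match_scalars <;> field_simp <;> ring

/-- The full limit, if the contribution of `∇B² × B` is negligible. -/
lemma tendsto_rayE_zero (h : RayLimit m e 1 A₀ 0 β A Jβ A' fun _ => 1)
    (hP : P ⇝ (lam ^ 2 * k + (‖A₀‖ ^ 2 - ⟪e, A₀⟫ ^ 2)))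
    (hs : s ⇝ (2 * (lam ^ 2 * k + (‖A₀‖ ^ 2 - ⟪e, A₀⟫ ^ 2)))) :
    (fun t => rayE 1 (rayh k t (β t)) (rayZ k lam t 1 (β t) (A t)) (P t) (s t)
        ((2 : ℝ) • Jβ t (β t)) (-(Jβ t (A t) + A' t (β t))) (A' t (A t)) (β t) (A t)) ⇝ ((-2 * (lam ^ 2 * k + (‖A₀‖ ^ 2 - ⟪e, A₀⟫ ^ 2)) * m ^ 2) • cross e A₀) := by
  have h1 := h.tendsto_rayE_part (k := k) (lam := lam) hP hs
  have hh := h.tendsto_h (k := k)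
  have hZ := h.tendsto_Z (k := k) (lam := lam)
  have h2 := (((hZ.mul hh).mul ((hs.add (hh.mul (hZ.pow 2))).sub hP)).mul_const (1 : ℝ)⁻¹).smul
    (tendsto_cross h.lim_g h.tendsto_β)
  refine (congrArg (fun x => Tendsto _ _ (𝓝 x)) ?_).mp (h1.sub h2)
  simp only [zero_apply, cross_zero_left, cross_zero_right, cross_add_left, cross_sub_left,
    cross_smul_left, cross_smul_right, cross_self]
  module

end RayLimit

/-! ### The curl along a ray -/

section
variable {T p : ℝ} {β A : V3} {Jβ A' : V3 →L[ℝ] V3}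

/-- A positive multiple of `∇ × E` in terms of the fields and their Jacobians. -/
def pointE (S' : ℝ → ℝ) (k lam p : ℝ) (B δ : V3) (JB Jδ : V3 →L[ℝ] V3) : V3 :=
  thetaE (2 * reducedForm k lam B δ + 2 * p ^ 3 * S' p) (mixingGrad k lam B δ JB Jδ)
    (reducedFormGrad k lam B δ JB Jδ - p ^ 2 • ((2 : ℝ) • JB B)) B (δ + mixing k lam B δ • B)

/-- A positive multiple of `∇ × H` in terms of the fields and their Jacobians. -/
def pointH (S' : ℝ → ℝ) (k lam p : ℝ) (B δ : V3) (JB Jδ : V3 →L[ℝ] V3) : V3 :=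
  thetaH (2 * reducedForm k lam B δ + 2 * p ^ 3 * S' p) (p ^ 2) (lam - mixing k lam B δ)
    (mixingGrad k lam B δ JB Jδ)
    (reducedFormGrad k lam B δ JB Jδ - p ^ 2 • ((2 : ℝ) • JB B)) B (δ + mixing k lam B δ • B)

lemma pointE_ray (hk : 0 < k) (ht : 0 < t) (hT : T ≠ 0) :
    pointE S' k lam p ((t ^ 2)⁻¹ • β) (T • A) ((t ^ 3)⁻¹ • Jβ) ((T * t⁻¹) • A') =
      (rayh k t β * T * t⁻¹) • rayE T (rayh k t β) (rayZ k lam t T β A)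
        (p ^ 2 * (‖(t ^ 2)⁻¹ • β‖ ^ 2 + k)) (2 * rayL k lam t T β A + 2 * p ^ 3 * S' p)
        ((2 : ℝ) • Jβ β) (-(Jβ A + A' β)) (A' A) β A := by
  rw [pointE, grad_ray hk ht, mixingGrad_ray hk ht, mixing_ray hk ht, reducedForm_ray hk ht,
    ← thetaE_ray ht.ne' hT (rayh_ne hk ht)]
  congr 2
  rw [smul_smul]
  congr 1
  field_simp

lemma pointH_ray (hk : 0 < k) (ht : 0 < t) (hT : T ≠ 0) :
    pointH S' k lam p ((t ^ 2)⁻¹ • β) (T • A) ((t ^ 3)⁻¹ • Jβ) ((T * t⁻¹) • A') =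
      (rayh k t β * T * t⁻¹) • (-((lam - t ^ 2 * rayh k t β * rayZ k lam t T β A) •
        rayE T (rayh k t β) (rayZ k lam t T β A)
        (p ^ 2 * (‖(t ^ 2)⁻¹ • β‖ ^ 2 + k)) (2 * rayL k lam t T β A + 2 * p ^ 3 * S' p)
        ((2 : ℝ) • Jβ β) (-(Jβ A + A' β)) (A' A) β A) +
        rayH t T (rayh k t β) (rayZ k lam t T β A)
        (p ^ 2 * (‖(t ^ 2)⁻¹ • β‖ ^ 2 + k)) (2 * rayL k lam t T β A + 2 * p ^ 3 * S' p)
        ((2 : ℝ) • Jβ β) (-(Jβ A + A' β)) (A' A) β A) := by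
  have h1 : p ^ 2 = t ^ 4 * rayh k t β * (p ^ 2 * (‖(t ^ 2)⁻¹ • β‖ ^ 2 + k)) := by
    rw [← rayh_eq hk ht]
    have : ‖(t ^ 2)⁻¹ • β‖ ^ 2 + k ≠ 0 := by positivity
    field_simp
  rw [pointH, grad_ray hk ht, mixingGrad_ray hk ht, mixing_ray hk ht, reducedForm_ray hk ht,
    ← thetaH_ray ht.ne' hT (rayh_ne hk ht), ← h1]
  congr 2
  rw [smul_smul]
  congr 1
  field_simp

end

/-- The value of `p²(B² + k)` along a ray. -/
def rayP (k t p : ℝ) (β : V3) : ℝ := p ^ 2 * (‖(t ^ 2)⁻¹ • β‖ ^ 2 + k)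

/-- The value of `2 L + 2 p³ S'(p)` along a ray. -/
def rayS (S' : ℝ → ℝ) (k lam t T p : ℝ) (β A : V3) : ℝ := 2 * rayL k lam t T β A + 2 * p ^ 3 * S' p

namespace RayLimit
variable {p : ℝ → ℝ}

lemma tendsto_scalars (h : RayLimit m e ι A₀ A₀' β A Jβ A' T) (hS : Response S S')
    (hp : ∀ᶠ t in 𝓝[>] 0, IsRoot S (rayL k lam t (T t) (β t) (A t)) (‖(t ^ 2)⁻¹ • β t‖ ^ 2) (p t)) :
    Tendsto p (𝓝[>] 0) (𝓝[>] 0) ∧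
    (fun t => rayP k t (p t) (β t)) ⇝ (lam ^ 2 * k + ι ^ 2 * (‖A₀‖ ^ 2 - ⟪e, A₀⟫ ^ 2)) ∧
    (fun t => rayS S' k lam t (T t) (p t) (β t) (A t)) ⇝ (2 * (lam ^ 2 * k + ι ^ 2 * (‖A₀‖ ^ 2 - ⟪e, A₀⟫ ^ 2))) := by
  have hL := h.tendsto_L (k := k) (lam := lam)
  obtain ⟨h1, h2, h3⟩ := tendsto_root (k := k) hS hL h.tendsto_b hp
  refine ⟨h1, h2, ?_⟩
  have h4 := (hL.const_mul 2).add h3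
  rwa [add_zero] at h4

lemma tendsto_τ (h : RayLimit m e ι A₀ A₀' β A Jβ A' T) :
    (fun t => lam - t ^ 2 * rayh k t (β t) * rayZ k lam t (T t) (β t) (A t)) ⇝ lam := by
  simpa using (((tendsto_pow_nhdsGT 2).mul (h.tendsto_h (k := k))).mul
    (h.tendsto_Z (k := k) (lam := lam))).const_sub lam

end RayLimit

section
variable {C₀ : V3} {p : ℝ → ℝ} {a : ℕ}

/-- `rayE`, for the fields along a ray. -/
def fieldE (S' : ℝ → ℝ) (k lam t T p : ℝ) (β A : V3) (Jβ A' : V3 →L[ℝ] V3) : V3 :=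
  rayE T (rayh k t β) (rayZ k lam t T β A) (rayP k t p β) (rayS S' k lam t T p β A)
    ((2 : ℝ) • Jβ β) (-(Jβ A + A' β)) (A' A) β A

/-- `rayH`, for the fields along a ray. -/
def fieldH (S' : ℝ → ℝ) (k lam t T p : ℝ) (β A : V3) (Jβ A' : V3 →L[ℝ] V3) : V3 :=
  rayH t T (rayh k t β) (rayZ k lam t T β A) (rayP k t p β) (rayS S' k lam t T p β A)
    ((2 : ℝ) • Jβ β) (-(Jβ A + A' β)) (A' A) β A

/-- `λ - μ` along a ray. -/
def rayτ (k lam t T : ℝ) (β A : V3) : ℝ := lam - t ^ 2 * rayh k t β * rayZ k lam t T β A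

lemma tendsto_of_eq {ι E : Type*} [TopologicalSpace E] {f : ι → E} {l : Filter ι} {x y : E}
    (h : Tendsto f l (𝓝 x)) (hxy : x = y) : Tendsto f l (𝓝 y) := hxy ▸ h

/-- The root equation along a ray. -/
def RayRoot (S : ℝ → ℝ) (k lam : ℝ) (T p : ℝ → ℝ) (β A : ℝ → V3) : Prop :=
  ∀ᶠ t in 𝓝[>] 0, IsRoot S (rayL k lam t (T t) (β t) (A t)) (‖(t ^ 2)⁻¹ • β t‖ ^ 2) (p t)

namespace RayLimit

lemma tendsto_fieldH_zero (h : RayLimit m e 1 A₀ A₀' β A Jβ A' fun _ => 1) (hS : Response S S')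
    (hp : RayRoot S k lam (fun _ => 1) p β A) :
    (fun t => fieldH S' k lam t 1 (p t) (β t) (A t) (Jβ t) (A' t)) ⇝ 0 := by
  obtain ⟨-, hP, hs⟩ := h.tendsto_scalars hS hp
  have hh := h.tendsto_h (k := k)
  have hZ := h.tendsto_Z (k := k) (lam := lam)
  have ht := tendsto_pow_nhdsGT 2
  have h1 := (((hP.const_mul 2).mul_const 1).mul ht).smul (tendsto_cross h.j h.tendsto_β)
  have h2 := ((((hP.const_mul 2).mul ht).mul hh).mul hZ).smul (tendsto_cross h.z h.tendsto_β)
  have h3 := hs.smul (((ht.const_mul 1).smul (tendsto_cross h.z h.tendsto_A)).add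
    (((ht.mul hh).mul hZ).smul (tendsto_cross h.z h.tendsto_β)) |>.sub
    (((ht.mul hh).mul hZ).smul (tendsto_cross h.lim_g h.tendsto_A)))
  have h4 := ((ht.mul_const (1 : ℝ)⁻¹).mul (((hP.mul hh).mul ((hh.mul (hZ.pow 2)).sub hP)).sub
    ((hs.mul (hh.pow 2)).mul (hZ.pow 2)))).smul (tendsto_cross h.lim_g h.tendsto_β)
  have h5 := ((h1.sub h2).add h3).add h4
  simp only [mul_zero, zero_mul, zero_smul, sub_zero, add_zero, smul_zero] at h5
  exact h5

/-- If the deviation from the self-dual ratio does not vanish at the charge, then it is radial in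
every direction, which is absurd. -/
lemma cross_eq_zero_of_zero (h : RayLimit m e 1 A₀ 0 β A Jβ A' fun _ => 1) (hS : Response S S')
    (hk : 0 < k) (hlam : lam ≠ 0) (hp : RayRoot S k lam (fun _ => 1) p β A)
    (hE : (fun t => fieldE S' k lam t 1 (p t) (β t) (A t) (Jβ t) (A' t)) ⇝ 0) :
    cross e A₀ = 0 := by
  obtain ⟨-, hP, hs⟩ := h.tendsto_scalars hS hp
  simp only [one_pow, one_mul] at hP hs
  have h1 := tendsto_nhds_unique hE (h.tendsto_rayE_zero hP hs)
  refine (smul_eq_zero.1 h1.symm).resolve_left ?_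
  have h2 : ⟪e, A₀⟫ ^ 2 ≤ ‖A₀‖ ^ 2 := by
    have := inner_sq_le e A₀
    simpa [h.unit] using this
  have h3 : 0 < lam ^ 2 * k := by positivity
  have h4 : 0 < lam ^ 2 * k + (‖A₀‖ ^ 2 - ⟪e, A₀⟫ ^ 2) := by linarith
  have := h.ne
  positivity

lemma tendsto_field_of_pointH (h : RayLimit m e ι A₀ A₀' β A Jβ A' T) {j : ℕ} (hlam : lam ≠ 0)
    (hX : (fun t => (t ^ j)⁻¹ • fieldH S' k lam t (T t) (p t) (β t) (A t) (Jβ t) (A' t)) ⇝ 0)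
    (hH : ∀ᶠ t in 𝓝[>] 0, -(rayτ k lam t (T t) (β t) (A t) •
      fieldE S' k lam t (T t) (p t) (β t) (A t) (Jβ t) (A' t)) +
      fieldH S' k lam t (T t) (p t) (β t) (A t) (Jβ t) (A' t) = 0) :
    (fun t => (t ^ j)⁻¹ • fieldE S' k lam t (T t) (p t) (β t) (A t) (Jβ t) (A' t)) ⇝ 0 := by
  have hτ : (fun t => rayτ k lam t (T t) (β t) (A t)) ⇝ lam := h.tendsto_τ
  have h1 := (hτ.inv₀ hlam).smul hX
  rw [smul_zero] at h1
  refine h1.congr' ?_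
  filter_upwards [hH, hτ.eventually_ne hlam] with t h2 h3
  rw [neg_add_eq_zero] at h2
  rw [← h2, smul_smul, smul_smul, mul_comm, mul_inv_cancel_left₀ h3]

/-- The leading balance for `∇ × E = 0`. -/
lemma balanceE (h : RayLimit m e 0 A₀ A₀' β A Jβ A' T) (hS : Response S S')
    (hp : RayRoot S k lam T p β A) (hT : ∀ t, 0 < t → T t ≠ 0) (ha : A₀' e = (a : ℝ) • A₀)
    (hW : (fun t => (t ^ (d + 2))⁻¹ • cross (Jβ t (β t)) (β t)) ⇝ (-(m ^ 2) • ((3 + d : ℝ) • cross e C₀)))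
    (hE : ∀ᶠ t in 𝓝[>] 0, fieldE S' k lam t (T t) (p t) (β t) (A t) (Jβ t) (A' t) = 0) :
    ∃ U W : ℝ → V3, U ⇝ ((2 * (lam ^ 2 * k) * m ^ 2 * (a - 1)) • cross e A₀) ∧
      W ⇝ ((2 * lam * k * (lam ^ 2 * k) * (3 + d)) • cross e C₀) ∧
      ∀ᶠ t in 𝓝[>] 0, U t + (t ^ (d + 4) * (T t)⁻¹) • W t = 0 := by
  obtain ⟨-, hP, hs⟩ := h.tendsto_scalars hS hp
  have hh := h.tendsto_h (k := k)
  have hZ := h.tendsto_Z (k := k) (lam := lam)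
  simp only [zero_pow two_ne_zero, zero_mul, add_zero, neg_zero] at hP hs hZ
  have hU := h.tendsto_rayE_part (k := k) (lam := lam) hP hs
  have hQ := (hs.add (hh.mul (hZ.pow 2))).sub hP
  have hU' := hU.add (((((h.lim_w.const_mul 2).mul hh).mul hQ).mul
    (tendsto_pow_nhdsGT (d + 2))).smul hW)
  have hW' := ((hh.const_mul (2 * lam * k)).mul hQ).neg.smul hW
  refine ⟨_, _, tendsto_of_eq hU' ?_, tendsto_of_eq hW' ?_, ?_⟩
  · rw [ha, cross_smul_right]
    module
  · have := h.ne
    match_scalars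
    field_simp
    ring
  · filter_upwards [hE, eventually_pos] with t h1 ht
    have hT' := hT t ht
    rw [← h1, fieldE, rayE]
    simp only [cross_smul_left _ _ (β t)]
    have h6 : rayZ k lam t (T t) (β t) (A t) * (T t)⁻¹ =
        lam * k * t ^ 2 * (T t)⁻¹ - ⟪β t, A t⟫ := by
      rw [rayZ]; field_simp
    generalize rayS S' k lam t (T t) (p t) (β t) (A t) = s, rayP k t (p t) (β t) = P,
      rayh k t (β t) = η, rayZ k lam t (T t) (β t) (A t) = Z at h6 ⊢
    have h7 : (Z * η * (s + η * Z ^ 2 - P) * (T t)⁻¹) • (2 : ℝ) • cross (Jβ t (β t)) (β t) =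
        (η * (s + η * Z ^ 2 - P) * (lam * k * t ^ 2 * (T t)⁻¹ - ⟪β t, A t⟫)) • (2 : ℝ) • cross (Jβ t (β t)) (β t) := by
      rw [← h6]; congr 1; ring
    rw [h7]
    match_scalars <;> field_simp <;> ring

end RayLimit

/-- In the leading balance for `∇ × H = 0`, the contributions of `∇B² × B` cancel up to a factor
`L - P = p² (2 S - k)`. -/
lemma coefficient_identity {h Z P N w T : ℝ} (hZ : Z = lam * k * t ^ 2 - T * w)
    (hL : L = lam ^ 2 * k + T ^ 2 * N - h * Z ^ 2) (hs : s = 2 * L + r * (L - P)) :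
    (lam - t ^ 2 * h * Z) * (Z * h * (s + h * Z ^ 2 - P)) +
      t ^ 2 * (P * h * (h * Z ^ 2 - P) - s * h ^ 2 * Z ^ 2) =
    t ^ 2 * h * ((L - P) * (2 * L + P + r * (L - h * Z ^ 2) - h * Z ^ 2)) -
      h * (t ^ 2 * T ^ 2 * N + lam * T * w) * (s + h * Z ^ 2 - P) := by
  have h2 : t ^ 2 * T ^ 2 * N = t ^ 2 * L - lam * (Z + T * w) + t ^ 2 * h * Z ^ 2 := by
    rw [hL, hZ]; ring
  rw [h2, hs]
  ring

lemma tendsto_sq_div {p : ℝ → ℝ} {x : ℝ}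
    (hp : ∀ᶠ t in 𝓝[>] 0, 0 < p t) (h : (fun t => p t ^ 2 * (t ^ 4)⁻¹) ⇝ x) :
    (fun t => p t / t ^ 2) ⇝ (Real.sqrt x) := by
  refine h.sqrt.congr' ?_
  filter_upwards [hp, eventually_pos] with t h1 ht
  have : p t ^ 2 * (t ^ 4)⁻¹ = (p t / t ^ 2) ^ 2 := by field_simp
  rw [this, sqrt_sq (by positivity)]

namespace RayLimit

/-- `p ~ |λ| k^{1/2} t² / |m|` if `δ` vanishes at the charge. -/
lemma tendsto_p_div (h : RayLimit m e 0 A₀ A₀' β A Jβ A' T) (hS : Response S S') (hk : 0 < k)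
    (hp : RayRoot S k lam T p β A) :
    (fun t => p t / t ^ 2) ⇝ (√(lam ^ 2 * k * (m ^ 2)⁻¹)) := by
  obtain ⟨-, hP, -⟩ := h.tendsto_scalars hS hp
  simp only [zero_pow two_ne_zero, zero_mul, add_zero] at hP
  refine tendsto_sq_div (hp.mono fun t ht => ht.1) ((hP.mul (h.tendsto_h (k := k))).congr' ?_)
  filter_upwards [eventually_pos] with t ht
  have h1 := rayh_eq (β := β t) hk ht
  have h2 : ‖(t ^ 2)⁻¹ • β t‖ ^ 2 + k ≠ 0 := by positivity
  have h3 : rayh k t (β t) = (t ^ 4)⁻¹ * (‖(t ^ 2)⁻¹ • β t‖ ^ 2 + k)⁻¹ := by rw [h1]; field_simp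
  rw [rayP, h3]
  field_simp

/-- The leading balance for `∇ × H = 0`. -/
lemma balanceH (h : RayLimit m e 0 A₀ A₀' β A Jβ A' T) (hS : Response S S') (hk : 0 < k)
    (hlam : lam ≠ 0) (hp : RayRoot S k lam T p β A) (hT : ∀ t, 0 < t → T t ≠ 0)
    (ha : A₀' e = (a : ℝ) • A₀) {c₀ : ℝ}
    (hr : (fun p => 2 * p * S' p / (2 * S p - k)) ⇝ r)
    (hc₀ : c₀ = √(lam ^ 2 * k * (m ^ 2)⁻¹))
    (hW : (fun t => (t ^ (d + 2))⁻¹ • cross (Jβ t (β t)) (β t)) ⇝ (-(m ^ 2) • ((3 + d : ℝ) • cross e C₀)))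
    (hH : ∀ᶠ t in 𝓝[>] 0, -(rayτ k lam t (T t) (β t) (A t) •
      fieldE S' k lam t (T t) (p t) (β t) (A t) (Jβ t) (A' t)) +
      fieldH S' k lam t (T t) (p t) (β t) (A t) (Jβ t) (A' t) = 0) :
    ∃ U W : ℝ → V3, U ⇝ ((-lam * (2 * (lam ^ 2 * k) * m ^ 2 * (a - 1))) • cross e A₀) ∧
      W ⇝ ((-2 * (m ^ 2)⁻¹ * (lam ^ 2 * k) ^ 2 * (3 + r) * (3 + d)) • cross e C₀) ∧
      ∀ᶠ t in 𝓝[>] 0, U t + (t ^ 4 * (2 * S (c₀ * t ^ 2) - k) * (t ^ (d + 4) * (T t)⁻¹)) • W t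
        = 0 := by
  obtain ⟨hp0, hP, hs⟩ := h.tendsto_scalars hS hp
  have hm := h.ne
  have hc : 0 < c₀ := by rw [hc₀]; positivity
  have hh := h.tendsto_h (k := k)
  have hZ := h.tendsto_Z (k := k) (lam := lam)
  have hL := h.tendsto_L (k := k) (lam := lam)
  have hτ : (fun t => rayτ k lam t (T t) (β t) (A t)) ⇝ lam := h.tendsto_τ
  have hT0 := h.tendsto_T
  have ht2 := tendsto_pow_nhdsGT 2
  have hd2 := tendsto_pow_nhdsGT (d + 2)
  have hd4 := tendsto_pow_nhdsGT (d + 4)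
  simp only [zero_pow two_ne_zero, zero_mul, add_zero, neg_zero] at hP hs hZ hL
  have hU := h.tendsto_rayE_part (k := k) (lam := lam) hP hs
  have hQ := (hs.add (hh.mul (hZ.pow 2))).sub hP
  have hX : (fun t => (2 * S (p t) - k) / (2 * S (c₀ * t ^ 2) - k)) ⇝ 1 := by
    refine hS.ratio k hk p (fun t => c₀ * t ^ 2) hp0 (tendsto_nhdsWithin_iff.2 ⟨?_, ?_⟩) ?_
    · simpa using ht2.const_mul c₀
    · filter_upwards [eventually_pos] with t ht
      exact mul_pos hc (pow_pos ht 2)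
    · have h1 := (h.tendsto_p_div hS hk hp).div_const c₀
      rw [← hc₀, div_self hc.ne'] at h1
      refine h1.congr fun t => ?_
      rw [div_div, mul_comm c₀]
  have hr' := hr.comp hp0
  have hc' : ∀ᶠ t in 𝓝[>] (0 : ℝ), 2 * S (c₀ * t ^ 2) - k ≠ 0 := by
    have h1 : ∀ᶠ t in 𝓝[>] (0 : ℝ), c₀ * t ^ 2 < 1 := by
      have := ht2.const_mul c₀
      rw [mul_zero] at this
      exact this.eventually_lt_const one_pos
    filter_upwards [h1, eventually_pos] with t h1 ht
    have := hS.neg (by positivity) h1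
    linarith
  have hX' : ∀ᶠ t in 𝓝[>] (0 : ℝ), 2 * S (p t) - k ≠ 0 := by
    filter_upwards [hp0.eventually (mem_nhdsWithin_of_mem_nhds (Iio_mem_nhds one_pos)),
      hp0.eventually self_mem_nhdsWithin] with t h1 h2
    have := hS.neg h2 h1
    linarith
  have hN := h.tendsto_A.norm.pow 2
  -- the terms without `∇B² × B`
  have hU1 := (hτ.smul hU).neg
  have hU2 := (((hP.const_mul 2).mul hT0).mul ht2).smul (tendsto_cross h.j h.tendsto_β)
  have hU3 := ((((hP.const_mul 2).mul ht2).mul hh).mul hZ).smul (tendsto_cross h.z h.tendsto_β)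
  have hU4 := hs.smul ((((hT0.mul ht2).smul (tendsto_cross h.z h.tendsto_A)).add
    (((ht2.mul hh).mul hZ).smul (tendsto_cross h.z h.tendsto_β))).sub
    (((ht2.mul hh).mul hZ).smul (tendsto_cross h.lim_g h.tendsto_A)))
  have hU5 := ((((hh.mul (((hd4.mul hT0).mul hN).add ((h.lim_w.const_mul lam).mul hd2))).mul
    hQ).mul_const 2).smul hW)
  have hU' := (((hU1.add hU2).sub hU3).add hU4).sub hU5
  have hW' := (((((hh.pow 2).mul hX).mul hP).mul ((((hL.const_mul 2).add hP).add
    (hr'.mul (hL.sub (hh.mul (hZ.pow 2))))).sub (hh.mul (hZ.pow 2)))).mul_const 2).smul hW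
  refine ⟨_, _, tendsto_of_eq hU' ?_, tendsto_of_eq hW' ?_, ?_⟩
  · rw [ha, cross_smul_right]
    module
  · match_scalars
    field_simp
    ring
  · filter_upwards [hH, hc', hX', hp, eventually_pos] with t h1 hct hXt hpt ht
    have hT' := hT t ht
    rw [← h1, fieldE, fieldH, rayE, rayH]
    simp only [cross_smul_left _ _ (β t), comp_apply]
    have hη := rayh_eq (β := β t) hk ht
    have hb : ‖(t ^ 2)⁻¹ • β t‖ ^ 2 + k ≠ 0 := by positivity
    have hLP : rayL k lam t (T t) (β t) (A t) - rayP k t (p t) (β t) =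
        p t ^ 2 * (2 * S (p t) - k) := by rw [← hpt.2, rayP]; ring
    have hLP' : rayL k lam t (T t) (β t) (A t) - rayP k t (p t) (β t) =
        t ^ 4 * rayh k t (β t) * rayP k t (p t) (β t) * (2 * S (p t) - k) := by
      rw [hLP, ← hη, rayP]; field_simp
    have hs' : rayS S' k lam t (T t) (p t) (β t) (A t) = 2 * rayL k lam t (T t) (β t) (A t) +
        2 * p t * S' (p t) / (2 * S (p t) - k) *
          (rayL k lam t (T t) (β t) (A t) - rayP k t (p t) (β t)) := by
      rw [hLP, rayS]; field_simp
    have key := coefficient_identity (lam := lam) (k := k) (t := t) (T := T t)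
      (w := ⟪β t, A t⟫) (N := ‖A t‖ ^ 2) (Z := rayZ k lam t (T t) (β t) (A t))
      (h := rayh k t (β t)) (L := rayL k lam t (T t) (β t) (A t)) rfl rfl hs'
    rw [← rayτ, hLP'] at key
    have h9 := div_mul_cancel₀ (2 * S (p t) - k) hct
    generalize rayL k lam t (T t) (β t) (A t) = L, rayP k t (p t) (β t) = P,
      rayS S' k lam t (T t) (p t) (β t) (A t) = s, rayτ k lam t (T t) (β t) (A t) = τ,
      rayZ k lam t (T t) (β t) (A t) = Z, rayh k t (β t) = η,
      2 * p t * S' (p t) / (2 * S (p t) - k) = r' at key ⊢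
    generalize (2 * S (p t) - k) / (2 * S (c₀ * t ^ 2) - k) = ρ at h9 ⊢
    rw [← h9] at key
    have h8 : t ^ 4 * (2 * S (c₀ * t ^ 2) - k) * (t ^ (d + 4) * (T t)⁻¹) * (η ^ 2 * ρ * P *
          (2 * L + P + r' * (L - η * Z ^ 2) - η * Z ^ 2) * 2) * (t ^ (d + 2))⁻¹ -
        η * (t ^ (d + 4) * T t * ‖A t‖ ^ 2 + lam * ⟪β t, A t⟫ * t ^ (d + 2)) *
          (s + η * Z ^ 2 - P) * 2 * (t ^ (d + 2))⁻¹ =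
        2 * (T t)⁻¹ * (τ * (Z * η * (s + η * Z ^ 2 - P)) +
          t ^ 2 * (P * η * (η * Z ^ 2 - P) - s * η ^ 2 * Z ^ 2)) := by
      rw [key]
      generalize 2 * S (c₀ * t ^ 2) - k = Xc
      field_simp
      ring
    linear_combination (norm := module) h8 • cross (Jβ t (β t)) (β t)

end RayLimit
end

section

/-! ### The next order, if `δ` vanishes to first order at the charge -/

lemma scaled_cross (he : ‖e‖ = 1) (m : ℝ) (hs : s ≠ 0) (b : V3) (N : V3 →L[ℝ] V3) :
    s⁻¹ • cross ((m • kernelJac e + s • N) (m • e + s • b)) (m • e + s • b) =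
      -(m ^ 2) • (3 • cross e b + cross e (N e)) + s •
        (m • cross (N e) b + cross (N b) (m • e + s • b) - (3 * m * ⟪e, b⟫) • cross e b) := by
  have h1 : (m • kernelJac e + s • N) (m • e + s • b) =
      m • ((m • e + s • b) - (3 * ⟪e, m • e + s • b⟫) • e) + (s • N) (m • e + s • b) := by
    rw [add_apply, smul_apply, kernelJac_unit he]
  rw [h1, cross_jac_expansion he]
  simp only [smul_apply, map_smul, cross_smul_left, cross_smul_right, inner_smul_right]
  match_scalars <;> field_simp

/-- Expansions of the rescaled fields along a ray in the direction `e`, where `δ` is, up to higher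
order terms, the linear map `J`. -/
structure RayExpansion (m : ℝ) (e C₀ : V3) (J : V3 →L[ℝ] V3) (a₃ : V3) (J₃ : V3 →L[ℝ] V3)
    (b A₃ : ℝ → V3) (N A₃' : ℝ → V3 →L[ℝ] V3) (ε : ℝ → ℝ) : Prop where
  unit : ‖e‖ = 1
  ne : m ≠ 0
  tendsto_ε : ε ⇝ 0
  tendsto_b : b ⇝ C₀
  tendsto_N : N ⇝ 0
  tendsto_A₃ : A₃ ⇝ a₃
  tendsto_A₃' : A₃' ⇝ J₃

/-- The part of the limit in `RayExpansion.tendsto_fieldE` that is odd in `e`. -/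
def oddPart (m L₀ : ℝ) (J : V3 →L[ℝ] V3) (C₀ e : V3) : V3 :=
  (-(2 * L₀)) • (cross (m • ((2 : ℝ) • J e - (3 * ⟪e, J e⟫) • e)) C₀ + cross (J C₀) (m • e)) +
    (2 * L₀ * m) • cross (C₀ - (3 * ⟪e, C₀⟫) • e) (J e) -
    (6 * L₀ * m * ⟪e, J e⟫) • cross e C₀

/-- The part of the limit in `RayExpansion.tendsto_fieldE` that is even in `e`. -/
def evenPart (m κ₁ : ℝ) (J : V3 →L[ℝ] V3) (e : V3) : V3 :=
  ((κ₁ + 2 * ⟪e, J e⟫ ^ 2) * m ^ 2) • cross e (J e) -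
    (2 * m ^ 2) • (cross (J (J e)) (J e) + ⟪e, J e⟫ • cross e (J (J e)))

namespace RayExpansion
variable {C₀ a₃ : V3} {J₃ : V3 →L[ℝ] V3} {b A₃ : ℝ → V3} {N A₃' : ℝ → V3 →L[ℝ] V3} {ε p : ℝ → ℝ}

lemma rayLimit (h : RayExpansion m e C₀ J a₃ J₃ b A₃ N A₃' ε) :
    RayLimit m e 0 (J e) J (fun t => m • e + t ^ 2 • b t) (fun t => J e + ε t • A₃ t)
      (fun t => m • kernelJac e + t ^ 2 • N t) (fun t => J + ε t • A₃' t) (fun t => t) := by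
  have ht2 := tendsto_pow_nhdsGT 2
  refine ⟨h.unit, h.ne, tendsto_self_nhdsGT, ?_, ?_, ?_, ?_⟩
  · simpa using (ht2.smul h.tendsto_b).const_add (m • e)
  · exact tendsto_of_eq ((ht2.smul h.tendsto_N).const_add (m • kernelJac e)) (by ext; simp)
  · simpa using (h.tendsto_ε.smul h.tendsto_A₃).const_add (J e)
  · exact tendsto_of_eq ((h.tendsto_ε.smul h.tendsto_A₃').const_add J) (by ext; simp)

lemma cross_z_expansion {ε : ℝ} {b A₃ : V3} {N A₃' : V3 →L[ℝ] V3} (he : ‖e‖ = 1) :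
    cross (-((m • kernelJac e + t ^ 2 • N) (J e + ε • A₃) +
        (J + ε • A₃') (m • e + t ^ 2 • b))) (m • e + t ^ 2 • b) =
      m ^ 2 • ((2 : ℝ) • cross e (J e) + ε • cross e (A₃ + A₃' e)) + t ^ 2 •
        -(cross (m • (J e + ε • A₃ + (J + ε • A₃') e - (3 * ⟪e, J e + ε • A₃⟫) • e)) b +
          cross (N (J e + ε • A₃) + (J + ε • A₃') b) (m • e + t ^ 2 • b)) := by
  have h1 : -((m • kernelJac e + t ^ 2 • N) (J e + ε • A₃) + (J + ε • A₃') (m • e + t ^ 2 • b)) =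
      -(m • ((2 : ℝ) • J e + ε • (A₃ + A₃' e) - (3 * ⟪e, J e + ε • A₃⟫) • e) + t ^ 2 •
        (N (J e + ε • A₃) + (J + ε • A₃') b)) := by
    rw [add_apply, smul_apply, kernelJac_unit he, map_add (J + ε • A₃'), map_smul, map_smul]
    simp only [add_apply, smul_apply]
    module
  have h2 : J e + ε • A₃ + (J + ε • A₃') e - (3 * ⟪e, J e + ε • A₃⟫) • e =
      (2 : ℝ) • J e + ε • (A₃ + A₃' e) - (3 * ⟪e, J e + ε • A₃⟫) • e := by
    simp only [add_apply, smul_apply]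
    module
  rw [h1, h2]
  generalize N (J e + ε • A₃) + (J + ε • A₃') b = u
  generalize A₃ + A₃' e = v
  generalize 3 * ⟪e, J e + ε • A₃⟫ = x
  simp only [cross_neg_left, cross_add_left, cross_sub_left, cross_add_right, cross_smul_left,
    cross_smul_right, cross_self, cross_comm (J e) e, cross_comm v e]
  module

lemma cross_g_expansion {ε : ℝ} {b A₃ : V3} {N : V3 →L[ℝ] V3} (he : ‖e‖ = 1) :
    cross ((2 : ℝ) • (m • kernelJac e + t ^ 2 • N) (m • e + t ^ 2 • b)) (J e + ε • A₃) =
      -(4 * m ^ 2) • (cross e (J e) + ε • cross e A₃) + t ^ 2 • ((2 : ℝ) •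
        cross (m • (b - (3 * ⟪e, b⟫) • e) + N (m • e + t ^ 2 • b)) (J e + ε • A₃)) := by
  rw [add_apply, smul_apply, kernelJac_unit he, smul_apply, inner_add_right, inner_smul_right,
    inner_smul_right, real_inner_self_eq_norm_sq, he]
  generalize N (m • e + t ^ 2 • b) = u
  simp only [cross_add_left, cross_sub_left, cross_add_right, cross_smul_left, cross_smul_right]
  module

/-- The coefficient of `ε` in the expansion. -/
def epsPart (S' : ℝ → ℝ) (k lam m t p : ℝ) (e A₃ : V3) (A₃' : V3 →L[ℝ] V3) (β A : V3) : V3 :=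
  m ^ 2 • ((rayS S' k lam t t p β A + 2 * rayh k t β * rayZ k lam t t β A ^ 2) •
      cross e (A₃ + A₃' e) -
    (4 * (rayP k t p β - rayh k t β * rayZ k lam t t β A ^ 2)) • cross e A₃)

lemma tendsto_epsPart (h : RayExpansion m e C₀ J a₃ J₃ b A₃ N A₃' ε) (hS : Response S S')
    (hp : RayRoot S k lam (fun t => t) p (fun t => m • e + t ^ 2 • b t)
      (fun t => J e + ε t • A₃ t)) :
    (fun t => epsPart S' k lam m t (p t) e (A₃ t) (A₃' t) (m • e + t ^ 2 • b t)
      (J e + ε t • A₃ t)) ⇝ ((m ^ 2 * (2 * (lam ^ 2 * k))) • (cross e (J₃ e) - cross e a₃)) := by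
  have hl := h.rayLimit
  obtain ⟨-, hP, hs⟩ := hl.tendsto_scalars hS hp
  have hh := hl.tendsto_h (k := k)
  have hZ := hl.tendsto_Z (k := k) (lam := lam)
  simp only [zero_pow two_ne_zero, zero_mul, add_zero, neg_zero] at hP hs hZ
  have he : (fun _ : ℝ => e) ⇝ e := tendsto_const_nhds
  have h1 := (hs.add ((hh.const_mul 2).mul (hZ.pow 2))).smul
    (tendsto_cross he (h.tendsto_A₃.add (tendsto_clm_apply h.tendsto_A₃' he)))
  have h2 := ((hP.sub (hh.mul (hZ.pow 2))).const_mul 4).smul (tendsto_cross he h.tendsto_A₃)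
  refine tendsto_of_eq ((h1.sub h2).const_smul (m ^ 2)) ?_
  rw [cross_add_right]
  module

/-- The expansion of the rescaled multiple of `∇ × E` to order `t²`. -/
lemma tendsto_fieldE (h : RayExpansion m e C₀ J a₃ J₃ b A₃ N A₃' ε) (hS : Response S S')
    (hk : 0 < k) (hp : RayRoot S k lam (fun t => t) p (fun t => m • e + t ^ 2 • b t)
      (fun t => J e + ε t • A₃ t)) {s₀ : ℝ} (hs1 : (fun p => p * S p) ⇝ (-s₀))
    (hs2 : (fun p => p ^ 2 * S' p) ⇝ s₀) :
    (fun t => (t ^ 2)⁻¹ • fieldE S' k lam t t (p t) (m • e + t ^ 2 • b t)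
        (J e + ε t • A₃ t) (m • kernelJac e + t ^ 2 • N t) (J + ε t • A₃' t) -
      ((t ^ 2)⁻¹ * ε t) • epsPart S' k lam m t (p t) e (A₃ t) (A₃' t) (m • e + t ^ 2 • b t)
        (J e + ε t • A₃ t)) ⇝ (evenPart m (-(4 * √(lam ^ 2 * k * (m ^ 2)⁻¹) * s₀)) J e +
        oddPart m (lam ^ 2 * k) J C₀ e) := by
  have hl := h.rayLimit
  obtain ⟨hp0, hP, hs⟩ := hl.tendsto_scalars hS hp
  have hm := h.ne
  have hh := hl.tendsto_h (k := k)
  have hZ := hl.tendsto_Z (k := k) (lam := lam)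
  simp only [zero_pow two_ne_zero, zero_mul, add_zero, neg_zero] at hP hs hZ
  have he : (fun _ : ℝ => e) ⇝ e := tendsto_const_nhds
  have hZ1 := (tendsto_self_nhdsGT.const_mul (lam * k)).sub hl.lim_w
  rw [mul_zero, zero_sub] at hZ1
  have hhi := hh.inv₀ (inv_ne_zero (pow_ne_zero 2 hm))
  have hc1 := hs.add ((hh.const_mul 2).mul (hZ.pow 2))
  have hc3 := hP.sub (hh.mul (hZ.pow 2))
  have hpd := hl.tendsto_p_div hS hk hp
  -- the coefficient of `e × J e`
  have hκ := ((hpd.const_mul 4).mul ((((hs1.comp hp0).const_mul 2).sub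
    ((hp0.mono_right nhdsWithin_le_nhds).const_mul k)).add (hs2.comp hp0))).add
    ((hh.const_mul 8).mul (hZ1.pow 2))
  -- the first corrections to `∇(B · δ) × B`, `∇B² × δ` and `∇B² × B`
  have hR1 := ((tendsto_cross (((hl.tendsto_A.add (tendsto_clm_apply hl.tendsto_A' he)).sub
    (((he.inner (𝕜 := ℝ) hl.tendsto_A).const_mul 3).smul he)).const_smul m) h.tendsto_b).add
    (tendsto_cross ((tendsto_clm_apply h.tendsto_N hl.tendsto_A).add
      (tendsto_clm_apply hl.tendsto_A' h.tendsto_b)) hl.tendsto_β)).neg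
  have hR3 := (tendsto_cross (((h.tendsto_b.sub
    (((he.inner (𝕜 := ℝ) h.tendsto_b).const_mul 3).smul he)).const_smul m).add
    (tendsto_clm_apply h.tendsto_N hl.tendsto_β)) hl.tendsto_A).const_smul (2 : ℝ)
  have hW := tendsto_cross_jac_expansion (u := e) (m := m) (tendsto_pow_nhdsGT 2)
    h.tendsto_b (tendsto_clm_apply h.tendsto_N he) (tendsto_clm_apply h.tendsto_N h.tendsto_b)
  have h1 := (((((((hκ.mul_const (m ^ 2)).smul_const (cross e (J e))).add (hc1.smul hR1)).add
    (hc3.smul hR3)).add ((hZ1.const_mul 2).smul (tendsto_cross hl.z hl.tendsto_A))).sub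
    ((hhi.const_mul 2).smul (tendsto_cross hl.j hl.tendsto_A))).sub
    ((hZ1.const_mul 2).smul (tendsto_cross hl.j hl.tendsto_β))).sub
    ((((hZ1.const_mul 2).mul hh).mul ((hs.add (hh.mul (hZ.pow 2))).sub hP)).smul hW)
  refine (tendsto_of_eq h1 ?_).congr' ?_
  · simp only [evenPart, oddPart, zero_apply, add_zero, zero_add, cross_zero_right, cross_add_left,
      cross_sub_left, cross_neg_left, cross_smul_left, cross_smul_right,
      cross_comm (J (J e)) e, cross_self]
    match_scalars <;> field_simp <;> ring
  · filter_upwards [hp, eventually_pos] with t hpt ht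
    have hz := cross_z_expansion (m := m) (J := J) (t := t) (ε := ε t) (b := b t) (A₃ := A₃ t)
      (N := N t) (A₃' := A₃' t) h.unit
    have hg := cross_g_expansion (m := m) (J := J) (t := t) (ε := ε t) (b := b t) (A₃ := A₃ t)
      (N := N t) h.unit
    have hw := scaled_cross h.unit m (pow_ne_zero 2 ht.ne') (b t) (N t)
    rw [fieldE, rayE, epsPart, hz, hg, ← hw, cross_smul_left _ _ (m • e + t ^ 2 • b t)]
    generalize m • e + t ^ 2 • b t = β, J e + ε t • A₃ t = A at hpt ⊢
    have hZt : rayZ k lam t t β A = t * (lam * k * t - ⟪β, A⟫) := by rw [rayZ]; ring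
    have hLP : rayS S' k lam t t (p t) β A = 2 * rayP k t (p t) β + t ^ 2 * (2 * (p t / t ^ 2) *
        (2 * (p t * S (p t)) - k * p t + p t ^ 2 * S' (p t))) := by
      rw [rayS, ← hpt.2, rayP]; field_simp; ring
    simp only [comp_apply]
    rw [hZt]
    generalize lam * k * t - ⟪β, A⟫ = Z1
    rw [hLP]
    generalize p t / t ^ 2 = y
    match_scalars <;> field_simp <;> ring

end RayExpansion
/-! ### Isotropic vectors

The even part of the limit is homogenized to a polynomial identity on the whole space, which is
evaluated at the isotropic vectors `e_i + √(-1) e_j`. -/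

lemma oddPart_neg (m L₀ : ℝ) (J : V3 →L[ℝ] V3) (C₀ e : V3) :
    oddPart m L₀ J C₀ (-e) = -oddPart m L₀ J C₀ e := by
  simp only [oddPart, map_neg, inner_neg_left, inner_neg_right, neg_neg, smul_neg, cross_neg_left,
    cross_neg_right, mul_neg, neg_smul, cross_sub_left, cross_smul_left]
  module

lemma evenPart_neg (m κ₁ : ℝ) (J : V3 →L[ℝ] V3) (e : V3) :
    evenPart m κ₁ J (-e) = evenPart m κ₁ J e := by
  simp only [evenPart, map_neg, inner_neg_left, inner_neg_right, neg_neg, cross_neg_left,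
    cross_neg_right]

section
open Polynomial (C X aeval eval_mul eval_pow eval_X eval_C eval_add eval_sub eval_one eval_ofNat
  eval_finsetSum aeval_C aeval_X)

/-- Components of a homogeneous polynomial map along a line. -/
lemma exists_polynomial_line (M : V3 [×d]→L[ℝ] V3) (u v : V3) (l : Fin 3) :
    ∃ P : Polynomial ℝ, ∀ y : ℝ, (M fun _ => u + y • v) l = P.eval y := by
  classical
  refine ⟨∑ s : Finset (Fin d), X ^ s.card *
    C ((M (s.piecewise (fun _ => v) fun _ => u)) l), fun y => ?_⟩
  have h1 : (M fun _ => u + y • v) = M ((fun _ => y • v) + fun _ => u) := by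
    congr 1; funext i; exact add_comm _ _
  have h2 : M ((fun _ => y • v) + fun _ => u) =
      ∑ s : Finset (Fin d), M (s.piecewise (fun _ => y • v) fun _ => u) :=
    M.toMultilinearMap.map_add_univ _ _
  rw [h1, h2, eval_finsetSum]
  simp only [eval_mul, eval_pow, eval_X, eval_C]
  rw [WithLp.ofLp_sum, Finset.sum_apply]
  refine Finset.sum_congr rfl fun s _ => ?_
  have h3 : s.piecewise (fun _ => y • v) (fun _ : Fin d => u) =
      s.piecewise (fun i => y • s.piecewise (fun _ => v) (fun _ => u) i)
        (s.piecewise (fun _ => v) (fun _ => u)) := by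
    funext i
    by_cases hi : i ∈ s <;> simp [hi]
  have h4 : M (s.piecewise (fun i => y • s.piecewise (fun _ => v) (fun _ => u) i)
        (s.piecewise (fun _ => v) (fun _ => u))) =
      (∏ _i ∈ s, y) • M (s.piecewise (fun _ => v) fun _ => u) :=
    M.toMultilinearMap.map_piecewise_smul (fun _ => y) _ s
  rw [h3, h4, Finset.prod_const]
  rfl

/-- A polynomial identity modulo `1 + y²`, at `y = √(-1)`. -/
lemma entries_of_identity {a c : ℝ} {R : Polynomial ℝ}
    (h : ∀ y : ℝ, (a + 2 * b * y + c * y ^ 2) ^ 2 * (b + (c - a) * y - b * y ^ 2) =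
      (1 + y ^ 2) * R.eval y) : a = c ∧ b = 0 := by
  have h1 : (C a + 2 * C b * X + C c * X ^ 2) ^ 2 * (C b + (C c - C a) *
      X - C b * X ^ 2) = (1 + X ^ 2) * R := by
    refine Polynomial.funext fun y => ?_
    simpa using h y
  have h2 := congrArg (aeval Complex.I) h1
  simp only [map_mul, map_add, map_sub, map_pow, aeval_C, aeval_X,
    map_one, Complex.I_sq, map_ofNat, add_neg_cancel, zero_mul, mul_eq_zero, pow_eq_zero_iff,
    ne_eq, OfNat.ofNat_ne_zero, not_false_eq_true, Complex.coe_algebraMap] at h2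
  rcases h2 with h2 | h2
  · have hr := congrArg Complex.re h2
    have hi := congrArg Complex.im h2
    simp at hr hi
    exact ⟨by linarith, hi⟩
  · have hr := congrArg Complex.re h2
    have hi := congrArg Complex.im h2
    simp at hr hi
    exact ⟨by linarith, by linarith⟩

/-- The homogenization of the even part. -/
lemma evenPart_homogeneous {A : V3 → V3} (hA : ∀ (t : ℝ) (u : V3), A (t • u) = t ^ 3 • A u)
    (h : ∀ e : V3, ‖e‖ = 1 → evenPart m κ₁ J e + ν • cross e (A e) = 0) (hv : v ≠ 0) :
    (m ^ 2 * (κ₁ * (‖v‖ ^ 2) ^ 2 + 2 * ⟪v, J v⟫ ^ 2)) • cross v (J v) -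
      (2 * m ^ 2 * ‖v‖ ^ 2) • (‖v‖ ^ 2 • cross (J (J v)) (J v) +
        ⟪v, J v⟫ • cross v (J (J v))) + (ν * ‖v‖ ^ 2) • cross v (A v) = 0 := by
  have hn : ‖v‖ ≠ 0 := norm_ne_zero_iff.2 hv
  have h1 := h (‖v‖⁻¹ • v) (by rw [norm_smul, norm_inv, norm_norm, inv_mul_cancel₀ hn])
  simp only [evenPart, hA, map_smul, cross_smul_left, cross_smul_right, inner_smul_left,
    inner_smul_right, conj_trivial] at h1
  have h2 := congrArg (fun w => ‖v‖ ^ 6 • w) h1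
  simp only [smul_zero] at h2
  rw [← h2]
  match_scalars <;> field_simp

/-- The homogenized identity at the isotropic vector `e_i + √(-1) e_j`. -/
lemma entries_of_evenPart (hm : m ≠ 0) (hJ : SymTraceless J)
    {M : V3 [×3]→L[ℝ] V3} (hA : ∀ (t : ℝ) (u : V3), (M fun _ => t • u) = t ^ 3 • M fun _ => u)
    (h : ∀ e : V3, ‖e‖ = 1 → evenPart m κ₁ J e + ν • cross e (M fun _ => e) = 0) {i j l : Fin 3}
    (hij : i ≠ j) (hl : ∀ u v : V3, (cross u v) l = u i * v j - u j * v i) :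
    (J (single i 1)) i = (J (single j 1)) j ∧ (J (single i 1)) j = 0 := by
  set f : V3 := single i 1 with hf
  set g : V3 := single j 1 with hg
  have hsym : (J g) i = (J f) j := by
    have := hJ.1 f g
    simpa [hf, hg, inner_single_left, inner_single_right] using this.symm
  obtain ⟨Pi, hPi⟩ := exists_polynomial_line M f g i
  obtain ⟨Pj, hPj⟩ := exists_polynomial_line M f g j
  have hvi : ∀ y : ℝ, (f + y • g) i = 1 := fun y => by simp [hf, hg, hij]
  have hvj : ∀ y : ℝ, (f + y • g) j = y := fun y => by simp [hf, hg, hij.symm]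
  have hinner : ∀ (y : ℝ) (u : V3), ⟪f + y • g, u⟫ = u i + y * u j := fun y u => by
    simp [hf, hg, inner_add_left, inner_smul_left, inner_single_left]
  have hn : ∀ y : ℝ, ‖f + y • g‖ ^ 2 = 1 + y ^ 2 := fun y => by
    rw [← real_inner_self_eq_norm_sq, hinner, hvi, hvj]; ring
  have hco : ∀ (K : V3 →L[ℝ] V3) (y : ℝ) (k : Fin 3), (K (f + y • g)) k = (K f) k + y * (K g) k :=
    fun K y k => by simp
  refine entries_of_identity (b := (J f) j) (R := C (-(1 / (2 * m ^ 2))) *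
    (C (m ^ 2 * κ₁) * (1 + X ^ 2) * (C ((J f) j) + (C ((J g) j) - C ((J f) i)) * X -
        C ((J f) j) * X ^ 2) -
    C (2 * m ^ 2) * ((1 + X ^ 2) * ((C ((J (J f)) i) + C ((J (J g)) i) * X) *
        (C ((J f) j) + C ((J g) j) * X) -
      (C ((J (J f)) j) + C ((J (J g)) j) * X) * (C ((J f) i) + C ((J f) j) * X)) +
      (C ((J f) i) + 2 * C ((J f) j) * X + C ((J g) j) * X ^ 2) *
      (C ((J (J f)) j) + C ((J (J g)) j) * X - X * (C ((J (J f)) i) + C ((J (J g)) i) * X))) +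
    C ν * (Pj - X * Pi))) fun y => ?_
  have hv : f + y • g ≠ 0 := fun h0 => by
    have := hn y
    rw [h0] at this
    simp at this
    nlinarith [sq_nonneg y]
  have h1 := congrArg (fun w : V3 => w l) (evenPart_homogeneous hA h hv)
  have hJJ : ∀ k : Fin 3, (J (J (f + y • g))) k = (J (J f)) k + y * (J (J g)) k :=
    fun k => hco (J.comp J) y k
  simp only [PiLp.add_apply, PiLp.sub_apply, PiLp.smul_apply, PiLp.zero_apply, smul_eq_mul, hl, hn,
    hinner, hvi, hvj, hJJ, hco J, hsym, hPi, hPj] at h1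
  simp only [eval_mul, eval_add, eval_sub, eval_pow, eval_X, eval_C, eval_one, eval_ofNat]
  field_simp
  linear_combination h1

end

/-- The even part vanishes only for `J = 0`. -/
lemma eq_zero_of_evenPart (hm : m ≠ 0) (hJ : SymTraceless J)
    {M : V3 [×3]→L[ℝ] V3} (hA : ∀ (t : ℝ) (u : V3), (M fun _ => t • u) = t ^ 3 • M fun _ => u)
    (h : ∀ e : V3, ‖e‖ = 1 → evenPart m κ₁ J e + ν • cross e (M fun _ => e) = 0) : J = 0 := by
  obtain ⟨h01, h01'⟩ := entries_of_evenPart hm hJ hA h (i := 0) (j := 1) (l := 2) (by decide)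
    fun u v => by simp
  obtain ⟨h12, h12'⟩ := entries_of_evenPart hm hJ hA h (i := 1) (j := 2) (l := 0) (by decide)
    fun u v => by simp
  obtain ⟨h20, h20'⟩ := entries_of_evenPart hm hJ hA h (i := 2) (j := 0) (l := 1) (by decide)
    fun u v => by simp
  have htr := hJ.sum_diag
  rw [Fin.sum_univ_three] at htr
  have hsym : ∀ i j : Fin 3, (J (single i 1)) j = (J (single j 1)) i := fun i j => by
    have := hJ.1 (single i 1) (single j 1)
    simpa [inner_single_left, inner_single_right] using this
  have key : ∀ i j : Fin 3, (J (single i 1)) j = 0 := by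
    intro i j
    fin_cases i <;> fin_cases j <;> simp only [Fin.zero_eta, Fin.mk_one, Fin.reduceFinMk] <;>
      first | linarith | (rw [hsym]; assumption)
  ext v j
  have hv : v = ∑ i, v i • (single i (1 : ℝ) : V3) := by apply ext3 <;> simp [Fin.sum_univ_three]
  rw [hv, map_sum]
  simp [Fin.sum_univ_three, key]

end

local notation "𝔉[" Φ "," p "," c "," g "," w "," x "]" =>
  Φ (p x) (coulomb c g x) (coulomb c w x) (coulombJac c g x) (coulombJac c w x)

section

lemma RayLimit.tendsto_fieldH_one {w₀ : V3} {p : ℝ → ℝ}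
    (h : RayLimit m e 0 A₀ A₀' β A Jβ A' fun t => t) (hS : Response S S')
    (hp : RayRoot S k lam (fun t => t) p β A)
    (hW : (fun t => (t ^ 2)⁻¹ • cross (Jβ t (β t)) (β t)) ⇝ w₀) :
    (fun t => (t ^ 2)⁻¹ • fieldH S' k lam t t (p t) (β t) (A t) (Jβ t) (A' t)) ⇝ 0 := by
  obtain ⟨-, hP, hs⟩ := h.tendsto_scalars hS hp
  have hh := h.tendsto_h (k := k)
  have hZ := h.tendsto_Z (k := k) (lam := lam)
  have ht := h.tendsto_T
  simp only [zero_mul, neg_zero] at hZ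
  have h1 := ((hP.const_mul 2).mul ht).smul (tendsto_cross h.j h.tendsto_β)
  have h2 := (((hP.const_mul 2).mul hh).mul hZ).smul (tendsto_cross h.z h.tendsto_β)
  have h3 := hs.smul ((ht.smul (tendsto_cross h.z h.tendsto_A)).add
    ((hh.mul hZ).smul (tendsto_cross h.z h.tendsto_β)) |>.sub
    ((hh.mul hZ).smul (tendsto_cross h.lim_g h.tendsto_A)))
  have h4 := ((ht.mul (((hP.mul hh).mul ((hh.mul (hZ.pow 2)).sub hP)).sub
    ((hs.mul (hh.pow 2)).mul (hZ.pow 2)))).mul_const 2).smul hW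
  have h5 := ((h1.sub h2).add h3).add h4
  simp only [mul_zero, zero_mul, zero_smul, sub_zero, add_zero, smul_zero] at h5
  refine h5.congr' ?_
  filter_upwards [eventually_pos] with t ht
  rw [fieldH, rayH]
  simp only [cross_smul_left _ _ (β t)]
  match_scalars <;> field_simp

section
/-- The rescaled field `B` along a ray from the charge `i`. -/
def rayβ (c : Fin n → V3) (g : Fin n → ℝ) (i : Fin n) (e : V3) (t : ℝ) : V3 :=
  (g i / (4 * π)) • e + t ^ 2 • coulomb c (update g i 0) (c i + t • e)

/-- The rescaled Jacobian of `B` along a ray from the charge `i`. -/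
def rayJβ (c : Fin n → V3) (g : Fin n → ℝ) (i : Fin n) (e : V3) (t : ℝ) : V3 →L[ℝ] V3 :=
  (g i / (4 * π)) • kernelJac e + t ^ 2 • (t • coulombJac c (update g i 0) (c i + t • e))

lemma coulomb_eq_rayβ (he : ‖e‖ = 1) (ht : 0 < t) :
    coulomb c g (c i + t • e) = (t ^ 2)⁻¹ • rayβ c g i e t := coulomb_ray c g i he ht

lemma coulombJac_eq_rayJβ (he : ‖e‖ = 1) (ht : 0 < t) :
    coulombJac c g (c i + t • e) = (t ^ 3)⁻¹ • rayJβ c g i e t := by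
  refine ContinuousLinearMap.ext fun v => ?_
  rw [coulombJac_ray c g i he ht, rayJβ, smul_smul]
  simp only [smul_apply, add_apply, kernelJac_unit he]
  rw [← pow_succ]

lemma tendsto_coulomb_center (hc : Injective c) (hw : w i = 0) :
    (fun t : ℝ => coulomb c w (c i + t • e)) ⇝ (coulomb c w (c i)) :=
  (analyticAt_coulomb_center hc hw).continuousAt.tendsto.comp (tendsto_ray (c i) e)

lemma eventually_fderiv_coulomb (hc : Injective c) (hw : w i = 0) :
    ∀ᶠ x in 𝓝 (c i), HasFDerivAt (coulomb c w) (coulombJac c w x) x := by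
  filter_upwards [eventually_ne_of_charge fun j hj => ne_center_of_charge hc hw j hj] with x hx
  exact hasFDerivAt_coulomb hx

lemma tendsto_coulombJac_center (hc : Injective c) (hw : w i = 0) :
    (fun t : ℝ => coulombJac c w (c i + t • e)) ⇝ (coulombJac c w (c i)) := by
  have h1 := (analyticAt_coulomb_center hc hw).fderiv.continuousAt.tendsto.comp (tendsto_ray (c i) e)
  have h2 := eventually_fderiv_coulomb hc hw
  rw [h2.self_of_nhds.fderiv] at h1
  refine h1.congr' ?_
  filter_upwards [(tendsto_ray (c i) e).eventually h2] with t ht using ht.fderiv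

lemma rayLimit_coulomb (hc : Injective c) (he : ‖e‖ = 1) (hg : g i ≠ 0) (hT : T ⇝ ι) (hA : A ⇝ A₀)
    (hA' : A' ⇝ A₀') :
    RayLimit (g i / (4 * π)) e ι A₀ A₀' (rayβ c g i e) A (rayJβ c g i e) A' T := by
  have ht2 := tendsto_pow_nhdsGT 2
  refine ⟨he, by positivity, hT, ?_, ?_, hA, hA'⟩
  · refine tendsto_of_eq ((ht2.smul (tendsto_coulomb_center hc (update_self i 0 g))).const_add _) ?_
    rw [zero_smul, add_zero]
  · refine tendsto_of_eq ((ht2.smul (tendsto_self_nhdsGT.smul (tendsto_coulombJac_center hc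
      (update_self i 0 g)))).const_add _) ?_
    ext; simp

/-- `∇B² × B` along a ray. -/
lemma tendsto_rayW (he : ‖e‖ = 1) {C C' : V3} {b : ℝ → V3} {N : ℝ → V3 →L[ℝ] V3}
    {N₀ : V3 →L[ℝ] V3} (hb : b ⇝ C) (hN : N ⇝ N₀)
    (hC : N₀ e = C')
    (hb' : ∀ t > 0, t ^ d • b t = coulomb c (update g i 0) (c i + t • e))
    (hN' : ∀ t > 0, t ^ d • N t = t • coulombJac c (update g i 0) (c i + t • e)) :
    (fun t => (t ^ (d + 2))⁻¹ • cross (rayJβ c g i e t (rayβ c g i e t)) (rayβ c g i e t)) ⇝ (-((g i / (4 * π)) ^ 2) • (3 • cross e C + cross e C')) := by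
  have h1 := tendsto_cross_jac_expansion (u := e) (m := g i / (4 * π))
    (tendsto_pow_nhdsGT (d + 2)) hb (tendsto_clm_apply hN (tendsto_const_nhds (x := e)))
    (tendsto_clm_apply hN hb)
  rw [hC] at h1
  refine h1.congr' ?_
  filter_upwards [eventually_pos] with t ht
  rw [← scaled_cross he _ (pow_ne_zero (d + 2) ht.ne'), rayβ, rayJβ, ← hb' t ht, ← hN' t ht]
  rw [smul_smul, smul_smul, ← pow_add, add_comm 2 d]

lemma smul_pow_inv (ht : 0 < t) (a : ℕ) (y : V3 →L[ℝ] V3) :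
    (t ^ a * t⁻¹) • ((t ^ a)⁻¹ * t) • y = y := by
  rw [smul_smul, show t ^ a * t⁻¹ * ((t ^ a)⁻¹ * t) = 1 by field_simp, one_smul]

lemma tendsto_pow_mul_inv {a : ℕ} (h : a ≤ d) : (fun t : ℝ => t ^ (d + 4) * (t ^ a)⁻¹) ⇝ 0 := by
  refine (tendsto_pow_nhdsGT (d + 4 - a) (by omega)).congr' ?_
  filter_upwards [eventually_pos] with t ht
  rw [show d + 4 = d + 4 - a + a by omega, pow_add, mul_inv_cancel_right₀ (pow_ne_zero a ht.ne'),
    Nat.add_sub_cancel]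

lemma LeadingTerm.tendsto_rayW (hc : Injective c) (he : ‖e‖ = 1) {C : V3 [×d]→L[ℝ] V3}
    {C' : V3 → V3 →L[ℝ] V3} (hC : LeadingTerm (coulomb c (update g i 0)) (c i) d C C') :
    (fun t => (t ^ (d + 2))⁻¹ • cross (rayJβ c g i e t (rayβ c g i e t)) (rayβ c g i e t)) ⇝
      (-((g i / (4 * π)) ^ 2) • ((3 + d : ℝ) • cross e (C fun _ => e))) := by
  refine tendsto_of_eq (MultiCenter.tendsto_rayW he (hC.tendsto e)
    (hC.tendsto_jac hc (update_self i 0 g) e) (hC.form.euler e)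
    (fun t ht => smul_inv_smul₀ (pow_ne_zero d (ne_of_gt ht)) _) fun t ht => ?_) ?_
  · rw [smul_smul, mul_inv_cancel_left₀ (pow_ne_zero d (ne_of_gt ht))]
  · rw [cross_smul_right]
    module

/-- Along a ray, the curl of one of the fields is zero. -/
def RayCurlFree (S' : ℝ → ℝ) (k lam : ℝ) (T p : ℝ → ℝ) (β A : ℝ → V3)
    (Jβ A' : ℝ → V3 →L[ℝ] V3) : Prop :=
  (∀ᶠ t in 𝓝[>] 0, fieldE S' k lam t (T t) (p t) (β t) (A t) (Jβ t) (A' t) = 0) ∨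
  (∀ᶠ t in 𝓝[>] 0, -(rayτ k lam t (T t) (β t) (A t) •
      fieldE S' k lam t (T t) (p t) (β t) (A t) (Jβ t) (A' t)) +
      fieldH S' k lam t (T t) (p t) (β t) (A t) (Jβ t) (A' t) = 0)

lemma RayCurlFree.tendsto {p : ℝ → ℝ} (hf : RayCurlFree S' k lam T p β A Jβ A')
    (h : RayLimit m e ι A₀ A₀' β A Jβ A' T) {j : ℕ} (hlam : lam ≠ 0)
    (hX : (fun t => (t ^ j)⁻¹ • fieldH S' k lam t (T t) (p t) (β t) (A t) (Jβ t) (A' t)) ⇝ 0) :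
    (fun t => (t ^ j)⁻¹ • fieldE S' k lam t (T t) (p t) (β t) (A t) (Jβ t) (A' t)) ⇝ 0 := by
  rcases hf with hf | hf
  · refine tendsto_const_nhds.congr' ?_
    filter_upwards [hf] with t ht
    rw [ht, smul_zero]
  · exact h.tendsto_field_of_pointH hlam hX hf

/-- The situation near a charge: `p` solves the constitutive equation for `D = λ B + δ`, and the
curl of `E` or that of `H` vanishes. -/
structure CurlFreeNear (S S' : ℝ → ℝ) (k lam : ℝ) (c : Fin n → V3) (g w : Fin n → ℝ) (i : Fin n)
    (p : V3 → ℝ) : Prop where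
  response : Response S S'
  inj : Injective c
  pos : 0 < k
  lam_ne : lam ≠ 0
  ne : g i ≠ 0
  root : ∀ᶠ x in 𝓝[≠] (c i),
    IsRoot S (reducedForm k lam (coulomb c g x) (coulomb c w x)) (‖coulomb c g x‖ ^ 2) (p x)
  curl : (∀ᶠ x in 𝓝[≠] (c i), 𝔉[pointE S' k lam, p, c, g, w, x] = 0) ∨
    (∀ᶠ x in 𝓝[≠] (c i), 𝔉[pointH S' k lam, p, c, g, w, x] = 0)

lemma CurlFreeNear.ray (h : CurlFreeNear S S' k lam c g w i p)
    (he : ‖e‖ = 1) (hT : ∀ t > 0, T t ≠ 0)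
    (hA : ∀ᶠ t in 𝓝[>] 0, coulomb c w (c i + t • e) = T t • A t)
    (hA' : ∀ᶠ t in 𝓝[>] 0, coulombJac c w (c i + t • e) = (T t * t⁻¹) • A' t) :
    RayRoot S k lam T (fun t => p (c i + t • e)) (rayβ c g i e) A ∧
    ((∀ᶠ x in 𝓝[≠] (c i), 𝔉[pointE S' k lam, p, c, g, w, x] = 0) →
      ∀ᶠ t in 𝓝[>] 0, fieldE S' k lam t (T t) (p (c i + t • e)) (rayβ c g i e t) (A t)
        (rayJβ c g i e t) (A' t) = 0) ∧
    ((∀ᶠ x in 𝓝[≠] (c i), 𝔉[pointH S' k lam, p, c, g, w, x] = 0) →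
      ∀ᶠ t in 𝓝[>] 0, -(rayτ k lam t (T t) (rayβ c g i e t) (A t) •
        fieldE S' k lam t (T t) (p (c i + t • e)) (rayβ c g i e t) (A t) (rayJβ c g i e t) (A' t)) +
        fieldH S' k lam t (T t) (p (c i + t • e)) (rayβ c g i e t) (A t) (rayJβ c g i e t)
          (A' t) = 0) := by
  have hray := tendsto_ray_ne (c i) he
  have hk := h.pos
  refine ⟨?_, fun h0 => ?_, fun h0 => ?_⟩
  · filter_upwards [hray.eventually h.root, hA, eventually_pos] with t h1 h2 ht
    rwa [h2, coulomb_eq_rayβ he ht, reducedForm_ray hk ht] at h1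
  · filter_upwards [hray.eventually h0, hA, hA', eventually_pos] with t h1 h2 h3 ht
    rw [h2, h3, coulomb_eq_rayβ he ht, coulombJac_eq_rayJβ he ht, pointE_ray hk ht (hT t ht)] at h1
    refine (smul_eq_zero.1 h1).resolve_left ?_
    have := rayh_ne (β := rayβ c g i e t) hk ht
    have := hT t ht
    positivity
  · filter_upwards [hray.eventually h0, hA, hA', eventually_pos] with t h1 h2 h3 ht
    rw [h2, h3, coulomb_eq_rayβ he ht, coulombJac_eq_rayJβ he ht, pointH_ray hk ht (hT t ht)] at h1
    refine (smul_eq_zero.1 h1).resolve_left ?_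
    have := rayh_ne (β := rayβ c g i e t) hk ht
    have := hT t ht
    positivity

lemma CurlFreeNear.rayCurlFree (h : CurlFreeNear S S' k lam c g w i p)
    (he : ‖e‖ = 1) (hT : ∀ t > 0, T t ≠ 0)
    (hA : ∀ᶠ t in 𝓝[>] 0, coulomb c w (c i + t • e) = T t • A t)
    (hA' : ∀ᶠ t in 𝓝[>] 0, coulombJac c w (c i + t • e) = (T t * t⁻¹) • A' t) :
    RayCurlFree S' k lam T (fun t => p (c i + t • e)) (rayβ c g i e) A (rayJβ c g i e) A' :=
  h.curl.imp (h.ray he hT hA hA').2.1 (h.ray he hT hA hA').2.2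

/-! ### Vanishing of the deviation from the self-dual ratio -/

variable {a : ℕ} {M : V3 [×a]→L[ℝ] V3} {P' : V3 → V3 →L[ℝ] V3}

lemma HarmonicForm.eq_of_degree_zero {A : V3 → V3} {A' : V3 → V3 →L[ℝ] V3}
    (h : HarmonicForm 0 A A') (u : V3) : A' u = 0 := by
  have h1 : ∀ v, A v = A 0 := fun v => by simpa using (h.smul 0 v).symm
  have h2 : A = fun _ => A 0 := funext h1
  have h3 := h.hasFDerivAt u
  rw [h2] at h3
  exact h3.unique (hasFDerivAt_const _ _)

lemma HarmonicForm.eq_of_degree_one {A : V3 → V3} {A' : V3 → V3 →L[ℝ] V3}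
    (h : HarmonicForm 1 A A') : (∀ u, A u = A' 0 u) ∧ ∀ u, A' u = A' 0 := by
  have h1 : ∀ u, A u = A' 0 u := fun u => by
    have h2 : HasDerivAt (fun t : ℝ => t • u) u 0 := by
      simpa using (hasDerivAt_id (0 : ℝ)).smul_const u
    have h3 : HasDerivAt (fun t : ℝ => A (t • u)) (A' 0 u) 0 := by
      have h4 := h.hasFDerivAt ((0 : ℝ) • u)
      rw [zero_smul] at h4
      exact HasFDerivAt.comp_hasDerivAt_of_eq (0 : ℝ) h4 h2 (by simp)
    have h5 : HasDerivAt (fun t : ℝ => A (t • u)) (A u) 0 := by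
      simp only [h.smul, pow_one]
      simpa using (hasDerivAt_id (0 : ℝ)).smul_const (A u)
    exact h5.unique h3
  refine ⟨h1, fun u => ?_⟩
  have h2 : A = A' 0 := funext h1
  have h3 := h.hasFDerivAt u
  rw [h2] at h3
  exact h3.unique (A' 0).hasFDerivAt

/-- Here `e × δ(c i)` vanishes for all unit vectors `e`. -/
lemma CurlFreeNear.false_of_degree_zero (h : CurlFreeNear S S' k lam c g w i p)
    (hw : w i = 0) {M : V3 [×0]→L[ℝ] V3} (hM : LeadingTerm (coulomb c w) (c i) 0 M P') : False := by
  refine hM.ne (hM.form.eq_zero fun e he => ?_)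
  have hA := hM.tendsto e
  have hA' := hM.tendsto_jac h.inj hw e
  rw [hM.form.eq_of_degree_zero e] at hA'
  have hl := rayLimit_coulomb h.inj he h.ne (T := fun _ => 1) tendsto_const_nhds hA hA'
  have hJ : ∀ᶠ t : ℝ in 𝓝[>] 0, coulombJac c w (c i + t • e) =
      (1 * t⁻¹) • ((t ^ 0)⁻¹ * t) • coulombJac c w (c i + t • e) :=
    eventually_pos.mono fun t ht => by simpa using (smul_pow_inv ht 0 _).symm
  have hA₁ : ∀ᶠ t : ℝ in 𝓝[>] 0, coulomb c w (c i + t • e) =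
      (1 : ℝ) • (t ^ 0)⁻¹ • coulomb c w (c i + t • e) := .of_forall fun t => by simp
  have h1 := (h.ray he (T := fun _ => 1) (fun _ _ => one_ne_zero) hA₁ hJ).1
  have h2 := h.rayCurlFree he (T := fun _ => 1) (fun _ _ => one_ne_zero) hA₁ hJ
  refine hl.cross_eq_zero_of_zero h.response h.pos h.lam_ne h1 ?_
  have h3 := h2.tendsto hl (j := 0) h.lam_ne (by simpa using hl.tendsto_fieldH_zero h.response h1)
  simpa using h3

/-- Here the leading term of `δ` and that of the field of the other magnetic charges would have
to balance. -/
lemma CurlFreeNear.false_of_two_le (h : CurlFreeNear S S' k lam c g w i p)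
    (hg' : update g i 0 ≠ 0) (hw : w i = 0) (ha : 2 ≤ a)
    (hM : LeadingTerm (coulomb c w) (c i) a M P') : False := by
  obtain ⟨d, C, C', hC⟩ := exists_leadingTerm_coulomb h.inj (update_self i 0 g) hg'
  have ha' : (a : ℝ) - 1 ≠ 0 := by
    have : (2 : ℝ) ≤ a := by exact_mod_cast ha
    linarith
  have hg := h.ne
  have hk := h.pos
  have hlam := h.lam_ne
  have hm : g i / (4 * π) ≠ 0 := by positivity
  obtain ⟨r, hr3, hr⟩ := h.response.exponent k hk
  obtain ⟨s₀, hs1, -⟩ := h.response.limits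
  set m := g i / (4 * π) with hmdef
  set c₀ := √(lam ^ 2 * k * (m ^ 2)⁻¹) with hc₀
  have hc0 : 0 < c₀ := by rw [hc₀]; positivity
  have hT : ∀ t : ℝ, 0 < t → t ^ a ≠ 0 := fun t ht => pow_ne_zero a ht.ne'
  have hlimit : ∀ e : V3, ‖e‖ = 1 → RayLimit m e 0 (M fun _ => e) (P' e) (rayβ c g i e) _
      (rayJβ c g i e) _ (fun t => t ^ a) := fun e he =>
    rayLimit_coulomb h.inj he hg (tendsto_pow_nhdsGT a) (hM.tendsto e)
      (hM.tendsto_jac h.inj hw e)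
  have hray : ∀ e : V3, ‖e‖ = 1 → _ := fun e he => h.ray he (T := fun t => t ^ a) hT
    (A' := fun t => ((t ^ a)⁻¹ * t) • coulombJac c w (c i + t • e))
    (eventually_pos.mono fun t ht => (smul_inv_smul₀ (hT t ht) _).symm)
    (eventually_pos.mono fun t ht => (smul_pow_inv ht a _).symm)
  have hΛ : 0 < lam ^ 2 * k := by positivity
  rcases h.curl with hcurl | hcurl
  · refine hM.form.no_balance hC.form hM.ne hC.ne (l := 𝓝[>] (0 : ℝ)) tendsto_pow_mul_inv
      (k₁ := 2 * (lam ^ 2 * k) * m ^ 2 * (a - 1))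
      (k₂ := 2 * lam * k * (lam ^ 2 * k) * (3 + d)) (by positivity) (by positivity) fun e he => ?_
    exact (hlimit e he).balanceE h.response (hray e he).1 hT (hM.form.euler e)
      (hC.tendsto_rayW h.inj he)
      ((hray e he).2.1 hcurl)
  · have hS0 : (fun t : ℝ => t ^ 4 * (2 * S (c₀ * t ^ 2) - k)) ⇝ 0 := by
      have ht2 := tendsto_pow_nhdsGT 2
      have h1 : Tendsto (fun t : ℝ => c₀ * t ^ 2) (𝓝[>] 0) (𝓝[>] 0) := by
        refine tendsto_nhdsWithin_iff.2 ⟨by simpa using ht2.const_mul c₀, ?_⟩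
        filter_upwards [eventually_pos] with t ht
        exact mul_pos hc0 (pow_pos ht 2)
      have h2 := ((ht2.mul (hs1.comp h1)).const_mul (2 * c₀⁻¹)).sub
        ((tendsto_pow_nhdsGT 4).mul_const k)
      refine (tendsto_of_eq h2 (by ring)).congr' ?_
      filter_upwards [eventually_pos] with t ht
      simp only [comp_apply]
      field_simp
    refine hM.form.no_balance hC.form hM.ne hC.ne (l := 𝓝[>] (0 : ℝ))
      (y := fun t => t ^ 4 * (2 * S (c₀ * t ^ 2) - k) * (t ^ (d + 4) * (t ^ a)⁻¹))
      (fun had => by simpa using hS0.mul (tendsto_pow_mul_inv had))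
      (k₁ := -lam * (2 * (lam ^ 2 * k) * m ^ 2 * (a - 1)))
      (k₂ := -2 * (m ^ 2)⁻¹ * (lam ^ 2 * k) ^ 2 * (3 + r) * (3 + d))
      (by simp only [neg_mul, neg_ne_zero]; positivity) ?_ fun e he => ?_
    · have h3 : 3 + r ≠ 0 := fun h0 => hr3 (by linarith)
      have h4 : (3 + d : ℝ) ≠ 0 := by positivity
      simp only [neg_mul, neg_ne_zero]
      positivity
    · exact (hlimit e he).balanceH h.response hk hlam (hray e he).1 hT (hM.form.euler e) hr hc₀
        (hC.tendsto_rayW h.inj he)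
        ((hray e he).2.2 hcurl)

/-- If the deviation is `J (x - c) + ε δ'` along a ray, then the expansion of the curl gives a
relation between `J` and the limit of `δ'`. -/
lemma CurlFreeNear.exists_limit (h : CurlFreeNear S S' k lam c g w i p)
    (he : ‖e‖ = 1) {J₃ : V3 →L[ℝ] V3} {a₃ : V3} {A₃ : ℝ → V3} {A₃' : ℝ → V3 →L[ℝ] V3} {ε : ℝ → ℝ}
    (hε : ε ⇝ 0) (hA₃ : A₃ ⇝ a₃)
    (hA₃' : A₃' ⇝ J₃) {s₀ : ℝ}
    (hs1 : (fun p => p * S p) ⇝ (-s₀))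
    (hs2 : (fun p => p ^ 2 * S' p) ⇝ s₀)
    (hA : ∀ᶠ t in 𝓝[>] 0, coulomb c w (c i + t • e) = t • (J e + ε t • A₃ t))
    (hA' : ∀ᶠ t in 𝓝[>] 0, coulombJac c w (c i + t • e) = (t * t⁻¹) • (J + ε t • A₃' t)) :
    ∃ U : ℝ → V3, U ⇝ (((g i / (4 * π)) ^ 2 * (2 * (lam ^ 2 * k))) • (cross e (J₃ e) - cross e a₃)) ∧
      (fun t => ((t ^ 2)⁻¹ * ε t) • U t) ⇝ (-(evenPart (g i / (4 * π))
          (-(4 * √(lam ^ 2 * k * ((g i / (4 * π)) ^ 2)⁻¹) * s₀)) J e +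
          oddPart (g i / (4 * π)) (lam ^ 2 * k) J (coulomb c (update g i 0) (c i)) e)) := by
  have hc := h.inj
  have hb : (fun t : ℝ => coulomb c (update g i 0) (c i + t • e)) ⇝ (coulomb c (update g i 0) (c i)) :=
    tendsto_coulomb_center hc (update_self i 0 g)
  have hN : (fun t : ℝ => t • coulombJac c (update g i 0) (c i + t • e)) ⇝ 0 :=
    tendsto_of_eq (tendsto_self_nhdsGT.smul
      (tendsto_coulombJac_center hc (update_self i 0 g))) (by ext; simp)
  have hexp : RayExpansion (g i / (4 * π)) e _ J a₃ J₃ _ A₃ _ A₃' ε :=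
    ⟨he, by have := h.ne; positivity, hε, hb, hN, hA₃, hA₃'⟩
  have hroot := (h.ray he (T := fun t => t) (fun t ht => ne_of_gt ht) hA hA').1
  have hcf := h.rayCurlFree he (T := fun t => t) (fun t ht => ne_of_gt ht) hA hA'
  have hW := tendsto_rayW (g := g) (c := c) (i := i) he (d := 0) hb hN rfl (fun t _ => by simp)
    (fun t _ => by simp)
  have hl := hexp.rayLimit
  have hH := hl.tendsto_fieldH_one h.response hroot hW
  have hE := hcf.tendsto hl h.lam_ne hH
  refine ⟨_, hexp.tendsto_epsPart h.response hroot, ?_⟩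
  have h1 := hE.sub (hexp.tendsto_fieldE h.response h.pos hroot hs1 hs2)
  rw [zero_sub] at h1
  refine h1.congr fun t => ?_
  exact sub_sub_cancel _ _

/-- Here the leading order is no obstruction, due to the factor `a - 1` in `balanceE`, and the next
order is used. The remainder `δ - J (x - c i)` contributes its terms of degree two, which would dominate, and of
degree three. -/
lemma CurlFreeNear.false_of_degree_one (h : CurlFreeNear S S' k lam c g w i p)
    (hw : w i = 0) {M : V3 [×1]→L[ℝ] V3} (hM : LeadingTerm (coulomb c w) (c i) 1 M P') : False := by
  obtain ⟨s₀, hs1, hs2⟩ := h.response.limits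
  have hc := h.inj
  have hg := h.ne
  have hk := h.pos
  have hlam := h.lam_ne
  obtain ⟨hMJ, hPJ⟩ := hM.form.eq_of_degree_one
  have hJ : SymTraceless (P' 0) := hM.form.sym 0
  set J := P' 0 with hJdef
  set m := g i / (4 * π) with hmdef
  have hm : m ≠ 0 := by positivity
  set C₀ := coulomb c (update g i 0) (c i)
  set κ₁ := -(4 * √(lam ^ 2 * k * (m ^ 2)⁻¹) * s₀)
  have hΛ : 0 < m ^ 2 * (2 * (lam ^ 2 * k)) := by positivity
  have hJ0 : J ≠ 0 := fun h0 => hM.ne (by funext u; rw [hMJ, h0]; rfl)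
  -- the even part is isolated by comparing opposite directions
  have hparity : ∀ {ν : ℝ} {A : V3 [×3]→L[ℝ] V3}, (∀ e : V3, ‖e‖ = 1 → ν • cross e (A fun _ => e) =
      -(evenPart m κ₁ J e + oddPart m (lam ^ 2 * k) J C₀ e)) → False := fun {ν A} hA => by
    have hhom : ∀ (t : ℝ) (u : V3), (A fun _ => t • u) = t ^ 3 • A fun _ => u := fun t u => by
      have := A.map_smul_univ (fun _ => t) (fun _ => u)
      simpa using this
    refine hJ0 (eq_zero_of_evenPart (κ₁ := κ₁) (ν := ν) hm hJ hhom fun e he => ?_)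
    have h1 := hA e he
    have h2 := hA (-e) (by rwa [norm_neg])
    have h3 : (A fun _ => -e) = -A fun _ => e := by
      have h4 := hhom (-1) e
      rw [neg_one_smul] at h4
      rw [h4, Odd.neg_one_pow (by decide), neg_one_smul]
    rw [evenPart_neg, oddPart_neg, h3, cross_neg_left, cross_neg_right, neg_neg] at h2
    linear_combination (norm := module) (1 / 2 : ℝ) • h1 + (1 / 2 : ℝ) • h2
  set δ : V3 → V3 := fun x => coulomb c w x - J (x - c i) with hδ
  have hδan : AnalyticAt ℝ δ (c i) := by
    refine (analyticAt_coulomb_center hc hw).sub ?_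
    exact (J.analyticAt _).comp (analyticAt_id.sub analyticAt_const)
  have hδd : ∀ᶠ x in 𝓝 (c i), HasFDerivAt δ (coulombJac c w x - J) x := by
    filter_upwards [eventually_fderiv_coulomb hc hw] with x hx
    exact hx.sub (J.hasFDerivAt.comp x ((hasFDerivAt_id x).sub_const (c i)))
  have hsym : ∀ᶠ x in 𝓝 (c i), SymTraceless (fderiv ℝ δ x) := by
    filter_upwards [hδd, eventually_fderiv_coulomb hc hw, eventually_symTraceless_coulomb
      fun j hj => ne_center_of_charge hc hw j hj] with x h1 h2 h3
    rw [h1.fderiv, sub_eq_add_neg, ← neg_one_smul ℝ J, ← h2.fderiv]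
    exact h3.add (hJ.smul _)
  have hray : ∀ e : V3, (fun t : ℝ => c i + t • e) ⇝ (c i) := tendsto_ray (c i)
  by_cases h0 : ∀ᶠ x in 𝓝 (c i), δ x = 0
  · refine hparity (ν := 0) (A := 0) fun e he => ?_
    have h1 : ∀ᶠ x in 𝓝 (c i), coulombJac c w x = J := by
      filter_upwards [h0.eventually_nhds, hδd] with x hx hd
      have h2 : HasFDerivAt δ (0 : V3 →L[ℝ] V3) x :=
        (hasFDerivAt_const (0 : V3) x).congr_of_eventuallyEq hx
      exact sub_eq_zero.1 (hd.unique h2)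
    obtain ⟨U, -, hU⟩ := h.exists_limit he (J := J) (ε := fun _ => 0)
      (A₃ := fun _ => 0) (A₃' := fun _ => 0) tendsto_const_nhds tendsto_const_nhds
      tendsto_const_nhds hs1 hs2 (by
        filter_upwards [(hray e).eventually h0] with t ht
        rw [hδ] at ht; rw [sub_eq_zero.1 ht]; simp) (by
        filter_upwards [(hray e).eventually h1, eventually_pos] with t ht ht0
        rw [ht, mul_inv_cancel₀ ht0.ne']
        exact ContinuousLinearMap.ext fun v => by simp)
    simp only [mul_zero, zero_smul] at hU
    rw [zero_smul]
    exact tendsto_nhds_unique tendsto_const_nhds hU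
  · obtain ⟨a', M', P'', hM'⟩ := exists_leadingTerm hδan hsym h0
    have ha' : 2 ≤ a' := by
      by_contra! hlt
      refine hM'.ne (funext fun u => ?_)
      have h1 : (fun t : ℝ => (t ^ 1)⁻¹ • δ (c i + t • u)) ⇝ 0 := by
        have h2 := (hM.tendsto u).sub_const (J u)
        rw [hMJ, sub_self] at h2
        refine h2.congr' ?_
        filter_upwards [eventually_pos] with t ht
        rw [hδ, pow_one]
        simp only [add_sub_cancel_left, map_smul]
        rw [smul_sub, inv_smul_smul₀ ht.ne']
      interval_cases a'
      · refine tendsto_nhds_unique (hM'.tendsto u) ?_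
        have h2 := tendsto_self_nhdsGT.smul h1
        refine (tendsto_of_eq h2 (by simp)).congr' ?_
        filter_upwards [eventually_pos] with t ht
        simp only [pow_one, pow_zero, inv_one, one_smul]
        rw [smul_inv_smul₀ ht.ne']
      · exact tendsto_nhds_unique (hM'.tendsto u) h1
    obtain ⟨a'', rfl⟩ := Nat.exists_eq_add_of_le ha'
    have key : ∀ e : V3, ‖e‖ = 1 → ∃ U : ℝ → V3, U ⇝ ((m ^ 2 * (2 * (lam ^ 2 * k)) * (a'' + 1)) • cross e (M' fun _ => e)) ∧
      (fun t => ((t ^ 2)⁻¹ * t ^ (a'' + 1)) • U t) ⇝ (-(evenPart m κ₁ J e + oddPart m (lam ^ 2 * k) J C₀ e)) := fun e he => by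
      obtain ⟨U, hU1, hU2⟩ := h.exists_limit he (J := J)
        (ε := fun t => t ^ (a'' + 1)) (tendsto_pow_nhdsGT (a'' + 1)) (hM'.tendsto e)
        (hM'.tendsto_fderiv e) hs1 hs2 (by
          filter_upwards [eventually_pos] with t ht
          have h3 : t ^ (a'' + 1) * (t ^ (2 + a''))⁻¹ = t⁻¹ := by
            rw [show 2 + a'' = a'' + 1 + 1 by ring, pow_succ t (a'' + 1)]
            field_simp
          rw [smul_smul, h3, hδ, smul_add, smul_inv_smul₀ ht.ne']
          simp) (by
          filter_upwards [(hray e).eventually hδd, eventually_pos] with t h4 ht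
          have h3 : t ^ (a'' + 1) * ((t ^ (2 + a''))⁻¹ * t) = 1 := by
            rw [show 2 + a'' = a'' + 1 + 1 by ring, pow_succ t (a'' + 1)]
            field_simp
          rw [smul_smul, h3, h4.fderiv, mul_inv_cancel₀ ht.ne']
          simp)
      refine ⟨U, tendsto_of_eq hU1 ?_, hU2⟩
      rw [hM'.form.euler e, cross_smul_right]
      push_cast
      module
    match a'', M', P'', hM', key with
    | 0, M', P'', hM', key =>
      refine hM'.ne (hM'.form.eq_zero fun e he => ?_)
      obtain ⟨U, hU1, hU2⟩ := key e he
      have h2 := (tendsto_pow_nhdsGT 1).smul hU2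
      rw [zero_smul] at h2
      have h3 := tendsto_nhds_unique hU1 (h2.congr' (by
        filter_upwards [eventually_pos] with t ht
        rw [smul_smul, show t ^ 1 * ((t ^ 2)⁻¹ * t ^ (0 + 1)) = 1 by
          rw [zero_add, pow_one]; field_simp, one_smul]))
      exact (smul_eq_zero.1 h3).resolve_left (by positivity)
    | 1, M', P'', hM', key =>
      refine hparity (ν := m ^ 2 * (2 * (lam ^ 2 * k)) * ((1 : ℕ) + 1)) (A := M') fun e he => ?_
      obtain ⟨U, hU1, hU2⟩ := key e he
      refine tendsto_nhds_unique hU1 (hU2.congr' ?_)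
      filter_upwards [eventually_pos] with t ht
      rw [inv_mul_cancel₀ (by positivity), one_smul]
    | b + 2, M', P'', hM', key =>
      refine hparity (ν := 0) (A := 0) fun e he => ?_
      obtain ⟨U, hU1, hU2⟩ := key e he
      rw [zero_smul]
      have h3 := (tendsto_pow_nhdsGT (b + 1)).smul hU1
      rw [zero_smul] at h3
      refine tendsto_nhds_unique h3 (hU2.congr' ?_)
      filter_upwards [eventually_pos] with t ht
      rw [show b + 2 + 1 = 2 + (b + 1) by ring, pow_add, inv_mul_cancel_left₀ (by positivity)]

/-- If `κ > 0`, then neither `E` nor `H` is irrotational near a charge, unless the charge ratio is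
the same for all charges. -/
lemma CurlFreeNear.false (h : CurlFreeNear S S' k lam c g w i p)
    (hg' : update g i 0 ≠ 0) (hw : w i = 0) (hw0 : w ≠ 0) : False := by
  obtain ⟨a, M, P', hM⟩ := exists_leadingTerm_coulomb h.inj hw hw0
  match a, M, P', hM with
  | 0, M, P', hM => exact h.false_of_degree_zero hw hM
  | 1, M, P', hM => exact h.false_of_degree_one hw hM
  | a + 2, M, P', hM => exact h.false_of_two_le hg' hw (by omega) hM

end

end

/-! ### Limits of the root of the constitutive equation -/

section
variable {ι : Type*} {l : Filter ι} {L b p : ι → ℝ}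

lemma IsRoot.le_of_lt (hS : Response S S') {L b p : ℝ} (h : IsRoot S L b p) (hp' : 0 < p')
    (hlt : p' < p) (h0 : 0 ≤ 2 * S p' + b) : p' ^ 2 * (2 * S p' + b) ≤ L := by
  have h1 := hS.strictMonoOn hp' h.1 hlt
  rw [← h.2]
  gcongr

lemma IsRoot.ge_of_lt (hS : Response S S') {L b p : ℝ} (hL : 0 ≤ L) (h : IsRoot S L b p)
    (hlt : p < p') : L ≤ p' ^ 2 * (2 * S p' + b) := by
  have h1 := hS.strictMonoOn h.1 (mem_Ioi.2 (h.1.trans hlt)) hlt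
  have h2 : 0 ≤ 2 * S p + b := by
    have := h.2 ▸ hL
    exact nonneg_of_mul_nonneg_right this (pow_pos h.1 2)
  have := h.1
  rw [← h.2]
  gcongr

/-- If `B² → ∞` and `L ~ x B²`, then `p² → x`. -/
lemma tendsto_root_ratio (hS : Response S S') {x : ℝ} (hx : 0 < x)
    (hL : Tendsto (fun t => L t / b t) l (𝓝 (x ^ 2))) (hb : Tendsto b l atTop)
    (hp : ∀ᶠ t in l, IsRoot S (L t) (b t) (p t)) : Tendsto p l (𝓝 x) := by
  have hlim : ∀ y : ℝ, Tendsto (fun t => y ^ 2 * (2 * S y / b t + 1)) l (𝓝 (y ^ 2)) := fun y => by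
    simpa using ((hb.const_div_atTop (2 * S y)).add_const 1).const_mul (y ^ 2)
  refine tendsto_order.2 ⟨fun y hy => ?_, fun y hy => ?_⟩
  · obtain ⟨z, hz1, hz2⟩ := exists_between (max_lt hy hx)
    have hz0 : 0 < z := (le_max_right _ _).trans_lt hz1
    have h1 := (hlim z).eventually_lt hL (by gcongr)
    filter_upwards [h1, hp, hb.eventually_gt_atTop 0, hL.eventually_const_lt (show 0 < x ^ 2 by positivity)]
      with t h2 h3 h4 h5
    by_contra! h6
    have hL0 : 0 ≤ L t := by
      have := (div_pos_iff_of_pos_right h4).1 h5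
      exact this.le
    have h7 := h3.ge_of_lt hS hL0 (h6.trans_lt ((le_max_left _ _).trans_lt hz1))
    have h8 : L t / b t ≤ z ^ 2 * (2 * S z / b t + 1) := by
      rw [div_le_iff₀ h4]
      refine h7.trans_eq ?_
      field_simp
    linarith
  · obtain ⟨z, hz1, hz2⟩ := exists_between hy
    have hz0 : 0 < z := hx.trans hz1
    have h1 := hL.eventually_lt (hlim z) (by gcongr)
    filter_upwards [h1, hp, hb.eventually_gt_atTop 0, hb.eventually_ge_atTop (-(2 * S z))]
      with t h2 h3 h4 h5
    by_contra! h6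
    have h7 := h3.le_of_lt hS hz0 (hz2.trans_le h6) (by linarith)
    have h8 : z ^ 2 * (2 * S z / b t + 1) ≤ L t / b t := by
      rw [le_div_iff₀ h4]
      refine h7.trans_eq' ?_
      field_simp
    linarith

/-- If `L → 0` and `B² → 0`, then `p → 1`. -/
lemma tendsto_root_one (hS : Response S S') (hL : Tendsto L l (𝓝 0)) (hL0 : ∀ᶠ t in l, 0 ≤ L t)
    (hb : Tendsto b l (𝓝 0)) (hp : ∀ᶠ t in l, IsRoot S (L t) (b t) (p t)) :
    Tendsto p l (𝓝 1) := by
  have hlim : ∀ y : ℝ, Tendsto (fun t => y ^ 2 * (2 * S y + b t)) l (𝓝 (y ^ 2 * (2 * S y))) :=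
    fun y => by simpa using (hb.const_add (2 * S y)).const_mul (y ^ 2)
  refine tendsto_order.2 ⟨fun y hy => ?_, fun y hy => ?_⟩
  · obtain ⟨z, hz1, hz2⟩ := exists_between (max_lt hy one_pos)
    have hz0 : 0 < z := (le_max_right _ _).trans_lt hz1
    have hSz := hS.neg hz0 hz2
    have h1 := (hlim z).eventually_lt_const (show z ^ 2 * (2 * S z) < 0 by nlinarith [pow_pos hz0 2])
    filter_upwards [h1, hp, hL0] with t h2 h3 h4
    by_contra! h6
    have := h3.ge_of_lt hS h4 (h6.trans_lt ((le_max_left _ _).trans_lt hz1))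
    linarith
  · obtain ⟨z, hz1, hz2⟩ := exists_between hy
    have hz0 : 0 < z := one_pos.trans hz1
    have hSz : 0 < S z := by rw [← hS.one]; exact hS.strictMonoOn (mem_Ioi.2 one_pos) hz0 hz1
    have h1 := hL.eventually_lt (hlim z) (by positivity)
    filter_upwards [h1, hp, hb.eventually_const_lt (show -(2 * S z) < 0 by linarith)]
      with t h2 h3 h4
    by_contra! h6
    have h7 := h3.le_of_lt hS hz0 (hz2.trans_le h6) (by linarith)
    linarith

end

/-! ### The case `κ = 0` -/

/-- `∇D² - p² ∇B²`, in terms of `B` and `δ = D - λ B`. -/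
def gradDiff (lam p : ℝ) (B δ : V3) (JB Jδ : V3 →L[ℝ] V3) : V3 :=
  (lam ^ 2 - p ^ 2) • ((2 : ℝ) • JB B) + (2 * lam) • (JB δ + Jδ B) + (2 : ℝ) • Jδ δ

lemma gradDiff_ray {p T : ℝ} {β A : V3} {Jβ A' : V3 →L[ℝ] V3} (ht : 0 < t) :
    gradDiff lam p ((t ^ 2)⁻¹ • β) (T • A) ((t ^ 3)⁻¹ • Jβ) ((T * t⁻¹) • A') =
      (2 * (lam ^ 2 - p ^ 2) * (t ^ 5)⁻¹) • Jβ β + (2 * lam * T * (t ^ 3)⁻¹) • (Jβ A + A' β) +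
        (2 * T ^ 2 * t⁻¹) • A' A := by
  rw [gradDiff]
  simp only [smul_apply, map_smul]
  match_scalars <;> field_simp

section
/-- If `κ = 0`, then neither `E` nor `H` is irrotational near a charge, unless the charge ratio
is the same for all charges. -/
lemma false_of_cross_gradDiff (hS : Response S S') (hc : Injective c) (hlam : lam ≠ 0)
    (hg : g i ≠ 0) (hg' : update g i 0 ≠ 0) (hw : w i = 0) (hw0 : w ≠ 0)
    (hp : ∀ᶠ x in 𝓝[≠] (c i),
      IsRoot S (‖lam • coulomb c g x + coulomb c w x‖ ^ 2) (‖coulomb c g x‖ ^ 2) (p x))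
    (hcurl : (∀ᶠ x in 𝓝[≠] (c i), cross (𝔉[gradDiff lam, p, c, g, w, x]) (lam • coulomb c g x + coulomb c w x) = 0) ∨
      (∀ᶠ x in 𝓝[≠] (c i), cross (𝔉[gradDiff lam, p, c, g, w, x]) (coulomb c g x) = 0)) : False := by
  obtain ⟨a, M, P', hM⟩ := exists_leadingTerm_coulomb hc hw hw0
  obtain ⟨d, C, C', hC⟩ := exists_leadingTerm_coulomb hc (update_self i 0 g) hg'
  set m := g i / (4 * π) with hmdef
  have hm : m ≠ 0 := by positivity
  have hT : ∀ t : ℝ, 0 < t → t ^ a ≠ 0 := fun t ht => pow_ne_zero a ht.ne'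
  have hlam' : 0 < |lam| := abs_pos.2 hlam
  obtain ⟨ε, hG⟩ : ∃ ε : ℝ, ∀ᶠ x in 𝓝[≠] (c i), cross 𝔉[gradDiff lam, p, c, g, w, x]
      (coulomb c g x + ε • coulomb c w x) = 0 := by
    rcases hcurl with h | h
    · refine ⟨lam⁻¹, h.mono fun x hx => ?_⟩
      rw [← inv_smul_smul₀ hlam (coulomb c g x + _), smul_add, smul_inv_smul₀ hlam,
        cross_smul_right, hx, smul_zero]
    · exact ⟨0, by simpa using h⟩
  refine hM.form.no_balance hC.form hM.ne hC.ne (l := 𝓝[>] (0 : ℝ))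
    (fun had => by simpa using (tendsto_pow_mul_inv had).const_mul (S |lam|))
    (k₁ := -(2 * lam * (1 + a) * m ^ 2)) (k₂ := -(4 * lam ^ 2 * (3 + d)))
    (neg_ne_zero.2 (by positivity)) (neg_ne_zero.2 (by positivity)) fun e he => ?_
  set β := rayβ c g i e with hβ
  set Jβ := rayJβ c g i e with hJβ
  set A : ℝ → V3 := fun t => (t ^ a)⁻¹ • coulomb c w (c i + t • e) with hAdef
  set A' : ℝ → V3 →L[ℝ] V3 := fun t => ((t ^ a)⁻¹ * t) • coulombJac c w (c i + t • e) with hA'def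
  obtain ⟨ι, hT0⟩ : ∃ ι : ℝ, (fun t : ℝ => t ^ a) ⇝ ι :=
    ⟨(0 : ℝ) ^ a, ((continuous_pow a).tendsto 0).mono_left nhdsWithin_le_nhds⟩
  have hl : RayLimit m e ι (M fun _ => e) (P' e) β A Jβ A' (fun t => t ^ a) :=
    rayLimit_coulomb hc he hg hT0 (hM.tendsto e) (hM.tendsto_jac hc hw e)
  have hA : ∀ t > 0, coulomb c w (c i + t • e) = t ^ a • A t := fun t ht =>
    (smul_inv_smul₀ (hT t ht) _).symm
  have hA' : ∀ t > 0, coulombJac c w (c i + t • e) = (t ^ a * t⁻¹) • A' t := fun t ht =>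
    (smul_pow_inv ht a _).symm
  have hW := hC.tendsto_rayW hc he
  rw [← hmdef] at hW
  have ht2 := tendsto_pow_nhdsGT 2
  have ht4 := tendsto_pow_nhdsGT 4
  have hray := tendsto_ray_ne (c i) he
  have hβn : (fun t => ‖β t‖ ^ 2) ⇝ (m ^ 2) := by
    refine tendsto_of_eq (hl.tendsto_β.norm.pow 2) ?_
    rw [norm_smul, he, mul_one, norm_eq_abs, sq_abs]
  have hβ0 : ∀ᶠ t in 𝓝[>] 0, ‖β t‖ ^ 2 ≠ 0 := hβn.eventually_ne (by positivity)
  have hroot : ∀ᶠ t in 𝓝[>] (0 : ℝ), IsRoot S (‖lam • (t ^ 2)⁻¹ • β t + t ^ a • A t‖ ^ 2)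
      (‖(t ^ 2)⁻¹ • β t‖ ^ 2) (p (c i + t • e)) := by
    filter_upwards [hray.eventually hp, eventually_pos] with t h1 ht
    rwa [hA t ht, coulomb_eq_rayβ he ht] at h1
  have hplim : (fun t : ℝ => p (c i + t • e)) ⇝ (|lam|) := by
    refine tendsto_root_ratio hS hlam' ?_ ?_ hroot
    · have h1 := ((((hl.tendsto_β.const_smul lam).add
        ((ht2.mul hT0).smul hl.tendsto_A)).norm).pow 2).div hβn (by positivity)
      have h2 : ‖lam • m • e + ((0 : ℝ) * ι) • M fun _ => e‖ ^ 2 / m ^ 2 = |lam| ^ 2 := by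
        rw [zero_mul, zero_smul, add_zero, norm_smul, norm_smul, he, mul_one, norm_eq_abs,
          norm_eq_abs, mul_pow, sq_abs, sq_abs]
        field_simp
      rw [h2] at h1
      refine h1.congr' ?_
      filter_upwards [eventually_pos, hβ0] with t ht h0
      have h3 : lam • (t ^ 2)⁻¹ • β t + t ^ a • A t =
          (t ^ 2)⁻¹ • (lam • β t + (t ^ 2 * t ^ a) • A t) := by
        match_scalars <;> field_simp
      rw [h3, norm_sq_ray ht.ne', norm_sq_ray ht.ne', Pi.div_apply]
      field_simp
    · have h1 : Tendsto (fun t : ℝ => ‖coulomb c g (c i + t • e)‖) (𝓝[>] 0) atTop :=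
        (tendsto_norm_coulomb_atTop hc hg).comp hray
      have h2 := (tendsto_pow_atTop two_ne_zero).comp h1
      refine h2.congr' ?_
      filter_upwards [eventually_pos] with t ht
      simp only [comp_apply]
      rw [coulomb_eq_rayβ he ht]
  -- the difference quotient of `S` at `|λ|`
  set h' : ℝ → ℝ := fun t : ℝ => dslope S |lam| (p (c i + t • e)) / (p (c i + t • e) + |lam|) with hh'
  have hh'lim : h' ⇝ (dslope S |lam| |lam| / (|lam| + |lam|)) :=
    ((continuousAt_dslope_same.2 (hS.hasDerivAt _ hlam').differentiableAt).tendsto.comp hplim).div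
      (hplim.add_const |lam|) (by positivity)
  have hSlim : (fun t : ℝ => S (p (c i + t • e))) ⇝ (S |lam|) :=
    (hS.hasDerivAt _ hlam').continuousAt.tendsto.comp hplim
  have hh's : ∀ᶠ t in 𝓝[>] (0 : ℝ), S (p (c i + t • e)) = S |lam| +
      (p (c i + t • e) ^ 2 - lam ^ 2) * h' t := by
    filter_upwards [hroot] with t ht
    have h1 := sub_smul_dslope S |lam| (p (c i + t • e))
    have h2 : p (c i + t • e) + |lam| ≠ 0 := by have := ht.1; positivity
    have h3 : p (c i + t • e) ^ 2 - lam ^ 2 = (p (c i + t • e) - |lam|) * (p (c i + t • e) + |lam|) := by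
      rw [← sq_abs lam]; ring
    rw [h3, hh', mul_assoc, mul_div_cancel₀ _ h2, ← smul_eq_mul, h1]
    ring
  clear_value h'
  have hq := hβn.add (ht4.mul ((hSlim.const_mul 2).add (hh'lim.const_mul (2 * lam ^ 2))))
  rw [zero_mul, add_zero] at hq
  have hq0 := hq.eventually_ne (by positivity)
  have hqi := hq.inv₀ (by positivity)
  have hJ := (tendsto_clm_apply hl.tendsto_Jβ hl.tendsto_A).add
    (tendsto_clm_apply hl.tendsto_A' hl.tendsto_β)
  have hX := tendsto_cross hJ hl.tendsto_β
  have hX' := tendsto_cross hJ hl.tendsto_A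
  have hY := tendsto_cross hl.j hl.tendsto_β
  have hY' := tendsto_cross hl.j hl.tendsto_A
  have hV := tendsto_cross (tendsto_clm_apply hl.tendsto_Jβ hl.tendsto_β) hl.tendsto_A
  have hu := hl.lim_w
  have hN := hl.tendsto_A.norm.pow 2
  have hd2 := tendsto_pow_nhdsGT (d + 2)
  have hd4 := tendsto_pow_nhdsGT (d + 4)
  have hpp := (hplim.pow 2).const_sub (lam ^ 2)
  rw [sq_abs, sub_self] at hpp
  have hU := (((((((((hd2.mul hu).const_mul (4 * lam)).add
    (((hT0.mul hd4).mul hN).const_mul 2)).mul hqi).neg.smul hW).add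
    (hX.const_smul (2 * lam))).add (((hT0.mul ht2).const_mul 2).smul hY)).add
    ((hpp.const_mul (2 * ε)).smul hV)).add
    (((hT0.mul ht2).const_mul (2 * lam * ε)).smul hX')).add
    (((hT0.mul (hT0.mul ht4)).const_mul (2 * ε)).smul hY')
  have hWW := (hqi.const_mul (4 * lam ^ 2)).smul hW
  refine ⟨_, _, tendsto_of_eq hU ?_, tendsto_of_eq hWW ?_, ?_⟩
  · rw [map_smul (P' e), hM.form.euler, smul_apply, kernelJac_unit he]
    simp only [mul_zero, zero_mul, zero_smul, neg_zero, zero_add, add_zero, cross_add_left,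
      cross_sub_left, cross_smul_left, cross_smul_right, cross_self, smul_zero, sub_zero]
    rw [cross_comm _ e]
    module
  · match_scalars
    field_simp
  · filter_upwards [eventually_pos, hray.eventually hG, hroot, hh's, hq0] with t ht h1 h2 h3 h4
    have hTt := hT t ht
    have h5 := h2.2
    rw [norm_add_sq_real, norm_sq_ray ht.ne', norm_smul lam, mul_pow, norm_sq_ray ht.ne',
      norm_smul (t ^ a), mul_pow, norm_eq_abs, norm_eq_abs, sq_abs, sq_abs,
      inner_smul_left, inner_smul_left, inner_smul_right] at h5
    simp only [conj_trivial] at h5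
    rw [hA t ht, hA' t ht, coulomb_eq_rayβ he ht, coulombJac_eq_rayJβ he ht, gradDiff_ray ht] at h1
    have h6 := congrArg (fun v => ((t ^ a)⁻¹ * t ^ 5) • v) h1
    simp only [smul_zero, cross_add_left, cross_add_right, cross_smul_left, cross_smul_right] at h6
    rw [← h6]
    clear h6 h1
    simp only [cross_add_left]
    set P := p (c i + t • e)
    have h7 : (lam ^ 2 - P ^ 2) = t ^ 4 * (2 * S |lam| * lam ^ 2 - 2 * lam * t ^ a * (t ^ 2)⁻¹ *
        ⟪β t, A t⟫ - (t ^ a) ^ 2 * ‖A t‖ ^ 2) *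
        (‖β t‖ ^ 2 + t ^ 4 * (2 * S P + 2 * lam ^ 2 * h' t))⁻¹ := by
      rw [eq_mul_inv_iff_mul_eq₀ h4]
      have e1 : t ^ 4 * (t ^ 4)⁻¹ = 1 := mul_inv_cancel₀ (by positivity)
      linear_combination (-t ^ 4) * h5 + (P ^ 2 - lam ^ 2) * ‖β t‖ ^ 2 * e1 +
        2 * lam ^ 2 * t ^ 4 * h3
    generalize (‖β t‖ ^ 2 + t ^ 4 * (2 * S P + 2 * lam ^ 2 * h' t))⁻¹ = r at *
    have h8 : (t ^ a)⁻¹ * t ^ 5 * ((t ^ 2)⁻¹ * (2 * (lam ^ 2 - P ^ 2) * (t ^ 5)⁻¹)) =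
        (-((4 * lam * (t ^ (d + 2) * ⟪β t, A t⟫) + 2 * (t ^ a * t ^ (d + 4) * ‖A t‖ ^ 2)) * r) +
          S |lam| * (t ^ (d + 4) * (t ^ a)⁻¹) * (4 * lam ^ 2 * r)) * (t ^ (d + 2))⁻¹ := by
      rw [h7, show d + 4 = (d + 2) + 2 by ring, pow_add t (d + 2) 2]
      field_simp
      ring
    linear_combination (norm := skip) -h8 • cross (Jβ t (β t)) (β t)
    match_scalars <;> field_simp <;> ring

end

/-! ### Regularity of the root of the constitutive equation -/

section
lemma Response.contDiffAt (hS : Response S S') {p : ℝ} (hp : 0 < p) : ContDiffAt ℝ 1 S p := by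
  refine contDiffAt_one_iff.2 ⟨fun y => S' y • ContinuousLinearMap.id ℝ ℝ, Ioi 0,
    Ioi_mem_nhds hp, hS.continuousOn.smul continuousOn_const, fun y hy =>
    (hS.hasDerivAt y hy).hasFDerivAt.congr_fderiv ?_⟩
  ext
  simp

/-- The root is locally a `C¹` function of the data, by the inverse function theorem. -/
lemma exists_local_root (hS : Response S S') {p : ℝ} (hL : 0 ≤ L) (h : IsRoot S L b p) :
    ∃ P : ℝ × ℝ → ℝ, ContDiffAt ℝ 1 P (L, b) ∧ P (L, b) = p ∧
      ∀ᶠ z in 𝓝 (L, b), IsRoot S z.1 z.2 (P z) := by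
  have hp := h.1
  set a : ℝ := 2 * p * (2 * S p + b) + p ^ 2 * (2 * S' p) with ha
  have ha0 : a ≠ 0 := by
    have h1 : a * p = 2 * L + 2 * p ^ 3 * S' p := by rw [← h.2, ha]; ring
    have h2 : 0 < a * p := by
      rw [h1]
      have := hS.pos p hp
      positivity
    exact fun h0 => by simp [h0] at h2
  set Φ : ℝ × ℝ → ℝ × ℝ := fun z => (z.1 ^ 2 * (2 * S z.1 + z.2), z.2) with hΦ
  have hΦp : Φ (p, b) = (L, b) := by rw [hΦ]; simp only; rw [h.2]
  have hc : ContDiffAt ℝ 1 Φ (p, b) := by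
    have h1 : ContDiffAt ℝ 1 (fun z : ℝ × ℝ => S z.1) (p, b) :=
      ContDiffAt.comp (f := Prod.fst) (p, b) (hS.contDiffAt hp) contDiffAt_fst
    exact ((contDiffAt_fst.pow 2).mul ((contDiffAt_const.mul h1).add contDiffAt_snd)).prodMk
      contDiffAt_snd
  let A : ℝ × ℝ →L[ℝ] ℝ × ℝ := (a • ContinuousLinearMap.fst ℝ ℝ ℝ +
    p ^ 2 • ContinuousLinearMap.snd ℝ ℝ ℝ).prod (ContinuousLinearMap.snd ℝ ℝ ℝ)
  let A₁ : ℝ × ℝ →L[ℝ] ℝ × ℝ := (a⁻¹ • ContinuousLinearMap.fst ℝ ℝ ℝ -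
    (a⁻¹ * p ^ 2) • ContinuousLinearMap.snd ℝ ℝ ℝ).prod (ContinuousLinearMap.snd ℝ ℝ ℝ)
  let e : (ℝ × ℝ) ≃L[ℝ] ℝ × ℝ := ContinuousLinearEquiv.equivOfInverse A A₁
    (fun z => by ext <;> simp [A, A₁]; field_simp; ring)
    (fun z => by ext <;> simp [A, A₁]; field_simp; ring)
  have hd : HasFDerivAt Φ (e : ℝ × ℝ →L[ℝ] ℝ × ℝ) (p, b) := by
    have h1 : HasFDerivAt (fun z : ℝ × ℝ => S z.1) (S' p • ContinuousLinearMap.fst ℝ ℝ ℝ) (p, b) :=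
      HasDerivAt.comp_hasFDerivAt (f := Prod.fst) (p, b) (hS.hasDerivAt p hp) hasFDerivAt_fst
    have h2 := ((hasFDerivAt_fst (𝕜 := ℝ) (p := (p, b))).pow 2).mul
      ((h1.const_mul 2).add hasFDerivAt_snd)
    refine (h2.prodMk hasFDerivAt_snd).congr_fderiv ?_
    ext <;> simp [e, A, ha]
    ring
  refine ⟨fun z => (hc.localInverse hd one_ne_zero z).1, ?_, ?_, ?_⟩
  · have := hc.to_localInverse hd one_ne_zero
    rw [hΦp] at this
    exact contDiffAt_fst.comp _ this
  · have := hc.localInverse_apply_image hd one_ne_zero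
    rw [hΦp] at this
    simp only [this]
  · have h1 := (hc.to_localInverse hd one_ne_zero).continuousAt
    have h2 := hc.localInverse_apply_image hd one_ne_zero
    have h3 := (hc.hasStrictFDerivAt' hd one_ne_zero).eventually_right_inverse
    rw [hΦp] at h1 h2 h3
    have h4 : ∀ᶠ z in 𝓝 (L, b), 0 < (hc.localInverse hd one_ne_zero z).1 := by
      have := (continuous_fst.tendsto _).comp h1.tendsto
      rw [h2] at this
      exact this.eventually_const_lt hp
    filter_upwards [h3, h4] with z hz hz0
    have h5 : Φ (hc.localInverse hd one_ne_zero z) = z := hz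
    have h6 := congrArg Prod.fst h5
    have h7 := congrArg Prod.snd h5
    simp only [hΦ] at h6 h7
    exact ⟨hz0, by rw [h7] at h6; exact h6⟩

/-- A root function for `C¹` data is `C¹`. -/
lemma contDiffAt_root (hS : Response S S') {E : Type*} [NormedAddCommGroup E] [NormedSpace ℝ E]
    {L b p : E → ℝ} {x : E} (hL : ContDiffAt ℝ 1 L x) (hb : ContDiffAt ℝ 1 b x)
    (hL0 : ∀ᶠ y in 𝓝 x, 0 ≤ L y) (hp : ∀ᶠ y in 𝓝 x, IsRoot S (L y) (b y) (p y)) :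
    ContDiffAt ℝ 1 p x := by
  obtain ⟨P, hP, -, hroot⟩ := exists_local_root hS hL0.self_of_nhds hp.self_of_nhds
  have h1 : ContDiffAt ℝ 1 (fun y => (L y, b y)) x := hL.prodMk hb
  refine (ContDiffAt.comp x hP h1).congr_of_eventuallyEq ?_
  filter_upwards [h1.continuousAt.tendsto.eventually hroot, hL0, hp] with y h2 h3 h4
  exact h4.unique hS h3 h2

/-- The gradient of the root. -/
lemma exists_gradient_root (hS : Response S S') {L b : V3 → ℝ} {gL gb : V3}
    (hL : HasFDerivAt L (innerSL ℝ gL) x) (hb : HasFDerivAt b (innerSL ℝ gb) x)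
    (hpd : DifferentiableAt ℝ p x) (hp : ∀ᶠ y in 𝓝 x, IsRoot S (L y) (b y) (p y)) :
    ∃ (gp : V3) (M : ℝ), HasFDerivAt p (innerSL ℝ gp) x ∧ M • gp = gL - p x ^ 2 • gb ∧
      p x * M = 2 * L x + 2 * p x ^ 3 * S' (p x) := by
  obtain ⟨gp, hgp⟩ : ∃ gp : V3, HasFDerivAt p (innerSL ℝ gp) x :=
    ⟨(InnerProductSpace.toDual ℝ V3).symm (fderiv ℝ p x), by
      refine hpd.hasFDerivAt.congr_fderiv ?_
      ext v; simp⟩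
  have hroot := hp.self_of_nhds
  refine ⟨gp, 2 * p x * (2 * S (p x) + b x) + p x ^ 2 * (2 * S' (p x)), hgp, ?_, ?_⟩
  · have h1 := (hS.hasDerivAt _ hroot.1).comp_hasFDerivAt x hgp
    have h2 := (hgp.pow 2).mul ((h1.const_mul 2).add hb)
    have h3 : HasFDerivAt L _ x := h2.congr_of_eventuallyEq (hp.mono fun y hy => hy.2.symm)
    have h4 := h3.unique hL
    refine ext_inner_right ℝ fun v => ?_
    have h5 := congrArg (fun A : V3 →L[ℝ] ℝ => A v) h4
    simp at h5
    simp only [inner_smul_left, inner_sub_left, conj_trivial]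
    linear_combination h5
  · rw [← hroot.2]; ring

end

section

/-! ### Regularity of dyonic fields -/

lemma reducedSq_eq (κ : ℝ) (D B : V3) :
    reducedSq κ D B = ‖D‖ ^ 2 - κ ^ 2 * ⟪B, D⟫ ^ 2 / (1 + κ ^ 2 * ‖B‖ ^ 2) := by
  have h1 : 1 + κ ^ 2 * ‖B‖ ^ 2 ≠ 0 := by positivity
  rw [reducedSq, norm_cross_sq]
  field_simp
  ring

lemma reducedSq_nonneg (κ : ℝ) (D B : V3) : 0 ≤ reducedSq κ D B := by rw [reducedSq]; positivity

lemma reducedSq_le (κ : ℝ) (D B : V3) : reducedSq κ D B ≤ ‖D‖ ^ 2 := by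
  rw [reducedSq_eq]
  have : 0 ≤ κ ^ 2 * ⟪B, D⟫ ^ 2 / (1 + κ ^ 2 * ‖B‖ ^ 2) := by positivity
  linarith

lemma reducedSq_zero (D B : V3) : reducedSq 0 D B = ‖D‖ ^ 2 := by simp [reducedSq_eq]

section
variable {D B : V3 → V3}

lemma contDiffAt_reducedSq (hD : ContDiffAt ℝ 1 D x) (hB : ContDiffAt ℝ 1 B x) :
    ContDiffAt ℝ 1 (fun y => reducedSq κ (D y) (B y)) x := by
  simp only [reducedSq_eq]
  refine (hD.norm_sq ℝ).sub ((contDiffAt_const.mul ((hB.inner ℝ hD).pow 2)).div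
    (contDiffAt_const.add (contDiffAt_const.mul (hB.norm_sq ℝ))) ?_)
  positivity

lemma contDiffAt_dyonicE (hD : ContDiffAt ℝ 1 D x) (hB : ContDiffAt ℝ 1 B x)
    (hp : ContDiffAt ℝ 1 p x) (h0 : p x ≠ 0) :
    ContDiffAt ℝ 1 (fun y => dyonicE κ (p y) (D y) (B y)) x := by
  refine (hp.inv h0).smul (hD.sub (((contDiffAt_const.mul (hB.inner ℝ hD)).div
    (contDiffAt_const.add (contDiffAt_const.mul (hB.norm_sq ℝ))) ?_).smul hB))
  positivity

lemma contDiffAt_dyonicH (hD : ContDiffAt ℝ 1 D x) (hB : ContDiffAt ℝ 1 B x)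
    (hp : ContDiffAt ℝ 1 p x) (h0 : p x ≠ 0) :
    ContDiffAt ℝ 1 (fun y => dyonicH κ (p y) (D y) (B y)) x := by
  simp only [dyonicH_eq_sub]
  refine (hp.smul hB).sub (((contDiffAt_const.mul (hB.inner ℝ hD)).div
    (contDiffAt_const.add (contDiffAt_const.mul (hB.norm_sq ℝ))) ?_).smul
    (contDiffAt_dyonicE hD hB hp h0))
  positivity

end

lemma contDiffAt_coulomb (q : Fin n → ℝ) (hx : x ∈ (range c)ᶜ) : ContDiffAt ℝ 1 (coulomb c q) x :=
  contDiffOn_coulomb.contDiffAt (isOpen_compl_range.mem_nhds hx)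

/-- `p` is the root of the constitutive equation for the data of the charges `q`, `g` on a set
`Ω` which contains all points where `D ≠ 0` or `B = 0`, and a neighborhood of infinity. -/
structure RootField (S S' : ℝ → ℝ) (κ : ℝ) (c : Fin n → V3) (q g : Fin n → ℝ) (Ω : Set V3)
    (p : V3 → ℝ) : Prop where
  response : Response S S'
  isOpen : IsOpen Ω
  subset : Ω ⊆ (range c)ᶜ
  mem : ∀ x ∈ (range c)ᶜ, (coulomb c q x ≠ 0 ∨ coulomb c g x = 0) → x ∈ Ω
  infinity : ∀ᶠ x in cobounded V3, x ∈ Ω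
  root : ∀ x ∈ Ω, IsRoot S (reducedSq κ (coulomb c q x) (coulomb c g x)) (‖coulomb c g x‖ ^ 2) (p x)

namespace RootField
lemma contDiffAt (h : RootField S S' κ c q g Ω p) (hx : x ∈ Ω) : ContDiffAt ℝ 1 p x :=
  contDiffAt_root h.response
    (contDiffAt_reducedSq (contDiffAt_coulomb q (h.subset hx)) (contDiffAt_coulomb g (h.subset hx)))
    ((contDiffAt_coulomb g (h.subset hx)).norm_sq ℝ)
    (.of_forall fun _ => reducedSq_nonneg _ _ _)
    (Filter.mem_of_superset (h.isOpen.mem_nhds hx) fun y hy => h.root y hy)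

/-- The electric field. -/
abbrev fieldE (κ : ℝ) (c : Fin n → V3) (q g : Fin n → ℝ) (p : V3 → ℝ) (x : V3) : V3 :=
  dyonicE κ (p x) (coulomb c q x) (coulomb c g x)

/-- The magnetic intensity field. -/
abbrev fieldH (κ : ℝ) (c : Fin n → V3) (q g : Fin n → ℝ) (p : V3 → ℝ) (x : V3) : V3 :=
  dyonicH κ (p x) (coulomb c q x) (coulomb c g x)

lemma contDiffOn_E (h : RootField S S' κ c q g Ω p) :
    ContDiffOn ℝ 1 (fieldE κ c q g p) Ω := fun x hx =>
  (contDiffAt_dyonicE (contDiffAt_coulomb q (h.subset hx)) (contDiffAt_coulomb g (h.subset hx))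
    (h.contDiffAt hx) (h.root x hx).1.ne').contDiffWithinAt

lemma contDiffOn_H (h : RootField S S' κ c q g Ω p) :
    ContDiffOn ℝ 1 (fieldH κ c q g p) Ω := fun x hx =>
  (contDiffAt_dyonicH (contDiffAt_coulomb q (h.subset hx)) (contDiffAt_coulomb g (h.subset hx))
    (h.contDiffAt hx) (h.root x hx).1.ne').contDiffWithinAt

lemma eventually_mem (h : RootField S S' κ c q g Ω p) (hc : Injective c) (hq : q i ≠ 0) :
    ∀ᶠ x in 𝓝[≠] (c i), x ∈ Ω := by
  filter_upwards [eventually_mem_compl_range hc i,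
    (tendsto_norm_coulomb_atTop hc hq).eventually_gt_atTop 0] with x h1 h2
  exact h.mem x h1 (Or.inl (norm_pos_iff.1 h2))

/-! ### The curl of dyonic fields is non-zero -/

/-- In the case `κ > 0`. -/
lemma curlFreeNear (h : RootField S S' κ c q g Ω p) (hc : Injective c) (hκ : 0 < κ)
    (hlam : lam ≠ 0) (hqi : q i ≠ 0) (hgi : g i ≠ 0) (hqw : q = lam • g + w)
    (hcurl : (∀ x ∈ Ω, curl (fieldE κ c q g p) x = 0) ∨ ∀ x ∈ Ω, curl (fieldH κ c q g p) x = 0) :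
    CurlFreeNear S S' (κ ^ 2)⁻¹ lam c g w i p := by
  have hk : 0 < (κ ^ 2)⁻¹ := by positivity
  have hD : ∀ x, coulomb c q x = lam • coulomb c g x + coulomb c w x := fun x => by
    rw [hqw, coulomb_add, coulomb_smul]
  have hmem := h.eventually_mem hc hqi
  have hL : ∀ x, reducedSq κ (coulomb c q x) (coulomb c g x) =
      reducedForm (κ ^ 2)⁻¹ lam (coulomb c g x) (coulomb c w x) := fun x => by
    rw [hD, reducedSq_eq_reducedForm hκ]
  have hroot : ∀ x ∈ Ω, IsRoot S (reducedForm (κ ^ 2)⁻¹ lam (coulomb c g x) (coulomb c w x))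
      (‖coulomb c g x‖ ^ 2) (p x) := fun x hx => hL x ▸ h.root x hx
  have key : ∀ x ∈ Ω,
      (curl (fieldE κ c q g p) x = 0 → 𝔉[pointE S' (κ ^ 2)⁻¹ lam, p, c, g, w, x] = 0) ∧
      (curl (fieldH κ c q g p) x = 0 → 𝔉[pointH S' (κ ^ 2)⁻¹ lam, p, c, g, w, x] = 0) := fun x hx => by
    have hB := hasFDerivAt_coulomb_compl g (h.subset hx)
    have hδ := hasFDerivAt_coulomb_compl w (h.subset hx)
    have hJB := symTraceless_coulombJac_compl g (h.subset hx)
    have hJδ := symTraceless_coulombJac_compl w (h.subset hx)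
    obtain ⟨gp, M, hgp, hM, hs⟩ := exists_gradient_root h.response
      (hasFDerivAt_reducedForm (lam := lam) hk hB hδ hJB hJδ) (hasFDerivAt_norm_sq hB hJB)
      ((h.contDiffAt hx).differentiableAt one_ne_zero)
      (Filter.mem_of_superset (h.isOpen.mem_nhds hx) fun y hy => hroot y hy)
    have hp0 := (h.root x hx).1.ne'
    have hm := hasFDerivAt_mixing (lam := lam) hk hB hδ hJB hJδ
    constructor <;> intro h1
    · change curl (fun x => dyonicE κ (p x) (coulomb c q x) (coulomb c g x)) x = 0 at h1
      simp only [hD, dyonicE_eq hκ] at h1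
      rw [curl_electric hB hδ hJB hJδ hgp hp0 hm] at h1
      exact thetaE_eq_zero hp0 hM hs h1
    · change curl (fun x => dyonicH κ (p x) (coulomb c q x) (coulomb c g x)) x = 0 at h1
      simp only [hD, dyonicH_eq hκ] at h1
      rw [curl_magnetic hB hδ hJB hJδ hgp hp0 hm] at h1
      exact thetaH_eq_zero hp0 hM hs h1
  exact ⟨h.response, hc, hk, hlam, hgi, hmem.mono hroot, hcurl.imp (fun h0 => hmem.mono fun x hx => (key x hx).1 (h0 x hx))
    fun h0 => hmem.mono fun x hx => (key x hx).2 (h0 x hx)⟩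

/-- In the case `κ = 0`, the curls of `E` and `H` are multiples of `(∇D² - p² ∇B²) × D` and
`(∇D² - p² ∇B²) × B`. -/
lemma cross_gradDiff_eq_zero (h : RootField S S' 0 c q g Ω p) (hqw : q = lam • g + w) (hx : x ∈ Ω) :
    (curl (fieldE 0 c q g p) x = 0 → cross (𝔉[gradDiff lam, p, c, g, w, x]) (coulomb c q x) = 0) ∧
    (curl (fieldH 0 c q g p) x = 0 →
      cross (𝔉[gradDiff lam, p, c, g, w, x]) (coulomb c g x) = 0) := by
  have hd := fun v => hasFDerivAt_coulomb_compl v (h.subset hx)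
  have hJ := fun v => symTraceless_coulombJac_compl v (h.subset hx)
  have hJq : coulombJac c q x = lam • coulombJac c g x + coulombJac c w x := by
    have h1 := ((hd g).const_smul lam).add (hd w)
    refine (hd q).unique (h1.congr_of_eventuallyEq (.of_forall fun y => ?_))
    rw [hqw, coulomb_add, coulomb_smul]; rfl
  have hD : coulomb c q x = lam • coulomb c g x + coulomb c w x := by
    rw [hqw, coulomb_add, coulomb_smul]
  obtain ⟨gp, M, hgp, hM, -⟩ := exists_gradient_root h.response
    (hasFDerivAt_norm_sq (hd q) (hJ q)) (hasFDerivAt_norm_sq (hd g) (hJ g))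
    ((h.contDiffAt hx).differentiableAt one_ne_zero)
    (Filter.mem_of_superset (h.isOpen.mem_nhds hx) fun y hy => by
      have h1 := h.root y hy
      rw [reducedSq_zero] at h1
      exact h1)
  have hG : 𝔉[gradDiff lam, p, c, g, w, x] = M • gp := by
    rw [hM, hJq, hD, gradDiff]
    simp only [add_apply, smul_apply, map_add, map_smul]
    module
  have hp0 := (h.root x hx).1.ne'
  have hE : (fieldE 0 c q g p) = fun x => (p x)⁻¹ • coulomb c q x := by funext y; simp [dyonicE]
  have hH : (fieldH 0 c q g p) = fun x => p x • coulomb c g x := by funext y; simp [dyonicH]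
  rw [hE, hH, hG, curl_smul (hasFDerivAt_inv hgp hp0) (hd q).differentiableAt,
    curl_smul hgp (hd g).differentiableAt, curl_coulomb (h.subset hx), curl_coulomb (h.subset hx)]
  simp only [smul_zero, add_zero, cross_neg_left, cross_smul_left]
  refine ⟨fun h1 => ?_, fun h1 => by rw [h1, smul_zero]⟩
  rw [neg_eq_zero] at h1
  rw [(smul_eq_zero.1 h1).resolve_left (by positivity), smul_zero]

end RootField

/-- If a field `φ(|K|²) K` has no curl, then `φ` is constant, and has the same limits for small and
for large `K`. -/
lemma eq_of_curl_radial_eq_zero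
    (hc : Injective c) (hi : q i ≠ 0) (hq : update q i 0 ≠ 0) {φ : ℝ → ℝ}
    (hφ : ContDiffOn ℝ 1 φ (Ioi 0)) (h0 : ∀ x, coulomb c q x = 0 → F x = 0)
    (hF : ∀ x ∈ (range c)ᶜ, coulomb c q x ≠ 0 → F x = φ (‖coulomb c q x‖ ^ 2) • coulomb c q x)
    (h : ∀ x ∈ (range c)ᶜ, curl F x = 0) {a : ℝ} (ha : φ ⇝ a)
    (hb : Tendsto φ atTop (𝓝 b)) : a = b := by
  have hd : DifferentiableOn ℝ φ (Ioi 0) := hφ.differentiableOn one_ne_zero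
  have hcon : ∀ s ∈ Ioi (0 : ℝ), φ s = φ 1 := fun s hs => by
    refine isOpen_Ioi.is_const_of_deriv_eq_zero isPreconnected_Ioi hd (fun t ht => ?_) hs
      (mem_Ioi.2 one_pos)
    by_contra h1
    obtain ⟨x, hx, hx'⟩ := exists_curl_radial_ne_zero hc hi hq
      (fun s hs => (hd.differentiableAt (Ioi_mem_nhds hs)).hasDerivAt)
      (hφ.continuousOn_deriv_of_isOpen isOpen_Ioi le_rfl) ht h1
    refine hx' ((curl_congr ?_).trans (h x hx))
    filter_upwards [isOpen_compl_range.mem_nhds hx] with y hy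
    by_cases h2 : coulomb c q y = 0
    · rw [h0 y h2, h2, smul_zero]
    · rw [hF y hy h2]
  rw [tendsto_nhds_unique ha (tendsto_const_nhds.congr' (by
    filter_upwards [self_mem_nhdsWithin] with s hs using (hcon s hs).symm))]
  exact tendsto_nhds_unique (tendsto_const_nhds.congr' (by
    filter_upwards [eventually_gt_atTop 0] with s hs using (hcon s hs).symm)) hb

namespace RootField
/-- Proportional charges: here `E = φ(B²) B` with `φ = λ / (p (1 + κ² B²))`, and similarly for
`H`. -/
lemma eq_of_curl_eq_zero (h : RootField S S' κ c q g Ω p) (hc : Injective c) (hκ : 0 ≤ κ) (hlam : lam ≠ 0) (hqg : q = lam • g) (hi : g i ≠ 0)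
    (hg : update g i 0 ≠ 0)
    (hcurl : (∀ x ∈ Ω, curl (fieldE κ c q g p) x = 0) ∨ ∀ x ∈ Ω, curl (fieldH κ c q g p) x = 0) :
    κ = 0 ∧ |lam| = 1 := by
  have hS := h.response
  have hD : ∀ x, coulomb c q x = lam • coulomb c g x := fun x => by rw [hqg, coulomb_smul]
  obtain rfl : Ω = (range c)ᶜ := h.subset.antisymm fun x hx => h.mem x hx (by
    rw [hD, smul_ne_zero_iff]
    exact (em' _).imp_left fun h0 => ⟨hlam, h0⟩)
  have hL : ∀ x, reducedSq κ (coulomb c q x) (coulomb c g x) =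
      lam ^ 2 * ‖coulomb c g x‖ ^ 2 / (1 + κ ^ 2 * ‖coulomb c g x‖ ^ 2) := fun x => by
    rw [hD, reducedSq, cross_smul_right, cross_self, norm_smul, mul_pow, norm_eq_abs, sq_abs]
    simp
  choose! X hX hXs using fun (s : ℝ) (hs : 0 < s) => exists_norm_coulomb_eq (q := g) hc hi hs
  set P : ℝ → ℝ := fun s => p (X s)
  have hroot : ∀ s, 0 < s → IsRoot S (lam ^ 2 * s / (1 + κ ^ 2 * s)) s (P s) := fun s hs => by
    have h1 := h.root (X s) (hX s hs)
    rwa [hL, hXs s hs] at h1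
  have hPp : ∀ x ∈ (range c)ᶜ, coulomb c g x ≠ 0 → p x = P (‖coulomb c g x‖ ^ 2) := fun x hx h0 => by
    have h1 := h.root x hx
    rw [hL] at h1
    exact h1.unique hS (by positivity) (hroot _ (by positivity))
  have hPc : ContDiffOn ℝ 1 P (Ioi 0) := fun s (hs : 0 < s) => by
    have h1 : ContDiffAt ℝ 1 (fun s : ℝ => lam ^ 2 * s / (1 + κ ^ 2 * s)) s :=
      (contDiffAt_const.mul contDiffAt_id).div (contDiffAt_const.add
        (contDiffAt_const.mul contDiffAt_id)) (by positivity)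
    refine (contDiffAt_root hS h1 contDiffAt_id ?_ ?_).contDiffWithinAt
    · filter_upwards [Ioi_mem_nhds hs] with t (ht : 0 < t)
      positivity
    · filter_upwards [Ioi_mem_nhds hs] with t ht using hroot t ht
  have hP0 : ∀ s ∈ Ioi (0 : ℝ), P s ≠ 0 := fun s hs => (hroot s hs).1.ne'
  have hden0 : ∀ s ∈ Ioi (0 : ℝ), 1 + κ ^ 2 * s ≠ 0 := fun s (hs : 0 < s) => by positivity
  have hden : ContDiffOn ℝ 1 (fun s : ℝ => 1 + κ ^ 2 * s) (Ioi 0) := by fun_prop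
  have hinv := (hPc.mul hden).inv fun s hs => mul_ne_zero (hP0 s hs) (hden0 s hs)
  have hden1 : (fun s => 1 + κ ^ 2 * s) ⇝ 1 := by simpa using (tendsto_self_nhdsGT.const_mul (κ ^ 2)).const_add 1
  have hlim0 : P ⇝ 1 := by
    refine tendsto_root_one hS ?_ ?_ tendsto_self_nhdsGT (by
      filter_upwards [self_mem_nhdsWithin] with s hs using hroot s hs)
    · have h1 := (tendsto_self_nhdsGT.const_mul (lam ^ 2)).div hden1 one_ne_zero
      rw [mul_zero, zero_div] at h1
      exact h1
    · filter_upwards [eventually_pos] with s hs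
      positivity
  have h01 : (fun s => (P s * (1 + κ ^ 2 * s))⁻¹) ⇝ 1 := by
    simpa using (hlim0.mul hden1).inv₀ (by norm_num)
  have hrootT : ∀ᶠ s in atTop, IsRoot S (lam ^ 2 * s / (1 + κ ^ 2 * s)) s (P s) :=
    (eventually_gt_atTop 0).mono hroot
  -- the limits for large fields
  obtain ⟨a, b, d, ha, hb, hd, habd⟩ : ∃ a b d, Tendsto P atTop (𝓝 a) ∧
      Tendsto (fun s => (P s * (1 + κ ^ 2 * s))⁻¹) atTop (𝓝 b) ∧
      Tendsto (fun s => (1 + κ ^ 2 * s)⁻¹) atTop (𝓝 d) ∧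
      (b = 1 ∨ a - lam ^ 2 * (1 - d) * b = 1 → κ = 0 ∧ |lam| = 1) := by
    rcases hκ.eq_or_lt with rfl | hκ
    · have h1 : Tendsto P atTop (𝓝 |lam|) :=
        tendsto_root_ratio hS (abs_pos.2 hlam) (tendsto_const_nhds.congr' (by
          filter_upwards [eventually_gt_atTop 0] with s hs
          simp [hs.ne'])) tendsto_id hrootT
      refine ⟨|lam|, |lam|⁻¹, 1, h1, ?_, by simp, fun h2 => ⟨rfl, ?_⟩⟩
      · simpa using h1.inv₀ (abs_ne_zero.2 hlam)
      · simpa using h2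
    · have h1 : Tendsto (fun s => (1 + κ ^ 2 * s)⁻¹) atTop (𝓝 0) := tendsto_inv_atTop_zero.comp
        (tendsto_atTop_add_const_left _ _ (tendsto_id.const_mul_atTop (by positivity)))
      have h2 : Tendsto (fun s : ℝ => lam ^ 2 * s / (1 + κ ^ 2 * s)) atTop
          (𝓝 (lam ^ 2 * (κ ^ 2)⁻¹)) := by
        refine (((h1.const_sub 1).mul_const ((κ ^ 2)⁻¹)).const_mul (lam ^ 2)).congr' ?_ |>.trans
          (by simp)
        filter_upwards [eventually_gt_atTop 0] with s hs
        have := hden0 s hs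
        field_simp
        ring
      obtain ⟨h3, h4, -⟩ := tendsto_root hS (k := (κ ^ 2)⁻¹) h2 tendsto_id hrootT
      have h5 : Tendsto P atTop (𝓝 0) := h3.mono_right nhdsWithin_le_nhds
      refine ⟨0, 0, 0, h5, ?_, h1, fun h6 => by norm_num at h6⟩
      have h6 := (h5.mul (h4.inv₀ (by positivity))).const_mul ((κ ^ 2)⁻¹)
      rw [zero_mul, mul_zero] at h6
      refine h6.congr' ?_
      filter_upwards [eventually_gt_atTop 0] with s hs
      have := hP0 s hs
      have := hden0 s hs
      rw [show id s + (κ ^ 2)⁻¹ = (κ ^ 2)⁻¹ * (1 + κ ^ 2 * s) by simp only [id]; field_simp; ring]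
      field_simp
  refine habd (hcurl.imp (fun hcurl => ?_) fun hcurl => ?_)
  · have h1 := eq_of_curl_radial_eq_zero hc hi hg (φ := fun s => (P s * (1 + κ ^ 2 * s))⁻¹ * lam)
      (hinv.mul contDiffOn_const) (fun x hx => by rw [fieldE, hD, hx]; simp [dyonicE])
      (fun x hx h0 => ?_) hcurl (h01.mul_const lam) (hb.mul_const lam)
    · exact (mul_right_cancel₀ hlam h1).symm
    have h5 : 0 < ‖coulomb c g x‖ ^ 2 := by positivity
    have h6 := hP0 _ h5
    rw [fieldE, hPp x hx h0, hD, dyonicE, inner_smul_right, real_inner_self_eq_norm_sq]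
    match_scalars
    field_simp
    ring
  · have h1 := eq_of_curl_radial_eq_zero hc hi hg
      (φ := fun s => P s - lam ^ 2 * (1 - (1 + κ ^ 2 * s)⁻¹) * (P s * (1 + κ ^ 2 * s))⁻¹)
      (hPc.sub ((contDiffOn_const.mul (contDiffOn_const.sub (hden.inv hden0))).mul hinv))
      (fun x hx => by rw [fieldH, hD, hx]; simp [dyonicH]) (fun x hx h0 => ?_) hcurl
      (hlim0.sub ((((hden1.inv₀ one_ne_zero).const_sub 1).const_mul (lam ^ 2)).mul h01))
      (ha.sub (((hd.const_sub 1).const_mul (lam ^ 2)).mul hb))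
    · rw [← h1]
      simp
    have h5 : 0 < ‖coulomb c g x‖ ^ 2 := by positivity
    have h6 := hP0 _ h5
    rw [fieldH, hPp x hx h0, hD, dyonicH, inner_smul_right, real_inner_self_eq_norm_sq]
    match_scalars
    field_simp
    ring

/-- If the curl of `E` or of `H` vanishes, then the charges are proportional, since otherwise the
deviation `δ = D - λ B` from the ratio `λ` at some center is not zero; proportional charges have to
be equal up to a common sign. -/
lemma self_dual_of_curl_eq_zero (h : RootField S S' κ c q g Ω p) (hc : Injective c)
    (hκ : 0 ≤ κ) (hn : 2 ≤ n) (hq : ∀ i, q i ≠ 0) (hg : ∀ i, g i ≠ 0)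
    (hcurl : (∀ x ∈ Ω, curl (fieldE κ c q g p) x = 0) ∨ ∀ x ∈ Ω, curl (fieldH κ c q g p) x = 0) :
    κ = 0 ∧ (q = g ∨ q = -g) := by
  set i : Fin n := ⟨0, by omega⟩
  have hgi : update g i 0 ≠ 0 := fun h0 => by
    have h1 := congrFun h0 ⟨1, by omega⟩
    rw [update_of_ne (by simp [i])] at h1
    exact hg _ h1
  set lam := q i / g i with hlamdef
  have hlam : lam ≠ 0 := div_ne_zero (hq i) (hg i)
  set w := q - lam • g with hw
  have hqw : q = lam • g + w := by rw [hw]; abel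
  have hwi : w i = 0 := by
    have := hg i
    simp only [hw, Pi.sub_apply, Pi.smul_apply, smul_eq_mul, hlamdef]
    field_simp
    ring
  by_cases hw0 : w = 0
  · rw [hw0, add_zero] at hqw
    obtain ⟨h1, h2⟩ := h.eq_of_curl_eq_zero hc hκ hlam hqw (hg i) hgi hcurl
    refine ⟨h1, ?_⟩
    rcases eq_or_eq_neg_of_abs_eq h2 with h3 | h3
    · left; rw [hqw, h3, one_smul]
    · right; rw [hqw, h3, neg_one_smul]
  · exfalso
    rcases hκ.eq_or_lt with rfl | hκ
    · have hmem := h.eventually_mem hc (hq i)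
      have hD : ∀ x, coulomb c q x = lam • coulomb c g x + coulomb c w x := fun x => by
        conv_lhs => rw [hqw]
        rw [coulomb_add, coulomb_smul]
      refine false_of_cross_gradDiff (p := p) h.response hc hlam (hg i) hgi hwi hw0 ?_ ?_
      · filter_upwards [hmem] with x hx
        rw [← hD, ← reducedSq_zero _ (coulomb c g x)]
        exact h.root x hx
      · refine hcurl.imp (fun h0 => ?_) fun h0 => ?_
        · filter_upwards [hmem] with x hx
          rw [← hD]
          exact (h.cross_gradDiff_eq_zero hqw hx).1 (h0 x hx)
        · filter_upwards [hmem] with x hx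
          exact (h.cross_gradDiff_eq_zero hqw hx).2 (h0 x hx)
    · exact (h.curlFreeNear hc hκ hlam (hq i) (hg i) hqw hcurl).false hgi hwi hw0

/-- The self-dual case. -/
lemma curl_eq_zero_of_self_dual (h : RootField S S' 0 c q g Ω p) (hqg : q = g ∨ q = -g)
    (hx : x ∈ Ω) :
    curl (fieldE 0 c q g p) x = 0 ∧ curl (fieldH 0 c q g p) x = 0 := by
  have hN : ∀ y, ‖coulomb c q y‖ ^ 2 = ‖coulomb c g y‖ ^ 2 := fun y => by
    rcases hqg with rfl | rfl
    · rfl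
    · rw [coulomb_neg, norm_neg]
  have hp : ∀ y ∈ Ω, p y = 1 := fun y hy => by
    have h1 := h.root y hy
    rw [reducedSq_zero, hN] at h1
    exact h1.unique h.response (by positivity) ⟨one_pos, by rw [h.response.one]; ring⟩
  constructor
  · rw [← curl_coulomb (q := q) (h.subset hx)]
    refine curl_congr ?_
    filter_upwards [h.isOpen.mem_nhds hx] with y hy
    simp [dyonicE, hp y hy]
  · rw [← curl_coulomb (q := g) (h.subset hx)]
    refine curl_congr ?_
    filter_upwards [h.isOpen.mem_nhds hx] with y hy
    simp [dyonicH, hp y hy]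

lemma nonconservative_iff (h : RootField S S' κ c q g Ω p) (hc : Injective c)
    (hκ : 0 ≤ κ) (hn : 2 ≤ n) (hq : ∀ i, q i ≠ 0) (hg : ∀ i, g i ≠ 0) :
    (Nonconservative (fieldE κ c q g p) Ω ↔ ¬ (κ = 0 ∧ (q = g ∨ q = -g))) ∧
    (Nonconservative (fieldH κ c q g p) Ω ↔ ¬ (κ = 0 ∧ (q = g ∨ q = -g))) := by
  constructor
  · refine ⟨?_, fun h1 => ⟨h.contDiffOn_E, ?_⟩⟩
    · rintro ⟨_, x, hx, hx'⟩ ⟨rfl, h2⟩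
      exact hx' (h.curl_eq_zero_of_self_dual h2 hx).1
    · by_contra! h2
      exact h1 (h.self_dual_of_curl_eq_zero hc hκ hn hq hg (Or.inl h2))
  · refine ⟨?_, fun h1 => ⟨h.contDiffOn_H, ?_⟩⟩
    · rintro ⟨_, x, hx, hx'⟩ ⟨rfl, h2⟩
      exact hx' (h.curl_eq_zero_of_self_dual h2 hx).2
    · by_contra! h2
      exact h1 (h.self_dual_of_curl_eq_zero hc hκ hn hq hg (Or.inr h2))

end RootField

end

/-! ### Integration by parts and radial cutoffs -/

lemma inner_gradient (φ : V3 → ℝ) (x v : V3) : ⟪v, gradient φ x⟫ = fderiv ℝ φ x v := by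
  rw [real_inner_comm, gradient, InnerProductSpace.toDual_symm_apply]

lemma gradient_eq_of_hasFDerivAt {g : V3} (h : HasFDerivAt φ (innerSL ℝ g) x) :
    gradient φ x = g := by
  refine ext_inner_left ℝ fun v => ?_
  rw [inner_gradient, h.fderiv, innerSL_apply_apply, real_inner_comm]

lemma continuous_gradient (h : ContDiff ℝ ∞ φ) : Continuous (gradient φ) :=
  (InnerProductSpace.toDual ℝ V3).symm.continuous.comp (h.continuous_fderiv (by simp))

lemma gradient_eq_zero_of_notMem (h : x ∉ tsupport φ) : gradient φ x = 0 := by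
  rw [gradient, fderiv_of_notMem_tsupport ℝ h, map_zero]

/-- A field which is continuous on an open set, times a continuous function with compact support in
this set. -/
lemma integrable_smul_of_continuousOn (hU : IsOpen U) (hF : ContinuousOn F U) (hφ : Continuous φ)
    (hc : HasCompactSupport φ) (hs : tsupport φ ⊆ U) : Integrable (fun x => φ x • F x) := by
  refine (continuous_of_tsupport fun x hx => ?_).integrable_of_hasCompactSupport hc.smul_right
  have hx' := hs (closure_mono (support_smul_subset_left φ F) hx)
  exact hφ.continuousAt.smul (hF.continuousAt (hU.mem_nhds hx'))

lemma integrable_inner (hF : LocallyIntegrableOn F U) (hG : Continuous G)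
    (hc : HasCompactSupport G) (hs : tsupport G ⊆ U) : Integrable fun x => ⟪F x, G x⟫ := by
  have h1 := hF.integrableOn_compact_subset hs hc
  have h2 : IntegrableOn (fun x => ⟪F x, G x⟫) (tsupport G) := by
    obtain ⟨C, hC⟩ := hc.exists_bound_of_continuous hG
    refine Integrable.mono' (h1.norm.const_mul C)
      (h1.aestronglyMeasurable.inner hG.aestronglyMeasurable.restrict) ?_
    filter_upwards with x
    calc ‖⟪F x, G x⟫‖ ≤ ‖F x‖ * ‖G x‖ := norm_inner_le_norm _ _
      _ ≤ C * ‖F x‖ := by rw [mul_comm]; gcongr; exact hC x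
  refine (integrableOn_iff_integrable_of_support_subset fun x hx => ?_).1 h2
  by_contra h3
  refine hx ?_
  change ⟪F x, G x⟫ = 0
  rw [image_eq_zero_of_notMem_tsupport h3, inner_zero_right]

lemma hasCompactSupport_gradient (hc : HasCompactSupport φ) : HasCompactSupport (gradient φ) :=
  hc.mono' fun x hx => by
    by_contra h
    exact hx (gradient_eq_zero_of_notMem h)

/-- The divergence theorem for a field which is multiplied with a cutoff. -/
lemma integral_cutoff_mul_divergence (hU : IsOpen U) (hF : ContDiffOn ℝ 1 F U)
    (hφ : ContDiff ℝ ∞ φ) (hc : HasCompactSupport φ) (hs : tsupport φ ⊆ U) :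
    ∫ x, φ x * divergence F x = -∫ x, ⟪F x, gradient φ x⟫ := by
  have h1 := fun i : Fin 3 => integrable_smul_of_continuousOn hU
    ((hF.continuousOn_fderiv_of_isOpen hU le_rfl).clm_apply
      (continuousOn_const (c := single i (1 : ℝ)))) hφ.continuous hc hs
  have h2 := fun i : Fin 3 => integrable_smul_of_continuousOn hU hF.continuousOn
    ((hφ.continuous_fderiv (by simp)).clm_apply (continuous_const (y := single i (1 : ℝ))))
    (hc.fderiv_apply ℝ _) ((tsupport_fderiv_apply_subset ℝ _).trans hs)
  have h3 : ∀ i : Fin 3, ∫ x, φ x * fderiv ℝ F x (single i 1) i =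
      -∫ x, fderiv ℝ φ x (single i 1) * F x i := fun i => by
    have h := congrArg (EuclideanSpace.proj (𝕜 := ℝ) i)
      (integral_smul_fderiv_eq_neg_fderiv_smul_of_integrable (h2 i) (h1 i)
        (integrable_smul_of_continuousOn hU hF.continuousOn hφ.continuous hc hs)
        (fun x _ => hφ.differentiable (by simp) x) fun x hx =>
          (hF.contDiffAt (hU.mem_nhds (hs hx))).differentiableAt one_ne_zero)
    rwa [map_neg, ← ContinuousLinearMap.integral_comp_comm _ (h1 i),
      ← ContinuousLinearMap.integral_comp_comm _ (h2 i)] at h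
  have h4 : ∀ x, ⟪F x, gradient φ x⟫ = ∑ i, fderiv ℝ φ x (single i 1) * F x i := fun x => by
    have h : F x = ∑ i, F x i • single i 1 := by ext j; fin_cases j <;> simp [Fin.sum_univ_three]
    rw [inner_gradient]
    conv_lhs => rw [h]
    simp [mul_comm]
  simp only [h4, divergence, Finset.mul_sum]
  refine (integral_finsetSum _ fun i _ => (EuclideanSpace.proj (𝕜 := ℝ) i).integrable_comp
    (h1 i)).trans ((Finset.sum_congr rfl fun i _ => h3 i).trans ?_)
  rw [Finset.sum_neg_distrib]
  exact congrArg Neg.neg (integral_finsetSum _ fun i _ =>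
    (EuclideanSpace.proj (𝕜 := ℝ) i).integrable_comp (h2 i)).symm

/-- A smooth step from `0` on `(-∞, 1]` to `1` on `[2, ∞)`. -/
structure IsStep (η : ℝ → ℝ) : Prop where
  contDiff : ContDiff ℝ ∞ η
  zero : ∀ t ≤ 1, η t = 0
  one : ∀ t, 2 ≤ t → η t = 1

/-- The total variation of a step. -/
def stepMass (η : ℝ → ℝ) : ℝ := ∫ y in Ioi (0 : ℝ), |deriv η y|

/-- A cutoff which vanishes in the ball of radius `r` about `a`, and is `1` off the ball of radius
`2 r`. -/
def radialStep (η : ℝ → ℝ) (a : V3) (r : ℝ) (x : V3) : ℝ := η (‖x - a‖ / r)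

namespace IsStep
lemma deriv_eq_zero (h : IsStep η) (ht : t ≤ 1 ∨ 2 ≤ t) : deriv η t = 0 := by
  have hd := ((h.contDiff.differentiable (by simp)) t).hasDerivAt
  rcases ht with ht | ht
  · refine (uniqueDiffOn_Iic 1 t ht).eq_deriv _ hd.hasDerivWithinAt ?_
    exact (hasDerivWithinAt_const t _ 0).congr (fun s hs => h.zero s hs) (h.zero t ht)
  · refine (uniqueDiffOn_Ici 2 t ht).eq_deriv _ hd.hasDerivWithinAt ?_
    exact (hasDerivWithinAt_const t _ 1).congr (fun s hs => h.one s hs) (h.one t ht)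

lemma continuous_deriv (h : IsStep η) : Continuous (deriv η) := h.contDiff.continuous_deriv (by simp)

lemma hasCompactSupport_deriv (h : IsStep η) : HasCompactSupport (deriv η) := by
  refine HasCompactSupport.intro (isCompact_Icc (a := 1) (b := 2)) fun t ht => ?_
  refine h.deriv_eq_zero ?_
  by_contra! h1
  exact ht ⟨h1.1.le, h1.2.le⟩

lemma stepMass_nonneg (η : ℝ → ℝ) : 0 ≤ stepMass η := integral_nonneg fun _ => abs_nonneg _

lemma integral_deriv (h : IsStep η) : ∫ y in Ioi (0 : ℝ), deriv η y = 1 := by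
  have h1 : Tendsto η atTop (𝓝 1) := tendsto_const_nhds.congr' (by
    filter_upwards [eventually_ge_atTop 2] with t ht using (h.one t ht).symm)
  rw [integral_Ioi_of_hasDerivAt_of_tendsto'
    (fun x _ => ((h.contDiff.differentiable (by simp)) x).hasDerivAt)
    (h.continuous_deriv.integrable_of_hasCompactSupport h.hasCompactSupport_deriv).integrableOn h1,
    h.zero 0 (by norm_num), sub_zero]

lemma stepMass_eq_one (h : IsStep η) (hm : Monotone η) : stepMass η = 1 := by
  rw [stepMass, ← h.integral_deriv]
  exact integral_congr_ae (.of_forall fun y => abs_of_nonneg hm.deriv_nonneg)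

lemma radialStep_eq_zero (h : IsStep η) (hr : 0 < r) (hx : ‖x - a‖ ≤ r) : radialStep η a r x = 0 :=
  h.zero _ (by rwa [div_le_one hr])

lemma radialStep_eq_one (h : IsStep η) (hr : 0 < r) (hx : 2 * r ≤ ‖x - a‖) :
    radialStep η a r x = 1 :=
  h.one _ (by rwa [le_div_iff₀ hr])

lemma hasFDerivAt_radialStep (h : IsStep η) (hr : 0 < r) : HasFDerivAt (radialStep η a r)
      (innerSL ℝ ((deriv η (‖x - a‖ / r) / (r * ‖x - a‖)) • (x - a))) x := by
  by_cases hx : x = a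
  · subst hx
    rw [sub_self, smul_zero, map_zero]
    refine (hasFDerivAt_const 0 x).congr_of_eventuallyEq ?_
    filter_upwards [Metric.ball_mem_nhds x hr] with y hy
    exact h.radialStep_eq_zero hr (by rw [← dist_eq_norm]; exact (Metric.mem_ball.1 hy).le)
  · have h1 := (hasFDerivAt_norm (sub_ne_zero.2 hx)).comp x ((hasFDerivAt_id x).sub_const a)
    have h2 := HasDerivAt.comp_hasFDerivAt x (f := fun y => ‖y - a‖ * r⁻¹)
      (((h.contDiff.differentiable (by simp)) (‖x - a‖ * r⁻¹)).hasDerivAt) (h1.mul_const r⁻¹)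
    rw [div_eq_mul_inv ‖x - a‖ r]
    refine h2.congr_fderiv ?_
    ext v
    simp
    ring

lemma gradient_radialStep (h : IsStep η) (hr : 0 < r) :
    gradient (radialStep η a r) x = (deriv η (‖x - a‖ / r) / (r * ‖x - a‖)) • (x - a) :=
  gradient_eq_of_hasFDerivAt (h.hasFDerivAt_radialStep hr)

lemma contDiff_radialStep (h : IsStep η) (hr : 0 < r) : ContDiff ℝ ∞ (radialStep η a r) := by
  refine contDiff_iff_contDiffAt.2 fun x => ?_
  by_cases hx : x = a
  · subst hx
    refine (contDiffAt_const (c := 0)).congr_of_eventuallyEq ?_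
    filter_upwards [Metric.ball_mem_nhds x hr] with y hy
    exact h.radialStep_eq_zero hr (by rw [← dist_eq_norm]; exact (Metric.mem_ball.1 hy).le)
  · exact h.contDiff.contDiffAt.comp x
      (((contDiffAt_id.sub contDiffAt_const).norm ℝ (sub_ne_zero.2 hx)).div_const r)

lemma gradient_radialStep_eq_zero (h : IsStep η) (hr : 0 < r)
    (hx : ‖x - a‖ ≤ r ∨ 2 * r ≤ ‖x - a‖) : gradient (radialStep η a r) x = 0 := by
  rw [h.gradient_radialStep hr, h.deriv_eq_zero, zero_div, zero_smul]
  rwa [div_le_one hr, le_div_iff₀ hr]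

lemma tsupport_gradient_radialStep (h : IsStep η) (hr : 0 < r) :
    tsupport (gradient (radialStep η a r)) ⊆ {x | r ≤ ‖x - a‖ ∧ ‖x - a‖ ≤ 2 * r} := by
  refine closure_minimal (fun x hx => ?_) ?_
  · by_contra h1
    rw [mem_ofPred_eq, not_and_or, not_le, not_le] at h1
    exact hx (h.gradient_radialStep_eq_zero hr (h1.imp le_of_lt le_of_lt))
  · have h1 : Continuous fun x => ‖x - a‖ := (continuous_id.sub continuous_const).norm
    exact (isClosed_le continuous_const h1).inter (isClosed_le h1 continuous_const)

lemma hasCompactSupport_gradient_radialStep (h : IsStep η) (hr : 0 < r) :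
    HasCompactSupport (gradient (radialStep η a r)) := by
  refine (isCompact_closedBall a (2 * r)).of_isClosed_subset (isClosed_tsupport _)
    ((h.tsupport_gradient_radialStep hr).trans fun x hx => ?_)
  rw [Metric.mem_closedBall, dist_eq_norm]
  exact hx.2

end IsStep

/-- The integral of a function of the distance, in the form which is used for shells. -/
lemma integral_shell (f : ℝ → ℝ) (a : V3) (hr : 0 < r) :
    ∫ x, f (‖x - a‖ / r) / (r * ‖x - a‖ ^ 2) = 4 * π * ∫ y in Ioi (0 : ℝ), f y := by
  rw [integral_sub_right_eq_self (fun x => f (‖x‖ / r) / (r * ‖x‖ ^ 2)) a,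
    integral_fun_norm_addHaar volume fun y => f (y / r) / (r * y ^ 2)]
  have h1 : ∫ y in Ioi 0, y ^ (Module.finrank ℝ V3 - 1) • (f (y / r) / (r * y ^ 2)) =
      ∫ y in Ioi 0, r⁻¹ * f (r⁻¹ * y) := by
    refine setIntegral_congr_fun measurableSet_Ioi fun y (hy : 0 < y) => ?_
    simp only [finrank_euclideanSpace_fin, smul_eq_mul]
    rw [inv_mul_eq_div r y]
    field_simp
  rw [h1, integral_const_mul, integral_comp_mul_left_Ioi f 0 (inv_pos.2 hr), mul_zero, inv_inv,
    smul_eq_mul r, inv_mul_cancel_left₀ hr.ne', finrank_euclideanSpace_fin, measureReal_def,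
    EuclideanSpace.volume_ball_fin_three]
  simp [ENNReal.toReal_ofReal (show 0 ≤ π * 4 / 3 by positivity)]
  ring

namespace IsStep
lemma integral_shell_abs (a : V3) (hr : 0 < r) :
    ∫ x, |deriv η (‖x - a‖ / r)| / (r * ‖x - a‖ ^ 2) = 4 * π * stepMass η :=
  integral_shell (fun t => |deriv η t|) a hr

lemma integrable_shell_abs (h : IsStep η) (a : V3) (hr : 0 < r) :
    Integrable fun x : V3 => |deriv η (‖x - a‖ / r)| / (r * ‖x - a‖ ^ 2) := by
  have hc : HasCompactSupport fun x => |deriv η (‖x - a‖ / r)| / (r * ‖x - a‖ ^ 2) := by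
    refine HasCompactSupport.intro (isCompact_closedBall a (2 * r)) fun x hx => ?_
    rw [Metric.mem_closedBall, dist_eq_norm, not_le] at hx
    rw [h.deriv_eq_zero (Or.inr (by rw [le_div_iff₀ hr]; exact hx.le)), abs_zero, zero_div]
  refine Continuous.integrable_of_hasCompactSupport (continuous_iff_continuousAt.2 fun x => ?_) hc
  by_cases hx : x = a
  · subst hx
    refine (continuousAt_const (y := 0)).congr ?_
    filter_upwards [Metric.ball_mem_nhds x hr] with y hy
    rw [h.deriv_eq_zero (Or.inl ?_), abs_zero, zero_div]
    rw [div_le_one hr, ← dist_eq_norm]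
    exact (Metric.mem_ball.1 hy).le
  · have h1 : ContinuousAt (fun x => ‖x - a‖) x := by fun_prop
    have h2 : r * ‖x - a‖ ^ 2 ≠ 0 := by
      have := norm_sub_pos_iff.2 hx
      positivity
    exact ((h.continuous_deriv.continuousAt.comp (h1.div_const r)).abs).div
      (continuousAt_const.mul (h1.pow 2)) h2

/-- A field with small radial component contributes little to the flux through a shell. -/
lemma abs_integral_shell_le (h : IsStep η) (hr : 0 < r)
    (hG : ∀ x, r ≤ ‖x - a‖ → ‖x - a‖ ≤ 2 * r → |⟪G x, x - a⟫| ≤ ε * ‖x - a‖⁻¹) :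
    |∫ x, ⟪G x, gradient (radialStep η a r) x⟫| ≤ ε * (4 * π * stepMass η) := by
  rw [← integral_shell_abs a hr, ← integral_const_mul, ← norm_eq_abs]
  refine norm_integral_le_of_norm_le ((h.integrable_shell_abs a hr).const_mul ε)
    (.of_forall fun x => ?_)
  by_cases hx : ‖x - a‖ ≤ r ∨ 2 * r ≤ ‖x - a‖
  · rw [h.gradient_radialStep_eq_zero hr hx, h.deriv_eq_zero (by rwa [div_le_one hr, le_div_iff₀ hr])]
    simp
  · push Not at hx
    rw [h.gradient_radialStep hr, inner_smul_right, norm_mul, norm_eq_abs, norm_eq_abs,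
      abs_div, abs_of_pos (show 0 < r * ‖x - a‖ by nlinarith)]
    have h1 := hG x hx.1.le hx.2.le
    calc |deriv η (‖x - a‖ / r)| / (r * ‖x - a‖) * |⟪G x, x - a⟫|
        ≤ |deriv η (‖x - a‖ / r)| / (r * ‖x - a‖) * (ε * ‖x - a‖⁻¹) := by gcongr
      _ = ε * (|deriv η (‖x - a‖ / r)| / (r * ‖x - a‖ ^ 2)) := by field_simp

end IsStep

section

/-! ### Integrability of singular functions on space, and Gauss' law -/

lemma integrableOn_ball_norm_sub : IntegrableOn (fun x => f ‖x - a‖) (Metric.ball a r) ↔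
      IntegrableOn (fun y => y ^ 2 * f y) (Ioo 0 r) := by
  have h1 := integrableOn_fun_norm_addHaar (E := V3) volume (f := f) (r := r)
  rw [finrank_euclideanSpace_fin] at h1
  refine Iff.trans ?_ h1
  have h2 := (measurePreserving_sub_right (volume : Measure V3) a).integrableOn_comp_preimage
    (Homeomorph.subRight a).measurableEmbedding (f := fun x => f ‖x‖) (s := Metric.ball 0 r)
  rw [← h2]
  have h3 : (fun x => x - a) ⁻¹' Metric.ball (0 : V3) r = Metric.ball a r := by
    ext x
    simp [dist_eq_norm]
  rw [h3]
  rfl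

lemma locallyIntegrable_rpow (a : V3) (hs : s < 3) :
    LocallyIntegrable fun x : V3 => ‖x - a‖ ^ (-s) := by
  intro x
  refine ⟨Metric.ball a (‖x - a‖ + 1), Metric.isOpen_ball.mem_nhds ?_,
    (integrableOn_ball_norm_sub (f := fun y => y ^ (-s))).2 ?_⟩
  · rw [Metric.mem_ball, dist_eq_norm]
    linarith
  · have h1 : IntegrableOn (fun y : ℝ => y ^ (2 - s)) (Ioo 0 (‖x - a‖ + 1)) :=
      (intervalIntegral.integrableOn_Ioo_rpow_iff (by positivity)).2 (by linarith)
    refine h1.congr_fun (fun y hy => ?_) measurableSet_Ioo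
    simp only
    rw [← rpow_two, ← Real.rpow_add hy.1, sub_eq_add_neg]

lemma not_integrableAtFilter_inv_pow_four (a : V3) :
    ¬ IntegrableAtFilter (fun x : V3 => (‖x - a‖ ^ 4)⁻¹) (𝓝[≠] a) := by
  rintro ⟨s, hs, h⟩
  obtain ⟨r, hr, hrs⟩ := Metric.mem_nhdsWithin_iff.1 hs
  have h1 : IntegrableOn (fun x : V3 => (‖x - a‖ ^ 4)⁻¹) (Metric.ball a r) :=
    (h.mono_set hrs).congr_set_ae (sdiff_null_ae_eq_self (measure_singleton a)).symm
  have h2 := (integrableOn_ball_norm_sub (f := fun y => (y ^ 4)⁻¹)).1 h1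
  have h3 : IntegrableOn (fun y : ℝ => y ^ (-2 : ℝ)) (Ioo 0 r) := by
    refine h2.congr_fun (fun y hy => ?_) measurableSet_Ioo
    have := hy.1.ne'
    rw [rpow_neg hy.1.le, rpow_two]
    field_simp
  rw [intervalIntegral.integrableOn_Ioo_rpow_iff hr] at h3
  norm_num at h3

section
variable {W : Type*} [NormedAddCommGroup W] {F : V3 → W}

instance isMeasurablyGenerated_cobounded : (cobounded V3).IsMeasurablyGenerated := by
  refine ⟨fun s hs => ?_⟩
  obtain ⟨r, -, hr⟩ := (Metric.hasBasis_cobounded_compl_closedBall (0 : V3)).mem_iff.1 hs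
  exact ⟨_, (Metric.hasBasis_cobounded_compl_closedBall (0 : V3)).mem_of_mem trivial,
    measurableSet_closedBall.compl, hr⟩

instance isMeasurablyGenerated_punctured (a : V3) : (𝓝[≠] a).IsMeasurablyGenerated :=
  (measurableSet_singleton a).compl.nhdsWithin_isMeasurablyGenerated a

lemma integrableAtFilter_of_punctured (h : IntegrableAtFilter F (𝓝[≠] a)) :
    IntegrableAtFilter F (𝓝 a) := by
  obtain ⟨s, hs, h⟩ := h
  refine ⟨insert a s, insert_mem_nhds_iff.2 hs, ?_⟩
  rw [insert_eq, integrableOn_union]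
  exact ⟨integrableOn_singleton (hx := by simp), h⟩

/-- Functions which are bounded near the points off the centers, and singular at most like a power
of the distance with exponent greater than `-3` at the centers, are locally integrable. -/
lemma locallyIntegrable_of_isBigO (hm : AEStronglyMeasurable F)
    (hb : ∀ x ∈ (range c)ᶜ, F =O[𝓝 x] fun _ => (1 : ℝ)) (h3 : s < 3) (hs : ∀ i, F =O[𝓝[≠] (c i)] fun x => ‖x - c i‖ ^ (-s)) : LocallyIntegrable F := by
  intro x
  by_cases hx : x ∈ range c
  · obtain ⟨i, rfl⟩ := hx
    exact integrableAtFilter_of_punctured ((hs i).integrableAtFilter (hm.stronglyMeasurableAtFilter)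
      ((locallyIntegrable_rpow (c i) h3 (c i)).filter_mono nhdsWithin_le_nhds))
  · exact (hb x hx).integrableAtFilter hm.stronglyMeasurableAtFilter
      (locallyIntegrable_const (1 : ℝ) x)

lemma locallyIntegrableOn_of_isBigO (hm : AEStronglyMeasurable F)
    (hb : ∀ x ∈ (range c)ᶜ, F =O[𝓝 x] fun _ => (1 : ℝ)) : LocallyIntegrableOn F (range c)ᶜ :=
  fun x hx => ((hb x hx).integrableAtFilter hm.stronglyMeasurableAtFilter
    (locallyIntegrable_const (1 : ℝ) x)).filter_mono nhdsWithin_le_nhds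

lemma integrableAtFilter_inv_pow_four :
    IntegrableAtFilter (fun x : V3 => (‖x‖ ^ 4)⁻¹) (cobounded V3) := by
  have h1 : Integrable fun x : V3 => (1 + ‖x‖) ^ (-(4 : ℝ)) :=
    integrable_one_add_norm (by rw [finrank_euclideanSpace_fin]; norm_num)
  refine IsBigO.integrableAtFilter (g := fun x : V3 => (1 + ‖x‖) ^ (-(4 : ℝ))) ?_ ?_
    ⟨univ, univ_mem, h1.integrableOn⟩
  · refine IsBigO.of_bound 16 ?_
    filter_upwards [(tendsto_norm_cobounded_atTop (E := V3)).eventually_ge_atTop 1] with x hx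
    rw [norm_of_nonneg (by positivity), norm_of_nonneg (by positivity),
      rpow_neg (by positivity), show (4 : ℝ) = ((4 : ℕ) : ℝ) by norm_num, Real.rpow_natCast,
      ← div_eq_mul_inv, inv_eq_one_div, div_le_div_iff₀ (by positivity) (by positivity)]
    calc 1 * (1 + ‖x‖) ^ 4 ≤ 1 * (2 * ‖x‖) ^ 4 := by gcongr; linarith
      _ = 16 * ‖x‖ ^ 4 := by ring
  · exact Measurable.aestronglyMeasurable (by fun_prop) |>.stronglyMeasurableAtFilter

lemma integrable_of_isBigO (hm : AEStronglyMeasurable F)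
    (hb : ∀ x ∈ (range c)ᶜ, F =O[𝓝 x] fun _ => (1 : ℝ)) (h3 : s < 3) (hs : ∀ i, F =O[𝓝[≠] (c i)] fun x => ‖x - c i‖ ^ (-s))
    (hi : F =O[cobounded V3] fun x => (‖x‖ ^ 4)⁻¹) : Integrable F := by
  refine integrable_iff_integrableAtFilter_cocompact.2 ⟨?_, locallyIntegrable_of_isBigO hm hb h3 hs⟩
  rw [← Metric.cobounded_eq_cocompact]
  exact hi.integrableAtFilter hm.stronglyMeasurableAtFilter integrableAtFilter_inv_pow_four

/-- A function which is at least like the inverse fourth power of the distance is not integrable. -/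
lemma not_integrable_of_isBigO (h : (fun x => (‖x - a‖ ^ 4)⁻¹) =O[𝓝[≠] a] F) :
    ¬ Integrable F := fun hF =>
  not_integrableAtFilter_inv_pow_four a (h.integrableAtFilter
    (Measurable.aestronglyMeasurable (by fun_prop) |>.stronglyMeasurableAtFilter)
    ⟨univ, univ_mem, hF.integrableOn⟩)

end

lemma measurable_kernel : Measurable kernel := by
  unfold kernel
  fun_prop

lemma locallyIntegrable_kernel (a : V3) : LocallyIntegrable fun x => kernel (x - a) := by
  refine (locallyIntegrable_rpow a (s := 2) (by norm_num)).mono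
    (measurable_kernel.comp (measurable_id.sub_const a)).aestronglyMeasurable (.of_forall fun x => ?_)
  rw [norm_kernel, norm_of_nonneg (by positivity), rpow_neg (norm_nonneg _), rpow_two]

/-- A monotone step. -/
def steepStep (k : ℕ) (t : ℝ) : ℝ := smoothTransition ((k + 1) * (t - 1))

lemma isStep_steepStep (k : ℕ) : IsStep (steepStep k) where
  contDiff := Real.smoothTransition.contDiff.comp
    (contDiff_const.mul (contDiff_id.sub contDiff_const))
  zero t ht := Real.smoothTransition.zero_of_nonpos
    (mul_nonpos_of_nonneg_of_nonpos (by positivity) (by linarith))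
  one t ht := Real.smoothTransition.one_of_one_le (by
    have : (0 : ℝ) ≤ k := by positivity
    nlinarith)

lemma monotone_steepStep (k : ℕ) : Monotone (steepStep k) := fun s t h =>
  Real.smoothTransition.monotone (by gcongr)

lemma steepStep_nonneg (k : ℕ) (t : ℝ) : 0 ≤ steepStep k t := Real.smoothTransition.nonneg _

lemma steepStep_le_one (k : ℕ) (t : ℝ) : steepStep k t ≤ 1 := Real.smoothTransition.le_one _

lemma tendsto_steepStep (t : ℝ) :
    Tendsto (fun k => steepStep k t) atTop (𝓝 (if 1 < t then 1 else 0)) := by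
  by_cases ht : 1 < t
  swap
  · simp [ht, (isStep_steepStep _).zero t (not_lt.1 ht)]
  rw [if_pos ht]
  refine tendsto_const_nhds.congr' ?_
  filter_upwards [(tendsto_natCast_atTop_atTop (R := ℝ)).eventually_ge_atTop ((t - 1)⁻¹)] with k hk
  refine (Real.smoothTransition.one_of_one_le ?_).symm
  have h1 : 0 < t - 1 := sub_pos.2 ht
  calc (1 : ℝ) = (t - 1)⁻¹ * (t - 1) := (inv_mul_cancel₀ h1.ne').symm
    _ ≤ (k + 1) * (t - 1) := by gcongr; linarith

lemma integrable_kernel_inner (a : V3) (hG : Continuous G) (hc : HasCompactSupport G) :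
    Integrable fun x => ⟪kernel (x - a), G x⟫ :=
  integrable_inner (U := univ) ((locallyIntegrable_kernel a).locallyIntegrableOn _) hG hc
    (subset_univ _)

/-- The divergence of `x / |x|³` is `4 π δ`: in polar coordinates, the integrand is the radial
derivative of the test function. -/
lemma integral_kernel_gradient (a : V3) (hφ : ContDiff ℝ ∞ φ)
    (hc : HasCompactSupport φ) :
    ∫ x, ⟪kernel (x - a), gradient φ x⟫ = -(4 * π * φ a) := by
  set g : V3 → ℝ := fun x => ⟪kernel (x - a), gradient φ x⟫ with hg
  set G : Metric.sphere (0 : V3) 1 × Ioi (0 : ℝ) → ℝ := fun p => g (p.2.1 • p.1.1 + a)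
  have hint : Integrable fun x => g (x + a) := (integrable_kernel_inner a (continuous_gradient hφ)
    (hasCompactSupport_gradient hc)).comp_add_right a
  have hP := (volume : Measure V3).measurePreserving_homeomorphUnitSphereProd
  have hE := (homeomorphUnitSphereProd V3).measurableEmbedding
  have hG : ∀ x : ({0}ᶜ : Set V3), G (homeomorphUnitSphereProd V3 x) = g (x + a) := fun x => by
    simp [G, smul_inv_smul₀ (norm_ne_zero_iff.2 x.2)]
  have hGi : Integrable G _ := (hP.integrable_comp_emb hE).1 ((integrable_congr (.of_forall hG)).2
    ((integrableOn_iff_comap_subtypeVal (measurableSet_singleton _).compl).1 hint.integrableOn))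
  rw [← integral_add_right_eq_self _ a, ← restrict_compl_singleton (μ := volume) (0 : V3),
    ← integral_subtype_comap (measurableSet_singleton _).compl fun x => g (x + a),
    ← integral_congr_ae (.of_forall hG), hP.integral_comp hE, integral_prod _ hGi]
  have key : ∀ e : Metric.sphere (0 : V3) 1,
      ∫ r, G (e, r) ∂.volumeIoiPow (Module.finrank ℝ V3 - 1) = -φ a := fun e => by
    have he : ‖(e : V3)‖ = 1 := by simp
    have hi : Isometry fun r : ℝ => r • (e : V3) + a := Isometry.of_dist_eq fun r s => by
      rw [dist_add_right, dist_eq_norm, ← sub_smul, norm_smul, he, mul_one, dist_eq_norm]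
    have h1 := HasCompactSupport.integral_Ioi_deriv_eq (f := fun r : ℝ => φ (r • (e : V3) + a))
      ((hφ.of_le (by simp)).comp (by fun_prop)) (hc.comp_isClosedEmbedding hi.isClosedEmbedding) 0
    rw [zero_smul, zero_add] at h1
    simp only [Measure.volumeIoiPow, ENNReal.ofReal]
    rw [← h1, integral_withDensity_eq_integral_smul (by fun_prop), integral_subtype_comap
      measurableSet_Ioi fun r : ℝ => Real.toNNReal (r ^ (Module.finrank ℝ V3 - 1)) •
        g (r • (e : V3) + a)]
    refine setIntegral_congr_fun measurableSet_Ioi fun r (hr : 0 < r) => ?_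
    have h2 := ((hφ.differentiable (by simp)) (r • (e : V3) + a)).hasFDerivAt.comp_hasDerivAt r
      (((hasDerivAt_id r).smul_const (e : V3)).add_const a)
    beta_reduce
    rw [show deriv (fun r => φ (r • (e : V3) + a)) r = _ from h2.deriv, NNReal.smul_def, Real.coe_toNNReal _ (by positivity), show g _ = _ from inner_gradient φ _ _]
    simp only [kernel, add_sub_cancel_right, norm_smul, he, finrank_euclideanSpace_fin, map_smul,
      smul_eq_mul, Real.norm_of_nonneg hr.le, one_smul]
    field_simp
  rw [integral_congr_ae (.of_forall key), integral_const, Measure.toSphere_real_apply_univ,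
    finrank_euclideanSpace_fin, measureReal_def, EuclideanSpace.volume_ball_fin_three]
  simp [ENNReal.toReal_ofReal (show 0 ≤ π * 4 / 3 by positivity)]
  exact Or.inl (by ring)

/-- Gauss' law. -/
lemma hasPointSources_coulomb (c : Fin n → V3) (q : Fin n → ℝ) :
    HasPointSources (coulomb c q) c q := by
  have h0 : coulomb c q = fun y => ∑ i, (q i / (4 * π)) • kernel (y - c i) :=
    funext (coulomb_eq c q)
  constructor
  · rw [h0]
    exact locallyIntegrable_finsetSum _ fun i _ =>
      (locallyIntegrable_kernel (c i)).smul (q i / (4 * π))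
  · intro φ hφ hc
    simp only [h0, sum_inner, inner_smul_left, conj_trivial]
    rw [integral_finsetSum]
    · rw [← Finset.sum_neg_distrib]
      refine Finset.sum_congr rfl fun i _ => ?_
      rw [integral_const_mul, integral_kernel_gradient (c i) hφ hc]
      have := Real.pi_ne_zero
      field_simp
    · exact fun i _ => (integrable_inner (U := univ)
        ((locallyIntegrable_kernel (c i)).locallyIntegrableOn _)
        (continuous_gradient hφ) (hasCompactSupport_gradient hc) (subset_univ _)).const_mul _

lemma hasPointSources_zero (c : Fin n → V3) : HasPointSources 0 c (0 : Fin n → ℝ) := by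
  refine ⟨locallyIntegrable_zero, fun φ _ _ => ?_⟩
  simp

end

section

/-! ### Free charges as fluxes -/

variable {r : Fin n → ℝ} {R : ℝ}

/-- The closed balls of radii `2 r i` about the points `c i` are essentially disjoint, and
contained in the open ball of radius `R` about the origin. -/
structure Separated (c : Fin n → V3) (r : Fin n → ℝ) (R : ℝ) : Prop where
  pos : ∀ i, 0 < r i
  radius_pos : 0 < R
  inside : ∀ i x, ‖x - c i‖ ≤ 2 * r i → ‖x‖ < R
  disjoint : ∀ i j x, i ≠ j → ‖x - c i‖ ≤ 2 * r i → 2 * r j ≤ ‖x - c j‖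

lemma tendsto_radius (i : Fin n) :
    Tendsto (fun p : (Fin n → ℝ) × ℝ => p.1 i) (exhaustion n) (𝓝[>] 0) :=
  ((continuous_apply (A := fun _ => ℝ) i).continuousWithinAt.tendsto_nhdsWithin fun r
    (hr : r ∈ Set.univ.pi fun _ => Ioi (0 : ℝ)) => hr i (mem_univ i)).comp tendsto_fst

lemma tendsto_outer : Tendsto (fun p : (Fin n → ℝ) × ℝ => p.2) (exhaustion n) atTop := tendsto_snd

lemma eventually_separated (hc : Injective c) : ∀ᶠ p in exhaustion n, Separated c p.1 p.2 := by
  have h1 : ∀ᶠ p in exhaustion n, ∀ i, 0 < p.1 i ∧ p.1 i < 1 := eventually_all.2 fun i =>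
    (tendsto_radius i).eventually (Ioo_mem_nhdsGT one_pos)
  have h2 : ∀ᶠ p in exhaustion n, ∀ i j, i ≠ j → 2 * (p.1 i + p.1 j) < ‖c i - c j‖ :=
    eventually_all.2 fun i => eventually_all.2 fun j => by
      have h := fun i => (tendsto_nhdsWithin_iff.1 (tendsto_radius (n := n) i)).1
      by_cases hij : i = j
      · simp [hij]
      · filter_upwards [(((h i).add (h j)).const_mul 2).eventually_lt_const
          (by simpa using sub_ne_zero.2 (hc.ne hij) : _ < ‖c i - c j‖)] with p hp _ using hp
  have h3 : ∀ᶠ p in exhaustion n, ∀ i, ‖c i‖ + 2 < p.2 := eventually_all.2 fun i =>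
    tendsto_outer.eventually_gt_atTop _
  filter_upwards [h1, h2, h3, tendsto_outer.eventually_gt_atTop 0] with p h1 h2 h3 h4
  refine ⟨fun i => (h1 i).1, h4, fun i x hx => ?_, fun i j x hij hx => ?_⟩
  · linarith [h3 i, (h1 i).2, norm_sub_norm_le x (c i)]
  · linarith [h2 i j hij, norm_sub_le_norm_sub_add_norm_sub (c i) x (c j),
      norm_sub_rev x (c i)]

lemma locallyIntegrableOn_compl (hF : ContDiffOn ℝ 1 F (range c)ᶜ) :
    LocallyIntegrableOn F (range c)ᶜ :=
  hF.continuousOn.locallyIntegrableOn isOpen_compl_range.measurableSet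

lemma IsStep.integral_coulomb (h : IsStep η) {r : ℝ} (hr : 0 < r) (A : Fin n → ℝ) :
    ∫ x, ⟪coulomb c A x, gradient (radialStep η a r) x⟫ =
      ∑ j, A j * (1 - radialStep η a r (c j)) := by
  rw [← (hasPointSources_coulomb c A).2 (fun x => 1 - radialStep η a r x)
    (contDiff_const.sub (h.contDiff_radialStep hr))
    (HasCompactSupport.intro (isCompact_closedBall a (2 * r)) fun x hx => by
      rw [mem_closedBall_iff_norm, not_le] at hx
      rw [h.radialStep_eq_one hr hx.le, sub_self]), ← integral_neg]
  congr! 2 with x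
  rw [gradient, gradient, fderiv_const_sub, map_neg, inner_neg_right, neg_neg]

namespace Separated

lemma mem_compl_range (hs : Separated c r R) (h1 : r i ≤ ‖x - c i‖)
    (h2 : ‖x - c i‖ ≤ 2 * r i) : x ∈ (range c)ᶜ := by
  rintro ⟨j, rfl⟩
  by_cases hij : i = j
  · subst hij
    rw [sub_self, norm_zero] at h1
    linarith [hs.pos i]
  · have h3 := hs.disjoint i j _ hij h2
    rw [sub_self, norm_zero] at h3
    linarith [hs.pos j]

lemma mem_compl_range_outer (hs : Separated c r R) (h : R ≤ ‖x‖) : x ∈ (range c)ᶜ := by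
  rintro ⟨j, rfl⟩
  have h1 := hs.inside j (c j) (by rw [sub_self, norm_zero]; linarith [hs.pos j])
  linarith

lemma radialStep_other (hs : Separated c r R) (h : IsStep η) {j : Fin n} (hij : i ≠ j)
    (hx : ‖x - c i‖ ≤ 2 * r i) : radialStep η (c j) (r j) x = 1 :=
  h.radialStep_eq_one (hs.pos j) (hs.disjoint i j x hij hx)

lemma radialStep_outer (hs : Separated c r R) (h : IsStep η)
    (hx : ‖x - c i‖ ≤ 2 * r i) : radialStep η 0 R x = 0 :=
  h.radialStep_eq_zero hs.radius_pos (by rw [sub_zero]; exact (hs.inside i x hx).le)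

lemma cutoff_eq (hs : Separated c r R) (h : IsStep η) (x : V3) : cutoff η c r R x =
    1 - radialStep η 0 R x - ∑ i, (1 - radialStep η (c i) (r i) x) := by
  have h0 : cutoff η c r R x = (1 - radialStep η 0 R x) * ∏ i, radialStep η (c i) (r i) x := by
    simp only [cutoff, radialStep, sub_zero]
  rw [h0]
  by_cases hx : ∃ i, ‖x - c i‖ ≤ 2 * r i
  · obtain ⟨i, hi⟩ := hx
    rw [hs.radialStep_outer h hi, Finset.prod_eq_single i, Finset.sum_eq_single i]
    · ring
    · intro j _ hj
      rw [hs.radialStep_other h hj.symm hi, sub_self]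
    · simp
    · intro j _ hj
      exact hs.radialStep_other h hj.symm hi
    · simp
  · push Not at hx
    have h1 := fun i => h.radialStep_eq_one (hs.pos i) (hx i).le
    simp [h1]

lemma contDiff_cutoff (hs : Separated c r R) (h : IsStep η) : ContDiff ℝ ∞ (cutoff η c r R) := by
  rw [funext (hs.cutoff_eq h)]
  exact (contDiff_const.sub (h.contDiff_radialStep hs.radius_pos)).sub
    (ContDiff.sum fun i _ => contDiff_const.sub (h.contDiff_radialStep (hs.pos i)))

lemma gradient_cutoff (hs : Separated c r R) (h : IsStep η) (x : V3) : gradient (cutoff η c r R) x =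
      -gradient (radialStep η 0 R) x + ∑ i, gradient (radialStep η (c i) (r i)) x := by
  rw [funext (hs.cutoff_eq h), h.gradient_radialStep hs.radius_pos]
  simp only [fun i => h.gradient_radialStep (a := c i) (x := x) (hs.pos i)]
  refine gradient_eq_of_hasFDerivAt ?_
  refine (((h.hasFDerivAt_radialStep hs.radius_pos).const_sub 1).sub (HasFDerivAt.fun_sum
    fun i _ => (h.hasFDerivAt_radialStep (a := c i) (hs.pos i)).const_sub 1)).congr_fderiv ?_
  rw [map_add, map_neg, map_sum, Finset.sum_neg_distrib, sub_neg_eq_add]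

lemma integrable_shell (hs : Separated c r R) (h : IsStep η) (hF : LocallyIntegrableOn F (range c)ᶜ)
    (i : Fin n) : Integrable fun x => ⟪F x, gradient (radialStep η (c i) (r i)) x⟫ :=
  integrable_inner hF (continuous_gradient (h.contDiff_radialStep (hs.pos i)))
    (h.hasCompactSupport_gradient_radialStep (hs.pos i))
    ((h.tsupport_gradient_radialStep (hs.pos i)).trans fun _ hx => hs.mem_compl_range hx.1 hx.2)

lemma integrable_outer (hs : Separated c r R) (h : IsStep η) (hF : LocallyIntegrableOn F (range c)ᶜ) :
    Integrable fun x => ⟪F x, gradient (radialStep η 0 R) x⟫ :=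
  integrable_inner hF (continuous_gradient (h.contDiff_radialStep hs.radius_pos))
    (h.hasCompactSupport_gradient_radialStep hs.radius_pos)
    ((h.tsupport_gradient_radialStep hs.radius_pos).trans fun x hx =>
      hs.mem_compl_range_outer (by simpa using hx.1))

/-- The gradient of the cutoff lives on disjoint shells, one about each center and an outer one. -/
lemma flux_decomposition (hs : Separated c r R) (h : IsStep η)
    (hF : LocallyIntegrableOn F (range c)ᶜ) :
    -∫ x, ⟪F x, gradient (cutoff η c r R) x⟫ = (∫ x, ⟪F x, gradient (radialStep η 0 R) x⟫) -
        ∑ i, ∫ x, ⟪F x, gradient (radialStep η (c i) (r i)) x⟫ := by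
  have h1 : Integrable fun x => -⟪F x, gradient (radialStep η 0 R) x⟫ :=
    (hs.integrable_outer h hF).neg
  have h2 := fun i => hs.integrable_shell h hF i
  simp only [hs.gradient_cutoff h, inner_add_right, inner_neg_right, inner_sum]
  rw [integral_add h1 (integrable_finsetSum _ fun i _ => h2 i), integral_neg,
    integral_finsetSum _ fun i _ => h2 i]
  ring

lemma integral_coulomb_shell (hs : Separated c r R) (h : IsStep η) (A : Fin n → ℝ) (i : Fin n) :
    ∫ x, ⟪coulomb c A x, gradient (radialStep η (c i) (r i)) x⟫ = A i := by
  rw [h.integral_coulomb (hs.pos i), Finset.sum_eq_single i]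
  · rw [h.radialStep_eq_zero (hs.pos i) (by simp [(hs.pos i).le]), sub_zero, mul_one]
  · intro j _ hj
    rw [hs.radialStep_other h hj (by simp [(hs.pos j).le]), sub_self, mul_zero]
  · simp

lemma integral_coulomb_outer (hs : Separated c r R) (h : IsStep η) (q : Fin n → ℝ) :
    ∫ x, ⟪coulomb c q x, gradient (radialStep η 0 R) x⟫ = ∑ i, q i := by
  rw [h.integral_coulomb hs.radius_pos]
  refine Finset.sum_congr rfl fun j _ => ?_
  rw [hs.radialStep_outer h (i := j) (by simp [(hs.pos j).le]), sub_zero, mul_one]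

lemma flux_shell_le (hs : Separated c r R) (h : IsStep η) (hF : LocallyIntegrableOn F (range c)ᶜ)
    {A : Fin n → ℝ} (hA : ∀ x, r i ≤ ‖x - c i‖ → ‖x - c i‖ ≤ 2 * r i →
      |⟪F x - coulomb c A x, x - c i⟫| ≤ ε * ‖x - c i‖⁻¹) :
    |(∫ x, ⟪F x, gradient (radialStep η (c i) (r i)) x⟫) - A i| ≤ ε * (4 * π * stepMass η) := by
  rw [← hs.integral_coulomb_shell h A i, ← integral_sub (hs.integrable_shell h hF i)
    (hs.integrable_shell h (locallyIntegrableOn_compl contDiffOn_coulomb) i)]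
  simp only [← inner_sub_left]
  exact h.abs_integral_shell_le (hs.pos i) hA

lemma flux_outer_le (hs : Separated c r R) (h : IsStep η) (hF : LocallyIntegrableOn F (range c)ᶜ) (hQ : ∀ x, R ≤ ‖x‖ → ‖x‖ ≤ 2 * R →
      |⟪F x - coulomb c q x, x⟫| ≤ ε * ‖x‖⁻¹) :
    |(∫ x, ⟪F x, gradient (radialStep η 0 R) x⟫) - ∑ i, q i| ≤ ε * (4 * π * stepMass η) := by
  rw [← hs.integral_coulomb_outer h q, ← integral_sub (hs.integrable_outer h hF)
    (hs.integrable_outer h (locallyIntegrableOn_compl contDiffOn_coulomb))]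
  simp only [← inner_sub_left]
  refine h.abs_integral_shell_le hs.radius_pos ?_
  simpa only [sub_zero] using hQ

end Separated

/-- The flux of a field through the outer shell and the shells about the centers, for a field
which is asymptotic to Coulomb fields there. -/
lemma flux_estimate (hc : Injective c) (hF : LocallyIntegrableOn F (range c)ᶜ) {A : Fin n → ℝ}
    (hA : ∀ i, (fun x => ⟪F x - coulomb c A x, x - c i⟫) =o[𝓝[≠] (c i)] fun x => ‖x - c i‖⁻¹)
    (hQ : (fun x => ⟪F x - coulomb c q x, x⟫) =o[cobounded V3] fun x => ‖x‖⁻¹) (hε : 0 < ε) :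
    ∀ᶠ p in exhaustion n, Separated c p.1 p.2 ∧ ∀ η, IsStep η →
      |-(∫ x, ⟪F x, gradient (cutoff η c p.1 p.2) x⟫) - (∑ i, q i - ∑ i, A i)| ≤
        ε * stepMass η := by
  set e := ε / ((n + 1) * (4 * π)) with he
  have he0 : 0 < e := by positivity
  have h1 : ∀ᶠ p in exhaustion n, ∀ i, ∀ x, p.1 i ≤ ‖x - c i‖ → ‖x - c i‖ ≤ 2 * p.1 i →
      |⟪F x - coulomb c A x, x - c i⟫| ≤ e * ‖x - c i‖⁻¹ := by
    refine eventually_all.2 fun i => ?_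
    have h2 := (hA i).bound he0
    rw [eventually_nhdsWithin_iff, Metric.eventually_nhds_iff] at h2
    obtain ⟨δ, hδ, h2⟩ := h2
    filter_upwards [(tendsto_radius i).eventually (Ioo_mem_nhdsGT (half_pos hδ))] with p hp x h3 h4
    have h5 := h2 (y := x) (by rw [dist_eq_norm]; linarith) (fun h => by
      rw [mem_singleton_iff] at h
      rw [h, sub_self, norm_zero] at h3
      linarith)
    rwa [norm_eq_abs, norm_of_nonneg (by positivity)] at h5
  have h2 : ∀ᶠ p in exhaustion n, ∀ x, p.2 ≤ ‖x‖ →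
      |⟪F x - coulomb c q x, x⟫| ≤ e * ‖x‖⁻¹ := by
    have h3 := hQ.bound he0
    obtain ⟨ρ, -, hρ⟩ := (Metric.hasBasis_cobounded_compl_closedBall 0).mem_iff.1 h3
    filter_upwards [tendsto_outer.eventually_gt_atTop ρ] with p hp x hx
    have h5 := hρ (show x ∈ (Metric.closedBall 0 ρ)ᶜ by
      rw [mem_compl_iff, mem_closedBall_zero_iff, not_le]
      exact hp.trans_le hx)
    simpa using h5
  filter_upwards [h1, h2, eventually_separated hc] with p h1 h2 hs
  refine ⟨hs, fun η h => ?_⟩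
  rw [hs.flux_decomposition h hF]
  have h3 := hs.flux_outer_le h hF (q := q) fun x hx _ => h2 x hx
  have h4 := fun i => hs.flux_shell_le h hF (A := A) (h1 i)
  have h5 : |∑ i, ((∫ x, ⟪F x, gradient (radialStep η (c i) (p.1 i)) x⟫) - A i)| ≤
      ∑ _i : Fin n, e * (4 * π * stepMass η) :=
    (Finset.abs_sum_le_sum_abs _ _).trans (Finset.sum_le_sum fun i _ => h4 i)
  rw [Finset.sum_sub_distrib, Finset.sum_const, Finset.card_univ, Fintype.card_fin,
    nsmul_eq_mul] at h5
  have h6 : ε * stepMass η = e * (4 * π * stepMass η) + n * (e * (4 * π * stepMass η)) := by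
    rw [he]
    field_simp
    ring
  rw [h6]
  refine le_trans ?_ (add_le_add h3 h5)
  refine le_trans (le_of_eq ?_) (abs_sub _ _)
  congr 1
  ring

/-- The free charge is the flux at infinity minus the fluxes at the centers. -/
lemma hasWeakFreeCharge (hc : Injective c) (hF : LocallyIntegrableOn F (range c)ᶜ) {A : Fin n → ℝ}
    (hA : ∀ i, (fun x => ⟪F x - coulomb c A x, x - c i⟫) =o[𝓝[≠] (c i)] fun x => ‖x - c i‖⁻¹)
    (hQ : (fun x => ⟪F x - coulomb c q x, x⟫) =o[cobounded V3] fun x => ‖x‖⁻¹) :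
    HasWeakFreeCharge c F (∑ i, q i - ∑ i, A i) := by
  refine ⟨hF, fun η h h0 h1 => Metric.tendsto_nhds.2 fun ε hε => ?_⟩
  have hη : IsStep η := ⟨h, h0, h1⟩
  have hm := IsStep.stepMass_nonneg η
  filter_upwards [flux_estimate hc hF hA hQ (ε := ε / (2 * (stepMass η + 1))) (by positivity)]
    with p hp
  rw [dist_eq]
  refine (hp.2 η hη).trans_lt ?_
  rw [div_mul_eq_mul_div, div_lt_iff₀ (by positivity)]
  nlinarith

lemma isCompact_perforated (hr : ∀ i, 0 < r i) (R : ℝ) :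
    IsCompact {x : V3 | ‖x‖ ≤ R ∧ ∀ i, r i ≤ ‖x - c i‖} ∧
      {x : V3 | ‖x‖ ≤ R ∧ ∀ i, r i ≤ ‖x - c i‖} ⊆ (range c)ᶜ := by
  constructor
  · refine (isCompact_closedBall 0 R).of_isClosed_subset ?_ fun x hx => by simpa using hx.1
    simp only [ofPred_and, ofPred_forall]
    exact (isClosed_le continuous_norm continuous_const).inter (isClosed_iInter fun i =>
      isClosed_le continuous_const (continuous_id.sub continuous_const).norm)
  · rintro _ hx ⟨i, rfl⟩
    have := hx.2 i
    rw [sub_self, norm_zero] at this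
    linarith [hr i]

lemma continuousOn_divergence (hF : ContDiffOn ℝ 1 F (range c)ᶜ) :
    ContinuousOn (divergence F) (range c)ᶜ := by
  refine continuousOn_finsetSum _ fun i _ => ?_
  exact (EuclideanSpace.proj (𝕜 := ℝ) i).continuous.comp_continuousOn
    ((hF.continuousOn_fderiv_of_isOpen isOpen_compl_range le_rfl).clm_apply continuousOn_const)

lemma integrableOn_divergence (hF : ContDiffOn ℝ 1 F (range c)ᶜ) (hr : ∀ i, 0 < r i) (R : ℝ) :
    IntegrableOn (divergence F) {x : V3 | ‖x‖ ≤ R ∧ ∀ i, r i ≤ ‖x - c i‖} :=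
  ((continuousOn_divergence hF).mono (isCompact_perforated hr R).2).integrableOn_compact
    (isCompact_perforated hr R).1

lemma mem_perforatedBall : x ∈ perforatedBall c r R ↔ ‖x‖ < R ∧ ∀ i, r i < ‖x - c i‖ := by
  simp [perforatedBall, dist_eq_norm]

lemma measurableSet_perforatedBall : MeasurableSet (perforatedBall c r R) :=
  Metric.isOpen_ball.measurableSet.diff
    (MeasurableSet.iUnion fun _ => Metric.isClosed_closedBall.measurableSet)

/-- The integral of the divergence over a perforated ball is a limit of fluxes through shells. -/
lemma integral_perforatedBall_mem (hF : ContDiffOn ℝ 1 F (range c)ᶜ) (hs : Separated c r R)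
    {S : Set ℝ} (hS : IsClosed S) (h : ∀ η, IsStep η → Monotone η →
      -∫ x, ⟪F x, gradient (cutoff η c r R) x⟫ ∈ S) :
    ∫ x in perforatedBall c r R, divergence F x ∈ S := by
  set K : Set V3 := {x | ‖x‖ ≤ 2 * R ∧ ∀ i, r i ≤ ‖x - c i‖} with hK
  have hKc := (isCompact_perforated (c := c) hs.pos (2 * R)).1
  have hzero : ∀ η, IsStep η → ∀ x, x ∉ K → cutoff η c r R x = 0 := fun η hη x hx => by
    rw [hK, mem_ofPred_eq, not_and_or, not_le, not_forall] at hx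
    rcases hx with hx | ⟨i, hi⟩
    · rw [cutoff, hη.one _ (by rw [le_div_iff₀ hs.radius_pos]; exact hx.le), sub_self, zero_mul]
    · rw [cutoff, Finset.prod_eq_zero (Finset.mem_univ i), mul_zero]
      exact hη.zero _ (by rw [div_le_one (hs.pos i)]; exact (not_le.1 hi).le)
  have hcut : ∀ k : ℕ, ∫ x, cutoff (steepStep k) c r R x * divergence F x ∈ S := fun k => by
    have hη := isStep_steepStep k
    have h1 : tsupport (cutoff (steepStep k) c r R) ⊆ K :=
      closure_minimal (fun x hx => by_contra fun h => hx (hzero _ hη x h)) hKc.isClosed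
    rw [integral_cutoff_mul_divergence isOpen_compl_range hF (hs.contDiff_cutoff hη)
      (hKc.of_isClosed_subset (isClosed_tsupport _) h1)
      (h1.trans (isCompact_perforated (c := c) hs.pos (2 * R)).2)]
    exact h _ hη (monotone_steepStep k)
  refine hS.mem_of_tendsto (b := atTop) (f := fun k : ℕ =>
    ∫ x, cutoff (steepStep k) c r R x * divergence F x) ?_ (.of_forall hcut)
  have hKi := integrableOn_divergence hF hs.pos (2 * R)
  have hmem : ∀ k x, ‖cutoff (steepStep k) c r R x‖ ≤ 1 := fun k x => by
    have h1 := Finset.prod_nonneg (s := Finset.univ) fun i _ => steepStep_nonneg k (‖x - c i‖ / r i)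
    have h2 := sub_nonneg.2 (steepStep_le_one k (‖x‖ / R))
    rw [cutoff, norm_of_nonneg (mul_nonneg h2 h1)]
    exact mul_le_one₀ (sub_le_self _ (steepStep_nonneg _ _)) h1
      (Finset.prod_le_one (fun i _ => steepStep_nonneg _ _) fun i _ => steepStep_le_one _ _)
  have hsub : perforatedBall c r R ⊆ K := fun x hx => by
    rw [mem_perforatedBall] at hx
    exact ⟨by linarith [hs.radius_pos], fun i => (hx.2 i).le⟩
  rw [← inter_eq_self_of_subset_right hsub, ← setIntegral_indicator measurableSet_perforatedBall]
  simp_rw [fun k => (setIntegral_eq_integral_of_forall_compl_eq_zero (s := K) (μ := volume)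
    fun x hx => by simp [hzero _ (isStep_steepStep k) x hx] :
      _ = ∫ x, cutoff (steepStep k) c r R x * divergence F x).symm]
  refine tendsto_integral_of_dominated_convergence (fun x => ‖divergence F x‖)
    (fun k => (hs.contDiff_cutoff (isStep_steepStep k)).continuous.aestronglyMeasurable.mul
      hKi.aestronglyMeasurable) hKi.norm (fun k => .of_forall fun x => ?_) ?_
  · rw [norm_mul]
    exact mul_le_of_le_one_left (norm_nonneg _) (hmem k x)
  · have h0 : ∀ᵐ x : V3, ‖x‖ ≠ R := by
      rw [ae_iff]
      convert Measure.addHaar_sphere (volume : Measure V3) 0 R using 2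
      ext x
      simp
    filter_upwards [ae_restrict_of_ae h0] with x hx
    refine tendsto_of_eq (((((tendsto_steepStep (‖x‖ / R)).const_sub 1).mul (tendsto_finsetProd
      Finset.univ fun i _ => tendsto_steepStep (‖x - c i‖ / r i))).mul_const (divergence F x))) ?_
    by_cases h : x ∈ perforatedBall c r R
    · obtain ⟨h1, h2⟩ := mem_perforatedBall.1 h
      simp [h, one_lt_div hs.radius_pos, one_lt_div (hs.pos _), h1.not_gt, h2]
    · rw [indicator_of_notMem h]
      rw [mem_perforatedBall, not_and_or, not_lt, not_forall] at h
      rcases h with h | ⟨i, hi⟩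
      · simp [one_lt_div hs.radius_pos, h.lt_of_ne' hx]
      · rw [Finset.prod_eq_zero (Finset.mem_univ i) (if_neg (by rwa [one_lt_div (hs.pos i)])),
          mul_zero, zero_mul]

lemma hasFreeCharge (hc : Injective c) (hF : ContDiffOn ℝ 1 F (range c)ᶜ) {A : Fin n → ℝ}
    (hA : ∀ i, (fun x => ⟪F x - coulomb c A x, x - c i⟫) =o[𝓝[≠] (c i)] fun x => ‖x - c i‖⁻¹)
    (hQ : (fun x => ⟪F x - coulomb c q x, x⟫) =o[cobounded V3] fun x => ‖x‖⁻¹) :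
    HasFreeCharge c F (∑ i, q i - ∑ i, A i) := by
  refine ⟨fun r R hr => (integrableOn_divergence hF hr R).mono_set fun x hx => ?_, ?_⟩
  · rw [mem_perforatedBall] at hx
    exact ⟨hx.1.le, fun i => (hx.2 i).le⟩
  · refine Metric.tendsto_nhds.2 fun ε hε => ?_
    filter_upwards [flux_estimate hc (locallyIntegrableOn_compl hF) hA hQ (half_pos hε)] with p hp
    have h1 := integral_perforatedBall_mem hF hp.1
      (S := Metric.closedBall (∑ i, q i - ∑ i, A i) (ε / 2)) Metric.isClosed_closedBall
      fun η hη hm => by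
        have h2 := hp.2 η hη
        rwa [hη.stepMass_eq_one hm, mul_one, ← dist_eq] at h2
    exact (Metric.mem_closedBall.1 h1).trans_lt (half_lt_self hε)

end

/-! ### The zeros of a Coulomb field -/

/-- A set of points of space which meets every ray from the origin in a null set is a null set, by
polar coordinates. -/
lemma measure_zero_of_rays {Y : Set V3} (hY : MeasurableSet Y)
    (h : ∀ u : V3, ‖u‖ = 1 → volume {t : ℝ | 0 < t ∧ t • u ∈ Y} = 0) : volume Y = 0 := by
  have h0 : volume (Y ∩ {0}ᶜ) = 0 := by
    have hm : MeasurableSet ((↑) ⁻¹' Y : Set ({0}ᶜ : Set V3)) := measurable_subtype_coe hY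
    have hmp := (volume : Measure V3).measurePreserving_homeomorphUnitSphereProd
    have h1 := hmp.symm (homeomorphUnitSphereProd V3).toMeasurableEquiv
    have h2 := h1.measure_preimage hm.nullMeasurableSet
    rw [comap_subtype_coe_apply (measurableSet_singleton _).compl] at h2
    rw [Subtype.image_preimage_coe, inter_comm] at h2
    rw [← h2, Measure.measure_prod_null
      ((homeomorphUnitSphereProd V3).toMeasurableEquiv.symm.measurable hm)]
    refine .of_forall fun u => ?_
    refine withDensity_absolutelyContinuous _ _ ?_
    rw [comap_subtype_coe_apply measurableSet_Ioi]
    refine measure_mono_null ?_ (h u (by simpa using u.2))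
    rintro _ ⟨t, ht, rfl⟩
    exact ⟨t.2, ht⟩
  have h1 : Y ⊆ (Y ∩ {0}ᶜ) ∪ {0} := fun x hx => by
    by_cases h : x = 0
    · exact Or.inr h
    · exact Or.inl ⟨hx, h⟩
  exact measure_mono_null h1 (measure_union_null h0 (measure_singleton 0))

/-- On a ray from a center with non-zero charge which avoids the other centers, the field vanishes
on a null set. -/
lemma measure_zero_ray (hc : Injective c) (hq : q i ≠ 0)
    (hu : ‖u‖ = 1) (h : ∀ t : ℝ, 0 < t → c i + t • u ∈ (range c)ᶜ) :
    volume {t : ℝ | 0 < t ∧ coulomb c q (c i + t • u) = 0} = 0 := by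
  have ha : AnalyticOnNhd ℝ (fun t : ℝ => coulomb c q (c i + t • u)) (Ioi 0) := fun t ht =>
    (analyticOnNhd_coulomb _ (h t ht)).comp_of_eq
      (analyticAt_const.add (analyticAt_id.smul analyticAt_const)) rfl
  rcases ha.eqOn_zero_or_eventually_ne_zero_of_preconnected isPreconnected_Ioi with h1 | h1
  · exfalso
    have h2 := tendsto_coulomb_ray (w := q) hc i hu
    have h3 : (fun t : ℝ => t ^ 2 • coulomb c q (c i + t • u)) ⇝ 0 := tendsto_const_nhds.congr' (by
        filter_upwards [self_mem_nhdsWithin] with t ht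
        have h4 : coulomb c q (c i + t • u) = 0 := h1 ht
        rw [h4, smul_zero])
    have h4 := tendsto_nhds_unique h2 h3
    rw [smul_eq_zero] at h4
    rcases h4 with h4 | h4
    · exact div_ne_zero hq (by positivity) h4
    · rw [h4, norm_zero] at hu
      exact zero_ne_one hu
  · have h2 := ae_restrict_le_codiscreteWithin (μ := volume) measurableSet_Ioi h1
    rw [mem_ae_iff, Measure.restrict_apply' measurableSet_Ioi] at h2
    refine measure_mono_null ?_ h2
    intro t ht
    exact ⟨fun h3 => h3 ht.2, ht.1⟩

lemma measure_coulomb_eq_zero (hc : Injective c) (hq : q i ≠ 0) :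
    volume {x | x ∈ (range c)ᶜ ∧ coulomb c q x = 0} = 0 := by
  set Z : Set V3 := {x | x ∈ (range c)ᶜ ∧ coulomb c q x = 0} with hZ
  have hZm : MeasurableSet Z := by
    have h1 : ContinuousOn (coulomb c q) (range c)ᶜ := (contDiffOn_coulomb (k := 1)).continuousOn
    have h2 : Z = (range c)ᶜ \ ((range c)ᶜ ∩ coulomb c q ⁻¹' {0}ᶜ) := by
      ext x
      simp only [hZ, mem_ofPred_eq, Set.mem_sdiff, mem_inter_iff, mem_preimage, mem_compl_iff,
        mem_singleton_iff]
      tauto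
    rw [h2]
    exact isOpen_compl_range.measurableSet.diff
      (h1.isOpen_inter_preimage isOpen_compl_range isOpen_compl_singleton).measurableSet
  set N : Set V3 := ⋃ j, (Submodule.span ℝ {c j - c i} : Set V3) with hN
  have hNm : MeasurableSet N := MeasurableSet.iUnion fun j =>
    (Submodule.closed_of_finiteDimensional _).measurableSet
  have hN0 : volume N = 0 := by
    refine measure_iUnion_null fun j => Measure.addHaar_submodule _ _ fun h => ?_
    have h1 := finrank_span_le_card (R := ℝ) ({c j - c i} : Set V3)
    rw [h, finrank_top, finrank_euclideanSpace_fin] at h1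
    simp at h1
  have hY : volume (((fun x => c i + x) ⁻¹' Z) \ N) = 0 := by
    refine measure_zero_of_rays (((measurable_const_add (c i)) hZm).diff hNm) fun u hu => ?_
    by_cases h : ∀ t : ℝ, 0 < t → c i + t • u ∈ (range c)ᶜ
    · refine measure_mono_null ?_ (measure_zero_ray hc hq hu h)
      exact fun t ht => ⟨ht.1, ht.2.1.2⟩
    · push Not at h
      obtain ⟨t, ht, h⟩ := h
      rw [mem_compl_iff, not_not] at h
      obtain ⟨j, hj⟩ := h
      refine measure_mono_null (t := ∅) (fun s hs => hs.2.2 ?_) measure_empty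
      refine mem_iUnion.2 ⟨j, Submodule.mem_span_singleton.2 ⟨s * t⁻¹, ?_⟩⟩
      rw [hj, add_sub_cancel_left, smul_smul, inv_mul_cancel_right₀ ht.ne']
  rw [← measure_preimage_add volume (c i) Z]
  refine measure_mono_null (fun x hx => ?_) (measure_union_null hY hN0)
  by_cases h : x ∈ N
  · exact Or.inr h
  · exact Or.inl ⟨hx, h⟩

namespace RootField
lemma measure_compl (h : RootField S S' κ c q g Ω p) (hc : Injective c)
    (hq : q i ≠ 0) : volume Ωᶜ = 0 := by
  refine measure_mono_null (fun x hx => ?_)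
    (measure_union_null ((finite_range c).measure_zero volume) (measure_coulomb_eq_zero hc hq))
  by_cases h1 : x ∈ range c
  · exact Or.inl h1
  · refine Or.inr ⟨h1, ?_⟩
    by_contra h2
    exact hx (h.mem x h1 (Or.inl h2))

end RootField

section

/-! ### The constitutive equations of a dyonic field -/

/-- A Lagrangian density `f` in terms of the function `S` which inverts `f'`. The last three fields
serve to bound the energy density `L / p - f(S(p))`. -/
structure Model (f : ℝ → ℝ) (I : Set ℝ) (S S' : ℝ → ℝ) : Prop where
  response : Response S S'
  mem : ∀ p, 0 < p → S p ∈ I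
  deriv_eq : ∀ p, 0 < p → deriv f (S p) = p
  zero : f 0 = 0
  large : ∀ p, 1 ≤ p → |f (S p)| ≤ p * S p
  linear : ∃ C, 0 ≤ C ∧ ∀ p, 1 ≤ p → S p ≤ C * p
  small : ∃ C, 0 ≤ C ∧ ∀ p, 0 < p → p ≤ 1 → |f (S p)| ≤ C / p

lemma Model.hasDerivAt (M : Model f I S S') {p : ℝ} (hp : 0 < p) : HasDerivAt f p (S p) := by
  have h1 : DifferentiableAt ℝ f (S p) := by
    by_contra h
    have h2 := M.deriv_eq p hp
    rw [deriv_zero_of_not_differentiableAt h] at h2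
    exact hp.ne h2
  simpa only [M.deriv_eq p hp] using h1.hasDerivAt

section
variable {p : ℝ}

lemma one_add_pos (κ : ℝ) (B : V3) : 0 < 1 + κ ^ 2 * ‖B‖ ^ 2 := by positivity

/-- The coefficient of the component of `D` along `B` which is removed in `E`. -/
def mixCoeff (κ : ℝ) (D B : V3) : ℝ := κ ^ 2 * ⟪B, D⟫ / (1 + κ ^ 2 * ‖B‖ ^ 2)

lemma inner_sub_mix : ⟪B, D - mixCoeff κ D B • B⟫ = ⟪B, D⟫ / (1 + κ ^ 2 * ‖B‖ ^ 2) := by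
  have h := (one_add_pos κ B).ne'
  rw [inner_sub_right, inner_smul_right, real_inner_self_eq_norm_sq, mixCoeff]
  field_simp
  ring

lemma norm_sq_sub_smul (t : ℝ) : ‖D - t • B‖ ^ 2 = ‖D‖ ^ 2 - 2 * t * ⟪B, D⟫ + t ^ 2 * ‖B‖ ^ 2 := by
  rw [norm_sub_sq_real, inner_smul_right, norm_smul, mul_pow, norm_eq_abs, sq_abs, real_inner_comm]
  ring

lemma norm_sq_sub_mix : ‖D - mixCoeff κ D B • B‖ ^ 2 +
    κ ^ 2 * ⟪B, D - mixCoeff κ D B • B⟫ ^ 2 = reducedSq κ D B := by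
  have h := (one_add_pos κ B).ne'
  rw [inner_sub_mix, norm_sq_sub_smul, reducedSq_eq, mixCoeff]
  field_simp
  ring

lemma reducedSq_le_sub (t : ℝ) : κ ^ 2 * reducedSq κ D B ≤ κ ^ 2 * ‖D - t • B‖ ^ 2 + t ^ 2 := by
  have h := one_add_pos κ B
  have h1 : κ ^ 2 * ‖D - t • B‖ ^ 2 + t ^ 2 - κ ^ 2 * reducedSq κ D B =
      (1 + κ ^ 2 * ‖B‖ ^ 2) * (t - mixCoeff κ D B) ^ 2 := by
    rw [norm_sq_sub_smul, reducedSq_eq, mixCoeff]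
    field_simp
    ring
  have h2 : 0 ≤ (1 + κ ^ 2 * ‖B‖ ^ 2) * (t - mixCoeff κ D B) ^ 2 := by positivity
  linarith

/-- The least value of `L`, attained if `B` and `D` are parallel. -/
lemma le_reducedSq : ‖D‖ ^ 2 / (1 + κ ^ 2 * ‖B‖ ^ 2) ≤ reducedSq κ D B := by
  have h := one_add_pos κ B
  rw [reducedSq]
  gcongr
  have : 0 ≤ κ ^ 2 * ‖cross B D‖ ^ 2 := by positivity
  linarith

lemma norm_sub_mix_sq_le : ‖D - mixCoeff κ D B • B‖ ^ 2 ≤ reducedSq κ D B := by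
  rw [← norm_sq_sub_mix (κ := κ)]
  have : 0 ≤ κ ^ 2 * ⟪B, D - mixCoeff κ D B • B⟫ ^ 2 := by positivity
  linarith

lemma mixCoeff_eq : mixCoeff κ D B = κ ^ 2 * ⟪B, D - mixCoeff κ D B • B⟫ := by
  rw [inner_sub_mix, mixCoeff, mul_div_assoc]

lemma mixCoeff_sq_le : mixCoeff κ D B ^ 2 ≤ κ ^ 2 * reducedSq κ D B := by
  have h1 := norm_sq_sub_mix (κ := κ) (D := D) (B := B)
  have h2 : mixCoeff κ D B ^ 2 = κ ^ 2 * (κ ^ 2 * ⟪B, D - mixCoeff κ D B • B⟫ ^ 2) := by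
    conv_lhs => rw [mixCoeff_eq]
    ring
  rw [h2]
  gcongr
  have : 0 ≤ ‖D - mixCoeff κ D B • B‖ ^ 2 := by positivity
  linarith

lemma abs_mixCoeff_le : |mixCoeff κ D B| ≤ κ ^ 2 * (‖B‖ * ‖D‖) := by
  have h := one_add_pos κ B
  rw [mixCoeff, abs_div, abs_mul, abs_of_pos h, abs_of_nonneg (sq_nonneg κ)]
  refine (div_le_self (by positivity) ?_).trans ?_
  · have : 0 ≤ κ ^ 2 * ‖B‖ ^ 2 := by positivity
    linarith
  · gcongr
    exact abs_real_inner_le_norm B D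

lemma dyonicE_eq_smul : dyonicE κ p D B = p⁻¹ • (D - mixCoeff κ D B • B) := rfl

lemma dyonicH_eq_mix : dyonicH κ p D B = p • B - mixCoeff κ D B • dyonicE κ p D B :=
  dyonicH_eq_sub p D B

lemma inner_dyonicE : ⟪dyonicE κ p D B, B⟫ = p⁻¹ * ⟪B, D - mixCoeff κ D B • B⟫ := by
  rw [dyonicE_eq_smul, inner_smul_left, conj_trivial, real_inner_comm]

lemma norm_sq_dyonicE : ‖dyonicE κ p D B‖ ^ 2 + κ ^ 2 * ⟪dyonicE κ p D B, B⟫ ^ 2 =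
    reducedSq κ D B / p ^ 2 := by
  rw [inner_dyonicE, dyonicE_eq_smul, norm_smul, ← norm_sq_sub_mix (κ := κ), norm_inv, mul_pow,
    inv_pow, norm_eq_abs, sq_abs]
  field_simp

lemma norm_dyonicE_sq_le : ‖dyonicE κ p D B‖ ^ 2 ≤ reducedSq κ D B / p ^ 2 := by
  rw [← norm_sq_dyonicE]
  have : 0 ≤ κ ^ 2 * ⟪dyonicE κ p D B, B⟫ ^ 2 := by positivity
  linarith

lemma IsRoot.div_sq (h : IsRoot S L b p) : L / p ^ 2 = 2 * S p + b := by
  have := h.1.ne'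
  rw [← h.2]
  field_simp

lemma invariantS_dyonicE (h : IsRoot S (reducedSq κ D B) (‖B‖ ^ 2) p) :
    invariantS κ (dyonicE κ p D B) B = S p := by
  have h1 := norm_sq_dyonicE (κ := κ) (p := p) (D := D) (B := B)
  rw [h.div_sq] at h1
  rw [invariantS]
  linarith

lemma dyonicE_constitutive (hp : p ≠ 0) : D = p • (dyonicE κ p D B +
    (κ ^ 2 * ⟪dyonicE κ p D B, B⟫) • B) := by
  have h1 : κ ^ 2 * ⟪dyonicE κ p D B, B⟫ = p⁻¹ * mixCoeff κ D B := by
    conv_rhs => rw [mixCoeff_eq]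
    rw [inner_dyonicE]
    ring
  rw [h1, dyonicE_eq_smul]
  match_scalars <;> field_simp
  ring

lemma dyonicH_constitutive (hp : p ≠ 0) : dyonicH κ p D B = p • (B -
    (κ ^ 2 * ⟪dyonicE κ p D B, B⟫) • dyonicE κ p D B) := by
  have h1 : κ ^ 2 * ⟪dyonicE κ p D B, B⟫ = p⁻¹ * mixCoeff κ D B := by
    conv_rhs => rw [mixCoeff_eq]
    rw [inner_dyonicE]
    ring
  rw [h1, dyonicH_eq_mix]
  match_scalars <;> field_simp

end

lemma isLittleO_of_le_mul {α V W : Type*} [Norm V] [Norm W] {F : α → V} {G : α → W} {a : α → ℝ}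
    {l : Filter α} (ha : Tendsto a l (𝓝 0)) (hG : ∀ x, 0 ≤ ‖G x‖)
    (h : ∀ᶠ x in l, ‖F x‖ ≤ a x * ‖G x‖) : F =o[l] G := by
  refine isLittleO_iff.2 fun e he => ?_
  filter_upwards [h, ha.eventually_lt_const he] with x h1 h2
  exact h1.trans (mul_le_mul_of_nonneg_right h2.le (hG x))

namespace RootField
/-- The constitutive equations hold as `p` is a root; the sources are those of Coulomb fields. -/
lemma isStaticSolution (h : RootField S S' κ c q g Ω p) (M : Model f I S S') :
    IsStaticSolution f I κ c q g Ω (fieldE κ c q g p) (coulomb c g) (coulomb c q)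
      (fieldH κ c q g p) (curl (fieldH κ c q g p)) (fun x => -curl (fieldE κ c q g p) x) where
  isOpen := h.isOpen
  smooth_E := h.contDiffOn_E
  smooth_B := contDiffOn_coulomb.mono h.subset
  smooth_D := contDiffOn_coulomb.mono h.subset
  smooth_H := h.contDiffOn_H
  faraday x _ := by rw [neg_neg]
  ampere x _ := rfl
  coulomb_law := hasPointSources_coulomb c q
  gauss_law := hasPointSources_coulomb c g
  dom x hx := by
    rw [invariantS_dyonicE (h.root x hx)]
    exact M.mem _ (h.root x hx).1
  constitutive_D x hx := by
    rw [invariantS_dyonicE (h.root x hx), M.deriv_eq _ (h.root x hx).1]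
    exact dyonicE_constitutive (h.root x hx).1.ne'
  constitutive_H x hx := by
    rw [invariantS_dyonicE (h.root x hx), M.deriv_eq _ (h.root x hx).1]
    exact dyonicH_constitutive (h.root x hx).1.ne'

lemma energyDensity_eq (h : RootField S S' κ c q g Ω p) (M : Model f I S S') (hx : x ∈ Ω) :
    energyDensity f κ (fieldE κ c q g p) (coulomb c g) x =
      reducedSq κ (coulomb c q x) (coulomb c g x) / p x - f (S (p x)) := by
  have hp := (h.root x hx).1
  rw [energyDensity, invariantS_dyonicE (h.root x hx), M.deriv_eq _ hp, norm_sq_dyonicE]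
  congr 1
  field_simp

lemma tendsto_one (h : RootField S S' κ c q g Ω p) : Tendsto p (cobounded V3) (𝓝 1) := by
  have hD := (tendsto_coulomb_infinity c q).norm.pow 2
  have hB := (tendsto_coulomb_infinity c g).norm.pow 2
  rw [norm_zero, zero_pow two_ne_zero] at hD hB
  exact tendsto_root_one h.response
    (squeeze_zero (fun x => reducedSq_nonneg κ _ _) (fun x => reducedSq_le κ _ _) hD)
    (.of_forall fun x => reducedSq_nonneg κ _ _) hB
    (h.infinity.mono fun x hx => h.root x hx)

lemma isEquivalent_E (h : RootField S S' κ c q g Ω p) :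
    fieldE κ c q g p ~[cobounded V3] coulomb c q := by
  have hB := (tendsto_coulomb_infinity c g).norm.pow 2
  have hp : Tendsto (fun x => (p x)⁻¹) (cobounded V3) (𝓝 1) := by
    simpa using h.tendsto_one.inv₀ one_ne_zero
  rw [norm_zero, zero_pow two_ne_zero] at hB
  have ha : Tendsto (fun x => |(p x)⁻¹ - 1| + (p x)⁻¹ * (κ ^ 2 * ‖coulomb c g x‖ ^ 2))
      (cobounded V3) (𝓝 0) := by
    have h1 := ((hp.sub_const 1).abs).add (hp.mul (hB.const_mul (κ ^ 2)))
    simpa using h1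
  refine isLittleO_of_le_mul ha (fun x => norm_nonneg _) ?_
  filter_upwards [h.infinity] with x hx
  have hp0 := (h.root x hx).1
  have h1 : fieldE κ c q g p x - coulomb c q x = ((p x)⁻¹ - 1) • coulomb c q x -
      ((p x)⁻¹ * mixCoeff κ (coulomb c q x) (coulomb c g x)) • coulomb c g x := by
    rw [fieldE, dyonicE_eq_smul]
    module
  rw [Pi.sub_apply, h1]
  refine (norm_sub_le _ _).trans ?_
  rw [norm_smul, norm_smul, norm_mul, norm_eq_abs, norm_eq_abs, norm_eq_abs,
    abs_of_pos (inv_pos.2 hp0)]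
  calc |(p x)⁻¹ - 1| * ‖coulomb c q x‖ + (p x)⁻¹ *
        |mixCoeff κ (coulomb c q x) (coulomb c g x)| * ‖coulomb c g x‖
      ≤ |(p x)⁻¹ - 1| * ‖coulomb c q x‖ + (p x)⁻¹ *
        (κ ^ 2 * (‖coulomb c g x‖ * ‖coulomb c q x‖)) * ‖coulomb c g x‖ := by
          gcongr
          exact abs_mixCoeff_le
    _ = _ := by ring

lemma isEquivalent_H (h : RootField S S' κ c q g Ω p) :
    fieldH κ c q g p ~[cobounded V3] coulomb c g := by
  have hE : Tendsto (fieldE κ c q g p) (cobounded V3) (𝓝 0) :=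
    h.isEquivalent_E.symm.tendsto_nhds (tendsto_coulomb_infinity c q)
  have ha : Tendsto (fun x => |p x - 1| + κ ^ 2 * ‖coulomb c q x‖ * ‖fieldE κ c q g p x‖)
      (cobounded V3) (𝓝 0) := by
    have h1 := ((h.tendsto_one.sub_const 1).abs).add
      (((tendsto_coulomb_infinity c q).norm.const_mul (κ ^ 2)).mul hE.norm)
    simpa using h1
  refine isLittleO_of_le_mul ha (fun x => norm_nonneg _) (.of_forall fun x => ?_)
  have h1 : fieldH κ c q g p x - coulomb c g x = (p x - 1) • coulomb c g x -
      mixCoeff κ (coulomb c q x) (coulomb c g x) • fieldE κ c q g p x := by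
    rw [fieldH, dyonicH_eq_mix]
    module
  rw [Pi.sub_apply, h1]
  refine (norm_sub_le _ _).trans ?_
  rw [norm_smul, norm_smul, norm_eq_abs, norm_eq_abs]
  calc |p x - 1| * ‖coulomb c g x‖ + |mixCoeff κ (coulomb c q x) (coulomb c g x)| *
        ‖fieldE κ c q g p x‖
      ≤ |p x - 1| * ‖coulomb c g x‖ + (κ ^ 2 * (‖coulomb c g x‖ * ‖coulomb c q x‖)) *
        ‖fieldE κ c q g p x‖ := by
          gcongr
          exact abs_mixCoeff_le
    _ = _ := by ring

end RootField

/-- Near a center, the field of its charge dominates. -/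
lemma coulomb_isEquivalent_center (hc : Injective c) (hq : q i ≠ 0) :
    coulomb c q ~[𝓝[≠] (c i)] fun x => (q i / (4 * π)) • kernel (x - c i) := by
  refine (coulomb_sub_isBigO hc i).trans_isLittleO ?_
  refine isLittleO_const_left.2 (Or.inr ?_)
  have h1 : Tendsto (fun x => ‖x - c i‖ ^ 2) (𝓝[≠] (c i)) (𝓝[>] 0) :=
    (tendsto_nhdsWithin_iff.2 ⟨tendsto_pow_nhdsGT 2, by
      filter_upwards [self_mem_nhdsWithin] with t ht using mem_Ioi.2 (pow_pos (mem_Ioi.1 ht) 2)⟩).comp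
      (tendsto_norm_sub_center (c i))
  have h2 := (tendsto_inv_nhdsGT_zero.comp h1).const_mul_atTop
    (show 0 < |q i / (4 * π)| from abs_pos.2 (div_ne_zero hq (by positivity)))
  refine h2.congr fun x => ?_
  simp only [comp, norm_smul, norm_eq_abs, norm_kernel]

namespace RootField
lemma tendsto_ratio (h : RootField S S' 0 c q g Ω p) (hc : Injective c) (hq : q i ≠ 0)
    (hg : g i ≠ 0) : Tendsto p (𝓝[≠] (c i)) (𝓝 |q i / g i|) := by
  have hpi := pi_pos
  have hq' := tendsto_sq_norm_coulomb (q := q) hc i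
  have hg' := tendsto_sq_norm_coulomb (q := g) hc i
  have hg0 : |g i / (4 * π)| ≠ 0 := abs_ne_zero.2 (div_ne_zero hg (by positivity))
  refine tendsto_root_ratio h.response (abs_pos.2 (div_ne_zero hq hg)) ?_
    ((tendsto_pow_atTop two_ne_zero).comp (tendsto_norm_coulomb_atTop hc hg))
    ((h.eventually_mem hc hq).mono fun x hx => h.root x hx)
  have h1 := (hq'.div hg' hg0).pow 2
  have h2 : (|q i / (4 * π)| / |g i / (4 * π)|) = |q i / g i| := by
    rw [← abs_div]
    congr 1
    field_simp
  rw [h2] at h1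
  refine h1.congr' ?_
  filter_upwards [self_mem_nhdsWithin] with x hx
  have h3 : 0 < ‖x - c i‖ := norm_sub_pos_iff.2 hx
  rw [Pi.div_apply, reducedSq_zero, comp, mul_div_mul_left _ _ (by positivity), div_pow]

lemma local_zero (h : RootField S S' 0 c q g Ω p) (hc : Injective c) (hq : q i ≠ 0) (hg : g i ≠ 0) :
    (fieldE 0 c q g p ~[𝓝[≠] (c i)] fun x =>
      (|g i / q i| * q i / (4 * π * ‖x - c i‖ ^ 3)) • (x - c i)) ∧
    (fieldH 0 c q g p ~[𝓝[≠] (c i)] fun x =>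
      (|q i / g i| * g i / (4 * π * ‖x - c i‖ ^ 3)) • (x - c i)) := by
  have hp := h.tendsto_ratio hc hq hg
  have h0 : |q i / g i| ≠ 0 := abs_ne_zero.2 (div_ne_zero hq hg)
  constructor
  · have h1 : (fun x => (p x)⁻¹) ~[𝓝[≠] (c i)] fun _ => |q i / g i|⁻¹ :=
      (isEquivalent_const_iff_tendsto (inv_ne_zero h0)).2 (hp.inv₀ h0)
    refine (h1.smul (coulomb_isEquivalent_center hc hq)).congr_left ?_ |>.congr_right ?_
    · exact .of_forall fun x => by simp [fieldE, dyonicE]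
    · refine .of_forall fun x => ?_
      simp only [kernel, smul_smul]
      rw [← abs_inv, inv_div]
      congr 1
      field_simp
  · have h1 : p ~[𝓝[≠] (c i)] fun _ => |q i / g i| := (isEquivalent_const_iff_tendsto h0).2 hp
    refine (h1.smul (coulomb_isEquivalent_center hc hg)).congr_left ?_ |>.congr_right ?_
    · exact .of_forall fun x => by simp [fieldH, dyonicH]
    · refine .of_forall fun x => ?_
      simp only [kernel, smul_smul]
      congr 1
      field_simp

end RootField

end

/-! ### Energy and free charges of a dyonic field -/

lemma inner_isLittleO {l : Filter V3} (hG : G =o[l] fun x => (‖x - a‖ ^ 2)⁻¹) :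
    (fun x => ⟪G x, x - a⟫) =o[l] fun x => ‖x - a‖⁻¹ := by
  have h1 : (fun x => ‖G x‖ * ‖x - a‖) =o[l] fun x => (‖x - a‖ ^ 2)⁻¹ * ‖x - a‖ :=
    hG.norm_left.mul_isBigO (isBigO_refl _ _)
  refine (IsBigO.of_bound 1 (.of_forall fun x => ?_)).trans_isLittleO (h1.congr_right fun x => ?_)
  · rw [one_mul, norm_mul, norm_norm, norm_norm]
    exact norm_inner_le_norm _ _
  · by_cases hx : ‖x - a‖ = 0
    · simp [hx]
    · field_simp

lemma isLittleO_one_inv_sq (a : V3) : (fun _ => (1 : ℝ)) =o[𝓝[≠] a] fun x => (‖x - a‖ ^ 2)⁻¹ := by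
  refine isLittleO_const_left.2 (Or.inr ?_)
  have h1 : Tendsto (fun x => ‖x - a‖ ^ 2) (𝓝[≠] a) (𝓝[>] 0) :=
    (tendsto_nhdsWithin_iff.2 ⟨tendsto_pow_nhdsGT 2, by
      filter_upwards [self_mem_nhdsWithin] with t ht using mem_Ioi.2 (pow_pos (mem_Ioi.1 ht) 2)⟩).comp
      (tendsto_norm_sub_center a)
  refine (tendsto_inv_nhdsGT_zero.comp h1).congr fun x => ?_
  simp only [comp]
  rw [norm_of_nonneg (by positivity)]

lemma aestronglyMeasurable_indicator {W : Type*} [NormedAddCommGroup W] {F : V3 → W}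
    (hΩ : IsOpen Ω) (hF : ContinuousOn F Ω) : AEStronglyMeasurable (Ω.indicator F) := by
  exact (aestronglyMeasurable_indicator_iff hΩ.measurableSet).2
    (hF.aestronglyMeasurable hΩ.measurableSet)

namespace RootField
lemma exists_bound (h : RootField S S' κ c q g Ω p) (hx : x ∈ (range c)ᶜ) :
    ∃ K M : ℝ, 1 ≤ M ∧ ∀ᶠ y in 𝓝 x, ‖coulomb c q y‖ ≤ K ∧ ‖coulomb c g y‖ ≤ K ∧
      (y ∈ Ω → p y ≤ M) := by
  have hD := (contDiffAt_coulomb q hx).continuousAt.norm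
  have hB := (contDiffAt_coulomb g hx).continuousAt.norm
  set K := max ‖coulomb c q x‖ ‖coulomb c g x‖ + 1 with hK
  have h2 : 0 < S 2 := by
    have := h.response.strictMonoOn (mem_Ioi.2 one_pos) (mem_Ioi.2 two_pos) one_lt_two
    rwa [h.response.one] at this
  have hK0 : 0 ≤ K := by positivity
  refine ⟨K, 2 + K ^ 2 / (2 * S 2), ?_, ?_⟩
  · have : 0 ≤ K ^ 2 / (2 * S 2) := by positivity
    linarith
  filter_upwards [hD.eventually_lt_const (show ‖coulomb c q x‖ < K by
      rw [hK]; linarith [le_max_left ‖coulomb c q x‖ ‖coulomb c g x‖]),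
    hB.eventually_lt_const (show ‖coulomb c g x‖ < K by
      rw [hK]; linarith [le_max_right ‖coulomb c q x‖ ‖coulomb c g x‖])] with y hy1 hy2
  refine ⟨hy1.le, hy2.le, fun hy => ?_⟩
  by_contra! hlt
  have hM2 : 2 ≤ 2 + K ^ 2 / (2 * S 2) := by
    have : 0 ≤ K ^ 2 / (2 * S 2) := by positivity
    linarith
  set M := 2 + K ^ 2 / (2 * S 2) with hM
  have hMK : K ^ 2 < M * (2 * S 2) := by
    rw [hM, add_mul, div_mul_cancel₀ _ (by positivity)]
    linarith
  have h3 : S 2 ≤ S M := h.response.strictMonoOn.monotoneOn (mem_Ioi.2 two_pos)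
    (mem_Ioi.2 (by linarith)) hM2
  have h4 := (h.root y hy).le_of_lt h.response (by linarith) hlt
    (by have : 0 ≤ ‖coulomb c g y‖ ^ 2 := by positivity
        linarith)
  have h5 := (reducedSq_le κ (coulomb c q y) (coulomb c g y)).trans
    (pow_le_pow_left₀ (norm_nonneg _) hy1.le 2)
  have h6 : M * (2 * S 2) ≤ M ^ 2 * (2 * S M + ‖coulomb c g y‖ ^ 2) := by
    have h7 : M ≤ M ^ 2 := by nlinarith
    have h8 : 2 * S 2 ≤ 2 * S M + ‖coulomb c g y‖ ^ 2 := by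
      have : 0 ≤ ‖coulomb c g y‖ ^ 2 := by positivity
      linarith
    gcongr
  linarith

lemma indicator_E_isBigO (h : RootField S S' κ c q g Ω p) (hx : x ∈ (range c)ᶜ) :
    Ω.indicator (fieldE κ c q g p) =O[𝓝 x] fun _ => (1 : ℝ) := by
  obtain ⟨K, M, hM, hb⟩ := h.exists_bound hx
  refine IsBigO.of_bound (1 + (2 * S M + K ^ 2)) ?_
  have hS := h.response.nonneg hM
  filter_upwards [hb] with y hy
  rw [norm_one, mul_one]
  by_cases hyΩ : y ∈ Ω
  · rw [indicator_of_mem hyΩ]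
    have h1 := norm_dyonicE_sq_le (κ := κ) (p := p y) (D := coulomb c q y) (B := coulomb c g y)
    rw [(h.root y hyΩ).div_sq] at h1
    have h2 : S (p y) ≤ S M := h.response.strictMonoOn.monotoneOn (mem_Ioi.2 (h.root y hyΩ).1)
      (mem_Ioi.2 (by linarith)) (hy.2.2 hyΩ)
    have h3 := pow_le_pow_left₀ (norm_nonneg _) hy.2.1 2
    rw [fieldE]
    nlinarith [sq_nonneg (‖dyonicE κ (p y) (coulomb c q y) (coulomb c g y)‖ - 1)]
  · rw [indicator_of_notMem hyΩ, norm_zero]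
    positivity

lemma indicator_H_isBigO (h : RootField S S' κ c q g Ω p) (hx : x ∈ (range c)ᶜ) :
    Ω.indicator (fieldH κ c q g p) =O[𝓝 x] fun _ => (1 : ℝ) := by
  obtain ⟨K, M, hM, hb⟩ := h.exists_bound hx
  obtain ⟨C, hC⟩ := (h.indicator_E_isBigO hx).bound
  refine IsBigO.of_bound (M * K + κ ^ 2 * (K * K) * C) ?_
  filter_upwards [hb, hC] with y hy hy'
  rw [norm_one, mul_one] at hy'
  have hK0 : 0 ≤ K := (norm_nonneg _).trans hy.1
  have hC0 : 0 ≤ C := (norm_nonneg _).trans hy'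
  rw [norm_one, mul_one]
  by_cases hyΩ : y ∈ Ω
  · rw [indicator_of_mem hyΩ] at hy' ⊢
    rw [fieldH, dyonicH_eq_mix]
    refine (norm_sub_le _ _).trans ?_
    rw [norm_smul, norm_smul, norm_eq_abs, norm_eq_abs, abs_of_pos (h.root y hyΩ).1]
    have h1 := hy.2.2 hyΩ
    have h2 := abs_mixCoeff_le (κ := κ) (D := coulomb c q y) (B := coulomb c g y)
    have h3 : |mixCoeff κ (coulomb c q y) (coulomb c g y)| ≤ κ ^ 2 * (K * K) :=
      h2.trans (by gcongr; exacts [hy.2.1, hy.1])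
    gcongr
    exact hy.2.1
  · rw [indicator_of_notMem hyΩ, norm_zero]
    positivity

lemma locallyIntegrableOn (h : RootField S S' κ c q g Ω p) (hc : Injective c)
    (hq : q i ≠ 0) (hF : ContinuousOn F Ω)
    (hb : ∀ x ∈ (range c)ᶜ, Ω.indicator F =O[𝓝 x] fun _ => (1 : ℝ)) :
    LocallyIntegrableOn F (range c)ᶜ := by
  have h1 := locallyIntegrableOn_of_isBigO (aestronglyMeasurable_indicator h.isOpen hF) hb
  have h2 : Ω.indicator F =ᵐ[volume] F := by
    have h3 : ∀ᵐ x, x ∈ Ω := mem_ae_iff.2 (h.measure_compl hc hq)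
    filter_upwards [h3] with x hx
    exact indicator_of_mem hx F
  intro x hx
  obtain ⟨s, hs, h4⟩ := h1 x hx
  exact ⟨s, hs, h4.congr_fun_ae (ae_restrict_of_ae h2)⟩

lemma continuousOn_energyDensity (h : RootField S S' κ c q g Ω p) (M : Model f I S S') :
    ContinuousOn (energyDensity f κ (fieldE κ c q g p) (coulomb c g)) Ω := by
  intro x hx
  have hx' := h.subset hx
  have hp := (h.root x hx).1
  have hpc := (h.contDiffAt hx).continuousAt
  have hS : ContinuousAt (fun y => S (p y)) x :=
    ContinuousAt.comp (g := S) (M.response.hasDerivAt _ hp).continuousAt hpc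
  have h1 : ContinuousAt (fun y => reducedSq κ (coulomb c q y) (coulomb c g y) / p y - f (S (p y)))
      x :=
    ((contDiffAt_reducedSq (contDiffAt_coulomb q hx') (contDiffAt_coulomb g hx')).continuousAt.div
      hpc hp.ne').sub (ContinuousAt.comp (g := f) (M.hasDerivAt hp).continuousAt hS)
  refine (h1.congr ?_).continuousWithinAt
  filter_upwards [h.isOpen.mem_nhds hx] with y hy
  exact (h.energyDensity_eq M hy).symm

/-- Off the centers, the energy density on `Ω` is locally bounded, also at the points which do not
belong to `Ω`. -/
lemma indicator_energy_isBigO (h : RootField S S' κ c q g Ω p) (M : Model f I S S')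
    (hb : Ω = (range c)ᶜ ∨ ∀ m : ℝ, ∃ C, ∀ t, 0 < t → t ≤ m → |f (S t)| ≤ C)
    (hx : x ∈ (range c)ᶜ) :
    Ω.indicator (energyDensity f κ (fieldE κ c q g p) (coulomb c g)) =O[𝓝 x] fun _ => (1 : ℝ) := by
  rcases hb with rfl | hb
  · have h1 := (h.continuousOn_energyDensity M).continuousAt (h.isOpen.mem_nhds hx)
    refine (h1.norm.isBoundedUnder_le.isBigO_one ℝ).congr' ?_ EventuallyEq.rfl
    filter_upwards [h.isOpen.mem_nhds hx] with y hy
    rw [indicator_of_mem hy]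
  · obtain ⟨K, m, hm, hbd⟩ := h.exists_bound hx
    obtain ⟨C, hC⟩ := hb m
    have hS := h.response.nonneg hm
    have hC0 : 0 ≤ C := (abs_nonneg _).trans (hC m (by linarith) le_rfl)
    refine IsBigO.of_bound (m * (2 * S m + K ^ 2) + C) ?_
    filter_upwards [hbd] with y hy
    have hK0 : 0 ≤ K := (norm_nonneg _).trans hy.1
    rw [norm_one, mul_one]
    by_cases hyΩ : y ∈ Ω
    · rw [indicator_of_mem hyΩ, h.energyDensity_eq M hyΩ, norm_eq_abs]
      have hp := (h.root y hyΩ).1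
      have h1 : reducedSq κ (coulomb c q y) (coulomb c g y) / p y =
          p y * (2 * S (p y) + ‖coulomb c g y‖ ^ 2) := by
        rw [← (h.root y hyΩ).2]
        field_simp
      have h0 : 0 ≤ reducedSq κ (coulomb c q y) (coulomb c g y) / p y :=
        div_nonneg (reducedSq_nonneg _ _ _) hp.le
      have h2 : S (p y) ≤ S m := h.response.strictMonoOn.monotoneOn (mem_Ioi.2 hp)
        (mem_Ioi.2 (by linarith)) (hy.2.2 hyΩ)
      have h3 := pow_le_pow_left₀ (norm_nonneg _) hy.2.1 2
      refine (abs_sub _ _).trans (add_le_add ?_ (hC _ hp (hy.2.2 hyΩ)))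
      rw [abs_of_nonneg h0, h1]
      calc p y * (2 * S (p y) + ‖coulomb c g y‖ ^ 2) ≤ p y * (2 * S m + K ^ 2) := by gcongr
        _ ≤ m * (2 * S m + K ^ 2) := by
          have := hy.2.2 hyΩ
          gcongr
    · rw [indicator_of_notMem hyΩ, norm_zero]
      positivity

lemma energyDensity_isBigO_infinity (h : RootField S S' κ c q g Ω p) (M : Model f I S S') :
    energyDensity f κ (fieldE κ c q g p) (coulomb c g) =O[cobounded V3] fun x => (‖x‖ ^ 4)⁻¹ := by
  have hsq : ∀ w : Fin n → ℝ, (fun x => ‖coulomb c w x‖ ^ 2) =O[cobounded V3]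
      fun x => (‖x‖ ^ 4)⁻¹ := fun w =>
    ((coulomb_isBigO_infinity c w).norm_left.pow 2).congr_right fun x => by rw [inv_pow, ← pow_mul]
  have hL : (fun x => reducedSq κ (coulomb c q x) (coulomb c g x)) =O[cobounded V3]
      fun x => (‖x‖ ^ 4)⁻¹ := by
    refine (IsBigO.of_bound 1 (.of_forall fun x => ?_)).trans (hsq q)
    rw [one_mul, norm_of_nonneg (reducedSq_nonneg _ _ _), norm_of_nonneg (by positivity)]
    exact reducedSq_le _ _ _
  have hinv : ∀ k : ℕ, (fun x => (p x ^ k)⁻¹) =O[cobounded V3] fun _ => (1 : ℝ) :=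
    fun k => ((h.tendsto_one.pow k).inv₀ (by simp)).isBigO_one ℝ
  have hS : (fun x => S (p x)) =O[cobounded V3] fun x => (‖x‖ ^ 4)⁻¹ := by
    have h1 := ((hL.mul (hinv 2)).sub ((hsq g).mul (isBigO_refl (fun _ => (1 : ℝ)) _))).const_mul_left
      (1 / 2)
    refine h1.congr' ?_ (.of_forall fun x => by simp)
    filter_upwards [h.infinity] with x hx
    have h2 := (h.root x hx).div_sq
    rw [← div_eq_mul_inv, h2]
    ring
  have hf : (fun x => f (S (p x))) =O[cobounded V3] fun x => S (p x) := by
    have h1 : Tendsto (fun x => S (p x)) (cobounded V3) (𝓝 (S 1)) :=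
      (M.response.hasDerivAt 1 one_pos).continuousAt.tendsto.comp h.tendsto_one
    have h2 := (M.hasDerivAt one_pos).differentiableAt.isBigO_sub.comp_tendsto h1
    simpa [comp_def, M.response.one, M.zero] using h2
  refine (((hL.mul (hinv 1)).sub ((hf.trans hS).mul (isBigO_refl (fun _ => (1 : ℝ)) _)))).congr' ?_
    (.of_forall fun x => by simp)
  filter_upwards [h.infinity] with x hx
  rw [h.energyDensity_eq M hx, pow_one, div_eq_mul_inv, mul_one]

lemma finiteEnergy (h : RootField S S' κ c q g Ω p) (M : Model f I S S') (hc : Injective c)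
    (hn : 1 ≤ n) (hq : ∀ i, q i ≠ 0)
    (hb : Ω = (range c)ᶜ ∨ ∀ m : ℝ, ∃ C, ∀ t, 0 < t → t ≤ m → |f (S t)| ≤ C) (hs : s < 3)
    (hcen : ∀ i, energyDensity f κ (fieldE κ c q g p) (coulomb c g) =O[𝓝[≠] (c i)]
      fun x => ‖x - c i‖ ^ (-s)) :
    FiniteEnergy f κ (fieldE κ c q g p) (coulomb c g) := by
  have h1 := integrable_of_isBigO
    (aestronglyMeasurable_indicator h.isOpen (h.continuousOn_energyDensity M))
    (fun x hx => h.indicator_energy_isBigO M hb hx) hs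
    (fun i => (hcen i).congr' (by
      filter_upwards [h.eventually_mem hc (hq i)] with x hx; rw [indicator_of_mem hx]) EventuallyEq.rfl)
    ((h.energyDensity_isBigO_infinity M).congr' (by
      filter_upwards [h.infinity] with x hx; rw [indicator_of_mem hx]) EventuallyEq.rfl)
  refine h1.congr ?_
  have h3 : ∀ᵐ x, x ∈ Ω := mem_ae_iff.2 (h.measure_compl hc (hq ⟨0, hn⟩))
  filter_upwards [h3] with x hx
  rw [indicator_of_mem hx]

lemma flux_E (h : RootField S S' κ c q g Ω p) :
    (fun x => ⟪fieldE κ c q g p x - coulomb c q x, x⟫) =o[cobounded V3] fun x => ‖x‖⁻¹ := by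
  have h1 : (fun x => fieldE κ c q g p x - coulomb c q x) =o[cobounded V3]
      fun x => (‖x - 0‖ ^ 2)⁻¹ := by
    simp only [sub_zero]
    exact h.isEquivalent_E.isLittleO.trans_isBigO (coulomb_isBigO_infinity c q)
  simpa using inner_isLittleO h1

lemma flux_H (h : RootField S S' κ c q g Ω p) :
    (fun x => ⟪fieldH κ c q g p x - coulomb c g x, x⟫) =o[cobounded V3] fun x => ‖x‖⁻¹ := by
  have h1 : (fun x => fieldH κ c q g p x - coulomb c g x) =o[cobounded V3]
      fun x => (‖x - 0‖ ^ 2)⁻¹ := by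
    simp only [sub_zero]
    exact h.isEquivalent_H.isLittleO.trans_isBigO (coulomb_isBigO_infinity c g)
  simpa using inner_isLittleO h1

lemma dyonicFreeCharge_E (h : RootField S S' κ c q g Ω p) (hc : Injective c)
    (hq : q i ≠ 0) {A : Fin n → ℝ} (hA : ∀ i, (fun x =>
      ⟪fieldE κ c q g p x - coulomb c A x, x - c i⟫) =o[𝓝[≠] (c i)] fun x => ‖x - c i‖⁻¹) :
    DyonicFreeCharge c Ω (fieldE κ c q g p) (∑ i, q i - ∑ i, A i) := by
  refine ⟨hasWeakFreeCharge hc (h.locallyIntegrableOn hc hq h.contDiffOn_E.continuousOn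
    fun x hx => h.indicator_E_isBigO hx) hA h.flux_E, ?_⟩
  rintro rfl
  exact hasFreeCharge hc h.contDiffOn_E hA h.flux_E

lemma dyonicFreeCharge_H (h : RootField S S' κ c q g Ω p) (hc : Injective c)
    (hq : q i ≠ 0) {A : Fin n → ℝ} (hA : ∀ i, (fun x =>
      ⟪fieldH κ c q g p x - coulomb c A x, x - c i⟫) =o[𝓝[≠] (c i)] fun x => ‖x - c i‖⁻¹) :
    DyonicFreeCharge c Ω (fieldH κ c q g p) (∑ i, g i - ∑ i, A i) := by
  refine ⟨hasWeakFreeCharge hc (h.locallyIntegrableOn hc hq h.contDiffOn_H.continuousOn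
    fun x hx => h.indicator_H_isBigO hx) hA h.flux_H, ?_⟩
  rintro rfl
  exact hasFreeCharge hc h.contDiffOn_H hA h.flux_H

end RootField

/-! ### Dyonic fields at the centers -/

namespace RootField
/-- For `κ > 0`, `L` is bounded at the centers: it contains `D²` only up to multiples of `B`, and
subtracting `(q i / g i) B` from `D` removes the singularity. -/
lemma reducedSq_isBigO_one (hc : Injective c) (hκ : 0 < κ) (hg : g i ≠ 0) :
    (fun x => reducedSq κ (coulomb c q x) (coulomb c g x)) =O[𝓝[≠] (c i)] fun _ => (1 : ℝ) := by
  have h1 := (coulomb_sub_isBigO (q := q) hc i).sub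
    ((coulomb_sub_isBigO (q := g) hc i).const_smul_left (q i / g i))
  have h2 : (fun x => coulomb c q x - (q i / g i) • coulomb c g x) =O[𝓝[≠] (c i)]
      fun _ => (1 : ℝ) := by
    refine h1.congr_left fun x => ?_
    rw [Pi.smul_apply, smul_sub, smul_smul, show q i / g i * (g i / (4 * π)) = q i / (4 * π) by
      field_simp]
    abel
  obtain ⟨C, hC⟩ := h2.bound
  refine IsBigO.of_bound (C ^ 2 + (q i / g i) ^ 2 / κ ^ 2) ?_
  filter_upwards [hC] with x hx
  rw [norm_one, mul_one] at hx
  rw [norm_one, mul_one, norm_of_nonneg (reducedSq_nonneg _ _ _)]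
  have h3 := reducedSq_le_sub (κ := κ) (D := coulomb c q x) (B := coulomb c g x) (q i / g i)
  have h4 := pow_le_pow_left₀ (norm_nonneg _) hx 2
  have h5 : reducedSq κ (coulomb c q x) (coulomb c g x) ≤
      (κ ^ 2 * ‖coulomb c q x - (q i / g i) • coulomb c g x‖ ^ 2 + (q i / g i) ^ 2) / κ ^ 2 := by
    rw [le_div_iff₀ (by positivity), mul_comm]
    exact h3
  refine h5.trans ?_
  rw [add_div, mul_div_cancel_left₀ _ (by positivity)]
  gcongr

lemma reducedSq_lower (hc : Injective c) (hκ : 0 < κ) (hq : q i ≠ 0) :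
    ∃ ℓ > 0, ∀ᶠ x in 𝓝[≠] (c i), ℓ ≤ reducedSq κ (coulomb c q x) (coulomb c g x) := by
  have hpi := pi_pos
  have hρ : Tendsto (fun x => ‖x - c i‖ ^ 4) (𝓝[≠] (c i)) (𝓝 0) :=
    (tendsto_pow_nhdsGT 4).comp (tendsto_norm_sub_center (c i))
  have h1 := tendsto_sq_norm_coulomb (q := q) hc i
  have h2 := tendsto_sq_norm_coulomb (q := g) hc i
  have hq0 : 0 < |q i / (4 * π)| := abs_pos.2 (div_ne_zero hq (by positivity))
  -- the data are rescaled with the distance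
  set ℓ := (|q i / (4 * π)| / 2) ^ 2 / (1 + κ ^ 2 * (|g i / (4 * π)| + 1) ^ 2) with hℓ
  refine ⟨ℓ, by positivity, ?_⟩
  filter_upwards [h1.eventually_const_lt (half_lt_self hq0), h2.eventually_lt_const (lt_add_one _),
    hρ.eventually_lt_const one_pos, self_mem_nhdsWithin] with x hx1 hx2 hx3 hx4
  have h0 : 0 < ‖x - c i‖ := norm_sub_pos_iff.2 hx4
  refine le_trans ?_ le_reducedSq
  have h3 : ‖coulomb c q x‖ ^ 2 / (1 + κ ^ 2 * ‖coulomb c g x‖ ^ 2) =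
      (‖x - c i‖ ^ 2 * ‖coulomb c q x‖) ^ 2 /
        (‖x - c i‖ ^ 4 + κ ^ 2 * (‖x - c i‖ ^ 2 * ‖coulomb c g x‖) ^ 2) := by
    field_simp
  rw [h3, hℓ]
  gcongr

/-- For `κ > 0`, `p` tends to zero at the centers, since `B² → ∞` and `L` is bounded. -/
lemma tendsto_zero (h : RootField S S' κ c q g Ω p) (hc : Injective c) (hκ : 0 < κ)
    (hq : q i ≠ 0) (hg : g i ≠ 0) : Tendsto p (𝓝[≠] (c i)) (𝓝[>] 0) := by
  have hmem := h.eventually_mem hc hq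
  have hb : Tendsto (fun x => ‖coulomb c g x‖ ^ 2) (𝓝[≠] (c i)) atTop :=
    (tendsto_pow_atTop two_ne_zero).comp (tendsto_norm_coulomb_atTop hc hg)
  obtain ⟨C, hC⟩ := (reducedSq_isBigO_one (q := q) hc hκ hg).bound
  refine tendsto_nhdsWithin_iff.2 ⟨?_, hmem.mono fun x hx => (h.root x hx).1⟩
  refine tendsto_order.2 ⟨fun a ha => hmem.mono fun x hx => ha.trans (h.root x hx).1,
    fun a ha => ?_⟩
  have ha2 : 0 < a / 2 := half_pos ha
  have h1 : Tendsto (fun x => (a / 2) ^ 2 * (2 * S (a / 2) + ‖coulomb c g x‖ ^ 2)) (𝓝[≠] (c i))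
      atTop := (tendsto_atTop_add_const_left _ _ hb).const_mul_atTop (by positivity)
  filter_upwards [hmem, hC, h1.eventually_gt_atTop (max C 0)] with x hx hx1 hx2
  by_contra! hlt
  rw [norm_one, mul_one, norm_of_nonneg (reducedSq_nonneg _ _ _)] at hx1
  have h2 : 0 < (a / 2) ^ 2 * (2 * S (a / 2) + ‖coulomb c g x‖ ^ 2) :=
    (le_max_right C 0).trans_lt hx2
  have h3 := (h.root x hx).le_of_lt h.response ha2 (by linarith)
    (pos_of_mul_pos_right h2 (by positivity)).le
  linarith [le_max_left C 0]

lemma inv_isBigO (h : RootField S S' κ c q g Ω p) (hc : Injective c) (hκ : 0 < κ)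
    (hq : q i ≠ 0) (hg : g i ≠ 0) :
    (fun x => (p x)⁻¹) =O[𝓝[≠] (c i)] fun x => (‖x - c i‖ ^ 2)⁻¹ := by
  obtain ⟨ℓ, hℓ, hL⟩ := reducedSq_lower (g := g) hc hκ hq
  refine IsBigO.trans (IsBigO.of_bound (√ℓ)⁻¹ ?_) (coulomb_isBigO_center (q := g) hc i)
  have hp := h.tendsto_zero hc hκ hq hg
  filter_upwards [hL, h.eventually_mem hc hq,
    (tendsto_nhdsWithin_iff.1 hp).1.eventually_lt_const one_pos] with x h1 h2 h3
  have h4 := h.root x h2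
  have h5 : p x ^ 2 * ‖coulomb c g x‖ ^ 2 ≥ ℓ := by
    have h6 := h.response.neg h4.1 h3
    have h7 : p x ^ 2 * (2 * S (p x)) ≤ 0 :=
      mul_nonpos_of_nonneg_of_nonpos (by positivity) (by linarith)
    have h8 := h4.2
    rw [mul_add] at h8
    linarith
  have h6 : √ℓ ≤ p x * ‖coulomb c g x‖ := by
    rw [← mul_pow] at h5
    have h9 := h4.1
    exact Real.sqrt_le_iff.2 ⟨by positivity, h5⟩
  have h7 := Real.sqrt_pos.2 hℓ
  rw [norm_inv, norm_of_nonneg h4.1.le, inv_mul_eq_div, le_div_iff₀ h7, inv_mul_le_iff₀ h4.1]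
  exact h6

lemma isBigO_one_of_sq_le {l : Filter V3} {W : Type*} [SeminormedAddCommGroup W] {F : V3 → W}
    {G : V3 → ℝ}
    (hG : G =O[l] fun _ => (1 : ℝ)) {C : ℝ} (h : ∀ x, ‖F x‖ ^ 2 ≤ C * G x) :
    F =O[l] fun _ => (1 : ℝ) := by
  have h1 : (fun x => ‖F x‖ ^ 2) =O[l] fun _ => (1 : ℝ) ^ 2 := by
    refine IsBigO.trans (IsBigO.of_bound |C| (.of_forall fun x => ?_))
      (hG.congr_right fun _ => (one_pow 2).symm)
    rw [norm_of_nonneg (by positivity)]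
    refine (h x).trans ((le_abs_self _).trans ?_)
    rw [abs_mul, norm_eq_abs]
  exact (IsBigO.of_pow (n := 2) two_ne_zero h1).of_norm_left

/-- The radial component of `E` is small: the field `E` is nearly orthogonal to `B`. -/
lemma inner_E_isBigO (h : RootField S S' κ c q g Ω p) (hc : Injective c) (hκ : 0 < κ)
    (hq : q i ≠ 0) (hg : g i ≠ 0) :
    (fun x => ⟪fieldE κ c q g p x, x - c i⟫) =O[𝓝[≠] (c i)] fun x => ‖x - c i‖ := by
  have hpi := pi_pos
  have hL := reducedSq_isBigO_one (q := q) hc hκ hg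
  set w : V3 → V3 := fun x => coulomb c q x - mixCoeff κ (coulomb c q x) (coulomb c g x) •
    coulomb c g x with hw
  have hw1 : w =O[𝓝[≠] (c i)] fun _ => (1 : ℝ) := isBigO_one_of_sq_le hL (C := 1) fun x => by
      rw [one_mul]
      exact norm_sub_mix_sq_le
  have hB1 : (fun x => ⟪coulomb c g x, w x⟫) =O[𝓝[≠] (c i)] fun _ => (1 : ℝ) :=
    isBigO_one_of_sq_le hL (C := (κ ^ 2)⁻¹) fun x => by
      have h1 := norm_sq_sub_mix (κ := κ) (D := coulomb c q x) (B := coulomb c g x)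
      rw [norm_eq_abs, sq_abs, inv_mul_eq_div, le_div_iff₀ (by positivity), mul_comm, ← h1]
      linarith [sq_nonneg ‖coulomb c q x - mixCoeff κ (coulomb c q x) (coulomb c g x) •
        coulomb c g x‖]
  have hB2 : (fun x => ⟪coulomb c g x - (g i / (4 * π)) • kernel (x - c i), w x⟫)
      =O[𝓝[≠] (c i)] fun _ => (1 : ℝ) := by
    refine IsBigO.trans (IsBigO.of_bound 1 (.of_forall fun x => ?_))
      (((coulomb_sub_isBigO (q := g) hc i).norm_left.mul hw1.norm_left).congr_right
        fun _ => one_mul 1)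
    rw [one_mul, norm_mul, norm_norm, norm_norm]
    exact norm_inner_le_norm _ _
  have h3 := ((h.inv_isBigO hc hκ hq hg).mul
    ((isBigO_refl (fun x => ‖x - c i‖ ^ 3) (𝓝[≠] (c i))).mul (hB1.sub hB2))).const_mul_left
      (4 * π / g i)
  refine h3.congr' ?_ ?_
  · filter_upwards [self_mem_nhdsWithin] with x hx
    have h0 : 0 < ‖x - c i‖ := norm_sub_pos_iff.2 hx
    rw [← inner_sub_left, sub_sub_cancel, fieldE, dyonicE_eq_smul, inner_smul_left, conj_trivial,
      inner_smul_left, conj_trivial, kernel, inner_smul_left, conj_trivial, real_inner_comm]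
    field_simp
    rfl
  · filter_upwards [self_mem_nhdsWithin] with x hx
    have h0 : 0 < ‖x - c i‖ := norm_sub_pos_iff.2 hx
    field_simp

lemma norm_isLittleO_inv (a : V3) : (fun x => ‖x - a‖) =o[𝓝[≠] a] fun x => ‖x - a‖⁻¹ := by
  refine isLittleO_of_le_mul (tendsto_sq_sub_center a) (fun x => norm_nonneg _) ?_
  filter_upwards [self_mem_nhdsWithin] with x hx
  have h0 : 0 < ‖x - a‖ := norm_sub_pos_iff.2 hx
  rw [norm_norm, norm_inv, norm_norm]
  exact le_of_eq (by field_simp)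

lemma flux_E_center (h : RootField S S' κ c q g Ω p) (hc : Injective c) (hκ : 0 < κ)
    (hq : q i ≠ 0) (hg : g i ≠ 0) :
    (fun x => ⟪fieldE κ c q g p x - coulomb c 0 x, x - c i⟫) =o[𝓝[≠] (c i)]
      fun x => ‖x - c i‖⁻¹ := by
  simp only [coulomb_zero, Pi.zero_apply, sub_zero]
  exact (h.inner_E_isBigO hc hκ hq hg).trans_isLittleO (norm_isLittleO_inv _)

lemma flux_H_center (h : RootField S S' κ c q g Ω p) (hc : Injective c) (hκ : 0 < κ)
    (hq : q i ≠ 0) (hg : g i ≠ 0) :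
    (fun x => ⟪fieldH κ c q g p x - coulomb c 0 x, x - c i⟫) =o[𝓝[≠] (c i)]
      fun x => ‖x - c i‖⁻¹ := by
  simp only [coulomb_zero, Pi.zero_apply, sub_zero]
  have hp := (tendsto_nhdsWithin_iff.1 (h.tendsto_zero hc hκ hq hg)).1
  have h1 : (fun x => p x • coulomb c g x) =o[𝓝[≠] (c i)] fun x => (‖x - c i‖ ^ 2)⁻¹ := by
    have h2 := ((isLittleO_one_iff ℝ).2 hp).smul_isBigO (coulomb_isBigO_center (q := g) hc i)
    simpa using h2
  have hm : (fun x => mixCoeff κ (coulomb c q x) (coulomb c g x)) =O[𝓝[≠] (c i)] fun _ => (1 : ℝ) :=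
    isBigO_one_of_sq_le (reducedSq_isBigO_one (q := q) hc hκ hg) (C := κ ^ 2) fun x => by
      rw [norm_eq_abs, sq_abs]
      exact mixCoeff_sq_le
  have h2 := hm.mul_isLittleO ((h.inner_E_isBigO hc hκ hq hg).trans_isLittleO (norm_isLittleO_inv _))
  refine ((inner_isLittleO h1).sub (h2.congr_right fun x => one_mul _)).congr_left fun x => ?_
  rw [fieldH, dyonicH_eq_mix, inner_sub_left, inner_smul_left (dyonicE _ _ _ _), conj_trivial]

lemma energy_center (h : RootField S S' κ c q g Ω p) (M : Model f I S S')
    (hc : Injective c) (hκ : 0 < κ) (hq : q i ≠ 0) (hg : g i ≠ 0) :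
    energyDensity f κ (fieldE κ c q g p) (coulomb c g) =O[𝓝[≠] (c i)]
      fun x => ‖x - c i‖ ^ (-(2 : ℝ)) := by
  have h0 : (fun x => ‖x - c i‖ ^ (-(2 : ℝ))) = fun x => (‖x - c i‖ ^ 2)⁻¹ := funext fun x => by
    rw [rpow_neg (norm_nonneg _), rpow_two]
  rw [h0]
  have hinv := h.inv_isBigO hc hκ hq hg
  obtain ⟨C, hC0, hC⟩ := M.small
  have h1 : (fun x => f (S (p x))) =O[𝓝[≠] (c i)] fun x => (‖x - c i‖ ^ 2)⁻¹ := by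
    refine IsBigO.trans (IsBigO.of_bound C ?_) hinv
    filter_upwards [h.eventually_mem hc hq, (tendsto_nhdsWithin_iff.1
      (h.tendsto_zero hc hκ hq hg)).1.eventually_lt_const one_pos] with x hx hx1
    have h2 := (h.root x hx).1
    rw [norm_inv, norm_eq_abs, norm_of_nonneg h2.le, ← div_eq_mul_inv]
    exact hC _ h2 hx1.le
  have h2 := ((reducedSq_isBigO_one (q := q) hc hκ hg).mul hinv).congr_right fun x => one_mul _
  refine (h2.sub h1).congr' ?_ EventuallyEq.rfl
  filter_upwards [h.eventually_mem hc hq] with x hx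
  rw [h.energyDensity_eq M hx, div_eq_mul_inv]

/-- For `κ = 0`, the energy density is singular like the inverse fourth power of the distance. -/
lemma not_finiteEnergy (h : RootField S S' 0 c q g Ω p) (M : Model f I S S')
    (hc : Injective c) (hq : q i ≠ 0) (hg : g i ≠ 0) :
    ¬ FiniteEnergy f 0 (fieldE 0 c q g p) (coulomb c g) := by
  have hpi := pi_pos
  refine not_integrable_of_isBigO (a := c i) ?_
  have hp := h.tendsto_ratio hc hq hg
  have hr : 0 < |q i / g i| := abs_pos.2 (div_ne_zero hq hg)
  have hρ : Tendsto (fun x => ‖x - c i‖ ^ 4) (𝓝[≠] (c i)) (𝓝 0) :=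
    (tendsto_pow_nhdsGT 4).comp (tendsto_norm_sub_center (c i))
  have h1 := (tendsto_sq_norm_coulomb (q := q) hc i).pow 2
  have hf : Tendsto (fun x => f (S (p x))) (𝓝[≠] (c i)) (𝓝 (f (S |q i / g i|))) :=
    (M.hasDerivAt hr).continuousAt.tendsto.comp
      ((M.response.hasDerivAt _ hr).continuousAt.tendsto.comp hp)
  have h2 := (h1.div hp hr.ne').sub (hρ.mul hf)
  rw [zero_mul, sub_zero] at h2
  set ℓ := |q i / (4 * π)| ^ 2 / |q i / g i| with hℓ
  have hℓ0 : 0 < ℓ := by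
    have : 0 < |q i / (4 * π)| := abs_pos.2 (div_ne_zero hq (by positivity))
    positivity
  refine IsBigO.of_bound (2 / ℓ) ?_
  filter_upwards [h2.eventually_const_lt (half_lt_self hℓ0), h.eventually_mem hc hq,
    self_mem_nhdsWithin] with x hx hxΩ hx0
  have h0 : 0 < ‖x - c i‖ := norm_sub_pos_iff.2 hx0
  rw [h.energyDensity_eq M hxΩ, reducedSq_zero, norm_of_nonneg (by positivity)]
  have h3 : ℓ / 2 < ‖x - c i‖ ^ 4 * (‖coulomb c q x‖ ^ 2 / p x - f (S (p x))) := by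
    refine hx.trans_eq ?_
    simp only [Pi.div_apply]
    ring
  rw [inv_eq_one_div, div_le_iff₀ (by positivity), div_mul_eq_mul_div, div_mul_eq_mul_div,
    le_div_iff₀ hℓ0, one_mul]
  have h4 := le_abs_self (‖coulomb c q x‖ ^ 2 / p x - f (S (p x)))
  rw [norm_eq_abs]
  have h5 : 0 < ‖x - c i‖ ^ 4 := by positivity
  nlinarith

lemma flux_center_of_isEquivalent (hc : Injective c) {A : Fin n → ℝ} {a : ℝ}
    (hA : A i = a) (hF : F ~[𝓝[≠] (c i)] fun x => (a / (4 * π * ‖x - c i‖ ^ 3)) • (x - c i)) :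
    (fun x => ⟪F x - coulomb c A x, x - c i⟫) =o[𝓝[≠] (c i)] fun x => ‖x - c i‖⁻¹ := by
  refine inner_isLittleO ?_
  have h0 : (fun x => (a / (4 * π * ‖x - c i‖ ^ 3)) • (x - c i)) =
      fun x => (A i / (4 * π)) • kernel (x - c i) := funext fun x => by
    rw [kernel, smul_smul, hA]
    congr 1
    field_simp
  rw [h0] at hF
  have h1 : (fun x => (A i / (4 * π)) • kernel (x - c i)) =O[𝓝[≠] (c i)]
      fun x => (‖x - c i‖ ^ 2)⁻¹ := by
    refine IsBigO.of_bound |A i / (4 * π)| (.of_forall fun x => ?_)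
    rw [norm_smul, norm_kernel, norm_eq_abs, norm_of_nonneg (by positivity)]
  have h2 := (hF.isLittleO.trans_isBigO h1).sub
    ((coulomb_sub_isBigO (q := A) hc i).trans_isLittleO (isLittleO_one_inv_sq (c i)))
  refine h2.congr_left fun x => ?_
  simp

lemma abs_div_mul_eq {a : ℝ} (hb : b ≠ 0) : |a / b| * b = |a| * sign b := by
  rcases lt_or_gt_of_ne hb with h | h
  · rw [abs_div, abs_of_neg h, Real.sign_of_neg h]
    field_simp
  · rw [abs_div, abs_of_pos h, Real.sign_of_pos h]
    field_simp

theorem dyonicSolution (h : RootField S S' κ c q g Ω p) (M : Model f I S S')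
    (hb : Ω = (range c)ᶜ ∨ ∀ m : ℝ, ∃ C, ∀ t, 0 < t → t ≤ m → |f (S t)| ≤ C)
    (hn : 1 ≤ n) (hc : Injective c) (hq : ∀ i, q i ≠ 0) (hg : ∀ i, g i ≠ 0)
    (hκ : 0 ≤ κ) :
    DyonicSolution f I κ c q g Ω (fieldE κ c q g p) (fieldH κ c q g p) where
  null := h.measure_compl hc (hq ⟨0, hn⟩)
  solution := h.isStaticSolution M
  infinity_E := h.isEquivalent_E
  infinity_H := h.isEquivalent_H
  energy := by
    constructor
    · intro hE
      by_contra hκ'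
      obtain rfl : κ = 0 := le_antisymm (not_lt.1 hκ') hκ
      exact h.not_finiteEnergy M hc (hq ⟨0, hn⟩) (hg ⟨0, hn⟩) hE
    · exact fun hκ => h.finiteEnergy M hc hn hq hb (by norm_num) fun i =>
        h.energy_center M hc hκ (hq i) (hg i)
  free_charge_pos hκ := by
    have h1 := h.dyonicFreeCharge_E hc (hq ⟨0, hn⟩) (A := 0) fun i =>
      h.flux_E_center hc hκ (hq i) (hg i)
    have h2 := h.dyonicFreeCharge_H hc (hq ⟨0, hn⟩) (A := 0) fun i =>
      h.flux_H_center hc hκ (hq i) (hg i)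
    simp only [Pi.zero_apply, Finset.sum_const_zero, sub_zero] at h1 h2
    exact ⟨h1, h2⟩
  free_charge_zero hκ := by
    subst hκ
    exact ⟨h.dyonicFreeCharge_E hc (hq ⟨0, hn⟩) fun i =>
        flux_center_of_isEquivalent hc (abs_div_mul_eq (hq i)).symm
          (h.local_zero hc (hq i) (hg i)).1,
      h.dyonicFreeCharge_H hc (hq ⟨0, hn⟩) fun i =>
        flux_center_of_isEquivalent hc (abs_div_mul_eq (hg i)).symm
          (h.local_zero hc (hq i) (hg i)).2⟩
  local_zero hκ i := by
    subst hκ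
    exact h.local_zero hc (hq i) (hg i)
  nonconservative hn := h.nonconservative_iff hc hκ hn hq hg

end RootField

section

/-! ### The logarithmic, exponential and quadratic models -/

variable {β : ℝ}

lemma response_log (hβ : 0 < β) : Response (fun p => (1 - p⁻¹) / β) (fun p => (p ^ 2)⁻¹ / β) where
  hasDerivAt p hp := by
    have h1 := ((hasDerivAt_inv hp.ne').const_sub 1).div_const β
    simpa using h1
  continuousOn := by
    refine ContinuousOn.div_const (ContinuousOn.inv₀ (by fun_prop) fun p hp => ?_) β
    exact pow_ne_zero 2 (ne_of_gt hp)
  pos p hp := by positivity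
  one := by simp
  limits := by
    refine ⟨1 / β, ?_, ?_⟩
    · have h1 : (fun p : ℝ => (p - 1) / β) ⇝ ((0 - 1) / β) :=
        (tendsto_self_nhdsGT.sub_const 1).div_const β
      rw [zero_sub, neg_div] at h1
      refine h1.congr' ?_
      filter_upwards [self_mem_nhdsWithin] with p hp
      have := ne_of_gt (mem_Ioi.1 hp)
      field_simp
    · refine tendsto_const_nhds.congr' ?_
      filter_upwards [self_mem_nhdsWithin] with p hp
      have := ne_of_gt (mem_Ioi.1 hp)
      field_simp
  exponent k hk := by
    refine ⟨-1, by norm_num, ?_⟩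
    have h1 : (fun p : ℝ => 2 / (2 * (p - 1) - k * β * p)) ⇝ (2 / (2 * (0 - 1) - k * β * 0)) :=
      tendsto_const_nhds.div (((tendsto_self_nhdsGT.sub_const 1).const_mul 2).sub
        (tendsto_self_nhdsGT.const_mul (k * β))) (by norm_num)
    have h2 : (2 : ℝ) / (2 * (0 - 1) - k * β * 0) = -1 := by norm_num
    rw [h2] at h1
    refine h1.congr' ?_
    filter_upwards [self_mem_nhdsWithin] with p hp
    have hp' := mem_Ioi.1 hp
    have h3 : 2 * ((1 - p⁻¹) / β) - k = (2 * (p - 1) - k * β * p) / (β * p) := by field_simp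
    rw [h3]
    by_cases h4 : 2 * (p - 1) - k * β * p = 0
    · simp [h4]
    · field_simp
  ratio k hk p₁ p₂ h₁ h₂ h := by
    have e : ∀ p : ℝ → ℝ, Tendsto p (𝓝[>] 0) (𝓝[>] 0) →
        (fun t => 2 * (p t - 1) - k * β * p t) ⇝ (-2) := fun p hp => by
      have h0 := (tendsto_nhdsWithin_iff.1 hp).1
      have h1 := ((h0.sub_const 1).const_mul 2).sub (h0.const_mul (k * β))
      simpa using h1
    have h1 := (h.inv₀ one_ne_zero).mul ((e p₁ h₁).div (e p₂ h₂) (by norm_num))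
    rw [div_self (by norm_num), inv_one, one_mul] at h1
    refine h1.congr' ?_
    filter_upwards [(tendsto_nhdsWithin_iff.1 h₁).2, (tendsto_nhdsWithin_iff.1 h₂).2] with t h3 h4
    have h3' := mem_Ioi.1 h3
    have h4' := mem_Ioi.1 h4
    have h5 : ∀ p : ℝ, 0 < p → 2 * ((1 - p⁻¹) / β) - k = (2 * (p - 1) - k * β * p) / (β * p) :=
      fun p hp => by field_simp
    rw [h5 _ h3', h5 _ h4', Pi.div_apply]
    by_cases h6 : 2 * (p₂ t - 1) - k * β * p₂ t = 0
    · simp [h6]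
    · field_simp

lemma fLog_eq (hβ : 0 < β) {p : ℝ} (_hp : 0 < p) : fLog β ((1 - p⁻¹) / β) = Real.log p / β := by
  rw [fLog, mul_div_cancel₀ _ hβ.ne', sub_sub_cancel, Real.log_inv]
  ring

lemma hasDerivAt_fLog (hβ : 0 < β) (hs : s < 1 / β) : HasDerivAt (fLog β) (1 - β * s)⁻¹ s := by
  have h0 : 1 - β * s ≠ 0 := by
    rw [lt_div_iff₀ hβ] at hs
    linarith
  have h1 := (((hasDerivAt_id s).const_mul β).const_sub 1).log h0
  refine (h1.const_mul (-(1 / β))).congr_deriv ?_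
  simp only [mul_one, id]
  field_simp

lemma model_log (hβ : 0 < β) : Model (fLog β) (Iio (1 / β)) (fun p => (1 - p⁻¹) / β)
    (fun p => (p ^ 2)⁻¹ / β) where
  response := response_log hβ
  mem p hp := by
    rw [mem_Iio]
    gcongr
    have := inv_pos.2 hp
    linarith
  deriv_eq p hp := by
    rw [(hasDerivAt_fLog hβ _).deriv]
    · rw [mul_div_cancel₀ _ hβ.ne', sub_sub_cancel, inv_inv]
    · gcongr
      have := inv_pos.2 hp
      linarith
  zero := by simp [fLog]
  large p hp := by
    have hp0 : 0 < p := by linarith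
    rw [fLog_eq hβ hp0, abs_of_nonneg (div_nonneg (Real.log_nonneg hp) hβ.le), ← mul_div_assoc]
    gcongr
    rw [mul_sub, mul_inv_cancel₀ hp0.ne', mul_one]
    exact log_le_sub_one_of_pos hp0
  linear := by
    refine ⟨1 / β, by positivity, fun p hp => ?_⟩
    rw [div_mul_eq_mul_div]
    gcongr
    have := inv_pos.2 (show 0 < p by linarith)
    linarith
  small := by
    refine ⟨1 / β, by positivity, fun p hp hp1 => ?_⟩
    rw [fLog_eq hβ hp, abs_div, abs_of_pos hβ, abs_of_nonpos (Real.log_nonpos hp.le hp1),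
      div_right_comm, ← Real.log_inv]
    gcongr
    rw [one_div]
    linarith [log_le_sub_one_of_pos (inv_pos.2 hp)]

lemma tendsto_log_bot {p : ℝ → ℝ} (hp : Tendsto p (𝓝[>] 0) (𝓝[>] 0)) (k : ℝ) (hβ : 0 < β) :
    Tendsto (fun t => 2 * (Real.log (p t) / β) - k) (𝓝[>] 0) atBot := by
  have h1 := ((Real.tendsto_log_nhdsGT_zero.comp hp).const_mul_atBot (show 0 < 2 / β by positivity))
  refine (tendsto_atBot_add_const_right _ (-k) h1).congr fun t => ?_
  simp only [comp]
  ring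

lemma response_exp (hβ : 0 < β) : Response (fun p => Real.log p / β) (fun p => p⁻¹ / β) where
  hasDerivAt p hp := (Real.hasDerivAt_log hp.ne').div_const β
  continuousOn := (continuousOn_id.inv₀ fun _ hp => ne_of_gt hp).div_const β
  pos p hp := by positivity
  one := by simp
  limits := by
    refine ⟨0, ?_, ?_⟩
    · have h2 : (fun p : ℝ => Real.log p * p) ⇝ 0 := by
        simpa using tendsto_log_mul_rpow_nhdsGT_zero one_pos
      have h3 := h2.div_const β
      rw [zero_div] at h3
      rw [neg_zero]
      exact h3.congr fun p => by ring
    · have h1 := tendsto_self_nhdsGT.div_const β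
      rw [zero_div] at h1
      refine h1.congr' ?_
      filter_upwards [self_mem_nhdsWithin] with p hp
      have := ne_of_gt (mem_Ioi.1 hp)
      field_simp
  exponent k hk := by
    refine ⟨0, by norm_num, ?_⟩
    have h1 := (tendsto_log_bot tendsto_id k hβ).const_div_atBot (2 / β)
    refine h1.congr' ?_
    filter_upwards [self_mem_nhdsWithin] with p hp
    have := ne_of_gt (mem_Ioi.1 hp)
    simp only [id]
    congr 1
    field_simp
  ratio k hk p₁ p₂ h₁ h₂ h := by
    have h1 : (fun t => 2 / β * Real.log (p₁ t / p₂ t)) ⇝ 0 := by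
      have h2 := ((Real.continuousAt_log one_ne_zero).tendsto.comp h).const_mul (2 / β)
      simpa [comp_def] using h2
    have h3 := tendsto_log_bot h₂ k hβ
    have h4 := (h1.div_atBot h3).const_add 1
    rw [add_zero] at h4
    refine h4.congr' ?_
    filter_upwards [(tendsto_nhdsWithin_iff.1 h₁).2, (tendsto_nhdsWithin_iff.1 h₂).2,
      h3.eventually_lt_atBot 0] with t h5 h6 h7
    rw [Real.log_div (ne_of_gt h5) (ne_of_gt h6), eq_div_iff h7.ne, add_mul,
      div_mul_cancel₀ _ h7.ne]
    ring

lemma fExp_eq (hβ : 0 < β) {p : ℝ} (hp : 0 < p) : fExp β (Real.log p / β) = (p - 1) / β := by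
  rw [fExp, mul_div_cancel₀ _ hβ.ne', Real.exp_log hp]
  ring

lemma hasDerivAt_fExp (hβ : 0 < β) (s : ℝ) : HasDerivAt (fExp β) (exp (β * s)) s := by
  have h1 := ((((hasDerivAt_id s).const_mul β).exp).sub_const 1).const_mul (1 / β)
  refine h1.congr_deriv ?_
  simp only [mul_one, id]
  field_simp

lemma model_exp (hβ : 0 < β) :
    Model (fExp β) univ (fun p => Real.log p / β) (fun p => p⁻¹ / β) where
  response := response_exp hβ
  mem p hp := mem_univ _
  deriv_eq p hp := by rw [(hasDerivAt_fExp hβ _).deriv, mul_div_cancel₀ _ hβ.ne', Real.exp_log hp]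
  zero := by simp [fExp]
  large p hp := by
    have hp0 : 0 < p := by linarith
    rw [fExp_eq hβ hp0, abs_of_nonneg (div_nonneg (by linarith) hβ.le), ← mul_div_assoc]
    gcongr
    have h1 := mul_le_mul_of_nonneg_left (Real.one_sub_inv_le_log_of_pos hp0) hp0.le
    rwa [mul_sub, mul_inv_cancel₀ hp0.ne', mul_one] at h1
  linear := by
    refine ⟨1 / β, by positivity, fun p hp => ?_⟩
    rw [div_mul_eq_mul_div]
    gcongr
    linarith [log_le_sub_one_of_pos (show 0 < p by linarith)]
  small := by
    refine ⟨1 / β, by positivity, fun p hp hp1 => ?_⟩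
    rw [fExp_eq hβ hp, abs_div, abs_of_pos hβ, abs_of_nonpos (by linarith), div_right_comm]
    gcongr
    rw [le_div_iff₀ hp]
    nlinarith

lemma response_quad (hα : 0 < α) : Response (fun p => (p - 1) / (2 * α)) (fun _ => 1 / (2 * α)) where
  hasDerivAt p hp := ((hasDerivAt_id p).sub_const 1).div_const (2 * α)
  continuousOn := continuousOn_const
  pos p hp := by positivity
  one := by simp
  limits := by
    refine ⟨0, ?_, ?_⟩
    · have h1 := tendsto_self_nhdsGT.mul ((tendsto_self_nhdsGT.sub_const 1).div_const (2 * α))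
      rw [zero_mul] at h1
      rwa [neg_zero]
    · have h1 := (tendsto_self_nhdsGT.pow 2).mul_const (1 / (2 * α))
      rwa [zero_pow two_ne_zero, zero_mul] at h1
  exponent k hk := by
    refine ⟨0, by norm_num, ?_⟩
    have h0 : 2 * ((0 - 1) / (2 * α)) - k ≠ 0 := by
      have : 2 * ((0 - 1) / (2 * α)) - k = -(1 / α + k) := by field_simp; ring
      rw [this]
      have h1 : 0 < 1 / α + k := by positivity
      exact neg_ne_zero.2 h1.ne'
    have h1 := ((tendsto_self_nhdsGT.const_mul 2).mul_const (1 / (2 * α))).div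
      ((((tendsto_self_nhdsGT.sub_const 1).div_const (2 * α)).const_mul 2).sub_const k) h0
    rwa [mul_zero, zero_mul, zero_div] at h1
  ratio k hk p₁ p₂ h₁ h₂ h := by
    have h0 : 2 * ((0 - 1) / (2 * α)) - k ≠ 0 := by
      have : 2 * ((0 - 1) / (2 * α)) - k = -(1 / α + k) := by field_simp; ring
      rw [this]
      have h1 : 0 < 1 / α + k := by positivity
      exact neg_ne_zero.2 h1.ne'
    have e : ∀ p : ℝ → ℝ, Tendsto p (𝓝[>] 0) (𝓝[>] 0) →
        (fun t => 2 * ((p t - 1) / (2 * α)) - k) ⇝ (2 * ((0 - 1) / (2 * α)) - k) := fun p hp =>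
      ((((tendsto_nhdsWithin_iff.1 hp).1.sub_const 1).div_const (2 * α)).const_mul 2).sub_const k
    have h1 := (e p₁ h₁).div (e p₂ h₂) h0
    rwa [div_self h0] at h1

lemma fQuad_eq (hα : 0 < α) (p : ℝ) : fQuad α ((p - 1) / (2 * α)) = (p ^ 2 - 1) / (4 * α) := by
  rw [fQuad]
  field_simp
  ring

lemma hasDerivAt_fQuad (s : ℝ) : HasDerivAt (fQuad α) (1 + 2 * α * s) s := by
  have h1 := (hasDerivAt_id s).add (((hasDerivAt_id s).pow 2).const_mul α)
  refine h1.congr_deriv ?_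
  simp only [id]
  ring

lemma model_quad (hα : 0 < α) :
    Model (fQuad α) univ (fun p => (p - 1) / (2 * α)) (fun _ => 1 / (2 * α)) where
  response := response_quad hα
  mem p hp := mem_univ _
  deriv_eq p hp := by
    rw [(hasDerivAt_fQuad _).deriv]
    field_simp
    ring
  zero := by simp [fQuad]
  large p hp := by
    have h1 : 0 ≤ p ^ 2 - 1 := by nlinarith
    rw [fQuad_eq hα, abs_of_nonneg (by positivity), div_le_iff₀ (by positivity)]
    field_simp
    nlinarith
  linear := by
    refine ⟨1 / (2 * α), by positivity, fun p hp => ?_⟩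
    rw [div_mul_eq_mul_div]
    gcongr
    linarith
  small := by
    refine ⟨1 / (4 * α), by positivity, fun p hp hp1 => ?_⟩
    have h1 : p ^ 2 - 1 ≤ 0 := by nlinarith
    rw [fQuad_eq hα, abs_div, abs_of_pos (show 0 < 4 * α by positivity), abs_of_nonpos h1,
      div_right_comm]
    gcongr
    rw [le_div_iff₀ hp]
    nlinarith [sq_nonneg p, mul_pos hp hp]

lemma fQuad_bdd (hα : 0 < α) (m : ℝ) : ∃ C, ∀ t, 0 < t → t ≤ m → |fQuad α ((t - 1) / (2 * α))| ≤ C := by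
  refine ⟨(m ^ 2 + 1) / (4 * α), fun t ht htm => ?_⟩
  rw [fQuad_eq hα, abs_div, abs_of_pos (show 0 < 4 * α by positivity)]
  gcongr
  have h1 := pow_le_pow_left₀ ht.le htm 2
  rw [abs_le]
  constructor <;> nlinarith [sq_nonneg t]

end

section

/-! ### The roots of the constitutive equations of the three models -/

variable {β : ℝ}

/-- The equation is quadratic in `p`. -/
lemma isRoot_log (hβ : 0 < β) (hL : 0 ≤ L) (hb : 0 ≤ b) :
    IsRoot (fun p => (1 - p⁻¹) / β) L b ((1 + √(1 + β * L * (2 + β * b))) / (2 + β * b)) := by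
  have h0 : 0 ≤ 1 + β * L * (2 + β * b) := by positivity
  have h1 := Real.sq_sqrt h0
  set s := √(1 + β * L * (2 + β * b))
  have hs : 0 ≤ s := Real.sqrt_nonneg _
  have h2 : 0 < 2 + β * b := by positivity
  refine ⟨by positivity, ?_⟩
  have h3 : 1 + s ≠ 0 := by positivity
  have h4 : ((1 + s) / (2 + β * b)) ^ 2 * (2 * ((1 - ((1 + s) / (2 + β * b))⁻¹) / β) + b) =
      (s ^ 2 - 1) / (β * (2 + β * b)) := by
    field_simp
    ring
  rw [h4, h1]
  field_simp
  ring

lemma lambertW_mul_exp {x : ℝ} (hx : 0 ≤ x) : lambertW x * exp (lambertW x) = x := by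
  refine Function.invFunOn_eq (f := fun w : ℝ => w * exp w) ?_
  have h1 : ContinuousOn (fun w : ℝ => w * exp w) (Icc 0 x) := by fun_prop
  have h2 := intermediate_value_Icc hx h1
  obtain ⟨w, hw, hw'⟩ := h2 (show x ∈ Icc (0 * exp 0) (x * exp x) from
    ⟨by simpa using hx, le_mul_of_one_le_right hx (Real.one_le_exp hx)⟩)
  exact ⟨w, mem_Ici.2 (by linarith [hw.1]), hw'⟩

lemma isRoot_exp (hβ : 0 < β) (hL : 0 ≤ L) : IsRoot (fun p => Real.log p / β) L b
      (exp (β * (-b / 2 + 1 / (2 * β) * lambertW (β * exp (β * b) * L)))) := by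
  have h1 := lambertW_mul_exp (show 0 ≤ β * exp (β * b) * L by positivity)
  set w := lambertW (β * exp (β * b) * L)
  refine ⟨Real.exp_pos _, ?_⟩
  beta_reduce
  rw [Real.log_exp, ← Real.exp_nat_mul]
  have h2 : ((2 : ℕ) : ℝ) * (β * (-b / 2 + 1 / (2 * β) * w)) = -(β * b) + w := by
    push_cast
    field_simp
  have h3 : 2 * (β * (-b / 2 + 1 / (2 * β) * w) / β) + b = w / β := by
    field_simp
    ring
  rw [h2, h3, Real.exp_add, Real.exp_neg]
  calc (exp (β * b))⁻¹ * exp w * (w / β)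
      = (exp (β * b))⁻¹ * (w * exp w) / β := by ring
    _ = L := by
      rw [h1]
      have := Real.exp_ne_zero (β * b)
      field_simp

/-! The cubic formula: `C³ = X` where `X` is a root of `X² - 2 (8 γ³ + 108 σ²) X + 64 γ⁶`, and
`u = C + 4 γ² / C` solves `u³ = 12 γ² u + 16 γ³ + 216 σ²`, so that `a = (u - 4 γ) / 6`. -/

lemma cpow_third_pow (z : ℂ) : (z ^ (1 / 3 : ℂ)) ^ 3 = z := by
  have h := Complex.cpow_nat_inv_pow z (n := 3) (by norm_num)
  rwa [show (((3 : ℕ) : ℂ))⁻¹ = 1 / 3 by norm_num] at h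

lemma cpow_half_pow (z : ℂ) : (z ^ (1 / 2 : ℂ)) ^ 2 = z := by
  have h := Complex.cpow_nat_inv_pow z (n := 2) (by norm_num)
  rwa [show (((2 : ℕ) : ℂ))⁻¹ = 1 / 2 by norm_num] at h

/-- The principal cube root has an argument of at most `π / 3`. -/
lemma half_norm_le_re_cpow_third {z : ℂ} (hz : z ≠ 0) :
    ‖z ^ (1 / 3 : ℂ)‖ / 2 ≤ (z ^ (1 / 3 : ℂ)).re := by
  rw [Complex.cpow_def_of_ne_zero hz, Complex.norm_exp, Complex.exp_re]
  have h1 : (Complex.log z * (1 / 3)).im = z.arg / 3 := by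
    rw [show (1 / 3 : ℂ) = ((1 / 3 : ℝ) : ℂ) by norm_num, Complex.im_mul_ofReal, Complex.log_im]
    ring
  have h2 : 1 / 2 ≤ cos (z.arg / 3) := by
    rw [← Real.cos_pi_div_three, ← Real.cos_abs (z.arg / 3)]
    refine Real.cos_le_cos_of_nonneg_of_le_pi (abs_nonneg _) (by linarith [pi_pos]) ?_
    rw [abs_div, abs_of_pos (show (0 : ℝ) < 3 by norm_num)]
    have := Complex.abs_arg_le_pi z
    linarith
  rw [h1]
  have := Real.exp_pos (Complex.log z * (1 / 3)).re
  nlinarith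

/-- The algebra of the cubic formula. -/
lemma cubic_of_real {γ u : ℝ} {C w : ℂ} (hC : C ≠ 0)
    (hw : w ^ 2 = 12 * (γ : ℂ) ^ 3 * s + 81 * (s : ℂ) ^ 2)
    (hC3 : C ^ 3 = 8 * (γ : ℂ) ^ 3 + 108 * s + 12 * w) (hu : (u : ℂ) = C + 4 * γ ^ 2 / C) :
    ((C - 2 * γ) ^ 2 / (6 * C)).re = (u - 4 * γ) / 6 ∧
      (γ + (u - 4 * γ) / 6) ^ 2 * ((u - 4 * γ) / 6) = s := by
  constructor
  · have h1 : (C - 2 * γ) ^ 2 / (6 * C) = (((u - 4 * γ) / 6 : ℝ) : ℂ) := by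
      push_cast
      rw [hu]
      field_simp
      ring
    rw [h1, Complex.ofReal_re]
  · have h1 : (u : ℂ) ^ 3 = 12 * γ ^ 2 * u + 16 * γ ^ 3 + 216 * s := by
      have h2 : (u : ℂ) * C = C ^ 2 + 4 * γ ^ 2 := by
        rw [hu]
        field_simp
      have h3 : ((u : ℂ) ^ 3 - (12 * γ ^ 2 * u + 16 * γ ^ 3 + 216 * s)) * C ^ 3 = 0 := by
        have h4 : ((u : ℂ) ^ 3 - (12 * γ ^ 2 * u + 16 * γ ^ 3 + 216 * s)) * C ^ 3 =
            (C ^ 3) ^ 2 + 64 * γ ^ 6 - (16 * γ ^ 3 + 216 * s) * C ^ 3 := by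
          have h5 : (u : ℂ) ^ 3 * C ^ 3 = (C ^ 2 + 4 * γ ^ 2) ^ 3 := by rw [← h2]; ring
          have h6 : (u : ℂ) * C ^ 3 = (C ^ 2 + 4 * γ ^ 2) * C ^ 2 := by rw [← h2]; ring
          linear_combination h5 - 12 * (γ : ℂ) ^ 2 * h6
        rw [h4, hC3]
        linear_combination 144 * hw
      rcases mul_eq_zero.1 h3 with h | h
      · exact sub_eq_zero.1 h
      · exact absurd h (pow_ne_zero 3 hC)
    have h2 : u ^ 3 = 12 * γ ^ 2 * u + 16 * γ ^ 3 + 216 * s := by exact_mod_cast h1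
    linear_combination h2 / 216

lemma cubicRoot_spec {γ : ℝ} (hs : 0 < s ∨ s = 0 ∧ 0 < γ) :
    0 ≤ cubicRoot γ s ∧ 0 ≤ γ + cubicRoot γ s ∧ (γ + cubicRoot γ s) ^ 2 * cubicRoot γ s = s := by
  set w : ℂ := (12 * (γ : ℂ) ^ 3 * (s : ℂ) + 81 * (s : ℂ) ^ 2) ^ (1 / 2 : ℂ) with hw
  set X : ℂ := 8 * (γ : ℂ) ^ 3 + 108 * (s : ℂ) + 12 * w with hX
  set C : ℂ := X ^ (1 / 3 : ℂ) with hC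
  obtain ⟨Δ, hΔ⟩ : ∃ Δ, Δ = 12 * γ ^ 3 * s + 81 * s ^ 2 := ⟨_, rfl⟩
  have hΔc : 12 * (γ : ℂ) ^ 3 * (s : ℂ) + 81 * (s : ℂ) ^ 2 = Δ := by rw [hΔ]; push_cast; ring
  have hw2 : w ^ 2 = 12 * (γ : ℂ) ^ 3 * (s : ℂ) + 81 * (s : ℂ) ^ 2 := cpow_half_pow _
  have hC3 : C ^ 3 = X := cpow_third_pow X
  obtain ⟨u, hC0, hu, h1, h2⟩ :
      ∃ u : ℝ, C ≠ 0 ∧ (u : ℂ) = C + 4 * γ ^ 2 / C ∧ 4 * γ ≤ u ∧ -(2 * γ) ≤ u := by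
    by_cases hd : 0 ≤ Δ
    · -- `w` and `C` are real
      obtain ⟨r, hr, hwr⟩ : ∃ r : ℝ, 0 ≤ r ∧ w = r := ⟨Δ ^ (1 / 2 : ℝ), Real.rpow_nonneg hd _, by
        rw [hw, hΔc, Complex.ofReal_cpow hd]; norm_num⟩
      have hpos : 0 < 8 * γ ^ 3 + 108 * s + 12 * r := by
        rcases hs with hs | ⟨rfl, hγ⟩
        · have : 0 ≤ 12 * γ ^ 3 + 81 * s := nonneg_of_mul_nonneg_left (by linarith) hs
          linarith
        · positivity
      obtain ⟨v, hv, hCv⟩ : ∃ v : ℝ, 0 < v ∧ C = v :=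
        ⟨(8 * γ ^ 3 + 108 * s + 12 * r) ^ (1 / 3 : ℝ), Real.rpow_pos_of_pos hpos _, by
          rw [Complex.ofReal_cpow hpos.le, hC, hX, hwr]; push_cast; rfl⟩
      have h3 : 4 * |γ| ≤ v + 4 * γ ^ 2 / v := by
        rw [← sub_nonneg, ← sq_abs γ,
          show v + 4 * |γ| ^ 2 / v - 4 * |γ| = (v - 2 * |γ|) ^ 2 / v by field_simp; ring]
        positivity
      exact ⟨v + 4 * γ ^ 2 / v, by rw [hCv]; exact_mod_cast hv.ne', by rw [hCv]; push_cast; rfl,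
        by linarith [le_abs_self γ], by linarith [neg_abs_le γ, abs_nonneg γ]⟩
    · -- `w` is imaginary, so that `|C| = 2 |γ|`
      push Not at hd
      have hs0 : 0 < s := hs.resolve_right fun h => by rw [hΔ, h.1] at hd; norm_num at hd
      have hγ : γ < 0 := by
        by_contra! h
        have : 0 ≤ Δ := by rw [hΔ]; positivity
        linarith
      have hw' : (starRingEnd ℂ) w = -w := by
        refine (sq_eq_sq_iff_eq_or_eq_neg.1
          (by rw [← map_pow, hw2, hΔc, Complex.conj_ofReal])).resolve_left fun h => ?_
        obtain ⟨r, hr⟩ := Complex.conj_eq_iff_real.1 h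
        rw [hr, hΔc] at hw2
        have : r ^ 2 = Δ := by exact_mod_cast hw2
        nlinarith
      have hN : Complex.normSq C = 4 * γ ^ 2 := by
        refine (pow_left_inj₀ (Complex.normSq_nonneg _) (by positivity) three_ne_zero).1 ?_
        have : (Complex.normSq C : ℂ) ^ 3 = (4 * γ ^ 2) ^ 3 := by
          rw [← Complex.mul_conj, mul_pow, ← map_pow, hC3, hX]
          simp only [map_add, map_mul, map_pow, map_ofNat, Complex.conj_ofReal, hw']
          linear_combination -144 * hw2
        exact_mod_cast this
      have hC0 : C ≠ 0 := fun h => by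
        rw [h, map_zero] at hN
        nlinarith
      have h3 := half_norm_le_re_cpow_third (z := X) fun h => hC0 (by
        rw [← pow_eq_zero_iff three_ne_zero, hC3, h])
      have hn : ‖C‖ = 2 * -γ := (pow_left_inj₀ (norm_nonneg _) (by linarith) two_ne_zero).1 (by
        rw [Complex.sq_norm, hN]; ring)
      rw [← hC, hn] at h3
      refine ⟨2 * C.re, hC0, ?_, by linarith, by linarith⟩
      rw [← Complex.add_conj, add_right_inj, eq_div_iff hC0, mul_comm, Complex.mul_conj, hN]
      push_cast
      rfl
  obtain ⟨h3, h4⟩ := cubic_of_real hC0 hw2 hC3 hu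
  rw [show cubicRoot γ s = _ from h3]
  exact ⟨by linarith, by linarith, h4⟩

lemma reducedSq_eq_eta (κ : ℝ) (B : V3) (hD : D ≠ 0) : (1 + κ ^ 2 * etaRatio κ D B) *
      (‖D‖ ^ 2 / (1 + κ ^ 2 * (2 + κ ^ 2 * ‖B‖ ^ 2) * etaRatio κ D B)) = reducedSq κ D B := by
  have hD0 : 0 < ‖D‖ := norm_pos_iff.2 hD
  have h1 := one_add_pos κ B
  have h0 : 0 ≤ κ ^ 2 * (2 + κ ^ 2 * ‖B‖ ^ 2) * ‖cross B D‖ ^ 2 := by positivity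
  rw [reducedSq_eq, etaRatio]
  have hN : 0 < ‖D‖ ^ 2 + κ ^ 2 * (2 + κ ^ 2 * ‖B‖ ^ 2) * ‖cross B D‖ ^ 2 := by positivity
  have hN2 : ‖D‖ ^ 2 + κ ^ 2 * (2 + κ ^ 2 * ‖B‖ ^ 2) * ‖cross B D‖ ^ 2 +
      κ ^ 2 * (2 + κ ^ 2 * ‖B‖ ^ 2) * ⟪B, D⟫ ^ 2 =
      ‖D‖ ^ 2 * (1 + κ ^ 2 * ‖B‖ ^ 2) ^ 2 := by
    rw [norm_cross_sq]
    ring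
  set N := ‖D‖ ^ 2 + κ ^ 2 * (2 + κ ^ 2 * ‖B‖ ^ 2) * ‖cross B D‖ ^ 2
  set t := ⟪B, D⟫ ^ 2
  have h2 : 1 + κ ^ 2 * (2 + κ ^ 2 * ‖B‖ ^ 2) * (t / N) =
      ‖D‖ ^ 2 * (1 + κ ^ 2 * ‖B‖ ^ 2) ^ 2 / N := by
    rw [← hN2]
    field_simp
  have h3 : N = ‖D‖ ^ 2 * (1 + κ ^ 2 * ‖B‖ ^ 2) ^ 2 - κ ^ 2 * (2 + κ ^ 2 * ‖B‖ ^ 2) * t := by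
    linarith
  rw [h2]
  have h4 : (1 + κ ^ 2 * (t / N)) * (‖D‖ ^ 2 / (‖D‖ ^ 2 * (1 + κ ^ 2 * ‖B‖ ^ 2) ^ 2 / N)) =
      (N + κ ^ 2 * t) / (1 + κ ^ 2 * ‖B‖ ^ 2) ^ 2 := by
    field_simp
  rw [h4, h3]
  field_simp
  ring

/-- With `p = 1 - α B² + α (1 + κ² η) a`, the root equation is the cubic equation for `a`. -/
lemma isRoot_quad (hα : 0 < α) (κ : ℝ) (h : D ≠ 0 ∨ α * ‖B‖ ^ 2 < 1) :
    IsRoot (fun p => (p - 1) / (2 * α)) (reducedSq κ D B) (‖B‖ ^ 2) (pQuad α κ D B) := by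
  have hη : 0 ≤ etaRatio κ D B := by
    rw [etaRatio]
    positivity
  set k := 1 + κ ^ 2 * etaRatio κ D B with hk
  set m := 1 + κ ^ 2 * (2 + κ ^ 2 * ‖B‖ ^ 2) * etaRatio κ D B with hm
  have hk0 : 0 < k := by positivity
  have hm0 : 0 < m := by positivity
  set γ := (1 - α * ‖B‖ ^ 2) / (α * k) with hγ
  set s := ‖D‖ ^ 2 / ((α * k) ^ 2 * m) with hs
  have hspec : 0 < s ∨ s = 0 ∧ 0 < γ := by
    by_cases hD : D = 0
    · right
      refine ⟨by rw [hs, hD]; simp, ?_⟩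
      rcases h with h | h
      · exact absurd hD h
      · exact div_pos (by linarith) (by positivity)
    · left
      have : 0 < ‖D‖ := norm_pos_iff.2 hD
      positivity
  obtain ⟨h1, h2, h3⟩ := cubicRoot_spec hspec
  set a := cubicRoot γ s with ha
  have h4 : pQuad α κ D B = 1 - α * ‖B‖ ^ 2 + α * k * a := rfl
  clear_value k m
  have hp : pQuad α κ D B = α * k * (γ + a) := by
    rw [h4, mul_add, hγ, mul_div_cancel₀ _ (by positivity)]
  have h5 : 0 < γ + a := by
    rcases hspec with h6 | h6
    · refine lt_of_le_of_ne h2 fun h7 => ?_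
      rw [← h7] at h3
      norm_num at h3
      linarith
    · linarith [h6.2]
  refine ⟨by rw [hp]; positivity, ?_⟩
  have h6 : 2 * ((pQuad α κ D B - 1) / (2 * α)) + ‖B‖ ^ 2 = k * a := by
    rw [h4]
    field_simp
    ring
  have h7 : pQuad α κ D B ^ 2 * (k * a) = k * (‖D‖ ^ 2 / m) := by
    rw [hp]
    calc (α * k * (γ + a)) ^ 2 * (k * a) = k * ((α * k) ^ 2 * ((γ + a) ^ 2 * a)) := by ring
      _ = k * (‖D‖ ^ 2 / m) := by
        rw [h3, hs]
        field_simp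
  rw [h6, h7]
  by_cases hD : D = 0
  · subst hD
    simp [reducedSq_eq]
  · rw [hk, hm]
    exact reducedSq_eq_eta κ B hD

end

/-! ### Fields which are radial functions of a Coulomb field -/

section
variable {h φ : ℝ → ℝ}

lemma contDiffOn_radial (hφ : ContDiffOn ℝ 1 φ (Ici 0)) :
    ContDiffOn ℝ 1 (fun x => φ (‖coulomb c q x‖ ^ 2) • coulomb c q x) (range c)ᶜ := by
  have h1 : ContDiffOn ℝ 1 (coulomb c q) (range c)ᶜ := contDiffOn_coulomb
  exact (hφ.comp (h1.norm_sq ℝ) fun x _ => mem_Ici.2 (sq_nonneg _)).smul h1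

lemma nonconservative_radial (hc : Injective c) (hn : 2 ≤ n) (hq : ∀ i, q i ≠ 0)
    (hφ : ContDiffOn ℝ 1 φ (Ici 0)) (hs : 0 < s) (hs' : deriv φ s ≠ 0) :
    Nonconservative (fun x => φ (‖coulomb c q x‖ ^ 2) • coulomb c q x) (range c)ᶜ := by
  have h1 : ContDiffOn ℝ 1 φ (Ioi 0) := hφ.mono Ioi_subset_Ici_self
  refine ⟨contDiffOn_radial hφ, exists_curl_radial_ne_zero hc (hq ⟨0, by omega⟩) ?_
    (φ' := deriv φ) (fun t ht => ?_) (h1.continuousOn_deriv_of_isOpen isOpen_Ioi le_rfl) hs hs'⟩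
  · intro h2
    have h3 := congrFun h2 ⟨1, by omega⟩
    rw [update_of_ne (by simp)] at h3
    exact hq _ h3
  · exact ((h1.differentiableOn one_ne_zero).differentiableAt (Ioi_mem_nhds ht)).hasDerivAt

/-- If `f'` is constant on one side of `0`, a radial field is the Coulomb field itself. -/
lemma curl_radial_of_eq_one (hφ : ∀ t, 0 ≤ t → φ t = 1) (hx : x ∈ (range c)ᶜ) :
    curl (fun y => φ (‖coulomb c q y‖ ^ 2) • coulomb c q y) x = 0 := by
  have h1 : (fun y => φ (‖coulomb c q y‖ ^ 2) • coulomb c q y) = coulomb c q :=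
    funext fun y => by rw [hφ _ (sq_nonneg _), one_smul]
  rw [h1, curl_coulomb hx]

lemma deriv_eq_one_of_second_zero {J : Set ℝ} (hI : IsOpen I) (hf : ContDiffOn ℝ 2 f I)
    (hJ : Convex ℝ J) (hJI : J ⊆ I) (h0 : 0 ∈ J) (h1 : deriv f 0 = 1)
    (h2 : ∀ x ∈ interior J, deriv (deriv f) x = 0) (hs : s ∈ J) : deriv f s = 1 := by
  have h3 : ContDiffOn ℝ 1 (deriv f) I := hf.deriv_of_isOpen hI (by norm_num)
  rw [← h1]
  have h4 := h3.continuousOn.mono hJI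
  have h5 := (h3.differentiableOn one_ne_zero).mono (interior_subset.trans hJI)
  have hm := monotoneOn_of_deriv_nonneg hJ h4 h5 fun x hx => (h2 x hx).ge
  have ha := antitoneOn_of_deriv_nonpos hJ h4 h5 fun x hx => (h2 x hx).le
  rcases le_total s 0 with hs0 | hs0
  · exact le_antisymm (hm hs h0 hs0) (ha hs h0 hs0)
  · exact le_antisymm (ha h0 hs hs0) (hm h0 hs hs0)

/-- The function `h` resolves `f'(a/2)² a = t`, as in the passage from `D² = t` to `E² = a`. -/
structure Resolves (f h : ℝ → ℝ) (I : Set ℝ) : Prop where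
  isOpen : IsOpen I
  ordConnected : I.OrdConnected
  zero_mem : (0 : ℝ) ∈ I
  smooth : ContDiffOn ℝ 2 f I
  deriv_zero : deriv f 0 = 1
  zero : h 0 = 0
  differentiableOn : DifferentiableOn ℝ h (Ici 0)
  root : ∀ t, 0 ≤ t → h t / 2 ∈ I ∧ deriv f (h t / 2) ^ 2 * h t = t

namespace Resolves

lemma deriv_ne_zero (H : Resolves f h I) (ht : 0 ≤ t) : deriv f (h t / 2) ≠ 0 := by
  rcases ht.eq_or_lt with rfl | ht
  · rw [H.zero, zero_div, H.deriv_zero]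
    exact one_ne_zero
  · intro h0
    have h1 := (H.root t ht.le).2
    rw [h0] at h1
    norm_num at h1
    exact ht.ne h1

lemma eq_div (H : Resolves f h I) (ht : 0 ≤ t) : h t = t / deriv f (h t / 2) ^ 2 := by
  rw [eq_div_iff (pow_ne_zero 2 (H.deriv_ne_zero ht)), mul_comm]
  exact (H.root t ht).2

lemma nonneg (H : Resolves f h I) (ht : 0 ≤ t) : 0 ≤ h t := by
  rw [H.eq_div ht]
  positivity

lemma contDiffOn_deriv (H : Resolves f h I) : ContDiffOn ℝ 1 (deriv f) I :=
  H.smooth.deriv_of_isOpen H.isOpen (by norm_num)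

lemma hasDerivAt_deriv (H : Resolves f h I) (hs : s ∈ I) :
    HasDerivAt (deriv f) (deriv (deriv f) s) s :=
  ((H.contDiffOn_deriv.differentiableOn one_ne_zero).differentiableAt
    (H.isOpen.mem_nhds hs)).hasDerivAt

/-- The chain rule for `f'(h/2)² h = t`. -/
lemma derivWithin_mul (H : Resolves f h I) (ht : 0 ≤ t) :
    (deriv f (h t / 2) * deriv (deriv f) (h t / 2) * h t + deriv f (h t / 2) ^ 2) *
      derivWithin h (Ici 0) t = 1 := by
  have hu := uniqueDiffOn_Ici (0 : ℝ) t ht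
  have h1 := (H.differentiableOn t ht).hasDerivWithinAt
  have h2 := ((((H.hasDerivAt_deriv (H.root t ht).1).comp_hasDerivWithinAt t
    (h1.div_const 2)).pow 2).mul h1).derivWithin hu
  have h3 : derivWithin (fun t => deriv f (h t / 2) ^ 2 * h t) (Ici 0) t = 1 := by
    rw [derivWithin_congr (f := fun t => t) (fun t ht => (H.root t (mem_Ici.1 ht)).2) (H.root t ht).2]
    exact derivWithin_id t _ hu
  rw [← h3]
  refine Eq.trans ?_ h2.symm
  simp
  ring

lemma contDiffOn (H : Resolves f h I) : ContDiffOn ℝ 1 h (Ici 0) := by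
  refine (contDiffOn_one_iff_derivWithin (uniqueDiffOn_Ici 0)).2 ⟨H.differentiableOn, ?_⟩
  have hc : ContinuousOn (fun t => h t / 2) (Ici 0) := H.differentiableOn.continuousOn.div_const 2
  have hm : MapsTo (fun t => h t / 2) (Ici 0) I := fun t ht => (H.root t ht).1
  have h1 : ContinuousOn (fun t => deriv f (h t / 2)) (Ici 0) :=
    H.contDiffOn_deriv.continuousOn.comp hc hm
  have h2 : ContinuousOn (fun t => deriv (deriv f) (h t / 2)) (Ici 0) :=
    (H.contDiffOn_deriv.continuousOn_deriv_of_isOpen H.isOpen le_rfl).comp hc hm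
  refine ((((h1.mul h2).mul H.differentiableOn.continuousOn).add (h1.pow 2)).inv₀
    fun t ht => left_ne_zero_of_mul_eq_one (H.derivWithin_mul ht)).congr fun t ht => ?_
  exact eq_inv_of_mul_eq_one_right (H.derivWithin_mul ht)

/-- `E` as a multiple of `D`. -/
lemma contDiffOn_inv (H : Resolves f h I) :
    ContDiffOn ℝ 1 (fun t => (deriv f (h t / 2))⁻¹) (Ici 0) :=
  (H.contDiffOn_deriv.comp (H.contDiffOn.div_const 2) fun t ht => (H.root t ht).1).inv
    fun _ ht => H.deriv_ne_zero ht

/-- `h` takes all positive values `2 s` with `s ∈ I`. -/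
lemma exists_eq (H : Resolves f h I) (hs : s ∈ I) (hs0 : 0 < s) : ∃ t, 0 < t ∧ h t / 2 = s := by
  have hsub : Icc 0 s ⊆ I := H.ordConnected.out H.zero_mem hs
  obtain ⟨C, hC⟩ := isCompact_Icc.exists_bound_of_continuousOn
    (H.contDiffOn_deriv.continuousOn.mono hsub)
  have hC0 : 0 ≤ C := (norm_nonneg _).trans (hC 0 ⟨le_rfl, hs0.le⟩)
  set T : ℝ := C ^ 2 * (2 * s) + 1 with hT
  have hT0 : 0 ≤ T := by positivity
  have h1 : 2 * s < h T := by
    by_contra! h1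
    have h2 := (H.root T hT0).2
    have h3 := hC (h T / 2) ⟨by linarith [H.nonneg hT0], by linarith⟩
    have h4 : deriv f (h T / 2) ^ 2 ≤ C ^ 2 := sq_le_sq' (abs_le.1 h3).1 (abs_le.1 h3).2
    have h5 : deriv f (h T / 2) ^ 2 * h T ≤ C ^ 2 * (2 * s) :=
      mul_le_mul h4 h1 (H.nonneg hT0) (by positivity)
    linarith
  obtain ⟨t, ht, hts⟩ := intermediate_value_Icc hT0
    (H.differentiableOn.continuousOn.mono Icc_subset_Ici_self)
    (show 2 * s ∈ Icc (h 0) (h T) from ⟨by rw [H.zero]; linarith, h1.le⟩)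
  refine ⟨t, ht.1.lt_of_ne ?_, by rw [hts]; ring⟩
  rintro rfl
  rw [H.zero] at hts
  linarith

lemma nonconservative_iff (H : Resolves f h I) (hc : Injective c) (hn : 2 ≤ n) (hq : ∀ i, q i ≠ 0) :
    Nonconservative (fun x => (deriv f (h (‖coulomb c q x‖ ^ 2) / 2))⁻¹ • coulomb c q x) (range c)ᶜ ↔
      ∃ s ∈ I, 0 < s ∧ deriv (deriv f) s ≠ 0 := by
  constructor
  · rintro ⟨-, x, hx, hne⟩
    by_contra! h0
    refine hne (curl_radial_of_eq_one (φ := fun t => (deriv f (h t / 2))⁻¹) (fun t ht => ?_) hx)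
    have h1 := deriv_eq_one_of_second_zero H.isOpen H.smooth (J := I ∩ Ici 0)
      (H.ordConnected.convex.inter (convex_Ici 0)) inter_subset_left ⟨H.zero_mem, mem_Ici.2 le_rfl⟩
      H.deriv_zero (fun x hx => by
        have h2 := interior_mono inter_subset_right hx
        rw [interior_Ici] at h2
        exact h0 x (interior_subset hx).1 h2)
      (s := h t / 2) ⟨(H.root t ht).1, by have := H.nonneg ht; exact mem_Ici.2 (by linarith)⟩
    simp [h1]
  · rintro ⟨s, hs, hs0, hne⟩
    obtain ⟨t, ht, rfl⟩ := H.exists_eq hs hs0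
    refine nonconservative_radial (φ := fun t => (deriv f (h t / 2))⁻¹) hc hn hq H.contDiffOn_inv
      ht ?_
    have h1 : HasDerivAt h (derivWithin h (Ici 0) t) t :=
      (H.differentiableOn t ht.le).hasDerivWithinAt.hasDerivAt (Ici_mem_nhds ht)
    have h2 := HasDerivAt.inv (c := deriv f ∘ fun t => h t / 2)
      ((H.hasDerivAt_deriv hs).comp t (h1.div_const 2)) (H.deriv_ne_zero ht.le)
    have h3 := right_ne_zero_of_mul_eq_one (H.derivWithin_mul ht.le)
    rw [show (fun t => (deriv f (h t / 2))⁻¹) = (deriv f ∘ fun t => h t / 2)⁻¹ from rfl, h2.deriv]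
    exact div_ne_zero (neg_ne_zero.2 (mul_ne_zero hne (div_ne_zero h3 two_ne_zero)))
      (pow_ne_zero 2 (H.deriv_ne_zero ht.le))

lemma isStaticSolution (H : Resolves f h I) : IsStaticSolution f I κ c q 0 (range c)ᶜ
      (fun x => (deriv f (h (‖coulomb c q x‖ ^ 2) / 2))⁻¹ • coulomb c q x) 0 (coulomb c q) 0 0
      (fun x => -curl (fun x => (deriv f (h (‖coulomb c q x‖ ^ 2) / 2))⁻¹ • coulomb c q x) x) := by
  have hinv : ∀ x, invariantS κ
      ((deriv f (h (‖coulomb c q x‖ ^ 2) / 2))⁻¹ • coulomb c q x) ((0 : V3 → V3) x) =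
        h (‖coulomb c q x‖ ^ 2) / 2 := by
    intro x
    have h1 := H.eq_div (sq_nonneg ‖coulomb c q x‖)
    rw [invariantS, norm_smul, mul_pow, norm_inv, norm_eq_abs, inv_pow, sq_abs,
      ← div_eq_inv_mul, ← h1]
    simp
  have h0 : ContDiffOn ℝ 1 (0 : V3 → V3) (range c)ᶜ := contDiffOn_const
  refine ⟨isOpen_compl_range, contDiffOn_radial (φ := fun t => (deriv f (h t / 2))⁻¹)
    H.contDiffOn_inv, h0, contDiffOn_coulomb, h0, fun x _ => by simp,
    fun x _ => curl_zero x, hasPointSources_coulomb c q, hasPointSources_zero c,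
    fun x _ => ?_, fun x _ => ?_, fun x _ => ?_⟩
  · rw [hinv]
    exact (H.root _ (sq_nonneg _)).1
  · rw [hinv, Pi.zero_apply, smul_zero, add_zero, smul_smul,
      mul_inv_cancel₀ (H.deriv_ne_zero (sq_nonneg _)), one_smul]
  · rw [Pi.zero_apply, inner_zero_right]
    simp

end Resolves

/-! ### Magnetostatic solutions -/

/-- Assumptions on `f` for magnetostatic solutions. -/
structure MagneticModel (f : ℝ → ℝ) (I : Set ℝ) : Prop where
  isOpen : IsOpen I
  subset : Iic 0 ⊆ I
  smooth : ContDiffOn ℝ 2 f I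
  zero : f 0 = 0
  deriv_zero : deriv f 0 = 1

/-- The magnetic intensity `H = f'(-B²/2) B`. -/
abbrev magneticField (f : ℝ → ℝ) (c : Fin n → V3) (q : Fin n → ℝ) (x : V3) : V3 :=
  deriv f (-‖coulomb c q x‖ ^ 2 / 2) • coulomb c q x

namespace MagneticModel

lemma contDiffOn_deriv (H : MagneticModel f I) :
    ContDiffOn ℝ 1 (fun t => deriv f (-t / 2)) (Ici 0) :=
  (H.smooth.deriv_of_isOpen H.isOpen (m := 1) (by norm_num)).comp
    (g := deriv f) (f := fun t => -t / 2) (by fun_prop)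
    fun t ht => H.subset (mem_Iic.2 (by have := mem_Ici.1 ht; linarith))

lemma contDiffOn (H : MagneticModel f I) : ContDiffOn ℝ 1 (magneticField f c q) (range c)ᶜ :=
  contDiffOn_radial (φ := fun t => deriv f (-t / 2)) H.contDiffOn_deriv

lemma isStaticSolution (H : MagneticModel f I) :
    IsStaticSolution f I κ c 0 q (range c)ᶜ 0 (coulomb c q) 0 (magneticField f c q)
      (curl (magneticField f c q)) 0 := by
  have hinv : ∀ x, invariantS κ ((0 : V3 → V3) x) (coulomb c q x) = -‖coulomb c q x‖ ^ 2 / 2 :=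
    fun x => by simp [invariantS]
  have h0 : ContDiffOn ℝ 1 (0 : V3 → V3) (range c)ᶜ := contDiffOn_const
  refine ⟨isOpen_compl_range, h0, contDiffOn_coulomb, h0, H.contDiffOn,
    fun x _ => by simp [curl_zero x], fun x _ => rfl, hasPointSources_zero c,
    hasPointSources_coulomb c q, fun x _ => ?_, fun x _ => ?_, fun x _ => ?_⟩
  · rw [hinv]
    exact H.subset (mem_Iic.2 (by have := sq_nonneg ‖coulomb c q x‖; linarith))
  · rw [Pi.zero_apply, inner_zero_left]
    simp
  · rw [hinv, Pi.zero_apply, smul_zero, sub_zero]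

lemma nonconservative_iff (H : MagneticModel f I) (hc : Injective c) (hn : 2 ≤ n)
    (hq : ∀ i, q i ≠ 0) :
    Nonconservative (magneticField f c q) (range c)ᶜ ↔ ∃ s < 0, deriv (deriv f) s ≠ 0 := by
  constructor
  · rintro ⟨-, x, hx, hne⟩
    by_contra! h0
    refine hne (curl_radial_of_eq_one (φ := fun t => deriv f (-t / 2)) (fun t ht => ?_) hx)
    refine deriv_eq_one_of_second_zero H.isOpen H.smooth (convex_Iic 0) H.subset
      (mem_Iic.2 le_rfl) H.deriv_zero (fun x hx => ?_) (mem_Iic.2 (by linarith))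
    rw [interior_Iic] at hx
    exact h0 x hx
  · rintro ⟨s, hs, hne⟩
    refine nonconservative_radial (φ := fun t => deriv f (-t / 2)) (s := -2 * s) hc hn hq
      H.contDiffOn_deriv (by linarith) ?_
    have h1 : HasDerivAt (deriv f) (deriv (deriv f) s) (-(-2 * s) / 2) := by
      rw [show -(-2 * s) / 2 = s by ring]
      exact (((H.smooth.deriv_of_isOpen H.isOpen (m := 1) (by norm_num)).differentiableOn
        one_ne_zero).differentiableAt (H.isOpen.mem_nhds (H.subset (mem_Iic.2 hs.le)))).hasDerivAt
    have h2 := h1.comp (-2 * s) (((hasDerivAt_id (-2 * s)).neg).div_const 2)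
    rw [show (fun t => deriv f (-t / 2)) = deriv f ∘ fun t => (-id) t / 2 from rfl, h2.deriv]
    simpa using hne

end MagneticModel

end

/-! ### Electrostatic solutions -/

section
variable {P : ℝ → ℝ}

lemma eventually_compl_range (c : Fin n → V3) : ∀ᶠ x in cobounded V3, x ∈ (range c)ᶜ :=
  (finite_range c).isBounded

lemma RootField.of_forall (hS : Response S S') (h : ∀ x ∈ (range c)ᶜ,
    IsRoot S (reducedSq κ (coulomb c q x) (coulomb c g x)) (‖coulomb c g x‖ ^ 2) (p x)) :
    RootField S S' κ c q g (range c)ᶜ p :=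
  ⟨hS, isOpen_compl_range, subset_rfl, fun _ hx _ => hx, eventually_compl_range c, h⟩

/-- `f'` is not locally constant, as it has the inverse function `S`. -/
lemma Model.second_deriv_ne_zero (M : Model f I S S') (hI : IsOpen I) (hf : ContDiffOn ℝ 2 f I)
    (ht : 0 < t) : deriv (deriv f) (S t) ≠ 0 := by
  have h1 : HasDerivAt (deriv f) (deriv (deriv f) (S t)) (S t) :=
    (((hf.deriv_of_isOpen hI (m := 1) (by norm_num)).differentiableOn one_ne_zero).differentiableAt
      (hI.mem_nhds (M.mem t ht))).hasDerivAt
  have h2 := h1.comp t (M.response.hasDerivAt t ht)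
  have h3 : HasDerivAt (deriv f ∘ S) 1 t := (hasDerivAt_id t).congr_of_eventuallyEq (by
    filter_upwards [Ioi_mem_nhds ht] with x hx using M.deriv_eq x hx)
  exact left_ne_zero_of_mul_eq_one (h2.unique h3)

lemma Model.resolves (M : Model f I S S') (hI : IsOpen I) (hc : I.OrdConnected)
    (hf : ContDiffOn ℝ 2 f I) (hP : ∀ t, 0 ≤ t → IsRoot S t 0 (P t)) :
    Resolves f (fun t => 2 * S (P t)) I := by
  have hS := M.response
  have h0 : (0 : ℝ) ∈ I := by simpa only [hS.one] using M.mem 1 one_pos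
  have h1 : deriv f 0 = 1 := by simpa only [hS.one] using M.deriv_eq 1 one_pos
  refine ⟨hI, hc, h0, hf, h1, ?_, fun t ht => ?_, fun t ht => ?_⟩
  · have h2 := (hP 0 le_rfl).2
    rw [add_zero] at h2
    exact (mul_eq_zero.1 h2).resolve_left (pow_ne_zero 2 (hP 0 le_rfl).1.ne')
  · obtain ⟨P', hd, heq, hroot⟩ := exists_local_root hS ht (hP t ht)
    have hl : ContinuousAt (fun s : ℝ => (s, (0 : ℝ))) t := by fun_prop
    have h3 : DifferentiableAt ℝ (fun s => P' (s, 0)) t :=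
      (hd.differentiableAt one_ne_zero).comp t (by fun_prop : DifferentiableAt ℝ
        (fun s : ℝ => (s, (0 : ℝ))) t)
    have h4 : DifferentiableAt ℝ (fun s => 2 * S (P' (s, 0))) t := (DifferentiableAt.comp (g := S) t
        (by rw [heq]; exact (hS.hasDerivAt _ (hP t ht).1).differentiableAt) h3).const_mul 2
    refine h4.differentiableWithinAt.congr_of_eventuallyEq ?_ (by rw [heq])
    filter_upwards [nhdsWithin_le_nhds (hl.eventually hroot), self_mem_nhdsWithin] with s hs hs0
    rw [(hP s hs0).unique hS hs0 hs]
  · rw [mul_div_cancel_left₀ _ two_ne_zero, M.deriv_eq _ (hP t ht).1]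
    exact ⟨M.mem _ (hP t ht).1, by simpa using (hP t ht).2⟩

/-- In an electrostatic field `f'(s)³` grows at least like `D²`. -/
lemma Model.le_cube (M : Model f I S S') : ∃ C, 0 < C ∧ ∀ L p, 0 ≤ L → IsRoot S L 0 p →
    1 ≤ p ∧ L ≤ C * p ^ 3 ∧ |L / p - f (S p)| ≤ 2 * (L / p) := by
  obtain ⟨C, hC0, hC⟩ := M.linear
  refine ⟨2 * C + 1, by positivity, fun L p hL h => ?_⟩
  have hp := h.1
  have hr := h.2
  rw [add_zero] at hr
  have h1 : 1 ≤ p := by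
    by_contra! h1
    have h2 := M.response.neg hp h1
    have := mul_neg_of_pos_of_neg (pow_pos hp 2) (mul_neg_of_pos_of_neg two_pos h2)
    linarith
  have h2 : p ^ 2 * (2 * S p) ≤ p ^ 2 * (2 * (C * p)) := by gcongr; exact hC p h1
  have h3 := M.large p h1
  have h4 : L / p = 2 * (p * S p) := by rw [← hr]; field_simp
  have h5 : 0 ≤ L / p := by positivity
  refine ⟨h1, by nlinarith [pow_pos hp 3], ?_⟩
  rw [abs_le] at h3 ⊢
  constructor <;> linarith

theorem Model.electricSolution (M : Model f I S S') (hI : IsOpen I) (hoc : I.OrdConnected)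
    (hf : ContDiffOn ℝ 2 f I) (hP : ∀ t, 0 ≤ t → IsRoot S t 0 (P t)) (hn : 1 ≤ n)
    (hc : Injective c) (hq : ∀ i, q i ≠ 0) :
    ElectricSolution f I κ c q (fun x => (P (‖coulomb c q x‖ ^ 2))⁻¹ • coulomb c q x) := by
  have R := M.resolves hI hoc hf hP
  have h0 : coulomb c (0 : Fin n → ℝ) = 0 := coulomb_zero c
  have h6 : ∀ x, reducedSq κ (coulomb c q x) (coulomb c 0 x) = ‖coulomb c q x‖ ^ 2 :=
    fun x => by simp [reducedSq_eq, h0]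
  have h : RootField S S' κ c q 0 (range c)ᶜ (fun x => P (‖coulomb c q x‖ ^ 2)) :=
    RootField.of_forall M.response fun x _ => by
      rw [h6, h0, Pi.zero_apply, norm_zero, zero_pow two_ne_zero]
      exact hP _ (sq_nonneg _)
  have hE : RootField.fieldE κ c q 0 (fun x => P (‖coulomb c q x‖ ^ 2)) =
      fun x => (P (‖coulomb c q x‖ ^ 2))⁻¹ • coulomb c q x :=
    funext fun x => by simp [RootField.fieldE, dyonicE, h0]
  have hE' : (fun x => (deriv f (2 * S (P (‖coulomb c q x‖ ^ 2)) / 2))⁻¹ • coulomb c q x) =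
      fun x => (P (‖coulomb c q x‖ ^ 2))⁻¹ • coulomb c q x :=
    funext fun x => by rw [mul_div_cancel_left₀ _ two_ne_zero, M.deriv_eq _ (hP _ (sq_nonneg _)).1]
  obtain ⟨C, hC0, hC⟩ := M.le_cube
  have hC' := fun x => hC _ _ (sq_nonneg ‖coulomb c q x‖) (hP _ (sq_nonneg _))
  have hsol := R.isStaticSolution (κ := κ) (c := c) (q := q)
  have hnon := fun hn => R.nonconservative_iff hc (q := q) hn hq
  rw [hE'] at hsol hnon
  refine ⟨hsol, ?_, ?_, ?_, fun hn => (hnon hn).2 ?_⟩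
  · have h1 := h.finiteEnergy M hc hn hq (Or.inl rfl) (s := 8 / 3) (by norm_num) fun i => ?_
    · rwa [hE, h0] at h1
    refine IsBigO.of_pow (n := 3) three_ne_zero ?_
    have h2 : (energyDensity f κ (RootField.fieldE κ c q 0 fun x => P (‖coulomb c q x‖ ^ 2))
        (coulomb c 0) ^ 3) =O[𝓝[≠] (c i)] fun x => ‖coulomb c q x‖ ^ 4 := by
      refine IsBigO.of_bound (8 * C) ?_
      filter_upwards [eventually_mem_compl_range hc i] with x hx
      obtain ⟨h3, h4, h5⟩ := hC' x
      have hp := (hP _ (sq_nonneg ‖coulomb c q x‖)).1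
      rw [Pi.pow_apply, h.energyDensity_eq M hx, h6, norm_pow, norm_pow, norm_norm, norm_eq_abs]
      refine (pow_le_pow_left₀ (abs_nonneg _) h5 3).trans ?_
      rw [mul_pow, div_pow, mul_div_assoc', div_le_iff₀ (by positivity)]
      have := mul_le_mul_of_nonneg_left h4 (show 0 ≤ 8 * ‖coulomb c q x‖ ^ 4 by positivity)
      linarith
    refine (h2.trans ((coulomb_isBigO_center hc i).norm_left.pow 4)).congr' EventuallyEq.rfl ?_
    filter_upwards [self_mem_nhdsWithin] with x hx
    rw [Pi.pow_apply, inv_pow, ← pow_mul, ← Real.rpow_natCast (_ ^ _) 3,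
      ← Real.rpow_mul (norm_nonneg _), ← Real.rpow_natCast, ← rpow_neg (norm_nonneg _)]
    norm_num
  · have h7 := h.flux_E
    rw [hE] at h7
    have h1 := hasFreeCharge hc hsol.smooth_E (A := 0) (fun i => ?_) h7
    · simpa using h1
    · refine inner_isLittleO ?_
      have h2 : Tendsto (fun x => (P (‖coulomb c q x‖ ^ 2))⁻¹) (𝓝[≠] (c i)) (𝓝 0) := by
        refine tendsto_inv_atTop_zero.comp (tendsto_atTop.2 fun M => ?_)
        have h3 := ((tendsto_pow_atTop two_ne_zero).comp
          (tendsto_norm_coulomb_atTop hc (hq i))).eventually_gt_atTop (C * |M| ^ 3)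
        filter_upwards [h3] with x hx
        have h4 := lt_of_mul_lt_mul_left (hx.trans_le (hC' x).2.1) hC0.le
        exact (le_abs_self M).trans (lt_of_pow_lt_pow_left₀ 3 (zero_le_one.trans (hC' x).1) h4).le
      have h3 := (isLittleO_one_iff ℝ).2 h2 |>.smul_isBigO (coulomb_isBigO_center (q := q) hc i)
      simpa [h0] using h3
  · rw [← hE]
    exact h.isEquivalent_E
  · have h2 : 0 < S 2 := by
      have := M.response.strictMonoOn (mem_Ioi.2 one_pos) (mem_Ioi.2 two_pos) one_lt_two
      rwa [M.response.one] at this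
    exact ⟨S 2, M.mem 2 two_pos, h2, M.second_deriv_ne_zero hI hf two_pos⟩

end

/-! ### Free charge and energy of magnetostatic solutions -/

section
namespace MagneticModel

lemma energyDensity_eq (x : V3) : energyDensity f κ 0 (coulomb c q) x =
    -f (-‖coulomb c q x‖ ^ 2 / 2) := by
  simp [energyDensity, invariantS]

lemma neg_sq_mem (x : V3) : -‖coulomb c q x‖ ^ 2 / 2 ∈ Iic (0 : ℝ) :=
  mem_Iic.2 (by have := sq_nonneg ‖coulomb c q x‖; linarith)

lemma isEquivalent (H : MagneticModel f I) : magneticField f c q ~[cobounded V3] coulomb c q := by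
  have h1 : ContinuousAt (deriv f) 0 :=
    (H.smooth.deriv_of_isOpen H.isOpen (m := 1) (by norm_num)).continuousOn.continuousAt
      (H.isOpen.mem_nhds (H.subset (mem_Iic.2 le_rfl)))
  have h2 : Tendsto (fun x => -‖coulomb c q x‖ ^ 2 / 2) (cobounded V3) (𝓝 0) := by
    simpa using (((tendsto_coulomb_infinity c q).norm.pow 2).neg).div_const 2
  have h3 : Tendsto (fun x => deriv f (-‖coulomb c q x‖ ^ 2 / 2) - 1) (cobounded V3) (𝓝 0) := by
    simpa [H.deriv_zero] using (h1.tendsto.comp h2).sub_const 1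
  have h4 := ((isLittleO_one_iff ℝ).2 h3).smul_isBigO (isBigO_refl (coulomb c q) _)
  refine (h4.congr_left fun x => ?_).congr_right fun x => one_smul _ _
  simp [sub_smul]

theorem magneticSolution (H : MagneticModel f I) (hc : Injective c)
    (hq : ∀ i, q i ≠ 0) (hne : ∃ s < 0, deriv (deriv f) s ≠ 0) :
    MagneticSolution f I κ c q (magneticField f c q) :=
  ⟨H.isStaticSolution, H.isEquivalent, fun hn => (H.nonconservative_iff hc hn hq).2 hne⟩

theorem hasFreeCharge (H : MagneticModel f I) (hc : Injective c) (hq : ∀ i, q i ≠ 0)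
    (hlim : Tendsto (deriv f) atBot (𝓝 0)) :
    HasFreeCharge c (magneticField f c q) (∑ i, q i) := by
  have h1 := MultiCenter.hasFreeCharge hc (H.contDiffOn (q := q)) (q := q) (A := 0) (fun i => ?_) ?_
  · simpa using h1
  · refine inner_isLittleO ?_
    have h2 : Tendsto (fun x => -‖coulomb c q x‖ ^ 2 / 2) (𝓝[≠] (c i)) atBot :=
      (tendsto_neg_atTop_atBot.comp ((tendsto_pow_atTop two_ne_zero).comp
        (tendsto_norm_coulomb_atTop hc (hq i)))).atBot_div_const two_pos
    have h3 := ((isLittleO_one_iff ℝ).2 (hlim.comp h2)).smul_isBigO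
      (coulomb_isBigO_center (q := q) hc i)
    simpa [coulomb_zero] using h3
  · have h1 : (fun x => magneticField f c q x - coulomb c q x) =o[cobounded V3]
        fun x => (‖x - 0‖ ^ 2)⁻¹ := by
      simp only [sub_zero]
      exact H.isEquivalent.isLittleO.trans_isBigO (coulomb_isBigO_infinity c q)
    simpa using inner_isLittleO h1

theorem finiteEnergy (H : MagneticModel f I) (hc : Injective c) {C : ℝ}
    (hC : ∀ s ≤ 0, |f s| ≤ C * √(-2 * s)) : FiniteEnergy f κ 0 (coulomb c q) := by
  have hcont : ContinuousOn (fun x => -f (-‖coulomb c q x‖ ^ 2 / 2)) (range c)ᶜ :=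
    ((H.smooth.continuousOn.mono H.subset).comp (t := Iic 0)
      (((contDiffOn_coulomb (k := 1)).continuousOn.norm.pow 2).neg.div_const 2) fun x _ => neg_sq_mem x).neg
  have hbd : ∀ x, |f (-‖coulomb c q x‖ ^ 2 / 2)| ≤ C * ‖coulomb c q x‖ := fun x => by
    have h1 := hC _ (neg_sq_mem (c := c) (q := q) x)
    rwa [show -2 * (-‖coulomb c q x‖ ^ 2 / 2) = ‖coulomb c q x‖ ^ 2 by ring,
      sqrt_sq (norm_nonneg _)] at h1
  rw [FiniteEnergy, show energyDensity f κ 0 (coulomb c q) = _ from funext energyDensity_eq]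
  refine integrable_of_isBigO (c := c) ?_ (fun x hx => ?_) (s := 2) (by norm_num) (fun i => ?_) ?_
  · have h1 : ∀ᵐ x : V3, x ∈ (range c)ᶜ := compl_mem_ae_iff.2 ((finite_range c).measure_zero _)
    have h2 := hcont.aestronglyMeasurable isOpen_compl_range.measurableSet (μ := volume)
    rwa [Measure.restrict_eq_self_of_ae_mem h1] at h2
  · exact ((hcont.continuousAt (isOpen_compl_range.mem_nhds hx)).norm.isBoundedUnder_le).isBigO_one ℝ
  · refine ((IsBigO.of_bound C (.of_forall fun x => ?_)).trans
      (coulomb_isBigO_center (q := q) hc i)).congr_right fun x => ?_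
    · rw [norm_neg]
      exact hbd x
    · rw [rpow_neg (norm_nonneg _), rpow_two]
  · have h2 : Tendsto (fun x => -‖coulomb c q x‖ ^ 2 / 2) (cobounded V3) (𝓝 0) := by
      simpa using (((tendsto_coulomb_infinity c q).norm.pow 2).neg).div_const 2
    have h3 : DifferentiableAt ℝ f 0 := differentiableAt_of_deriv_ne_zero (by
      rw [H.deriv_zero]; exact one_ne_zero)
    have h4 := h3.isBigO_sub.comp_tendsto h2
    simp only [H.zero, sub_zero, comp_def] at h4
    refine (h4.neg_left.trans ?_).trans
      (((coulomb_isBigO_infinity c q).norm_left.pow 2).congr_right fun x => by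
        rw [inv_pow, ← pow_mul])
    refine IsBigO.of_bound 1 (.of_forall fun x => ?_)
    rw [norm_div, norm_neg]
    have := norm_nonneg (‖coulomb c q x‖ ^ 2)
    norm_num

end MagneticModel

end

/-! ### Fields without a finite free charge -/

section
lemma IsStep.le_integral_shell (h : IsStep η) (hm : Monotone η) (hr : 0 < r) {M : ℝ}
    (hI : Integrable fun x => ⟪G x, gradient (radialStep η a r) x⟫)
    (hG : ∀ x, r ≤ ‖x - a‖ → ‖x - a‖ ≤ 2 * r → M * ‖x - a‖⁻¹ ≤ s * ⟪G x, x - a⟫) :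
    M * (4 * π) ≤ s * ∫ x, ⟪G x, gradient (radialStep η a r) x⟫ := by
  rw [← mul_one (4 * π), ← h.stepMass_eq_one hm, ← integral_shell_abs a hr,
    ← integral_const_mul, ← integral_const_mul]
  refine integral_mono ((h.integrable_shell_abs a hr).const_mul M) (hI.const_mul s) fun x => ?_
  by_cases hx : ‖x - a‖ ≤ r ∨ 2 * r ≤ ‖x - a‖
  · beta_reduce
    rw [h.gradient_radialStep_eq_zero hr hx, h.deriv_eq_zero (by rwa [div_le_one hr, le_div_iff₀ hr])]
    simp
  · push Not at hx
    have h0 : 0 < ‖x - a‖ := hr.trans hx.1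
    have h1 := hG x hx.1.le hx.2.le
    have h2 : 0 ≤ deriv η (‖x - a‖ / r) := hm.deriv_nonneg
    beta_reduce
    rw [h.gradient_radialStep hr, inner_smul_right, abs_of_nonneg h2]
    calc M * (deriv η (‖x - a‖ / r) / (r * ‖x - a‖ ^ 2))
        = deriv η (‖x - a‖ / r) / (r * ‖x - a‖) * (M * ‖x - a‖⁻¹) := by field_simp
      _ ≤ deriv η (‖x - a‖ / r) / (r * ‖x - a‖) * (s * ⟪G x, x - a⟫) := by gcongr
      _ = _ := by ring

lemma exists_shell_bound (hF : ContinuousOn F U) (hr : 0 < r)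
    (hU : ∀ x, r ≤ ‖x - a‖ → ‖x - a‖ ≤ 2 * r → x ∈ U) : ∃ C, 0 ≤ C ∧ ∀ η, IsStep η →
      Monotone η → |∫ x, ⟪F x, gradient (radialStep η a r) x⟫| ≤ C := by
  obtain ⟨C, hC⟩ := ((isCompact_closedBall a (2 * r)).diff
    (Metric.isOpen_ball (x := a) (ε := r))).exists_bound_of_continuousOn (hF.mono fun x hx =>
      hU x (not_lt.1 fun h => hx.2 (mem_ball_iff_norm.2 h)) (mem_closedBall_iff_norm.1 hx.1))
  refine ⟨|C| * (2 * r) ^ 2 * (4 * π), by positivity, fun η hη hm => ?_⟩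
  have h := hη.abs_integral_shell_le (a := a) hr (G := F) (ε := |C| * (2 * r) ^ 2) fun x h1 h2 => by
    have h0 : 0 < ‖x - a‖ := hr.trans_le h1
    have h3 := (hC x ⟨mem_closedBall_iff_norm.2 h2, fun h =>
      h1.not_gt (mem_ball_iff_norm.1 h)⟩).trans (le_abs_self C)
    rw [← div_eq_mul_inv, le_div_iff₀ h0]
    calc |⟪F x, x - a⟫| * ‖x - a‖ ≤ ‖F x‖ * ‖x - a‖ * ‖x - a‖ := by
          gcongr; exact abs_real_inner_le_norm _ _
      _ = ‖F x‖ * ‖x - a‖ ^ 2 := by ring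
      _ ≤ _ := by gcongr
  rwa [hη.stepMass_eq_one hm, mul_one] at h

/-- If the flux of `F` through small spheres about a center tends to infinity, then `F` has no
finite free charge: all other fluxes are kept fixed while the sphere about this center shrinks. -/
theorem not_hasFreeCharge (hF : ContDiffOn ℝ 1 F (range c)ᶜ) (hc : Injective c)
    (h : Tendsto (fun x => s * (‖x - c i‖ * ⟪F x, x - c i⟫)) (𝓝[≠] (c i)) atTop) (G : ℝ) :
    ¬ HasFreeCharge c F G := by
  rintro ⟨-, hG⟩
  obtain ⟨T, hT, U, hU, hTU⟩ := mem_prod_iff.1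
    ((hG.eventually (Metric.ball_mem_nhds G one_pos)).and (eventually_separated hc))
  obtain ⟨R, hR⟩ := NeBot.nonempty_of_mem inferInstance hU
  obtain ⟨ε, hε, hball⟩ := Metric.mem_nhdsWithin_iff.1 hT
  have key : ∀ r : Fin n → ℝ, (∀ j, 0 < r j ∧ r j ≤ ε / 2) →
      |(∫ x in perforatedBall c r R, divergence F x) - G| < 1 ∧ Separated c r R := fun r hr =>
    hTU (mk_mem_prod (hball ⟨by
      rw [Metric.mem_ball, dist_pi_lt_iff hε]; intro j
      rw [Pi.zero_apply, dist_eq, sub_zero, abs_of_pos (hr j).1]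
      linarith [(hr j).2], fun j _ => (hr j).1⟩) hR)
  set r₀ : Fin n → ℝ := fun _ => ε / 2
  have hs₀ := (key r₀ fun j => ⟨half_pos hε, le_rfl⟩).2
  obtain ⟨C₀, -, hC₀⟩ := exists_shell_bound (a := 0) hF.continuousOn hs₀.radius_pos
    fun x hx _ => hs₀.mem_compl_range_outer (by rwa [sub_zero] at hx)
  choose C hC hCb using fun j => exists_shell_bound (a := c j) hF.continuousOn (hs₀.pos j)
    fun x => hs₀.mem_compl_range
  set K := |s| * C₀ + |s| * ∑ j, C j
  set M := |s| * (|G| + 1) + K + 1 with hM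
  obtain ⟨δ, hδ, hδM⟩ := Metric.mem_nhdsWithin_iff.1 (h.eventually_ge_atTop (M / (4 * π)))
  set t := min (ε / 2) (δ / 3)
  have ht : 0 < t := lt_min (half_pos hε) (by positivity)
  set r := update r₀ i t with hr
  obtain ⟨h1, hs⟩ := key r fun j => by
    rcases eq_or_ne j i with rfl | hj
    · rw [hr, update_self]
      exact ⟨ht, min_le_left _ _⟩
    · rw [hr, update_of_ne hj]
      exact ⟨half_pos hε, le_rfl⟩
  have hri : r i = t := update_self i t r₀
  have hLI := locallyIntegrableOn_compl hF
  have h2 := integral_perforatedBall_mem hF hs (S := {y | s * y ≤ K - M})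
    (isClosed_le (continuous_const.mul continuous_id) continuous_const) fun η hη hm => by
      have h3 := hη.le_integral_shell hm (hs.pos i) (hs.integrable_shell hη hLI i)
        (M := M / (4 * π)) (s := s) fun x hx1 hx2 => by
          have h0 : 0 < ‖x - c i‖ := (hs.pos i).trans_le hx1
          have h4 := hδM (a := x) ⟨by
            rw [mem_ball_iff_norm]
            linarith [min_le_right (ε / 2) (δ / 3)], fun hx => by
              simp [mem_singleton_iff.1 hx] at h0⟩
          rw [mem_ofPred_eq] at h4
          rw [← div_eq_mul_inv, div_le_iff₀ h0]
          linarith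
      rw [div_mul_cancel₀ _ (by positivity)] at h3
      have hb : ∀ {y C : ℝ}, |y| ≤ C → |s * y| ≤ |s| * C := fun hy => by
        rw [abs_mul]; gcongr
      have h6 := hb ((Finset.abs_sum_le_sum_abs _ _).trans
        ((Finset.sum_le_sum (s := Finset.univ.erase i)
          (f := fun j => |∫ x, ⟪F x, gradient (radialStep η (c j) (r j)) x⟫|) fun j hj => by
            rw [show r j = r₀ j from update_of_ne (Finset.ne_of_mem_erase hj) _ _]
            exact hCb j η hη hm).trans (Finset.sum_le_univ_sum_of_nonneg hC)))
      rw [mem_ofPred_eq, hs.flux_decomposition hη hLI,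
        ← Finset.add_sum_erase _ _ (Finset.mem_univ i), mul_sub, mul_add]
      linarith [(le_abs_self _).trans (hb (hC₀ η hη hm)), (abs_le.1 h6).1]
  rw [mem_ofPred_eq] at h2
  set y := ∫ x in perforatedBall c r R, divergence F x
  have h3 : |s * y| ≤ |s| * (|G| + 1) := by
    rw [abs_mul]
    gcongr
    linarith [abs_sub_abs_le_abs_sub y G]
  linarith [neg_abs_le (s * y)]

end

/-! ### The fields near the centers -/

section
variable {β : ℝ}

lemma sq_smul_kernel (hx : x ≠ 0) : ‖x‖ ^ 2 • kernel x = ‖x‖⁻¹ • x := by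
  have := norm_ne_zero_iff.2 hx
  rw [kernel, smul_smul]
  congr 1
  field_simp

lemma norm_inv_smul_self_le (x : V3) : ‖‖x‖⁻¹ • x‖ ≤ 1 := by
  rw [norm_smul, norm_inv, norm_norm]
  exact inv_mul_le_one

lemma tendsto_inner_center (hc : Injective c) (i : Fin n) :
    Tendsto (fun x => ‖x - c i‖ * ⟪coulomb c q x, x - c i⟫) (𝓝[≠] (c i)) (𝓝 (q i / (4 * π))) := by
  have h1 := (isLittleO_one_iff ℝ).2 (tendsto_sq_smul_sub (q := q) hc i)
  have h2 : (fun x => ‖x - c i‖⁻¹ • (x - c i)) =O[𝓝[≠] (c i)] fun _ => (1 : ℝ) :=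
    IsBigO.of_bound 1 (.of_forall fun x => by simpa using norm_inv_smul_self_le (x - c i))
  have h3 : Tendsto (fun x => ⟪‖x - c i‖ ^ 2 • (coulomb c q x - (q i / (4 * π)) •
      kernel (x - c i)), ‖x - c i‖⁻¹ • (x - c i)⟫) (𝓝[≠] (c i)) (𝓝 0) := by
    refine (isLittleO_one_iff ℝ).1 (IsBigO.trans_isLittleO (IsBigO.of_bound 1
      (.of_forall fun x => ?_)) ((h1.norm_left.mul_isBigO h2.norm_left).congr_right fun _ => one_mul 1))
    rw [one_mul, norm_mul, norm_norm, norm_norm]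
    exact norm_inner_le_norm _ _
  refine ((h3.add_const (q i / (4 * π))).congr' ?_).trans (by rw [zero_add])
  filter_upwards [self_mem_nhdsWithin] with x hx
  have h0 : ‖x - c i‖ ≠ 0 := (norm_sub_pos_iff.2 hx).ne'
  rw [kernel, inner_smul_left, inner_smul_right, inner_sub_left, inner_smul_left, inner_smul_left,
    real_inner_self_eq_norm_sq]
  simp only [conj_trivial]
  field_simp
  ring

/-- The electric field of the logarithmic model is bounded, with a direction-dependent limit. -/
theorem tendsto_log_electric (hβ : 0 < β) (hc : Injective c) (hq : q i ≠ 0) :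
    Tendsto (fun x => (2 / (1 + √(1 + 2 * β * ‖coulomb c q x‖ ^ 2))) • coulomb c q x -
      (√2 * sign (q i) / (√β * ‖x - c i‖)) • (x - c i)) (𝓝[≠] (c i)) (𝓝 0) := by
  set k := q i / (4 * π) with hk
  have hk0 : k ≠ 0 := div_ne_zero hq (by positivity)
  have hρ := tendsto_sq_sub_center (c i)
  have h1 := (hρ.pow 2).add (((tendsto_sq_norm_coulomb (q := q) hc i).pow 2).const_mul (2 * β))
  have h2 := ((hρ.add h1.sqrt).inv₀ (by
    rw [← hk]; positivity)).const_mul 2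
  rw [← hk] at h2
  set a := fun x => 2 * (‖x - c i‖ ^ 2 + √((‖x - c i‖ ^ 2) ^ 2 +
    2 * β * (‖x - c i‖ ^ 2 * ‖coulomb c q x‖) ^ 2))⁻¹
  have hlim : 2 * (0 + √(0 ^ 2 + 2 * β * |k| ^ 2))⁻¹ * k = √2 * sign (q i) / √β := by
    rw [zero_add, zero_pow two_ne_zero, zero_add, sqrt_mul (by positivity),
      sqrt_sq (abs_nonneg _), sqrt_mul two_pos.le]
    have h3 : k = |k| * sign (q i) := by
      rw [hk, abs_div, abs_of_pos (show 0 < 4 * π by positivity)]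
      rcases lt_or_gt_of_ne hq with h | h
      · rw [abs_of_neg h, Real.sign_of_neg h]; ring
      · rw [abs_of_pos h, Real.sign_of_pos h]; ring
    have h4 : |k| ≠ 0 := abs_ne_zero.2 hk0
    have h5 : √β ≠ 0 := (Real.sqrt_pos.2 hβ).ne'
    have h6 : √2 * √2 = (2 : ℝ) := Real.mul_self_sqrt two_pos.le
    nth_rewrite 2 [h3]
    field_simp
    linear_combination -sign (q i) * h6
  have h3 := h2.smul (tendsto_sq_smul_sub (q := q) hc i)
  have h2k := h2.mul_const k
  rw [hlim] at h2k
  have h4 := ((isLittleO_one_iff ℝ).2 (tendsto_sub_nhds_zero_iff.2 h2k)).smul_isBigO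
    (show (fun x => ‖x - c i‖⁻¹ • (x - c i)) =O[𝓝[≠] (c i)] fun _ => (1 : ℝ) from
      IsBigO.of_bound 1 (.of_forall fun x => by simpa using norm_inv_smul_self_le (x - c i)))
  have h5 := (isLittleO_one_iff ℝ).1 (h4.congr_right fun _ => one_smul ℝ (1 : ℝ))
  have h6 := h3.add h5
  rw [smul_zero, add_zero] at h6
  refine h6.congr' ?_
  filter_upwards [self_mem_nhdsWithin] with x hx
  have hx' := sub_ne_zero.2 hx
  have h0 : 0 < ‖x - c i‖ := norm_pos_iff.2 hx'
  have h7 : √((‖x - c i‖ ^ 2) ^ 2 + 2 * β * (‖x - c i‖ ^ 2 * ‖coulomb c q x‖) ^ 2) =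
      ‖x - c i‖ ^ 2 * √(1 + 2 * β * ‖coulomb c q x‖ ^ 2) := by
    rw [← sqrt_sq (sq_nonneg ‖x - c i‖), ← sqrt_mul (by positivity), sqrt_sq (sq_nonneg ‖x - c i‖)]
    congr 1
    ring
  have h8 : a x * ‖x - c i‖ ^ 2 = 2 / (1 + √(1 + 2 * β * ‖coulomb c q x‖ ^ 2)) := by
    simp only [a, h7]
    have : 0 < 1 + √(1 + 2 * β * ‖coulomb c q x‖ ^ 2) := by positivity
    field_simp
  have e1 : ‖x - c i‖ ^ 2 • (k • kernel (x - c i)) = k • (‖x - c i‖⁻¹ • (x - c i)) := by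
    rw [smul_comm, sq_smul_kernel hx']
  have e2 : (√2 * sign (q i) / (√β * ‖x - c i‖)) • (x - c i) =
      (√2 * sign (q i) / √β) • (‖x - c i‖⁻¹ • (x - c i)) := by
    rw [smul_smul]
    congr 1
    field_simp
  rw [← hk, smul_sub, e1, e2, smul_sub, smul_smul (a x), h8, smul_smul (a x) k, sub_smul]
  abel

/-- The magnetic intensity of the logarithmic model vanishes at the centers. -/
theorem isEquivalent_log_magnetic (hβ : 0 < β) (hc : Injective c) (hg : g i ≠ 0) :
    (fun x => (1 / (1 + β / 2 * ‖coulomb c g x‖ ^ 2)) • coulomb c g x) ~[𝓝[≠] (c i)]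
      fun x => (8 * π / (β * g i) * ‖x - c i‖) • (x - c i) := by
  set k := g i / (4 * π) with hk
  have hk0 : k ≠ 0 := div_ne_zero hg (by positivity)
  have hρ := tendsto_sq_sub_center (c i)
  have h1 : Tendsto (fun x => (β * k ^ 2 / 2) / ((‖x - c i‖ ^ 2) ^ 2 +
      β / 2 * (‖x - c i‖ ^ 2 * ‖coulomb c g x‖) ^ 2)) (𝓝[≠] (c i)) (𝓝 1) := by
    have h2 := (tendsto_const_nhds (x := β * k ^ 2 / 2)).div ((hρ.pow 2).add
      (((tendsto_sq_norm_coulomb (q := g) hc i).pow 2).const_mul (β / 2)))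
      (by rw [← hk, sq_abs]; positivity)
    rwa [← hk, sq_abs, zero_pow two_ne_zero, zero_add, div_mul_eq_mul_div, div_self (by positivity)]
      at h2
  have h2 : (fun x => 1 / (1 + β / 2 * ‖coulomb c g x‖ ^ 2)) ~[𝓝[≠] (c i)]
      fun x => (‖x - c i‖ ^ 2) ^ 2 / (β * k ^ 2 / 2) := by
    refine isEquivalent_of_tendsto_one (h1.congr' ?_)
    filter_upwards [self_mem_nhdsWithin] with x hx
    have h0 : 0 < ‖x - c i‖ := norm_sub_pos_iff.2 hx
    rw [Pi.div_apply]
    field_simp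
  refine (h2.smul (coulomb_isEquivalent_center hc hg)).congr_right ?_
  filter_upwards [self_mem_nhdsWithin] with x hx
  have h0 : 0 < ‖x - c i‖ := norm_sub_pos_iff.2 hx
  rw [kernel, smul_smul, smul_smul]
  congr 1
  rw [← hk, show g i = 4 * π * k by rw [hk]; field_simp]
  field_simp
  ring

/-- The magnetic flux of the quadratic model diverges at the centers. -/
lemma tendsto_quad_flux (hα : 0 < α) (hc : Injective c) (hg : g i ≠ 0) :
    Tendsto (fun x => -g i * (‖x - c i‖ *
      ⟪(1 - α * ‖coulomb c g x‖ ^ 2) • coulomb c g x, x - c i⟫)) (𝓝[≠] (c i)) atTop := by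
  have h1 := (tendsto_inner_center (q := g) hc i).const_mul (g i)
  have h2 : Tendsto (fun x => α * ‖coulomb c g x‖ ^ 2 + -1) (𝓝[≠] (c i)) atTop :=
    tendsto_atTop_add_const_right _ _ (((tendsto_pow_atTop two_ne_zero).comp
      (tendsto_norm_coulomb_atTop hc hg)).const_mul_atTop hα)
  have h3 : 0 < g i * (g i / (4 * π)) := by
    rw [← mul_div_assoc]
    exact div_pos (mul_self_pos.2 hg) (by positivity)
  refine (h2.atTop_mul_pos h3 h1).congr fun x => ?_
  rw [inner_smul_left]
  simp only [conj_trivial]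
  ring

lemma not_finiteEnergy_quad (hα : 0 < α) (hc : Injective c) (hg : g i ≠ 0) :
    ¬ FiniteEnergy (fQuad α) κ 0 (coulomb c g) := by
  refine not_integrable_of_isBigO (a := c i) ?_
  have h1 := (tendsto_sq_norm_coulomb (q := g) hc i).inv₀ (abs_ne_zero.2
    (div_ne_zero hg (by positivity : 4 * π ≠ 0))) |>.isBigO_one ℝ
  have h2 : _ =O[_] fun x => ‖coulomb c g x‖ ^ 2 :=
    ((h1.mul (isBigO_refl (fun x => ‖coulomb c g x‖) _)).pow 2).congr_right fun x => by rw [one_mul]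
  refine (h2.congr' ?_ EventuallyEq.rfl).trans ?_
  · filter_upwards [(tendsto_norm_coulomb_atTop hc hg).eventually_gt_atTop 0,
      self_mem_nhdsWithin] with x hx hx'
    have h0 : 0 < ‖x - c i‖ := norm_sub_pos_iff.2 hx'
    field_simp
  · refine IsBigO.of_bound 1 ?_
    filter_upwards [((tendsto_pow_atTop two_ne_zero).comp
      (tendsto_norm_coulomb_atTop hc hg)).eventually_ge_atTop (6 / α)] with x hx
    rw [MagneticModel.energyDensity_eq, fQuad, one_mul, norm_of_nonneg (sq_nonneg _)]
    rw [comp_apply, div_le_iff₀ hα] at hx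
    refine le_trans ?_ (neg_le_abs _)
    linarith [mul_le_mul_of_nonneg_left hx (sq_nonneg ‖coulomb c g x‖)]

end

/-! ### The three models -/

section
variable {β : ℝ}

lemma Model.magneticModel (M : Model f I S S')
    (hI : IsOpen I) (h0 : Iic 0 ⊆ I) (hf : ContDiffOn ℝ 2 f I) : MagneticModel f I :=
  ⟨hI, h0, hf, M.zero, by simpa only [M.response.one] using M.deriv_eq 1 one_pos⟩

lemma Model.exists_second_deriv_neg (M : Model f I S S')
    (hI : IsOpen I) (hf : ContDiffOn ℝ 2 f I) : ∃ s < 0, deriv (deriv f) s ≠ 0 :=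
  ⟨S (1 / 2), M.response.neg (by norm_num) (by norm_num), M.second_deriv_ne_zero hI hf (by norm_num)⟩

lemma contDiffOn_fLog (hβ : 0 < β) : ContDiffOn ℝ 2 (fLog β) (Iio (1 / β)) := by
  refine ContDiffOn.mul contDiffOn_const (ContDiffOn.log (by fun_prop) fun s hs => ?_)
  have := (lt_div_iff₀ hβ).1 (mem_Iio.1 hs)
  linarith

lemma contDiff_fExp : ContDiff ℝ 2 (fExp β) :=
  contDiff_const.mul ((Real.contDiff_exp.comp (contDiff_const.mul contDiff_id)).sub contDiff_const)

lemma contDiff_fQuad : ContDiff ℝ 2 (fQuad α) :=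
  contDiff_id.add (contDiff_const.mul (contDiff_id.pow 2))

lemma abs_fLog_le (hβ : 0 < β) (s : ℝ) (hs : s ≤ 0) :
    |fLog β s| ≤ 2 / β * √(β / 2) * √(-2 * s) := by
  have hy := neg_nonneg.2 (mul_nonpos_of_nonneg_of_nonpos hβ.le hs)
  have h1 : √(β / 2) * √(-2 * s) = √(-(β * s)) := by
    rw [← sqrt_mul (by positivity)]
    congr 1
    ring
  set y := -(β * s)
  have h2 : fLog β s = -(1 / β * Real.log (1 + y)) := by rw [fLog, sub_eq_add_neg, neg_mul]
  have h3 : Real.log (1 + y) ≤ 2 * √y := by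
    have h4 := log_le_sub_one_of_pos (Real.sqrt_pos.2 (show 0 < 1 + y by positivity))
    rw [Real.log_sqrt (by positivity)] at h4
    have h5 : √(1 + y) ≤ 1 + √y := Real.sqrt_le_iff.2 ⟨by positivity, by
      nlinarith [Real.sq_sqrt hy, Real.sqrt_nonneg y]⟩
    linarith
  rw [h2, abs_neg, abs_of_nonneg (mul_nonneg (by positivity)
    (Real.log_nonneg (by linarith))), mul_assoc, h1]
  calc 1 / β * Real.log (1 + y) ≤ 1 / β * (2 * √y) := by gcongr
    _ = 2 / β * √y := by ring

lemma abs_fExp_le (hβ : 0 < β) (s : ℝ) (hs : s ≤ 0) :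
    |fExp β s| ≤ 1 / β * √(β / 2) * √(-2 * s) := by
  have hy : 0 ≤ -(β * s) := neg_nonneg.2 (mul_nonpos_of_nonneg_of_nonpos hβ.le hs)
  have h1 : √(β / 2) * √(-2 * s) = √(-(β * s)) := by
    rw [← sqrt_mul (by positivity)]
    congr 1
    ring
  have h2 := Real.add_one_le_exp (β * s)
  have h3 := Real.exp_pos (β * s)
  have h4 : exp (β * s) ≤ 1 := Real.exp_le_one_iff.2 (by linarith)
  rw [fExp, abs_mul, abs_of_pos (by positivity : 0 < 1 / β), abs_of_nonpos (by linarith),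
    mul_assoc, h1]
  gcongr
  refine Real.le_sqrt_of_sq_le ?_
  nlinarith

lemma magneticField_log (hβ : 0 < β) : magneticField (fLog β) c g =
    fun x => (1 / (1 + β / 2 * ‖coulomb c g x‖ ^ 2)) • coulomb c g x := by
  funext x
  have h1 : -‖coulomb c g x‖ ^ 2 / 2 < 1 / β :=
    lt_of_le_of_lt (mem_Iic.1 (MagneticModel.neg_sq_mem x)) (by positivity)
  rw [magneticField, (hasDerivAt_fLog hβ h1).deriv, one_div]
  congr 3
  ring

lemma magneticField_exp (hβ : 0 < β) : magneticField (fExp β) c g =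
    fun x => exp (-(β * ‖coulomb c g x‖ ^ 2 / 2)) • coulomb c g x := by
  funext x
  rw [magneticField, (hasDerivAt_fExp hβ _).deriv]
  congr 2
  ring

lemma magneticField_quad : magneticField (fQuad α) c g =
    fun x => (1 - α * ‖coulomb c g x‖ ^ 2) • coulomb c g x := by
  funext x
  rw [magneticField, (hasDerivAt_fQuad _).deriv]
  congr 1
  ring

lemma tendsto_deriv_fLog (hβ : 0 < β) : Tendsto (deriv (fLog β)) atBot (𝓝 0) := by
  have h1 : Tendsto (fun s => 1 + β * -s) atBot atTop :=
    tendsto_atTop_add_const_left _ _ (tendsto_neg_atBot_atTop.const_mul_atTop hβ)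
  refine (tendsto_inv_atTop_zero.comp h1).congr' ?_
  filter_upwards [eventually_lt_atBot (1 / β)] with s hs
  rw [(hasDerivAt_fLog hβ hs).deriv, comp_apply, mul_neg, ← sub_eq_add_neg]

lemma tendsto_deriv_fExp (hβ : 0 < β) : Tendsto (deriv (fExp β)) atBot (𝓝 0) := by
  refine (Real.tendsto_exp_atBot.comp (tendsto_id.const_mul_atBot hβ)).congr fun s => ?_
  rw [(hasDerivAt_fExp hβ s).deriv, comp_apply, id]

lemma isRoot_quad_electric (hα : 0 < α) (ht : 0 ≤ t) : IsRoot (fun p => (p - 1) / (2 * α)) t 0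
    (1 + α * cubicRoot (1 / α) (t / α ^ 2)) := by
  obtain ⟨h1, -, h2⟩ := cubicRoot_spec (γ := 1 / α) (s := t / α ^ 2) (by
    rcases ht.eq_or_lt with rfl | ht
    · exact Or.inr ⟨zero_div _, by positivity⟩
    · exact Or.inl (by positivity))
  set a := cubicRoot (1 / α) (t / α ^ 2)
  refine ⟨by positivity, ?_⟩
  rw [show t = α ^ 2 * ((1 / α + a) ^ 2 * a) by rw [h2]; field_simp]
  field_simp
  ring

/-- The fields of the quadratic model are regular where `D ≠ 0` or `α B² < 1`. -/
lemma rootField_quad (hα : 0 < α) : RootField (fun p => (p - 1) / (2 * α)) (fun _ => 1 / (2 * α))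
    κ c q g {x | x ∉ range c ∧ (coulomb c q x ≠ 0 ∨ α * ‖coulomb c g x‖ ^ 2 < 1)}
    (fun x => pQuad α κ (coulomb c q x) (coulomb c g x)) := by
  refine ⟨response_quad hα, isOpen_iff_mem_nhds.2 fun x hx => ?_, fun x hx => hx.1,
    fun x hx h => ⟨hx, h.imp_right fun h => by simp [h]⟩, ?_, fun x hx => isRoot_quad hα κ hx.2⟩
  · have hD := (contDiffAt_coulomb (c := c) q hx.1).continuousAt
    have hB := (((contDiffAt_coulomb (c := c) g hx.1).continuousAt.norm.pow 2).const_mul α)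
    have h1 := isOpen_compl_range.mem_nhds hx.1
    rcases hx.2 with h | h
    · filter_upwards [h1, hD.eventually_ne h] with y hy hy' using ⟨hy, Or.inl hy'⟩
    · filter_upwards [h1, hB.eventually_lt_const h] with y hy hy' using ⟨hy, Or.inr hy'⟩
  · have h1 := (((tendsto_coulomb_infinity c g).norm.pow 2).const_mul α)
    rw [norm_zero, zero_pow two_ne_zero, mul_zero] at h1
    filter_upwards [eventually_compl_range c, h1.eventually_lt_const one_pos] with x hx hx'
    exact ⟨hx, Or.inr hx'⟩

end

end MultiCenter
end

open MultiCenter in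
theorem theorem6p1 (hn : 1 ≤ n) (c : Fin n → V3) (hc : Injective c)
    (q g : Fin n → ℝ) (hq : ∀ i, q i ≠ 0) (hg : ∀ i, g i ≠ 0) (κ : ℝ) (hκ : 0 ≤ κ) :
    -- (i) general models, electric point charges; `a = h(D²)` resolves `f'(a/2)² a = D²`
    (∀ (f h : ℝ → ℝ) (I : Set ℝ), IsOpen I → I.OrdConnected → (0 : ℝ) ∈ I →
      ContDiffOn ℝ 2 f I → f 0 = 0 → deriv f 0 = 1 →
      h 0 = 0 → DifferentiableOn ℝ h (Set.Ici 0) →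
      (∀ t, 0 ≤ t → h t / 2 ∈ I ∧ (deriv f (h t / 2)) ^ 2 * h t = t) →
      let D := coulomb c q
      let E : V3 → V3 := fun x => (deriv f (h (‖D x‖ ^ 2) / 2))⁻¹ • D x
      IsStaticSolution f I κ c q 0 (Set.range c)ᶜ E 0 D 0 0 (fun x => -curl E x) ∧
      (2 ≤ n → (Nonconservative E (Set.range c)ᶜ ↔
        ∃ s ∈ I, 0 < s ∧ deriv (deriv f) s ≠ 0))) ∧
    -- (i) general models, magnetic point charges
    (∀ (f : ℝ → ℝ) (I : Set ℝ), IsOpen I → Set.Iic 0 ⊆ I →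
      ContDiffOn ℝ 2 f I → f 0 = 0 → deriv f 0 = 1 →
      let B := coulomb c g
      let H : V3 → V3 := fun x => deriv f (-‖B x‖ ^ 2 / 2) • B x
      IsStaticSolution f I κ c 0 g (Set.range c)ᶜ 0 B 0 H (curl H) 0 ∧
      (2 ≤ n → (Nonconservative H (Set.range c)ᶜ ↔
        ∃ s < 0, deriv (deriv f) s ≠ 0))) ∧
    -- (ii) the logarithmic model
    (∀ β : ℝ, 0 < β →
      let f := fLog β
      let I := Set.Iio (1 / β)
      let D := coulomb c q
      let B := coulomb c g
      let E : V3 → V3 := fun x => (2 / (1 + √(1 + 2 * β * ‖D x‖ ^ 2))) • D x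
      let H : V3 → V3 := fun x => (1 / (1 + β / 2 * ‖B x‖ ^ 2)) • B x
      ElectricSolution f I κ c q E ∧
      (∀ i, Tendsto (fun x => E x -
        (Real.sqrt 2 * sign (q i) / (Real.sqrt β * ‖x - c i‖)) • (x - c i))
        (𝓝[≠] (c i)) (𝓝 0)) ∧
      MagneticSolution f I κ c g H ∧ FiniteEnergy f κ 0 B ∧ HasFreeCharge c H (∑ i, g i) ∧
      (∀ i, H ~[𝓝[≠] (c i)] fun x =>
        (8 * π / (β * g i) * ‖x - c i‖) • (x - c i)) ∧
      DyonicSolution f I κ c q g (Set.range c)ᶜ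
        (fun x => dyonicE κ (pLog β κ (D x) (B x)) (D x) (B x))
        (fun x => dyonicH κ (pLog β κ (D x) (B x)) (D x) (B x))) ∧
    -- (ii) the exponential model
    (∀ β : ℝ, 0 < β →
      let f := fExp β
      let D := coulomb c q
      let B := coulomb c g
      let H : V3 → V3 := fun x => exp (-(β * ‖B x‖ ^ 2 / 2)) • B x
      ElectricSolution f Set.univ κ c q
        (fun x => exp (-lambertW (β * ‖D x‖ ^ 2) / 2) • D x) ∧
      MagneticSolution f Set.univ κ c g H ∧ FiniteEnergy f κ 0 B ∧
      HasFreeCharge c H (∑ i, g i) ∧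
      DyonicSolution f Set.univ κ c q g (Set.range c)ᶜ
        (fun x => dyonicE κ (pExp β κ (D x) (B x)) (D x) (B x))
        (fun x => dyonicH κ (pExp β κ (D x) (B x)) (D x) (B x))) ∧
    -- (ii) the quadratic model
    (∀ α : ℝ, 0 < α →
      let f := fQuad α
      let D := coulomb c q
      let B := coulomb c g
      let H : V3 → V3 := fun x => (1 - α * ‖B x‖ ^ 2) • B x
      ElectricSolution f Set.univ κ c q
        (fun x => (1 + α * cubicRoot (1 / α) (‖D x‖ ^ 2 / α ^ 2))⁻¹ • D x) ∧
      MagneticSolution f Set.univ κ c g H ∧ ¬ FiniteEnergy f κ 0 B ∧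
      (¬ ∃ G : ℝ, HasFreeCharge c H G) ∧
      DyonicSolution f Set.univ κ c q g
        {x | x ∉ Set.range c ∧ (D x ≠ 0 ∨ α * ‖B x‖ ^ 2 < 1)}
        (fun x => dyonicE κ (pQuad α κ (D x) (B x)) (D x) (B x))
        (fun x => dyonicH κ (pQuad α κ (D x) (B x)) (D x) (B x))) := by
  refine ⟨fun f h I hI hoc h0 hf _ hd hh hdiff hroot => ?_, fun f I hI h0 hf hf0 hd => ?_,
    fun β hβ => ?_, fun β hβ => ?_, fun α hα => ?_⟩
  · have R : Resolves f h I := ⟨hI, hoc, h0, hf, hd, hh, hdiff, hroot⟩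
    exact ⟨R.isStaticSolution, fun hn => R.nonconservative_iff hc hn hq⟩
  · have R : MagneticModel f I := ⟨hI, h0, hf, hf0, hd⟩
    exact ⟨R.isStaticSolution, fun hn => R.nonconservative_iff hc hn hg⟩
  · have M := model_log hβ
    have hf := contDiffOn_fLog hβ
    have R := M.magneticModel isOpen_Iio (fun s hs =>
      mem_Iio.2 ((mem_Iic.1 hs).trans_lt (by positivity))) hf
    have hE := M.electricSolution (κ := κ) (c := c) (q := q) isOpen_Iio ordConnected_Iio hf
      (fun t ht => isRoot_log hβ ht le_rfl) hn hc hq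
    have hE' : ∀ t : ℝ, ((1 + √(1 + β * t * (2 + β * 0))) / (2 + β * 0))⁻¹ =
        2 / (1 + √(1 + 2 * β * t)) := fun t => by
      rw [mul_zero, add_zero, inv_div, show β * t * 2 = 2 * β * t by ring]
    simp only [hE'] at hE
    have hS := R.magneticSolution (κ := κ) hc hg (M.exists_second_deriv_neg isOpen_Iio hf)
    have hQ := R.hasFreeCharge hc hg (tendsto_deriv_fLog hβ)
    rw [magneticField_log hβ] at hS hQ
    exact ⟨hE, fun i => tendsto_log_electric hβ hc (hq i), hS, R.finiteEnergy hc (abs_fLog_le hβ),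
      hQ, fun i => isEquivalent_log_magnetic hβ hc (hg i),
      (RootField.of_forall M.response fun x _ => isRoot_log hβ (reducedSq_nonneg _ _ _)
        (sq_nonneg _)).dyonicSolution M (Or.inl rfl) hn hc hq hg hκ⟩
  · have M := model_exp hβ
    have hf := (contDiff_fExp (β := β)).contDiffOn (s := univ)
    have R := M.magneticModel isOpen_univ (subset_univ _) hf
    have hE := M.electricSolution (κ := κ) (c := c) (q := q) isOpen_univ ordConnected_univ hf
      (fun t ht => isRoot_exp (b := 0) hβ ht) hn hc hq
    have hE' : ∀ t : ℝ, (exp (β * (-0 / 2 + 1 / (2 * β) *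
        lambertW (β * exp (β * 0) * t))))⁻¹ = exp (-lambertW (β * t) / 2) := fun t => by
      rw [← Real.exp_neg, mul_zero, Real.exp_zero, mul_one]
      congr 1
      field_simp
      ring
    simp only [hE'] at hE
    have hS := R.magneticSolution (κ := κ) hc hg (M.exists_second_deriv_neg isOpen_univ hf)
    have hQ := R.hasFreeCharge hc hg (tendsto_deriv_fExp hβ)
    rw [magneticField_exp hβ] at hS hQ
    exact ⟨hE, hS, R.finiteEnergy hc (abs_fExp_le hβ), hQ,
      (RootField.of_forall M.response fun x _ => isRoot_exp hβ
        (reducedSq_nonneg _ _ _)).dyonicSolution M (Or.inl rfl) hn hc hq hg hκ⟩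
  · have M := model_quad hα
    have hf := (contDiff_fQuad (α := α)).contDiffOn (s := univ)
    have R := M.magneticModel isOpen_univ (subset_univ _) hf
    have hS := R.magneticSolution (κ := κ) hc hg (M.exists_second_deriv_neg isOpen_univ hf)
    have hF := R.contDiffOn (c := c) (q := g)
    rw [magneticField_quad] at hS hF
    exact ⟨M.electricSolution isOpen_univ ordConnected_univ hf
        (fun t ht => isRoot_quad_electric hα ht) hn hc hq, hS,
      not_finiteEnergy_quad hα hc (hg ⟨0, hn⟩),
      fun ⟨G, hG⟩ => not_hasFreeCharge hF hc (tendsto_quad_flux hα hc (hg ⟨0, hn⟩)) G hG,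
      (rootField_quad hα).dyonicSolution M (Or.inr (fQuad_bdd hα)) hn hc hq hg hκ⟩
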